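/- Setting. Let $M_1,\dots,M_n$ be smooth, Hausdorff, second-countable manifolds (without boundary) of the same dimension $d$. A smooth gluing datum on them consists of open subsets $M_{ij}\subseteq M_i$ and smooth open embeddings $f_{ij}:M_{ij}\to M_j$ such that (A1) $M_{ii}=M_i$ and $f_{ii}=\mathrm{id}$; (A2) $f_{ij}(M_{ij})=M_{ji}$ and $f_{ij}^{-1}=f_{ji}$; (A3) for $x\in M_{ij}\cap M_{ik}$ one has $f_{ij}(x)\in M_{jk}$ and $f_{ik}(x)=f_{jk}(f_{ij}(x))$. It is assumed moreover that each closure $\overline{M_{ij}}$ in $M_i$ is a regular domain (a closed codimension-$0$ smooth submanifold with boundary), and that the $f_{ij}$ extend to diffeomorphisms $\overline{f_{ij}}:\overline{M_{ij}}\to\overline{M_{ji}}$ which again satisfy (A1)–(A3), with $\overline{M_{ij}}$ in place of $M_{ij}$. Let $\mathbf M=\big(\bigsqcup_i M_i\big)/\!\sim$, where $(x,i)\sim(f_{ij}(x),j)$, be the resulting adjunction space (the colimit of the $M_i$, a possibly non-Hausdorff smooth manifold), with canonical open embeddings $\phi_i:M_i\to\mathbf M$. Put $M_{i_0\cdots i_p}=\bigcap_{a}M_{i_0i_a}\subseteq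 M_{i_0}$, with closure $\overline{M_{i_0\cdots i_p}}$ in $M_{i_0}$ (so $\overline{M_{i}}=M_i$). For a closed set $C$ of this kind, $\Omega^q(C)$ is the space of those families of alternating $q$-forms on the spaces $T_xM_{i_0}$, $x\in C$, that extend locally to smooth $q$-forms on open subsets of $M_{i_0}$. Let $\Phi^*\boldsymbol\omega=(\phi_i^*\boldsymbol\omega)_i$ and let $\delta$ be the Čech differential: on $\overline{M_{i_0\cdots i_{p+1}}}$, $$(\delta\omega)_{i_0\cdots i_{p+1}}=\sum_{\alpha=0}^{p+1}(-1)^{\alpha+1}\,\iota_\alpha^*\,\omega_{i_0\cdots\widehat{i_\alpha}\cdots i_{p+1}},$$ where $\iota_\alpha$ is the inclusion for $\alpha\ge 1$ and $\iota_0$ is the restriction of $\overline{f_{i_0i_1}}$. Theorem. (1) Suppose that each $M_{ij}$ is regular-open in $M_i$ (it equals the interior of its closure), and that the closure of every intersection $M_{i_1i_2}\cap\cdots\cap M_{i_1i_m}\subseteq M_{i_1}$ with $m\le n$ equals $\overline{M_{i_1i_2}}\cap\cdots\cap\overline{M_{i_1i_m}}$. Then for every $q\in\mathbb N$ the sequence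 $$0\to\Omega^q(\mathbf M)\xrightarrow{\Phi^*}\bigoplus_i\Omega^q(M_i)\xrightarrow{\delta}\bigoplus_{i<j}\Omega^q(\overline{M_{ij}})\xrightarrow{\delta}\cdots\xrightarrow{\delta}\Omega^q(\overline{M_{1\cdots n}})\to0$$ is exact. (2) Let $n=2$ (no further hypothesis). Then $0\to\Omega^q(\mathbf M)\to\Omega^q(M_1)\oplus\Omega^q(M_2)\to\Omega^q(\overline{M_{12}})\to0$, with maps $\Phi^*$ and $\iota_{12}^*-\overline{f_{12}}^*$, is exact for every $q$, and these maps, together with the connecting homomorphisms $d^*$ of the snake lemma, give a long exact sequence in de Rham cohomology $$0\to H^0_{dR}(\mathbf M)\to\cdots\to H^q_{dR}(\mathbf M)\to H^q_{dR}(M_1)\oplus H^q_{dR}(M_2)\to H^q_{dR}(\overline{M_{12}})\xrightarrow{d^*}H^{q+1}_{dR}(\mathbf M)\to\cdots.$$ (3) Let $n=2$ and suppose that $M_{12}$ and $M_{21}$ are regular-open. Then restriction of forms induces isomorphisms $H^q_{dR}(\overline{M_{12}})\cong H^q_{dR}(M_{12})$, and there is a long exact sequence as in (2) with $H^q_{dR}(M_{12})$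 in place of $H^q_{dR}(\overline{M_{12}})$ and $\iota_{12}^*-f_{12}^*$ in place of $\iota_{12}^*-\overline{f_{12}}^*$, whose connecting homomorphism corresponds to $d^*$ under these isomorphisms. -/

import Mathlib

open Set Topology
open scoped Manifold ContDiff

universe u v

namespace NonHausdorff

/-! ## Differential forms on subsets of a smooth manifold

Throughout, `M` is a space with charts in `ℝ^d` (no separation axiom is imposed).  A form on a subset
`S` of `M` assigns to every `x ∈ S` an alternating form on the whole tangent space `T_x M`.  It is
used for `S = M`, for open `S`, and for closed domains `S` of codimension zero, where it is the usual
notion of a form on the manifold with boundary `S`. -/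

section Forms

variable (d : ℕ) {M : Type u} [TopologicalSpace M] [ChartedSpace (EuclideanSpace ℝ (Fin d)) M]

/-- Not necessarily continuous `q`-forms on the subset `S` of `M`. -/
def RawForm (S : Set M) (q : ℕ) : Type u :=
  ∀ x : S, TangentSpace (𝓡 d) (x : M) [⋀^Fin q]→L[ℝ] ℝ

noncomputable instance (S : Set M) (q : ℕ) : AddCommGroup (RawForm d S q) :=
  inferInstanceAs (AddCommGroup (∀ x : S, TangentSpace (𝓡 d) (x : M) [⋀^Fin q]→L[ℝ] ℝ))

noncomputable instance (S : Set M) (q : ℕ) : Module ℝ (RawForm d S q) :=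
  inferInstanceAs (Module ℝ (∀ x : S, TangentSpace (𝓡 d) (x : M) [⋀^Fin q]→L[ℝ] ℝ))

/-- The differential at `x` of the preferred chart `φ` at `x`. -/
noncomputable def chartDeriv (x : M) :
    TangentSpace (𝓡 d) x →L[ℝ] EuclideanSpace ℝ (Fin d) :=
  mfderiv (𝓡 d) 𝓘(ℝ, EuclideanSpace ℝ (Fin d)) (extChartAt (𝓡 d) x) x

/-- The differential at `y` of the inverse `φ⁻¹` of the preferred chart `φ` at `x₀`. -/
noncomputable def chartSymmDeriv (x₀ : M) (y : EuclideanSpace ℝ (Fin d)) :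
    EuclideanSpace ℝ (Fin d) →L[ℝ] TangentSpace (𝓡 d) ((extChartAt (𝓡 d) x₀).symm y) :=
  mfderiv 𝓘(ℝ, EuclideanSpace ℝ (Fin d)) (𝓡 d) (extChartAt (𝓡 d) x₀).symm y

/-- The expression `(φ⁻¹)^* w` of a form `w` in the preferred chart `φ` at `x₀`. -/
noncomputable def coordRep {q : ℕ} (x₀ : M)
    (w : ∀ x : M, TangentSpace (𝓡 d) x [⋀^Fin q]→L[ℝ] ℝ) :
    EuclideanSpace ℝ (Fin d) → EuclideanSpace ℝ (Fin d) [⋀^Fin q]→L[ℝ] ℝ :=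
  fun y => (w ((extChartAt (𝓡 d) x₀).symm y)).compContinuousLinearMap (chartSymmDeriv d x₀ y)

/-- Smoothness near `x₀` is tested in the preferred chart at `x₀`. -/
def FormSmoothAt {q : ℕ} (w : ∀ x : M, TangentSpace (𝓡 d) x [⋀^Fin q]→L[ℝ] ℝ) (x₀ : M) : Prop :=
  ContDiffAt ℝ ∞ (coordRep d x₀ w) (extChartAt (𝓡 d) x₀ x₀)

/-- The exterior derivative, `dw = φ^* d((φ⁻¹)^* w)`, with `φ` the preferred chart at the point. -/
noncomputable def dForm {q : ℕ} (w : ∀ x : M, TangentSpace (𝓡 d) x [⋀^Fin q]→L[ℝ] ℝ) (x : M) :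
    TangentSpace (𝓡 d) x [⋀^Fin (q + 1)]→L[ℝ] ℝ :=
  (extDeriv (coordRep d x w) (extChartAt (𝓡 d) x x)).compContinuousLinearMap (chartDeriv d x)

variable {d}

theorem coordRep_add {q : ℕ} (x₀ : M) (w η : ∀ x : M, TangentSpace (𝓡 d) x [⋀^Fin q]→L[ℝ] ℝ) :
    coordRep d x₀ (w + η) = coordRep d x₀ w + coordRep d x₀ η := rfl

theorem coordRep_smul {q : ℕ} (x₀ : M) (c : ℝ)
    (w : ∀ x : M, TangentSpace (𝓡 d) x [⋀^Fin q]→L[ℝ] ℝ) :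
    coordRep d x₀ (c • w) = c • coordRep d x₀ w := rfl

theorem coordRep_zero {q : ℕ} (x₀ : M) :
    coordRep d x₀ (0 : ∀ x : M, TangentSpace (𝓡 d) x [⋀^Fin q]→L[ℝ] ℝ) = 0 := rfl

theorem FormSmoothAt.add {q : ℕ} {w η : ∀ x : M, TangentSpace (𝓡 d) x [⋀^Fin q]→L[ℝ] ℝ} {x : M}
    (hw : FormSmoothAt d w x) (hη : FormSmoothAt d η x) : FormSmoothAt d (w + η) x := by
  unfold FormSmoothAt at *
  rw [coordRep_add]
  exact ContDiffAt.add hw hη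

theorem FormSmoothAt.smul {q : ℕ} (c : ℝ)
    {w : ∀ x : M, TangentSpace (𝓡 d) x [⋀^Fin q]→L[ℝ] ℝ} {x : M}
    (hw : FormSmoothAt d w x) : FormSmoothAt d (c • w) x := by
  unfold FormSmoothAt at *
  rw [coordRep_smul]
  exact ContDiffAt.const_smul c hw

theorem FormSmoothAt.zero {q : ℕ} (x : M) :
    FormSmoothAt d (0 : ∀ x : M, TangentSpace (𝓡 d) x [⋀^Fin q]→L[ℝ] ℝ) x := by
  unfold FormSmoothAt
  rw [coordRep_zero]
  exact contDiffAt_const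

theorem FormSmoothAt.differentiableAt {q : ℕ}
    {w : ∀ x : M, TangentSpace (𝓡 d) x [⋀^Fin q]→L[ℝ] ℝ} {x : M} (hw : FormSmoothAt d w x) :
    DifferentiableAt ℝ (coordRep d x w) (extChartAt (𝓡 d) x x) :=
  ContDiffAt.differentiableAt hw (by simp)

theorem dForm_add {q : ℕ} {w η : ∀ x : M, TangentSpace (𝓡 d) x [⋀^Fin q]→L[ℝ] ℝ} {x : M}
    (hw : FormSmoothAt d w x) (hη : FormSmoothAt d η x) :
    dForm d (w + η) x = dForm d w x + dForm d η x := by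
  unfold dForm
  rw [coordRep_add, extDeriv_add hw.differentiableAt hη.differentiableAt]
  rfl

theorem dForm_smul {q : ℕ} (c : ℝ) (w : ∀ x : M, TangentSpace (𝓡 d) x [⋀^Fin q]→L[ℝ] ℝ) (x : M) :
    dForm d (c • w) x = c • dForm d w x := by
  unfold dForm
  rw [coordRep_smul, extDeriv_smul]
  rfl

theorem dForm_zero {q : ℕ} (x : M) :
    dForm d (0 : ∀ x : M, TangentSpace (𝓡 d) x [⋀^Fin q]→L[ℝ] ℝ) x = 0 := by
  have := dForm_smul (d := d) (0 : ℝ) (0 : ∀ x : M, TangentSpace (𝓡 d) x [⋀^Fin q]→L[ℝ] ℝ) x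
  simpa using this

variable (d)

/-- `Ω^q(S)`: a form on `S` is smooth if near every point of `S` it extends to a smooth form on an
open subset of the ambient manifold. -/
noncomputable def Omega (S : Set M) (q : ℕ) : Submodule ℝ (RawForm d S q) where
  carrier := {w | ∀ x : S, ∃ U : Set M, IsOpen U ∧ (x : M) ∈ U ∧
    ∃ η : ∀ y : M, TangentSpace (𝓡 d) y [⋀^Fin q]→L[ℝ] ℝ,
      (∀ y ∈ U, FormSmoothAt d η y) ∧ ∀ y : S, (y : M) ∈ U → η y = w y}
  add_mem' := by
    intro w₁ w₂ h₁ h₂ x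
    obtain ⟨U₁, hU₁, hx₁, η₁, hs₁, he₁⟩ := h₁ x
    obtain ⟨U₂, hU₂, hx₂, η₂, hs₂, he₂⟩ := h₂ x
    refine ⟨U₁ ∩ U₂, hU₁.inter hU₂, ⟨hx₁, hx₂⟩, η₁ + η₂,
      fun y hy => (hs₁ y hy.1).add (hs₂ y hy.2), fun y hy => ?_⟩
    change η₁ y + η₂ y = w₁ y + w₂ y
    rw [he₁ y hy.1, he₂ y hy.2]
  zero_mem' := fun x =>
    ⟨univ, isOpen_univ, mem_univ _, 0, fun y _ => FormSmoothAt.zero y, fun _ _ => rfl⟩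
  smul_mem' := by
    intro c w h x
    obtain ⟨U, hU, hx, η, hs, he⟩ := h x
    refine ⟨U, hU, hx, c • η, fun y hy => (hs y hy).smul c, fun y hy => ?_⟩
    change c • η y = c • w y
    rw [he y hy]

/-- `θ = dw` on `S`: the exterior derivative of a smooth form on `S` is computed from local smooth
extensions.  (It does not depend on them when `S` is contained in the closure of its interior.) -/
def HasExtDeriv {S : Set M} {q : ℕ} (w : RawForm d S q) (θ : RawForm d S (q + 1)) : Prop :=
  ∀ x : S, ∃ U : Set M, IsOpen U ∧ (x : M) ∈ U ∧
    ∃ η : ∀ y : M, TangentSpace (𝓡 d) y [⋀^Fin q]→L[ℝ] ℝ,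
      (∀ y ∈ U, FormSmoothAt d η y) ∧
        ∀ y : S, (y : M) ∈ U → η y = w y ∧ dForm d η y = θ y

variable {d}

theorem HasExtDeriv.add {S : Set M} {q : ℕ} {w₁ w₂ : RawForm d S q} {θ₁ θ₂ : RawForm d S (q + 1)}
    (h₁ : HasExtDeriv d w₁ θ₁) (h₂ : HasExtDeriv d w₂ θ₂) :
    HasExtDeriv d (w₁ + w₂) (θ₁ + θ₂) := by
  intro x
  obtain ⟨U₁, hU₁, hx₁, η₁, hs₁, he₁⟩ := h₁ x
  obtain ⟨U₂, hU₂, hx₂, η₂, hs₂, he₂⟩ := h₂ x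
  refine ⟨U₁ ∩ U₂, hU₁.inter hU₂, ⟨hx₁, hx₂⟩, η₁ + η₂,
    fun y hy => (hs₁ y hy.1).add (hs₂ y hy.2), fun y hy => ⟨?_, ?_⟩⟩
  · change η₁ y + η₂ y = w₁ y + w₂ y
    rw [(he₁ y hy.1).1, (he₂ y hy.2).1]
  · rw [dForm_add (hs₁ y hy.1) (hs₂ y hy.2), (he₁ y hy.1).2, (he₂ y hy.2).2]
    rfl

theorem HasExtDeriv.smul {S : Set M} {q : ℕ} (c : ℝ) {w : RawForm d S q} {θ : RawForm d S (q + 1)}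
    (h : HasExtDeriv d w θ) : HasExtDeriv d (c • w) (c • θ) := by
  intro x
  obtain ⟨U, hU, hx, η, hs, he⟩ := h x
  refine ⟨U, hU, hx, c • η, fun y hy => (hs y hy).smul c, fun y hy => ⟨?_, ?_⟩⟩
  · change c • η y = c • w y
    rw [(he y hy).1]
  · rw [dForm_smul, (he y hy).2]
    rfl

theorem HasExtDeriv.zero (S : Set M) (q : ℕ) :
    HasExtDeriv d (0 : RawForm d S q) (0 : RawForm d S (q + 1)) := fun _ =>
  ⟨univ, isOpen_univ, mem_univ _, 0, fun y _ => FormSmoothAt.zero y,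
    fun y _ => ⟨rfl, dForm_zero (y : M)⟩⟩

variable (d)

/-- Closed smooth `q`-forms on `S`. -/
noncomputable def closedForms (S : Set M) (q : ℕ) : Submodule ℝ (RawForm d S q) where
  carrier := {w | w ∈ Omega d S q ∧ HasExtDeriv d w 0}
  add_mem' := fun h₁ h₂ => ⟨(Omega d S q).add_mem h₁.1 h₂.1, by simpa using h₁.2.add h₂.2⟩
  zero_mem' := ⟨(Omega d S q).zero_mem, HasExtDeriv.zero S q⟩
  smul_mem' := fun c _ h => ⟨(Omega d S q).smul_mem c h.1, by simpa using h.2.smul c⟩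

/-- Exact smooth `q`-forms on `S`. -/
noncomputable def exactForms (S : Set M) : ∀ q : ℕ, Submodule ℝ (RawForm d S q)
  | 0 => ⊥
  | q + 1 =>
    { carrier := {θ | ∃ w ∈ Omega d S q, HasExtDeriv d w θ}
      add_mem' := by
        rintro θ₁ θ₂ ⟨w₁, h₁, e₁⟩ ⟨w₂, h₂, e₂⟩
        exact ⟨w₁ + w₂, (Omega d S q).add_mem h₁ h₂, e₁.add e₂⟩
      zero_mem' := ⟨0, (Omega d S q).zero_mem, HasExtDeriv.zero S q⟩
      smul_mem' := by
        rintro c θ ⟨w, h, e⟩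
        exact ⟨c • w, (Omega d S q).smul_mem c h, e.smul c⟩ }

/-- De Rham cohomology `H^q_dR(S)`: closed forms modulo exact forms. -/
abbrev HdR (S : Set M) (q : ℕ) : Type u :=
  closedForms d S q ⧸ (exactForms d S q).submoduleOf (closedForms d S q)

/-- The cohomology class of a closed form. -/
noncomputable abbrev cls {S : Set M} {q : ℕ} (w : RawForm d S q) (hw : w ∈ closedForms d S q) : HdR d S q :=
  Submodule.Quotient.mk ⟨w, hw⟩

/-! ### Smooth maps defined on subsets, and pullbacks -/

variable {N : Type v} [TopologicalSpace N] [ChartedSpace (EuclideanSpace ℝ (Fin d)) N]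

/-- A map defined on the subset `S` is smooth if it locally extends to a smooth map on an open set. -/
def SmoothMapOn {S : Set M} (f : S → N) : Prop :=
  ∀ x : S, ∃ U : Set M, IsOpen U ∧ (x : M) ∈ U ∧ ∃ g : M → N,
    ContMDiffOn (𝓡 d) (𝓡 d) ∞ g U ∧ ∀ y : S, (y : M) ∈ U → g y = f y

open Classical in
/-- The differential `T_x M → T_{f x} N` of a map defined on `S` (the values outside `S` of the
extension used here are irrelevant). -/
noncomputable def derivOn {S : Set M} (f : S → N) (x : S) :
    TangentSpace (𝓡 d) (x : M) →L[ℝ] TangentSpace (𝓡 d) (f x) :=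
  (mfderivWithin (𝓡 d) (𝓡 d) (fun y : M => if h : y ∈ S then f ⟨y, h⟩ else f x) S x :
    EuclideanSpace ℝ (Fin d) →L[ℝ] EuclideanSpace ℝ (Fin d))

/-- For `f : S → N` mapping `S' ⊆ S` into `T`, the pullback of forms on `T` to forms on `S'`. -/
noncomputable def pullback {S : Set M} (f : S → N) {S' : Set M} {T : Set N} (hS : S' ⊆ S)
    (hT : ∀ x (hx : x ∈ S'), f ⟨x, hS hx⟩ ∈ T) (q : ℕ) : RawForm d T q →ₗ[ℝ] RawForm d S' q where
  toFun w := fun x => (w ⟨f ⟨x, hS x.2⟩, hT x x.2⟩).compContinuousLinearMap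
    (derivOn d f ⟨x, hS x.2⟩)
  map_add' _ _ := rfl
  map_smul' _ _ := rfl

/-- Restriction of forms to a smaller subset. -/
def restrict {S S' : Set M} (h : S' ⊆ S) (q : ℕ) : RawForm d S q →ₗ[ℝ] RawForm d S' q where
  toFun w := fun x => w ⟨x, h x.2⟩
  map_add' _ _ := rfl
  map_smul' _ _ := rfl

/-- A closed set `D` is a regular domain (a properly embedded codimension-zero submanifold with
boundary): near each point of its frontier it is a half space in some smooth chart. -/
def IsRegularDomain (D : Set M) : Prop :=
  IsClosed D ∧ ∀ x ∈ frontier D, ∃ e ∈ IsManifold.maximalAtlas (𝓡 d) ∞ M, x ∈ e.source ∧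
    ∃ k : Fin d, ∀ y ∈ e.source, y ∈ D ↔ 0 ≤ e y k

end Forms

/-! ## Adjunction systems and adjunction spaces -/

/-- Gluing data: regions `A i j ⊆ M i` and maps `f i j : A i j → M j` satisfying the identity,
inversion and cocycle conditions. -/
structure AdjunctionSystem {ι : Type v} (M : ι → Type u) where
  A : ∀ i : ι, ι → Set (M i)
  f : ∀ i j, A i j → M j
  A_self : ∀ i, A i i = univ
  f_self : ∀ i (x : A i i), f i i x = x
  f_mem : ∀ i j (x : A i j), f i j x ∈ A j i
  f_inv : ∀ i j (x : A i j), f j i ⟨f i j x, f_mem i j x⟩ = x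
  f_mem_of_mem : ∀ i j k (x : M i) (hj : x ∈ A i j), x ∈ A i k → f i j ⟨x, hj⟩ ∈ A j k
  cocycle : ∀ i j k (x : M i) (hj : x ∈ A i j) (hk : x ∈ A i k),
    f i k ⟨x, hk⟩ = f j k ⟨f i j ⟨x, hj⟩, f_mem_of_mem i j k x hj hk⟩

/-- Smooth gluing data for `n` smooth manifolds of dimension `d`.  The gluing regions are open, the
gluing maps are smooth open embeddings, and they extend to diffeomorphisms between the closures of the
gluing regions such that the extensions again form an adjunction system (the inverse of the extension
`(i, j)` is the extension `(j, i)`, which is smooth too).  The closures are regular domains. -/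
structure SmoothSystem (d : ℕ) {n : ℕ} (M : Fin n → Type u) [∀ i, TopologicalSpace (M i)]
    [∀ i, ChartedSpace (EuclideanSpace ℝ (Fin d)) (M i)] extends AdjunctionSystem M where
  isOpen_A : ∀ i j, IsOpen (A i j)
  isOpenEmbedding_f : ∀ i j, IsOpenEmbedding (f i j)
  smooth_f : ∀ i j, SmoothMapOn d (f i j)
  closureSystem : AdjunctionSystem M
  closureSystem_A : ∀ i j, closureSystem.A i j = closure (A i j)
  closureSystem_f : ∀ i j (x : M i) (hx : x ∈ A i j) (hx' : x ∈ closureSystem.A i j),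
    closureSystem.f i j ⟨x, hx'⟩ = f i j ⟨x, hx⟩
  smooth_closureSystem_f : ∀ i j, SmoothMapOn d (closureSystem.f i j)
  isRegularDomain_closure : ∀ i j, IsRegularDomain d (closure (A i j))

section Gluing

variable {d n : ℕ} {M : Fin n → Type u} [∀ i, TopologicalSpace (M i)]
  [∀ i, ChartedSpace (EuclideanSpace ℝ (Fin d)) (M i)]

namespace SmoothSystem

/-- `(x, i) ∼ (y, j)` if and only if `x ∈ A i j` and `f i j x = y`. -/
def setoid (F : SmoothSystem d M) : Setoid (Σ i, M i) where
  r p p' := ∃ h : p.2 ∈ F.A p.1 p'.1, F.f p.1 p'.1 ⟨p.2, h⟩ = p'.2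
  iseqv :=
    { refl := fun p => ⟨by rw [F.A_self]; trivial, F.f_self _ _⟩
      symm := by
        rintro ⟨i, x⟩ ⟨j, y⟩ ⟨h, e⟩
        dsimp only at h e ⊢
        subst e
        exact ⟨F.f_mem _ _ _, F.f_inv _ _ ⟨x, h⟩⟩
      trans := by
        rintro ⟨i, x⟩ ⟨j, y⟩ ⟨k, z⟩ ⟨h, e⟩ ⟨h', e'⟩
        dsimp only at h e h' e' ⊢
        subst e
        have hk : x ∈ F.A i k := by
          have := F.f_mem_of_mem j i k _ (F.f_mem i j ⟨x, h⟩) h'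
          rwa [F.f_inv i j ⟨x, h⟩] at this
        exact ⟨hk, by rw [F.cocycle i j k x h hk, e']⟩ }

/-- The adjunction space: the quotient of the disjoint union of the `M i`, with its quotient
topology. -/
def Glued (F : SmoothSystem d M) : Type u := Quotient F.setoid

instance (F : SmoothSystem d M) : TopologicalSpace F.Glued :=
  inferInstanceAs (TopologicalSpace (Quotient F.setoid))

/-- The canonical map `M i → F.Glued`. -/
def φ (F : SmoothSystem d M) (i : Fin n) (x : M i) : F.Glued := Quotient.mk F.setoid ⟨i, x⟩

theorem φ_eq_φ (F : SmoothSystem d M) {i j : Fin n} {x : M i} {y : M j} :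
    F.φ i x = F.φ j y ↔ ∃ h : x ∈ F.A i j, F.f i j ⟨x, h⟩ = y :=
  ⟨fun h => Quotient.exact h, fun h => Quotient.sound h⟩

theorem isOpenEmbedding_φ (F : SmoothSystem d M) (i : Fin n) : IsOpenEmbedding (F.φ i) := by
  refine IsOpenEmbedding.of_continuous_injective_isOpenMap ?_ ?_ ?_
  · exact continuous_quotient_mk'.comp continuous_sigmaMk
  · intro x y h
    obtain ⟨hx, e⟩ := F.φ_eq_φ.1 h
    exact (F.f_self i ⟨x, hx⟩).symm.trans e
  · intro U hU
    change IsOpen (Quotient.mk F.setoid ⁻¹' (F.φ i '' U))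
    rw [isOpen_sigma_iff]
    intro j
    have : Sigma.mk j ⁻¹' (Quotient.mk F.setoid ⁻¹' (F.φ i '' U)) =
        F.f i j '' (Subtype.val ⁻¹' U) := by
      ext y
      constructor
      · rintro ⟨x, hx, e⟩
        obtain ⟨h, e'⟩ := F.φ_eq_φ.1 e
        exact ⟨⟨x, h⟩, hx, e'⟩
      · rintro ⟨x, hx, e⟩
        exact ⟨x, hx, F.φ_eq_φ.2 ⟨x.2, e⟩⟩
    rw [this]
    exact (F.isOpenEmbedding_f i j).isOpenMap _ (hU.preimage continuous_subtype_val)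

/-- The chart `c ∘ φ_i⁻¹` of the adjunction space induced by a chart `c` of `M i` (which is
nonempty, as it has a point `x`). -/
noncomputable def gluedChart (F : SmoothSystem d M) (i : Fin n) (x : M i)
    (c : OpenPartialHomeomorph (M i) (EuclideanSpace ℝ (Fin d))) :
    OpenPartialHomeomorph F.Glued (EuclideanSpace ℝ (Fin d)) :=
  haveI : Nonempty (M i) := ⟨x⟩
  ((F.isOpenEmbedding_φ i).toOpenPartialHomeomorph (F.φ i)).symm.trans c

/-- The atlas of the adjunction space consists of the charts of all the `M i`. -/
noncomputable instance (F : SmoothSystem d M) :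
    ChartedSpace (EuclideanSpace ℝ (Fin d)) F.Glued where
  atlas := {e | ∃ (i : Fin n) (x : M i),
    ∃ c ∈ atlas (EuclideanSpace ℝ (Fin d)) (M i), e = F.gluedChart i x c}
  chartAt p := F.gluedChart (Quotient.out p).1 (Quotient.out p).2 (chartAt _ (Quotient.out p).2)
  mem_chart_source p := by
    have hp : F.φ (Quotient.out p).1 (Quotient.out p).2 = p := Quotient.out_eq p
    have hne : Nonempty (M (Quotient.out p).1) := ⟨(Quotient.out p).2⟩
    have h1 := (F.isOpenEmbedding_φ (Quotient.out p).1).toOpenPartialHomeomorph_left_inv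
      (F.φ (Quotient.out p).1) (x := (Quotient.out p).2)
    rw [hp] at h1
    simp only [gluedChart, OpenPartialHomeomorph.trans_source, OpenPartialHomeomorph.symm_source,
      mem_inter_iff, mem_preimage]
    refine ⟨?_, ?_⟩
    · rw [IsOpenEmbedding.toOpenPartialHomeomorph_target]
      exact ⟨_, hp⟩
    · rw [h1]
      exact mem_chart_source _ _
  chart_mem_atlas p := ⟨_, _, _, chart_mem_atlas _ _, rfl⟩

/-- The extended gluing map on the closure of the gluing region. -/
def fbar (F : SmoothSystem d M) (i j : Fin n) : closure (F.A i j) → M j :=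
  fun x => F.closureSystem.f i j ⟨x, by rw [F.closureSystem_A]; exact x.2⟩

/-! ### The Čech complex -/

/-- The higher intersection `M_{i₀ … i_p} = ⋂ₐ M_{i₀ iₐ} ⊆ M_{i₀}`. -/
def inter (F : SmoothSystem d M) {p : ℕ} (σ : Fin (p + 1) ↪o Fin n) : Set (M (σ 0)) :=
  ⋂ a, F.A (σ 0) (σ a)

/-- The multi-index with its `α`-th entry omitted. -/
def face {p : ℕ} (σ : Fin (p + 2) ↪o Fin n) (α : Fin (p + 2)) : Fin (p + 1) ↪o Fin n :=
  (Fin.succAboveOrderEmb α).trans σ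

theorem closure_inter_subset (F : SmoothSystem d M) {p : ℕ} (σ : Fin (p + 2) ↪o Fin n)
    (α : Fin (p + 2)) : closure (F.inter σ) ⊆ closure (F.A (σ 0) (face σ α 0)) :=
  closure_mono (iInter_subset _ _)

theorem continuous_closureSystem_f (F : SmoothSystem d M) (i j : Fin n) :
    Continuous (F.closureSystem.f i j) := by
  rw [continuous_iff_continuousAt]
  intro x
  obtain ⟨U, hU, hx, g, hg, he⟩ := F.smooth_closureSystem_f i j x
  have h1 : ContinuousAt g x := (hg.continuousOn).continuousAt (hU.mem_nhds hx)
  refine (h1.comp continuousAt_subtype_val).congr ?_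
  filter_upwards [(hU.preimage continuous_subtype_val).mem_nhds hx] with y hy
  exact he y hy

theorem continuous_fbar (F : SmoothSystem d M) (i j : Fin n) : Continuous (F.fbar i j) :=
  (F.continuous_closureSystem_f i j).comp
    (Continuous.subtype_mk continuous_subtype_val _)

theorem fbar_mem_closure_inter (F : SmoothSystem d M) {p : ℕ} (σ : Fin (p + 2) ↪o Fin n)
    (α : Fin (p + 2)) (x : M (σ 0)) (hx : x ∈ closure (F.inter σ)) :
    F.fbar (σ 0) (face σ α 0) ⟨x, F.closure_inter_subset σ α hx⟩ ∈
      closure (F.inter (face σ α)) := by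
  have hsub : F.inter σ ⊆ F.A (σ 0) (face σ α 0) := iInter_subset _ _
  have h1 : (⟨x, F.closure_inter_subset σ α hx⟩ : closure (F.A (σ 0) (face σ α 0))) ∈
      closure (Subtype.val ⁻¹' F.inter σ) := by
    rw [closure_subtype, Subtype.image_preimage_coe,
      inter_eq_self_of_subset_right (hsub.trans subset_closure)]
    exact hx
  refine map_mem_closure (F.continuous_fbar _ _) h1 ?_
  rintro ⟨y, hy⟩ hyσ
  have hyσ' : y ∈ F.inter σ := hyσ
  have hyA := hsub hyσ'
  have e : F.fbar (σ 0) (face σ α 0) ⟨y, hy⟩ = F.f (σ 0) (face σ α 0) ⟨y, hyA⟩ :=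
    F.closureSystem_f _ _ _ _ _
  rw [e]
  refine mem_iInter.2 fun a => ?_
  exact F.f_mem_of_mem _ _ _ _ _ (mem_iInter.1 hyσ' _)

/-- Čech `p`-cochains: families, indexed by `i₀ < ⋯ < i_p`, of forms on the closures
`cl M_{i₀ … i_p} ⊆ M_{i₀}`.  For `p = 0` these are families of forms on the `M i`. -/
abbrev RawCochain (F : SmoothSystem d M) (p q : ℕ) : Type u :=
  ∀ σ : Fin (p + 1) ↪o Fin n, RawForm d (closure (F.inter σ)) q

/-- The space `⨁_{i₀ < ⋯ < i_p} Ω^q(cl M_{i₀ … i_p})`. -/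
noncomputable def Cochain (F : SmoothSystem d M) (p q : ℕ) : Submodule ℝ (F.RawCochain p q) :=
  Submodule.pi univ fun σ => Omega d (closure (F.inter σ)) q

/-- The map `Φ^* w = (φ_1^* w, …, φ_n^* w)`. -/
noncomputable def Φ (F : SmoothSystem d M) (q : ℕ) :
    RawForm d (univ : Set F.Glued) q →ₗ[ℝ] F.RawCochain 0 q :=
  LinearMap.pi fun σ =>
    pullback d (fun x : (univ : Set (M (σ 0))) => F.φ (σ 0) x) (subset_univ _)
      (fun _ _ => mem_univ _) q

/-- The Čech differential: the alternating sum of the pullbacks along the (extended) gluing maps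
`cl M_σ → cl M_{σ with one index omitted}`.  The map is the inclusion unless the first index is the
omitted one; the sign is such that for two manifolds `δ (w₁, w₂) = w₁ - fbar^* w₂`. -/
noncomputable def δ (F : SmoothSystem d M) (p q : ℕ) :
    F.RawCochain p q →ₗ[ℝ] F.RawCochain (p + 1) q :=
  LinearMap.pi fun σ => ∑ α : Fin (p + 2), (-1 : ℝ) ^ ((α : ℕ) + 1) •
    (pullback d (F.fbar (σ 0) (face σ α 0)) (F.closure_inter_subset σ α)
      (F.fbar_mem_closure_inter σ α) q).comp (LinearMap.proj (face σ α))

/-- Exactness of `0 → Ω^q(𝐌) → ⨁ Ω^q(M_i) → ⨁ Ω^q(cl M_{ij}) → ⋯ → Ω^q(cl M_{1…n}) → 0`.  Each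
equation also says that the map sends smooth forms to smooth forms.  As there are no cochains in degree
`n` and above, exactness in degree `n - 1` is surjectivity of the last arrow. -/
def CechExact (F : SmoothSystem d M) (q : ℕ) : Prop :=
  (∀ w ∈ Omega d (univ : Set F.Glued) q, F.Φ q w = 0 → w = 0) ∧
  (Omega d (univ : Set F.Glued) q).map (F.Φ q) = F.Cochain 0 q ⊓ LinearMap.ker (F.δ 0 q) ∧
  ∀ p, (F.Cochain p q).map (F.δ p q) = F.Cochain (p + 1) q ⊓ LinearMap.ker (F.δ (p + 1) q)

/-- Each gluing region is a regular open subset. -/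
def RegularOpen (F : SmoothSystem d M) : Prop :=
  ∀ i j, interior (closure (F.A i j)) = F.A i j

/-- The closure of a higher intersection is the intersection of the closures. -/
def ClosureIntersection (F : SmoothSystem d M) : Prop :=
  ∀ (i : Fin n) (s : Finset (Fin n)), closure (⋂ j ∈ s, F.A i j) = ⋂ j ∈ s, closure (F.A i j)

end SmoothSystem

end Gluing

/-! ## The binary Mayer–Vietoris sequence -/

section Binary

variable {d : ℕ} {M : Fin 2 → Type u} [∀ i, TopologicalSpace (M i)]
  [∀ i, ChartedSpace (EuclideanSpace ℝ (Fin d)) (M i)]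

namespace SmoothSystem

/-- The pullback `φ_i^*` from the adjunction space to `M i`. -/
noncomputable def φPull (F : SmoothSystem d M) (i : Fin 2) (q : ℕ) :
    RawForm d (univ : Set F.Glued) q →ₗ[ℝ] RawForm d (univ : Set (M i)) q :=
  pullback d (fun x : (univ : Set (M i)) => F.φ i x) (subset_univ _) (fun _ _ => mem_univ _) q

/-- The difference map `(w₁, w₂) ↦ ι^* w₁ - g^* w₂`, with `ι : S → M 0` the inclusion. -/
noncomputable def diff {S : Set (M 0)} (g : S → M 1) (q : ℕ)
    (w₁ : RawForm d (univ : Set (M 0)) q) (w₂ : RawForm d (univ : Set (M 1)) q) : RawForm d S q :=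
  restrict d (subset_univ S) q w₁ - pullback d g (Subset.refl S) (fun _ _ => mem_univ _) q w₂

/-- The long exact sequence
`0 → H^0(𝐌) → ⋯ → H^q(𝐌) → H^q(M 0) ⊕ H^q(M 1) → H^q(S) → H^{q+1}(𝐌) → ⋯`
for `S = cl M_{12}` with `g` the extended gluing map, or `S = M_{12}` with `g` the gluing map.  The maps
are induced by `Φ^*` and by the difference map `ι^* - g^*`, and the third is the connecting
homomorphism of the snake lemma: if `ι^* w₁ - g^* w₂ = θ` is closed and `φ_i^* w = dw_i`, it maps the
class of `θ` to the class of `w`. -/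
def MayerVietoris (F : SmoothSystem d M) {S : Set (M 0)} (g : S → M 1) : Prop :=
  ∃ (a : ∀ q, HdR d (univ : Set F.Glued) q →ₗ[ℝ]
        HdR d (univ : Set (M 0)) q × HdR d (univ : Set (M 1)) q)
    (b : ∀ q, HdR d (univ : Set (M 0)) q × HdR d (univ : Set (M 1)) q →ₗ[ℝ] HdR d S q)
    (c : ∀ q, HdR d S q →ₗ[ℝ] HdR d (univ : Set F.Glued) (q + 1)),
    (∀ q w (hw : w ∈ closedForms d (univ : Set F.Glued) q),
      ∃ (h₁ : F.φPull 0 q w ∈ closedForms d univ q) (h₂ : F.φPull 1 q w ∈ closedForms d univ q),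
        a q (cls d w hw) = (cls d _ h₁, cls d _ h₂)) ∧
    (∀ q w₁ (h₁ : w₁ ∈ closedForms d (univ : Set (M 0)) q)
        w₂ (h₂ : w₂ ∈ closedForms d (univ : Set (M 1)) q),
      ∃ h : diff g q w₁ w₂ ∈ closedForms d S q,
        b q (cls d w₁ h₁, cls d w₂ h₂) = cls d _ h) ∧
    (∀ q, ∀ w₁ ∈ Omega d (univ : Set (M 0)) q, ∀ w₂ ∈ Omega d (univ : Set (M 1)) q,
      ∀ (hθ : diff g q w₁ w₂ ∈ closedForms d S q)
        w (hw : w ∈ closedForms d (univ : Set F.Glued) (q + 1)),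
        HasExtDeriv d w₁ (F.φPull 0 (q + 1) w) → HasExtDeriv d w₂ (F.φPull 1 (q + 1) w) →
          c q (cls d _ hθ) = cls d w hw) ∧
    Function.Injective (a 0) ∧
    ∀ q, Function.Exact (a q) (b q) ∧ Function.Exact (b q) (c q) ∧
      Function.Exact (c q) (a (q + 1))

/-- Restriction of forms induces isomorphisms `H^q(cl M_{12}) ≅ H^q(M_{12})`. -/
def RestrictionIso (F : SmoothSystem d M) : Prop :=
  ∀ q, ∃ ρ : HdR d (closure (F.A 0 1)) q ≃ₗ[ℝ] HdR d (F.A 0 1) q,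
    ∀ θ (hθ : θ ∈ closedForms d (closure (F.A 0 1)) q),
      ∃ h : restrict d subset_closure q θ ∈ closedForms d (F.A 0 1) q,
        ρ (cls d θ hθ) = cls d _ h

end SmoothSystem

end Binary

end NonHausdorff

/-!
# De Rham theory of an adjunction space

Forms on the adjunction space are the same as families of forms on the `M i` that agree on the gluing
regions (`SmoothSystem.exists_glue`); by density they then agree on the closures.  This gives exactness at
the first two places of the Čech complex without further hypotheses (`SmoothSystem.Φ_injective`,
`SmoothSystem.map_Φ`).  The work is in the surjectivity statements.

*Two manifolds.*  A smooth form on the closed set `cl M_{12}` extends to `M_1` by a partition of unity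
(`exists_extension`), so the short sequence is exact, and the snake lemma gives the long exact sequence in
cohomology (`SmoothSystem.mayerVietoris_fbar`).  Regular domains are contained in the closure of their
interior, so exterior derivatives on them are well defined and natural (`HasExtDeriv.unique`,
`HasExtDeriv.pullback`).

*Closure and interior.*  For an open set `A` that is the interior of the regular domain `cl A`, forms on
`A` modulo forms that extend smoothly to `cl A` are an acyclic complex (`acyclic`).  Near a boundary point
choose a constant inward vector field `v`.  Integrating Cartan's formula along the segments from `y` to
`y + ε v` writes a form whose exterior derivative extends over the boundary as an exact form plus a form
that extends (`eq_translate_sub_succ`).  Local solutions are merged by cut-off functions, by induction on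
the degree, since the difference of two of them satisfies the hypothesis one degree lower
(`exists_merge`).  Hence restriction to the interior is an isomorphism in cohomology
(`SmoothSystem.restrictionIso`), and the second long exact sequence follows by transport.

*Many manifolds.*  Closed domains do not behave like an open cover: smooth forms on `cl M_{ij}` and
`cl M_{ik}` that agree on the intersection need not fit together to a smooth form on the union unless the
two boundaries are in good position.  At a common boundary point the gluing maps force this: the two
domains have the same inward directions there (`SmoothSystem.not_conormal_neg`), because otherwise the
conormal of `cl M_{jk}`, seen in `M_i`, would vanish on an open set of directions.  With a common inward
direction `v`, a form `f` that vanishes on the intersection of the domains is flat there, and it remains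
smooth when multiplied by a cutoff with polynomially growing derivatives that separates the rest of one
domain from the other (`exists_extension_of_cutoff`).  So a form on an intersection of closures can be
extended to a larger intersection, with prescribed zeros wherever these are consistent
(`SmoothSystem.exists_form_extension_finset`).  This extension property alone implies that cocycles of
positive degree are coboundaries: one splits off the largest index and corrects the cochain one index at a
time (`exists_coboundary_eq`, `SmoothSystem.exists_δ_eq`).

Tangent spaces of manifolds modelled on `ℝ^d` are by definition copies of `ℝ^d`, and forms are evaluated
there (`GForm.ev`, `rev`).  Forms on a whole manifold are total functions, so that a form smooth on an
open set only is represented by any of its extensions.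
-/

universe w
set_option linter.unusedSectionVars false

namespace NonHausdorff

/-! ### Smoothness of pullbacks in a vector space -/

section Linear

variable {E F : Type*} [NormedAddCommGroup E] [NormedSpace ℝ E] [NormedAddCommGroup F]
  [NormedSpace ℝ F] {q : ℕ}

/-- Alternatization divided by `q!`: a continuous left inverse of the inclusion of alternating maps
into multilinear maps. -/
noncomputable def alternatize :
    ContinuousMultilinearMap ℝ (fun _ : Fin q => E) ℝ →L[ℝ] E [⋀^Fin q]→L[ℝ] ℝ :=
  LinearMap.mkContinuous
    { toFun := fun f => ((q.factorial : ℝ)⁻¹) • ContinuousMultilinearMap.alternatization f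
      map_add' := fun f g => by rw [map_add, smul_add]
      map_smul' := fun c f => by
        ext v
        simp only [ContinuousAlternatingMap.smul_apply,
          ContinuousMultilinearMap.alternatization_apply_apply, RingHom.id_apply,
          smul_apply, smul_eq_mul, Finset.mul_sum]
        refine Finset.sum_congr rfl fun σ _ => ?_
        rw [Units.smul_def, Units.smul_def, zsmul_eq_mul, zsmul_eq_mul]
        ring }
    ((q.factorial : ℝ)⁻¹ * q.factorial) fun f => by
      refine ContinuousAlternatingMap.opNorm_le_bound _ (by positivity) fun v => ?_
      simp only [LinearMap.coe_mk, AddHom.coe_mk, ContinuousAlternatingMap.smul_apply,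
        ContinuousMultilinearMap.alternatization_apply_apply, norm_smul, norm_inv,
        Real.norm_natCast]
      rw [mul_assoc, mul_assoc]
      refine mul_le_mul_of_nonneg_left ?_ (by positivity)
      refine (norm_sum_le _ _).trans ?_
      have h : ∀ σ ∈ (Finset.univ : Finset (Equiv.Perm (Fin q))),
          ‖Equiv.Perm.sign σ • f (fun i => v (σ i))‖ ≤ ‖f‖ * ∏ i, ‖v i‖ := by
        intro σ _
        have h1 : ‖Equiv.Perm.sign σ • f (fun i => v (σ i))‖ = ‖f (fun i => v (σ i))‖ := by
          rcases Int.units_eq_one_or (Equiv.Perm.sign σ) with h | h <;> simp [h]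
        rw [h1]
        refine (f.le_opNorm _).trans_eq ?_
        rw [Equiv.prod_comp σ (fun i => ‖v i‖)]
      refine (Finset.sum_le_sum h).trans_eq ?_
      simp [Finset.card_univ, Fintype.card_perm]

theorem alternatize_toContinuousMultilinearMap (f : E [⋀^Fin q]→L[ℝ] ℝ) :
    alternatize f.toContinuousMultilinearMap = f := by
  ext v
  have hq : (q.factorial : ℝ) ≠ 0 := by positivity
  simp only [alternatize, LinearMap.mkContinuous_apply, LinearMap.coe_mk, AddHom.coe_mk,
    ContinuousAlternatingMap.smul_apply, ContinuousMultilinearMap.alternatization_apply_apply]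
  have : ∀ σ ∈ (Finset.univ : Finset (Equiv.Perm (Fin q))),
      Equiv.Perm.sign σ • f.toContinuousMultilinearMap (v ∘ σ) = f v := by
    intro σ _
    have := f.toAlternatingMap.map_perm v σ
    change Equiv.Perm.sign σ • f (v ∘ σ) = f v
    change f (v ∘ σ) = Equiv.Perm.sign σ • f v at this
    rw [this, smul_smul]
    simp
  have h2 : (∑ σ : Equiv.Perm (Fin q),
      Equiv.Perm.sign σ • f.toContinuousMultilinearMap (v ∘ σ)) = q.factorial • f v := by
    rw [Finset.sum_congr rfl this]
    simp [Finset.card_univ, Fintype.card_perm]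
  rw [h2]
  simp [hq]

theorem contDiffAt_compContinuousLinearMap {G : Type*} [NormedAddCommGroup G] [NormedSpace ℝ G]
    {n : ℕ∞ω} {f : G → F [⋀^Fin q]→L[ℝ] ℝ} {g : G → E →L[ℝ] F} {x : G}
    (hf : ContDiffAt ℝ n f x) (hg : ContDiffAt ℝ n g x) :
    ContDiffAt ℝ n (fun y => (f y).compContinuousLinearMap (g y)) x := by
  have h1 : ContDiffAt ℝ n (fun y =>
      ContinuousMultilinearMap.compContinuousLinearMapContinuousMultilinear ℝ
        (fun _ : Fin q => E) (fun _ => F) ℝ (fun _ => g y)) x :=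
    (ContinuousMultilinearMap.contDiff _).contDiffAt.comp x (contDiffAt_pi.2 fun _ => hg)
  have h2 : ContDiffAt ℝ n (fun y => (f y).toContinuousMultilinearMap) x :=
    (ContinuousAlternatingMap.toContinuousMultilinearMapCLM ℝ :
      F [⋀^Fin q]→L[ℝ] ℝ →L[ℝ] _).contDiff.contDiffAt.comp x hf
  have h3 := (alternatize (E := E) (q := q)).contDiff.contDiffAt.comp x (h1.clm_apply h2)
  refine h3.congr_of_eventuallyEq (Filter.Eventually.of_forall fun y => ?_)
  change _ = alternatize ((f y).compContinuousLinearMap (g y)).toContinuousMultilinearMap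
  rw [alternatize_toContinuousMultilinearMap]

theorem two_le_infty' : minSmoothness ℝ 2 ≤ ∞ := by
  rw [minSmoothness_of_isRCLikeNormedField]
  exact WithTop.coe_le_coe.2 (le_top : (2 : ℕ∞) ≤ ⊤)

theorem contDiffAt_extDeriv {f : E → E [⋀^Fin q]→L[ℝ] ℝ} {x : E} (hf : ContDiffAt ℝ ∞ f x) :
    ContDiffAt ℝ ∞ (extDeriv f) x := by
  have h1 : ContDiffAt ℝ ∞ (fderiv ℝ f) x := hf.fderiv_right (by simp)
  exact (ContinuousAlternatingMap.alternatizeUncurryFinCLM ℝ E ℝ).contDiff.contDiffAt.comp x h1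

end Linear
/-- The model space `ℝ^d`. -/
abbrev Euc (d : ℕ) : Type := EuclideanSpace ℝ (Fin d)

/-! ### Forms in coordinates, and pullbacks along smooth maps -/

section Coord

variable {d q : ℕ} {M : Type u} [TopologicalSpace M] [ChartedSpace (EuclideanSpace ℝ (Fin d)) M]
  {N : Type v} [TopologicalSpace N] [ChartedSpace (EuclideanSpace ℝ (Fin d)) N]

/-- Not necessarily continuous `q`-forms on the whole of `M`. -/
abbrev GForm (d : ℕ) (M : Type u) [TopologicalSpace M] [ChartedSpace (EuclideanSpace ℝ (Fin d)) M]
    (q : ℕ) : Type u := ∀ x : M, TangentSpace (𝓡 d) x [⋀^Fin q]→L[ℝ] ℝ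

/-- The pullback of a form along a map. -/
noncomputable def gpull (g : M → N) (w : GForm d N q) : GForm d M q :=
  fun x => (w (g x)).compContinuousLinearMap (mfderiv (𝓡 d) (𝓡 d) g x)

/-- The value of a form at a point, with the tangent space identified with the model space. -/
def GForm.ev (w : GForm d M q) (x : M) : Euc d [⋀^Fin q]→L[ℝ] ℝ := w x

/-- The differential of a map between manifolds, as an endomorphism of the model space. -/
noncomputable def mfd (d : ℕ) {M : Type u} [TopologicalSpace M]
    [ChartedSpace (EuclideanSpace ℝ (Fin d)) M] {N : Type v} [TopologicalSpace N]
    [ChartedSpace (EuclideanSpace ℝ (Fin d)) N] (g : M → N) (x : M) : Euc d →L[ℝ] Euc d :=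
  mfderiv (𝓡 d) (𝓡 d) g x

/-- The differential at `x` of the preferred chart at `x₀`, as an endomorphism of the model space. -/
noncomputable def chd (d : ℕ) {M : Type u} [TopologicalSpace M]
    [ChartedSpace (EuclideanSpace ℝ (Fin d)) M] (x₀ x : M) : Euc d →L[ℝ] Euc d :=
  mfderiv (𝓡 d) 𝓘(ℝ, Euc d) (extChartAt (𝓡 d) x₀) x

/-- The differential at `z` of the inverse of the preferred chart at `x₀`, as an endomorphism of the
model space. -/
noncomputable def chs (d : ℕ) {M : Type u} [TopologicalSpace M]
    [ChartedSpace (EuclideanSpace ℝ (Fin d)) M] (x₀ : M) (z : Euc d) : Euc d →L[ℝ] Euc d :=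
  chartSymmDeriv d x₀ z

theorem gpull_ev (g : M → N) (w : GForm d N q) (x : M) (v : Fin q → Euc d) :
    (gpull g w).ev x v = w.ev (g x) (fun i => mfd d g x (v i)) := rfl

theorem coordRep_apply (x₀ : M) (w : GForm d M q) (z : Euc d) (v : Fin q → Euc d) :
    coordRep d x₀ w z v = w.ev ((extChartAt (𝓡 d) x₀).symm z) (fun i => chs d x₀ z (v i)) := rfl

theorem dForm_ev (w : GForm d M q) (x : M) (v : Fin (q + 1) → Euc d) :
    GForm.ev (dForm d w) x v =
      extDeriv (coordRep d x w) (extChartAt (𝓡 d) x x) (fun i => chd d x x (v i)) := rfl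

theorem GForm.ext_ev {w η : GForm d M q} (x : M) (h : ∀ v, w.ev x v = η.ev x v) : w x = η x :=
  ContinuousAlternatingMap.ext h

theorem mfd_id (x : M) : mfd d (id : M → M) x = ContinuousLinearMap.id ℝ _ := mfderiv_id

theorem mdifferentiableAt_extChartAt_symm' [IsManifold (𝓡 d) ∞ M] {x₀ : M} {z : Euc d}
    (hz : z ∈ (extChartAt (𝓡 d) x₀).target) :
    MDifferentiableAt 𝓘(ℝ, Euc d) (𝓡 d) (extChartAt (𝓡 d) x₀).symm z := by
  have := (contMDiffOn_extChartAt_symm (I := 𝓡 d) (n := ∞) x₀).contMDiffAt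
    ((isOpen_extChartAt_target x₀).mem_nhds hz)
  exact this.mdifferentiableAt (by simp)

theorem mdifferentiableAt_extChartAt' [IsManifold (𝓡 d) ∞ M] {x₀ x : M}
    (hx : x ∈ (chartAt (Euc d) x₀).source) :
    MDifferentiableAt (𝓡 d) 𝓘(ℝ, Euc d) (extChartAt (𝓡 d) x₀) x :=
  (contMDiffAt_extChartAt' (I := 𝓡 d) (n := ∞) hx).mdifferentiableAt (by simp)

/-- The differential of the inverse chart after the differential of the chart. -/
theorem chs_chd [IsManifold (𝓡 d) ∞ M] {x₀ x : M}
    (hx : x ∈ (chartAt (Euc d) x₀).source) (v : Euc d) :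
    chs d x₀ (extChartAt (𝓡 d) x₀ x) (chd d x₀ x v) = v := by
  have hx' : x ∈ (extChartAt (𝓡 d) x₀).source := by rwa [extChartAt_source]
  have h := mfderiv_comp (I := 𝓡 d) (I' := 𝓘(ℝ, Euc d)) (I'' := 𝓡 d) x
    (mdifferentiableAt_extChartAt_symm' ((extChartAt (𝓡 d) x₀).map_source hx'))
    (mdifferentiableAt_extChartAt' hx)
  have h2 : (extChartAt (𝓡 d) x₀).symm ∘ (extChartAt (𝓡 d) x₀) =ᶠ[𝓝 x] id := by
    filter_upwards [(isOpen_extChartAt_source (I := 𝓡 d) x₀).mem_nhds hx'] with y hy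
    exact (extChartAt (𝓡 d) x₀).left_inv hy
  have h3 := h2.mfderiv_eq (I := 𝓡 d) (I' := 𝓡 d)
  rw [mfderiv_id] at h3
  have h4 := h.symm.trans h3
  exact congrArg (fun (L : Euc d →L[ℝ] Euc d) => L v) h4

/-- The differential of the chart after the differential of the inverse chart. -/
theorem chd_chs [IsManifold (𝓡 d) ∞ M] {x₀ : M} {z : Euc d}
    (hz : z ∈ (extChartAt (𝓡 d) x₀).target) (v : Euc d) :
    chd d x₀ ((extChartAt (𝓡 d) x₀).symm z) (chs d x₀ z v) = v := by
  have hx' : (extChartAt (𝓡 d) x₀).symm z ∈ (chartAt (Euc d) x₀).source := by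
    have := (extChartAt (𝓡 d) x₀).map_target hz
    rwa [extChartAt_source] at this
  have h := mfderiv_comp (I := 𝓘(ℝ, Euc d)) (I' := 𝓡 d) (I'' := 𝓘(ℝ, Euc d)) z
    (mdifferentiableAt_extChartAt' hx') (mdifferentiableAt_extChartAt_symm' hz)
  have h2 : (extChartAt (𝓡 d) x₀) ∘ (extChartAt (𝓡 d) x₀).symm =ᶠ[𝓝 z] id := by
    filter_upwards [(isOpen_extChartAt_target (I := 𝓡 d) x₀).mem_nhds hz] with y hy
    exact (extChartAt (𝓡 d) x₀).right_inv hy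
  have h3 := h2.mfderiv_eq (I := 𝓘(ℝ, Euc d)) (I' := 𝓘(ℝ, Euc d))
  rw [mfderiv_id] at h3
  have h4 := h.symm.trans h3
  exact congrArg (fun (L : Euc d →L[ℝ] Euc d) => L v) h4

/-- The expression of the map `g` in the preferred charts at `x₀` and `y₀`. -/
noncomputable def coordMap (d : ℕ) {M : Type u} [TopologicalSpace M]
    [ChartedSpace (EuclideanSpace ℝ (Fin d)) M] {N : Type v} [TopologicalSpace N]
    [ChartedSpace (EuclideanSpace ℝ (Fin d)) N] (x₀ : M) (y₀ : N) (g : M → N) : Euc d → Euc d :=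
  fun z => extChartAt (𝓡 d) y₀ (g ((extChartAt (𝓡 d) x₀).symm z))

theorem fderiv_coordMap [IsManifold (𝓡 d) ∞ M] [IsManifold (𝓡 d) ∞ N] {x₀ : M} {y₀ : N}
    {g : M → N} {z : Euc d} (hz : z ∈ (extChartAt (𝓡 d) x₀).target)
    (hg : MDifferentiableAt (𝓡 d) (𝓡 d) g ((extChartAt (𝓡 d) x₀).symm z))
    (hy : g ((extChartAt (𝓡 d) x₀).symm z) ∈ (chartAt (Euc d) y₀).source) (v : Euc d) :
    fderiv ℝ (coordMap d x₀ y₀ g) z v =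
      chd d y₀ (g ((extChartAt (𝓡 d) x₀).symm z))
        (mfd d g ((extChartAt (𝓡 d) x₀).symm z) (chs d x₀ z v)) := by
  have h1 := mfderiv_comp (I := 𝓘(ℝ, Euc d)) (I' := 𝓡 d) (I'' := 𝓡 d) z hg
    (mdifferentiableAt_extChartAt_symm' hz)
  have h2 := mfderiv_comp (I := 𝓘(ℝ, Euc d)) (I' := 𝓡 d) (I'' := 𝓘(ℝ, Euc d)) z
    (g := extChartAt (𝓡 d) y₀) (f := g ∘ (extChartAt (𝓡 d) x₀).symm)
    (mdifferentiableAt_extChartAt' hy) (hg.comp z (mdifferentiableAt_extChartAt_symm' hz))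
  rw [h1] at h2
  rw [← mfderiv_eq_fderiv]
  exact congrArg (fun (L : Euc d →L[ℝ] Euc d) => L v) h2

theorem coordRep_gpull [IsManifold (𝓡 d) ∞ M] [IsManifold (𝓡 d) ∞ N] {x₀ : M} {y₀ : N}
    {g : M → N} (w : GForm d N q) {z : Euc d} (hz : z ∈ (extChartAt (𝓡 d) x₀).target)
    (hg : MDifferentiableAt (𝓡 d) (𝓡 d) g ((extChartAt (𝓡 d) x₀).symm z))
    (hy : g ((extChartAt (𝓡 d) x₀).symm z) ∈ (chartAt (Euc d) y₀).source) :
    coordRep d x₀ (gpull g w) z = (coordRep d y₀ w (coordMap d x₀ y₀ g z)).compContinuousLinearMap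
      (fderiv ℝ (coordMap d x₀ y₀ g) z) := by
  ext v
  have hy' : (extChartAt (𝓡 d) y₀).symm (coordMap d x₀ y₀ g z) =
      g ((extChartAt (𝓡 d) x₀).symm z) :=
    (extChartAt (𝓡 d) y₀).left_inv (by rwa [extChartAt_source])
  have hw : GForm.ev w ((extChartAt (𝓡 d) y₀).symm (coordMap d x₀ y₀ g z)) =
      GForm.ev w (g ((extChartAt (𝓡 d) x₀).symm z)) := congrArg (GForm.ev w) hy'
  rw [coordRep_apply, gpull_ev, ContinuousAlternatingMap.compContinuousLinearMap_apply,
    coordRep_apply, hw]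
  congr 1
  funext i
  rw [Function.comp_apply, fderiv_coordMap hz hg hy]
  exact (chs_chd hy _).symm

theorem contDiffAt_coordMap [IsManifold (𝓡 d) ∞ M] [IsManifold (𝓡 d) ∞ N] {x₀ : M} {y₀ : N}
    {g : M → N} {z : Euc d} (hz : z ∈ (extChartAt (𝓡 d) x₀).target)
    (hg : ContMDiffAt (𝓡 d) (𝓡 d) ∞ g ((extChartAt (𝓡 d) x₀).symm z))
    (hy : g ((extChartAt (𝓡 d) x₀).symm z) ∈ (chartAt (Euc d) y₀).source) :
    ContDiffAt ℝ ∞ (coordMap d x₀ y₀ g) z := by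
  have h1 : ContMDiffAt 𝓘(ℝ, Euc d) (𝓡 d) ∞ (extChartAt (𝓡 d) x₀).symm z :=
    (contMDiffOn_extChartAt_symm (I := 𝓡 d) (n := ∞) x₀).contMDiffAt
      ((isOpen_extChartAt_target x₀).mem_nhds hz)
  have h2 : ContMDiffAt (𝓡 d) 𝓘(ℝ, Euc d) ∞ (extChartAt (𝓡 d) y₀)
      (g ((extChartAt (𝓡 d) x₀).symm z)) := contMDiffAt_extChartAt' hy
  exact contMDiffAt_iff_contDiffAt.1 (h2.comp z (hg.comp z h1))

theorem gpull_id (w : GForm d M q) : gpull (id : M → M) w = w := by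
  funext x
  refine GForm.ext_ev x fun v => ?_
  rw [gpull_ev, mfd_id]
  rfl

/-- Near `z`, the form `gpull g w` is in coordinates the pullback of `w`. -/
theorem coordRep_gpull_eventuallyEq [IsManifold (𝓡 d) ∞ M] [IsManifold (𝓡 d) ∞ N] {x₀ : M} {y₀ : N}
    {g : M → N} (w : GForm d N q) {z : Euc d} (hz : z ∈ (extChartAt (𝓡 d) x₀).target)
    (hg : ContMDiffAt (𝓡 d) (𝓡 d) ∞ g ((extChartAt (𝓡 d) x₀).symm z))
    (hy : g ((extChartAt (𝓡 d) x₀).symm z) ∈ (chartAt (Euc d) y₀).source) :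
    coordRep d x₀ (gpull g w) =ᶠ[𝓝 z] fun z =>
      (coordRep d y₀ w (coordMap d x₀ y₀ g z)).compContinuousLinearMap
        (fderiv ℝ (coordMap d x₀ y₀ g) z) := by
  have hc : ContinuousAt (extChartAt (𝓡 d) x₀).symm z := continuousAt_extChartAt_symm'' hz
  have hg' : ∀ᶠ y in 𝓝 ((extChartAt (𝓡 d) x₀).symm z), MDifferentiableAt (𝓡 d) (𝓡 d) g y := by
    have h1 : ContMDiffAt (𝓡 d) (𝓡 d) 1 g ((extChartAt (𝓡 d) x₀).symm z) := hg.of_le (by simp)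
    filter_upwards [(contMDiffAt_iff_contMDiffAt_nhds (by simp)).1 h1] with y hy
    exact hy.mdifferentiableAt (by simp)
  filter_upwards [(isOpen_extChartAt_target (I := 𝓡 d) x₀).mem_nhds hz, hc.eventually hg',
    hc.eventually (hg.continuousAt.preimage_mem_nhds
      ((chartAt (Euc d) y₀).open_source.mem_nhds hy))] with y h1 h2 h3
  exact coordRep_gpull w h1 h2 h3

theorem coordRep_congr {w η : GForm d M q} {x₀ : M} {z : Euc d}
    (hz : z ∈ (extChartAt (𝓡 d) x₀).target) (h : ∀ᶠ y in 𝓝 ((extChartAt (𝓡 d) x₀).symm z), w y = η y) :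
    coordRep d x₀ w =ᶠ[𝓝 z] coordRep d x₀ η := by
  filter_upwards [(continuousAt_extChartAt_symm'' hz).eventually h] with y hy
  simp only [coordRep, hy]

/-- Smoothness may be tested in any preferred chart. -/
theorem formSmoothAt_iff [IsManifold (𝓡 d) ∞ M] {w : GForm d M q} {x₀ x : M}
    (hx : x ∈ (chartAt (Euc d) x₀).source) :
    FormSmoothAt d w x ↔ ContDiffAt ℝ ∞ (coordRep d x₀ w) (extChartAt (𝓡 d) x₀ x) := by
  have key : ∀ {x₀ x₁ : M} (_ : x ∈ (chartAt (Euc d) x₀).source)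
      (_ : x ∈ (chartAt (Euc d) x₁).source),
      ContDiffAt ℝ ∞ (coordRep d x₀ w) (extChartAt (𝓡 d) x₀ x) →
      ContDiffAt ℝ ∞ (coordRep d x₁ w) (extChartAt (𝓡 d) x₁ x) := by
    intro x₀ x₁ h₀ h₁ h
    have h₁' : x ∈ (extChartAt (𝓡 d) x₁).source := by rwa [extChartAt_source]
    have hz := (extChartAt (𝓡 d) x₁).map_source h₁'
    have e : (extChartAt (𝓡 d) x₁).symm (extChartAt (𝓡 d) x₁ x) = x :=
      (extChartAt (𝓡 d) x₁).left_inv h₁'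
    have h2 := coordRep_gpull_eventuallyEq (x₀ := x₁) (y₀ := x₀) (g := id) w hz contMDiffAt_id
      (by rw [e]; exact h₀)
    rw [gpull_id] at h2
    have hs : ContDiffAt ℝ ∞ (coordMap d x₁ x₀ id) (extChartAt (𝓡 d) x₁ x) :=
      contDiffAt_coordMap hz contMDiffAt_id (by rw [e]; exact h₀)
    have e2 : coordMap d x₁ x₀ id (extChartAt (𝓡 d) x₁ x) = extChartAt (𝓡 d) x₀ x := by
      simp only [coordMap, e, id]
    refine ContDiffAt.congr_of_eventuallyEq ?_ h2
    exact contDiffAt_compContinuousLinearMap (f := fun z => coordRep d _ w (coordMap d _ _ _ z))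
      (ContDiffAt.comp (g := coordRep d x₀ w) _ (by rw [e2]; exact h) hs)
      (hs.fderiv_right (by simp))
  exact ⟨key (mem_chart_source _ x) hx, key hx (mem_chart_source _ x)⟩

theorem formSmoothAt_congr {w η : GForm d M q} {x : M} (h : ∀ᶠ y in 𝓝 x, w y = η y)
    (hw : FormSmoothAt d η x) : FormSmoothAt d w x := by
  refine ContDiffAt.congr_of_eventuallyEq hw (coordRep_congr (mem_extChartAt_target x) ?_)
  rwa [extChartAt_to_inv]

theorem dForm_congr {w η : GForm d M q} {x : M} (h : ∀ᶠ y in 𝓝 x, w y = η y) :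
    dForm d w x = dForm d η x := by
  have := coordRep_congr (x₀ := x) (mem_extChartAt_target (I := 𝓡 d) x)
    (w := w) (η := η) (by rwa [extChartAt_to_inv])
  simp only [dForm, this.extDeriv_eq]

theorem FormSmoothAt.gpull [IsManifold (𝓡 d) ∞ M] [IsManifold (𝓡 d) ∞ N] {g : M → N}
    {w : GForm d N q} {x : M} (hg : ContMDiffAt (𝓡 d) (𝓡 d) ∞ g x)
    (hw : FormSmoothAt d w (g x)) : FormSmoothAt d (gpull g w) x := by
  have e : (extChartAt (𝓡 d) x).symm (extChartAt (𝓡 d) x x) = x := extChartAt_to_inv x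
  have hz := mem_extChartAt_target (I := 𝓡 d) x
  have h2 := coordRep_gpull_eventuallyEq (x₀ := x) (y₀ := g x) (g := g) w hz (by rwa [e])
      (by rw [e]; exact mem_chart_source _ _)
  have hs : ContDiffAt ℝ ∞ (coordMap d x (g x) g) (extChartAt (𝓡 d) x x) :=
    contDiffAt_coordMap hz (by rwa [e]) (by rw [e]; exact mem_chart_source _ _)
  have e2 : coordMap d x (g x) g (extChartAt (𝓡 d) x x) = extChartAt (𝓡 d) (g x) (g x) := by
    simp only [coordMap, e]
  refine ContDiffAt.congr_of_eventuallyEq ?_ h2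
  exact contDiffAt_compContinuousLinearMap (f := fun z => coordRep d _ w (coordMap d _ _ _ z))
      (ContDiffAt.comp (g := coordRep d (g x) w) _ (by rw [e2]; exact hw) hs)
      (hs.fderiv_right (by simp))

/-- The exterior derivative commutes with pullbacks. -/
theorem dForm_gpull [IsManifold (𝓡 d) ∞ M] [IsManifold (𝓡 d) ∞ N] {g : M → N}
    {w : GForm d N q} {x : M} (hg : ContMDiffAt (𝓡 d) (𝓡 d) ∞ g x)
    (hw : FormSmoothAt d w (g x)) : dForm d (NonHausdorff.gpull g w) x =
      NonHausdorff.gpull g (dForm d w) x := by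
  have e : (extChartAt (𝓡 d) x).symm (extChartAt (𝓡 d) x x) = x := extChartAt_to_inv x
  have hz := mem_extChartAt_target (I := 𝓡 d) x
  have hy : g ((extChartAt (𝓡 d) x).symm (extChartAt (𝓡 d) x x)) ∈ (chartAt (Euc d) (g x)).source := by
    rw [e]; exact mem_chart_source _ _
  have h2 := coordRep_gpull_eventuallyEq (x₀ := x) (y₀ := g x) (g := g) w hz (by rwa [e]) hy
  have hs : ContDiffAt ℝ ∞ (coordMap d x (g x) g) (extChartAt (𝓡 d) x x) :=
    contDiffAt_coordMap hz (by rwa [e]) hy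
  have e2 : coordMap d x (g x) g (extChartAt (𝓡 d) x x) = extChartAt (𝓡 d) (g x) (g x) := by
    simp only [coordMap, e]
  have hw' : DifferentiableAt ℝ (coordRep d (g x) w) (coordMap d x (g x) g (extChartAt (𝓡 d) x x)) := by
    rw [e2]; exact hw.differentiableAt
  have hd := fun v => fderiv_coordMap (x₀ := x) (y₀ := g x) (g := g) hz
    (by rw [e]; exact hg.mdifferentiableAt (by simp)) hy v
  refine GForm.ext_ev x fun v => ?_
  rw [gpull_ev, dForm_ev, dForm_ev, h2.extDeriv_eq, extDeriv_pullback hw' hs two_le_infty', e2,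
    ContinuousAlternatingMap.compContinuousLinearMap_apply]
  congr 1
  funext i
  rw [Function.comp_apply, hd, e]
  congr 2
  exact chs_chd (mem_chart_source _ x) _

/-- The exterior derivative may be computed in any preferred chart. -/
theorem coordRep_dForm [IsManifold (𝓡 d) ∞ M] {w : GForm d M q} {x₀ : M} {z : Euc d}
    (hz : z ∈ (extChartAt (𝓡 d) x₀).target)
    (hw : FormSmoothAt d w ((extChartAt (𝓡 d) x₀).symm z)) :
    coordRep d x₀ (dForm d w) z = extDeriv (coordRep d x₀ w) z := by
  set x := (extChartAt (𝓡 d) x₀).symm z with hxdef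
  have hx' : x ∈ (extChartAt (𝓡 d) x₀).source := (extChartAt (𝓡 d) x₀).map_target hz
  have hx : x ∈ (chartAt (Euc d) x₀).source := by rwa [extChartAt_source] at hx'
  have e : (extChartAt (𝓡 d) x).symm (extChartAt (𝓡 d) x x) = x := extChartAt_to_inv x
  have ez : extChartAt (𝓡 d) x₀ x = z := (extChartAt (𝓡 d) x₀).right_inv hz
  have hzx := mem_extChartAt_target (I := 𝓡 d) x
  have hy : id ((extChartAt (𝓡 d) x).symm (extChartAt (𝓡 d) x x)) ∈ (chartAt (Euc d) x₀).source := by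
    rw [e]; exact hx
  have h2 := coordRep_gpull_eventuallyEq (x₀ := x) (y₀ := x₀) (g := id) w hzx contMDiffAt_id hy
  rw [gpull_id] at h2
  have hs : ContDiffAt ℝ ∞ (coordMap d x x₀ id) (extChartAt (𝓡 d) x x) :=
    contDiffAt_coordMap hzx contMDiffAt_id hy
  have e2 : coordMap d x x₀ id (extChartAt (𝓡 d) x x) = z := by
    simp only [coordMap, e, id, ez]
  have hw' : DifferentiableAt ℝ (coordRep d x₀ w) (coordMap d x x₀ id (extChartAt (𝓡 d) x x)) := by
    rw [e2, ← ez]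
    exact ((formSmoothAt_iff hx).1 hw).differentiableAt (by simp)
  have hd := fun v => fderiv_coordMap (x₀ := x) (y₀ := x₀) (g := id) hzx mdifferentiableAt_id hy v
  ext v
  rw [coordRep_apply, ← hxdef, dForm_ev, h2.extDeriv_eq, extDeriv_pullback hw' hs two_le_infty', e2,
    ContinuousAlternatingMap.compContinuousLinearMap_apply]
  congr 1
  funext i
  rw [Function.comp_apply, hd, e, mfd_id, id]
  have h5 := chs_chd (mem_chart_source _ x) (chs d x₀ z (v i))
  rw [h5]
  exact chd_chs hz (v i)

theorem FormSmoothAt.dForm [IsManifold (𝓡 d) ∞ M] {w : GForm d M q} {x : M}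
    (h : ∀ᶠ y in 𝓝 x, FormSmoothAt d w y) : FormSmoothAt d (dForm d w) x := by
  have hc : ContinuousAt (extChartAt (𝓡 d) x).symm (extChartAt (𝓡 d) x x) :=
    continuousAt_extChartAt_symm x
  have h1 : coordRep d x (NonHausdorff.dForm d w) =ᶠ[𝓝 (extChartAt (𝓡 d) x x)]
      extDeriv (coordRep d x w) := by
    have h2 : ∀ᶠ y in 𝓝 ((extChartAt (𝓡 d) x).symm (extChartAt (𝓡 d) x x)),
        FormSmoothAt d w y := by rw [extChartAt_to_inv]; exact h
    filter_upwards [extChartAt_target_mem_nhds (I := 𝓡 d) x, hc.eventually h2] with z hz hw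
    exact coordRep_dForm hz hw
  exact ContDiffAt.congr_of_eventuallyEq (contDiffAt_extDeriv h.self_of_nhds) h1

theorem dForm_dForm [IsManifold (𝓡 d) ∞ M] {w : GForm d M q} {x : M}
    (h : ∀ᶠ y in 𝓝 x, FormSmoothAt d w y) : NonHausdorff.dForm d (NonHausdorff.dForm d w) x = 0 := by
  have hc : ContinuousAt (extChartAt (𝓡 d) x).symm (extChartAt (𝓡 d) x x) :=
    continuousAt_extChartAt_symm x
  have h1 : coordRep d x (NonHausdorff.dForm d w) =ᶠ[𝓝 (extChartAt (𝓡 d) x x)]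
      extDeriv (coordRep d x w) := by
    have h2 : ∀ᶠ y in 𝓝 ((extChartAt (𝓡 d) x).symm (extChartAt (𝓡 d) x x)),
        FormSmoothAt d w y := by rw [extChartAt_to_inv]; exact h
    filter_upwards [extChartAt_target_mem_nhds (I := 𝓡 d) x, hc.eventually h2] with z hz hw
    exact coordRep_dForm hz hw
  rw [NonHausdorff.dForm, h1.extDeriv_eq,
    extDeriv_extDeriv_apply (r := ∞) h.self_of_nhds two_le_infty']
  rfl

end Coord

section Calculus

variable {d q : ℕ} {M : Type u} [TopologicalSpace M] [ChartedSpace (EuclideanSpace ℝ (Fin d)) M]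
  {N : Type v} [TopologicalSpace N] [ChartedSpace (EuclideanSpace ℝ (Fin d)) N]

theorem ev_eq_coordRep [IsManifold (𝓡 d) ∞ M] (w : GForm d M q) {x₀ x : M}
    (hx : x ∈ (chartAt (Euc d) x₀).source) (v : Fin q → Euc d) :
    w.ev x v = coordRep d x₀ w (extChartAt (𝓡 d) x₀ x) (fun i => chd d x₀ x (v i)) := by
  rw [coordRep_apply, (extChartAt (𝓡 d) x₀).left_inv (by rwa [extChartAt_source])]
  simp only [chs_chd hx]

theorem eq_of_frequently_eq {X Y : Type*} [TopologicalSpace X] [TopologicalSpace Y] [T2Space Y]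
    {f g : X → Y} {x : X} (hf : ContinuousAt f x) (hg : ContinuousAt g x)
    (h : ∃ᶠ y in 𝓝 x, f y = g y) : f x = g x := by
  by_contra hne
  exact h ((hf.prodMk hg).eventually (isClosed_diagonal.isOpen_compl.mem_nhds hne))

theorem frequently_extChartAt {p : Euc d → Prop} {x : M}
    (h : ∃ᶠ y in 𝓝 x, p (extChartAt (𝓡 d) x y)) : ∃ᶠ z in 𝓝 (extChartAt (𝓡 d) x x), p z :=
  (continuousAt_extChartAt (I := 𝓡 d) x).frequently h

/-- Smooth forms that agree on a set agree at the points of its closure. -/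
theorem FormSmoothAt.eq_of_mem_closure [IsManifold (𝓡 d) ∞ M] {w η : GForm d M q} {x : M}
    {O : Set M} (hw : FormSmoothAt d w x) (hη : FormSmoothAt d η x) (hx : x ∈ closure O)
    (h : ∀ᶠ y in 𝓝 x, y ∈ O → w y = η y) : w x = η x := by
  have h1 : ∃ᶠ z in 𝓝 (extChartAt (𝓡 d) x x), coordRep d x w z = coordRep d x η z := by
    apply frequently_extChartAt
    refine (mem_closure_iff_frequently.1 hx).mp ?_
    filter_upwards [(chartAt (Euc d) x).open_source.mem_nhds (mem_chart_source _ x), h]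
      with y hy h hyO
    have hy' := (extChartAt (𝓡 d) x).left_inv (by rwa [extChartAt_source])
    ext v
    have : w.ev y = η.ev y := h hyO
    rw [coordRep_apply, coordRep_apply, hy', this]
  have h2 := eq_of_frequently_eq hw.continuousAt hη.continuousAt h1
  refine GForm.ext_ev x fun v => ?_
  rw [ev_eq_coordRep w (mem_chart_source _ x), ev_eq_coordRep η (mem_chart_source _ x), h2]

/-- The exterior derivatives of smooth forms that agree on an open set agree at the points of its
closure. -/
theorem dForm_eq_of_mem_closure [IsManifold (𝓡 d) ∞ M] {w η : GForm d M q} {x : M}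
    {O : Set M} (hO : IsOpen O) (hw : ∀ᶠ y in 𝓝 x, FormSmoothAt d w y)
    (hη : ∀ᶠ y in 𝓝 x, FormSmoothAt d η y) (hx : x ∈ closure O)
    (h : ∀ᶠ y in 𝓝 x, y ∈ O → w y = η y) : dForm d w x = dForm d η x := by
  refine (FormSmoothAt.dForm hw).eq_of_mem_closure (FormSmoothAt.dForm hη) hx ?_
  filter_upwards [h.eventually_nhds] with y hy hyO
  refine dForm_congr ?_
  filter_upwards [hy, hO.mem_nhds hyO] with z hz hzO using hz hzO

theorem mfd_eq_fderiv [IsManifold (𝓡 d) ∞ M] [IsManifold (𝓡 d) ∞ N] {g : M → N} {x : M}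
    (hg : MDifferentiableAt (𝓡 d) (𝓡 d) g x) (v : Euc d) :
    mfd d g x v = chs d (g x) (extChartAt (𝓡 d) (g x) (g x))
      (fderiv ℝ (coordMap d x (g x) g) (extChartAt (𝓡 d) x x) (chd d x x v)) := by
  have e : (extChartAt (𝓡 d) x).symm (extChartAt (𝓡 d) x x) = x := extChartAt_to_inv x
  rw [fderiv_coordMap (mem_extChartAt_target x) (by rwa [e])
    (by rw [e]; exact mem_chart_source _ _), e, chs_chd (mem_chart_source _ _),
    chs_chd (mem_chart_source _ _)]

/-- The differentials of smooth maps that agree on an open set agree at the points of its closure. -/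
theorem mfd_eq_of_mem_closure [IsManifold (𝓡 d) ∞ M] [IsManifold (𝓡 d) ∞ N] {g h : M → N} {x : M}
    {O : Set M} (hO : IsOpen O) (hg : ContMDiffAt (𝓡 d) (𝓡 d) ∞ g x)
    (hh : ContMDiffAt (𝓡 d) (𝓡 d) ∞ h x) (hx : x ∈ closure O) (hgh : g x = h x)
    (he : ∀ᶠ y in 𝓝 x, y ∈ O → g y = h y) : mfd d g x = mfd d h x := by
  have e : (extChartAt (𝓡 d) x).symm (extChartAt (𝓡 d) x x) = x := extChartAt_to_inv x
  have hcg : ContDiffAt ℝ ∞ (coordMap d x (g x) g) (extChartAt (𝓡 d) x x) :=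
    contDiffAt_coordMap (mem_extChartAt_target x) (by rwa [e])
      (by rw [e]; exact mem_chart_source _ _)
  have hch : ContDiffAt ℝ ∞ (coordMap d x (g x) h) (extChartAt (𝓡 d) x x) :=
    contDiffAt_coordMap (mem_extChartAt_target x) (by rwa [e])
      (by rw [e, hgh]; exact mem_chart_source _ _)
  have h1 : ∃ᶠ z in 𝓝 (extChartAt (𝓡 d) x x),
      fderiv ℝ (coordMap d x (g x) g) z = fderiv ℝ (coordMap d x (g x) h) z := by
    apply frequently_extChartAt
    refine (mem_closure_iff_frequently.1 hx).mp ?_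
    filter_upwards [(chartAt (Euc d) x).open_source.mem_nhds (mem_chart_source _ x),
      he.eventually_nhds] with y hy he hyO
    have hys : y ∈ (extChartAt (𝓡 d) x).source := by rwa [extChartAt_source]
    have hy' := (extChartAt (𝓡 d) x).left_inv hys
    refine Filter.EventuallyEq.fderiv_eq ?_
    have hc := continuousAt_extChartAt_symm'' ((extChartAt (𝓡 d) x).map_source hys)
    rw [ContinuousAt, hy'] at hc
    filter_upwards [hc.eventually he, hc.eventually (hO.mem_nhds hyO)] with z hz hzO
    simp only [coordMap, hz hzO]
  have h2 := eq_of_frequently_eq (hcg.fderiv_right (m := ∞) (by simp)).continuousAt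
    (hch.fderiv_right (m := ∞) (by simp)).continuousAt h1
  ext1 v
  rw [mfd_eq_fderiv (hg.mdifferentiableAt (by simp)), mfd_eq_fderiv (hh.mdifferentiableAt (by simp)),
    h2, ← hgh]

theorem mfd_comp {P : Type w} [TopologicalSpace P] [ChartedSpace (EuclideanSpace ℝ (Fin d)) P]
    {g : N → P} {f : M → N} {x : M} (hg : MDifferentiableAt (𝓡 d) (𝓡 d) g (f x))
    (hf : MDifferentiableAt (𝓡 d) (𝓡 d) f x) :
    mfd d (g ∘ f) x = (mfd d g (f x)).comp (mfd d f x) := mfderiv_comp x hg hf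

theorem mfd_congr {g h : M → N} {x : M} (he : g =ᶠ[𝓝 x] h) : mfd d g x = mfd d h x :=
  he.mfderiv_eq

/-! ### Multiples, cut-off functions and partitions of unity -/

theorem FormSmoothAt.fsmul [IsManifold (𝓡 d) ∞ M] {f : M → ℝ} {w : GForm d M q} {x : M}
    (hf : ContMDiffAt (𝓡 d) 𝓘(ℝ, ℝ) ∞ f x) (hw : FormSmoothAt d w x) :
    FormSmoothAt d (fun y => f y • w y) x := by
  have h1 : ContDiffAt ℝ ∞ (f ∘ (extChartAt (𝓡 d) x).symm) (extChartAt (𝓡 d) x x) := by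
    have h2 : ContMDiffAt 𝓘(ℝ, Euc d) (𝓡 d) ∞ (extChartAt (𝓡 d) x).symm (extChartAt (𝓡 d) x x) :=
      (contMDiffOn_extChartAt_symm (I := 𝓡 d) (n := ∞) x).contMDiffAt
        (extChartAt_target_mem_nhds x)
    exact contMDiffAt_iff_contDiffAt.1 (ContMDiffAt.comp _ (by rwa [extChartAt_to_inv]) h2)
  exact ContDiffAt.smul h1 hw

theorem FormSmoothAt.sum {ι : Type*} (s : Finset ι) {w : ι → GForm d M q} {x : M}
    (h : ∀ i ∈ s, FormSmoothAt d (w i) x) : FormSmoothAt d (∑ i ∈ s, w i) x := by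
  classical
  induction s using Finset.induction_on with
  | empty => simpa using FormSmoothAt.zero x
  | insert a s ha ih =>
    rw [Finset.sum_insert ha]
    exact (h a (Finset.mem_insert_self a s)).add
      (ih fun i hi => h i (Finset.mem_insert_of_mem hi))

theorem formSmoothAt_finsum_smul [IsManifold (𝓡 d) ∞ M] {ι : Type*} {s : Set M}
    (ρ : SmoothPartitionOfUnity ι (𝓡 d) M s) {η : ι → GForm d M q} {x : M}
    (h : ∀ i, x ∈ tsupport (ρ i) → FormSmoothAt d (η i) x) :
    FormSmoothAt d (fun y => ∑ᶠ i, ρ i y • η i y) x := by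
  have h1 : FormSmoothAt d (∑ i ∈ ρ.fintsupport x, fun y => ρ i y • η i y : GForm d M q) x := by
    refine FormSmoothAt.sum (w := fun i y => ρ i y • η i y) _ fun i hi => ?_
    exact FormSmoothAt.fsmul (ρ i).contMDiff.contMDiffAt
      (h i ((ρ.mem_fintsupport_iff x i).1 hi))
  refine formSmoothAt_congr ?_ h1
  filter_upwards [ρ.eventually_finsupport_subset x] with y hy
  rw [Finset.sum_apply]
  refine finsum_eq_sum_of_support_subset _ fun i hi => ?_
  refine hy ((ρ.mem_finsupport y).2 fun h0 => hi ?_)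
  have h0' : ρ i y = 0 := h0
  simp only [h0', zero_smul]

/-- A smooth form on a closed set extends to a smooth form on the whole manifold. -/
theorem exists_extension [IsManifold (𝓡 d) ∞ M] [T2Space M] [SecondCountableTopology M] {C : Set M}
    (hC : IsClosed C) {w : RawForm d C q} (hw : w ∈ Omega d C q) :
    ∃ V : GForm d M q, (∀ x, FormSmoothAt d V x) ∧ ∀ x : C, V x = w x := by
  classical
  have : LocallyCompactSpace M := Manifold.locallyCompact_of_finiteDimensional (𝓡 d)
  have hloc : ∀ x : M, ∃ U : Set M, IsOpen U ∧ x ∈ U ∧ ∃ η : GForm d M q,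
      (∀ y ∈ U, FormSmoothAt d η y) ∧ ∀ y : C, (y : M) ∈ U → η y = w y := by
    intro x
    by_cases hx : x ∈ C
    · exact hw ⟨x, hx⟩
    · exact ⟨Cᶜ, hC.isOpen_compl, hx, 0, fun y _ => FormSmoothAt.zero y,
        fun y hy => (hy y.2).elim⟩
  choose U hU hxU η hη hηw using hloc
  obtain ⟨ρ, hρ⟩ := SmoothPartitionOfUnity.exists_isSubordinate (𝓡 d) isClosed_univ U hU
    (fun x _ => mem_iUnion.2 ⟨x, hxU x⟩)
  refine ⟨fun y => ∑ᶠ i, ρ i y • η i y, fun x => formSmoothAt_finsum_smul ρ fun i hi =>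
    hη i x (hρ i hi), fun x => ?_⟩
  have h1 : ∀ i, ρ i x • η i x = ρ i x • w x := by
    intro i
    by_cases hi : ρ i x = 0
    · rw [hi, zero_smul, zero_smul]
    · rw [hηw i x (hρ i (subset_tsupport _ hi))]
  have h2 : ∀ W : Euc d [⋀^Fin q]→L[ℝ] ℝ, ∑ᶠ i, ρ i (x : M) • W = W := fun W => by
    rw [← ρ.sum_finsupport_smul_eq_finsum (x₀ := (x : M)) (fun _ _ => W), ← Finset.sum_smul,
      ρ.sum_finsupport (x : M) (mem_univ _), one_smul]
  simp only [h1]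
  exact h2 (w x)

/-- A cut-off function for two open sets `U` and `V`: smooth on `U ∪ V`, equal to zero near the points
of `V` outside `U` and to one near the points of `U` outside `V`. -/
theorem exists_cutoff [IsManifold (𝓡 d) ∞ M] [T2Space M] [SecondCountableTopology M] {U V : Set M}
    (hU : IsOpen U) (hV : IsOpen V) : ∃ f : M → ℝ,
      (∀ x ∈ U ∪ V, ContMDiffAt (𝓡 d) 𝓘(ℝ, ℝ) ∞ f x) ∧
      (∀ x ∈ V, x ∉ U → ∀ᶠ y in 𝓝 x, f y = 0) ∧ (∀ x ∈ U, x ∉ V → ∀ᶠ y in 𝓝 x, f y = 1) := by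
  have : LocallyCompactSpace M := Manifold.locallyCompact_of_finiteDimensional (𝓡 d)
  obtain ⟨a, ha, has, ha0⟩ := hU.exists_contMDiff_support_eq (𝓡 d)
  obtain ⟨b, hb, hbs, hb0⟩ := hV.exists_contMDiff_support_eq (n := ⊤) (𝓡 d)
  rw [Function.support_eq_iff] at ha hb
  have hpos : ∀ x ∈ U ∪ V, a x + b x ≠ 0 := by
    rintro x (hx | hx)
    · exact (add_pos_of_pos_of_nonneg ((ha0 x).lt_of_ne' (ha.1 x hx)) (hb0 x)).ne'
    · exact (add_pos_of_nonneg_of_pos (ha0 x) ((hb0 x).lt_of_ne' (hb.1 x hx))).ne'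
  have hr : ∀ x ∈ U ∪ V, ContMDiffAt (𝓡 d) 𝓘(ℝ, ℝ) ∞
      (fun x => 2 * (a x / (a x + b x)) - 2⁻¹) x := by
    intro x hx
    exact (contMDiffAt_const.mul (has.contMDiffAt.div₀ (has.contMDiffAt.add hbs.contMDiffAt)
      (hpos x hx))).sub contMDiffAt_const
  refine ⟨fun x => Real.smoothTransition (2 * (a x / (a x + b x)) - 2⁻¹), fun x hx => ?_,
    fun x hxV hxU => ?_, fun x hxU hxV => ?_⟩
  · exact (Real.smoothTransition.contDiff (n := ⊤)).contMDiff.contMDiffAt.comp x (hr x hx)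
  · have h0 := (hr x (Or.inr hxV)).continuousAt
    have h1 : 2 * (a x / (a x + b x)) - 2⁻¹ < 0 := by
      rw [ha.2 x hxU]; norm_num
    filter_upwards [h0.eventually (isOpen_Iio.mem_nhds h1)] with y hy
    exact Real.smoothTransition.zero_of_nonpos (le_of_lt hy)
  · have h0 := (hr x (Or.inl hxU)).continuousAt
    have h1 : 1 < 2 * (a x / (a x + b x)) - 2⁻¹ := by
      rw [hb.2 x hxV, add_zero, div_self (ha.1 x hxU)]; norm_num
    filter_upwards [h0.eventually (isOpen_Ioi.mem_nhds h1)] with y hy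
    exact Real.smoothTransition.one_of_one_le (le_of_lt hy)
end Calculus

/-! ### Local structure of regular domains -/

section Growth

variable {E : Type*} [NormedAddCommGroup E] [NormedSpace ℝ E]

theorem exists_ball_pos {L : E →L[ℝ] ℝ} {v : E} (hv : 0 < L v) :
    ∃ δ > 0, ∀ v' ∈ Metric.ball v δ, 0 < L v' :=
  Metric.eventually_nhds_iff_ball.1 (L.continuous.continuousAt.eventually (isOpen_Ioi.mem_nhds hv))

/-- A function whose derivative in the direction `v` is positive grows linearly along `v`. -/
theorem exists_linear_growth {τ : E → ℝ} {z₀ v : E} (hτ : ContDiffAt ℝ ∞ τ z₀)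
    (hv : 0 < fderiv ℝ τ z₀ v) : ∃ c > 0, ∃ r > 0, ∀ z ∈ Metric.ball z₀ r, ∀ s : ℝ, 0 ≤ s →
      z + s • v ∈ Metric.ball z₀ r → τ z + c * s ≤ τ (z + s • v) := by
  have h1 : ContDiffAt ℝ 1 τ z₀ := hτ.of_le (by simp)
  have hd : ∀ᶠ z in 𝓝 z₀, DifferentiableAt ℝ τ z := by
    filter_upwards [h1.eventually (by simp)] with z hz using hz.differentiableAt (by simp)
  have hc : ContinuousAt (fun z => fderiv ℝ τ z v) z₀ :=
    (hτ.fderiv_right (m := ∞) (by simp)).continuousAt.clm_apply continuousAt_const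
  have hpos : ∀ᶠ z in 𝓝 z₀, fderiv ℝ τ z₀ v / 2 < fderiv ℝ τ z v :=
    hc.eventually (isOpen_Ioi.mem_nhds (half_lt_self hv))
  obtain ⟨r, hr, hball⟩ := Metric.eventually_nhds_iff_ball.1 (hd.and hpos)
  refine ⟨fderiv ℝ τ z₀ v / 2, half_pos hv, r, hr, fun z hz s hs hzs => ?_⟩
  have hseg : ∀ t ∈ Icc 0 s, z + t • v ∈ Metric.ball z₀ r := by
    intro t ht
    rcases hs.eq_or_lt with rfl | hs'
    · rwa [le_antisymm ht.2 ht.1]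
    have := (convex_ball z₀ r) hz hzs (a := 1 - t / s) (b := t / s)
      (by rw [sub_nonneg, div_le_one hs']; exact ht.2) (div_nonneg ht.1 hs) (by ring)
    convert this using 1
    rw [smul_add, ← add_assoc, ← add_smul, smul_smul, div_mul_cancel₀ _ hs'.ne']
    congr 1
    rw [sub_add_cancel, one_smul]
  have hder : ∀ t ∈ Icc 0 s, HasDerivAt (fun t : ℝ => τ (z + t • v)) (fderiv ℝ τ (z + t • v) v) t := by
    intro t ht
    have h2 : HasDerivAt (fun t : ℝ => z + t • v) v t := by
      simpa using ((hasDerivAt_id t).smul_const v).const_add z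
    exact (hball _ (hseg t ht)).1.hasFDerivAt.comp_hasDerivAt t h2
  have := image_le_of_deriv_right_le_deriv_boundary (a := 0) (b := s)
    (f := fun t => τ z + fderiv ℝ τ z₀ v / 2 * t) (f' := fun _ => fderiv ℝ τ z₀ v / 2)
    (B := fun t => τ (z + t • v)) (B' := fun t => fderiv ℝ τ (z + t • v) v)
    (by fun_prop) (fun t _ => by
      simpa using (((hasDerivAt_id t).const_mul (fderiv ℝ τ z₀ v / 2)).const_add
        (τ z)).hasDerivWithinAt) (by simp)
    (fun t ht => (hder t ht).continuousAt.continuousWithinAt)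
    (fun t ht => (hder t (Ico_subset_Icc_self ht)).hasDerivWithinAt)
    (fun t ht => (hball _ (hseg t (Ico_subset_Icc_self ht))).2.le)
  exact this (right_mem_Icc.2 hs)

end Growth

section Regular

variable {d q : ℕ} {M : Type u} [TopologicalSpace M] [ChartedSpace (EuclideanSpace ℝ (Fin d)) M]
  {N : Type v} [TopologicalSpace N] [ChartedSpace (EuclideanSpace ℝ (Fin d)) N]

/-- `τ` is a defining function of the closed set `D` near its boundary point `p`, in the preferred
chart at `p`. -/
structure IsDefining (d : ℕ) {M : Type u} [TopologicalSpace M]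
    [ChartedSpace (EuclideanSpace ℝ (Fin d)) M] (D : Set M) (p : M) (τ : Euc d → ℝ) : Prop where
  contDiffAt : ∀ᶠ z in 𝓝 (extChartAt (𝓡 d) p p), ContDiffAt ℝ ∞ τ z
  mem_iff : ∀ᶠ z in 𝓝 (extChartAt (𝓡 d) p p), ((extChartAt (𝓡 d) p).symm z ∈ D ↔ 0 ≤ τ z)
  eq_zero : τ (extChartAt (𝓡 d) p p) = 0
  exists_pos : ∃ v, 0 < fderiv ℝ τ (extChartAt (𝓡 d) p p) v

theorem IsRegularDomain.exists_isDefining [IsManifold (𝓡 d) ∞ M] {D : Set M}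
    (hD : IsRegularDomain d D) {p : M} (hp : p ∈ frontier D) : ∃ τ, IsDefining d D p τ := by
  obtain ⟨e, he, hpe, k, hk⟩ := hD.2 p hp
  set z₀ := extChartAt (𝓡 d) p p with hz₀
  have hsymm : ∀ᶠ z in 𝓝 z₀, ContMDiffAt 𝓘(ℝ, Euc d) (𝓡 d) ∞ (extChartAt (𝓡 d) p).symm z := by
    filter_upwards [(isOpen_extChartAt_target (I := 𝓡 d) p).mem_nhds
      (mem_extChartAt_target (I := 𝓡 d) p)] with z hz
    exact (contMDiffOn_extChartAt_symm (I := 𝓡 d) (n := ∞) p).contMDiffAt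
      ((isOpen_extChartAt_target p).mem_nhds hz)
  have hsrc : ∀ᶠ z in 𝓝 z₀, (extChartAt (𝓡 d) p).symm z ∈ e.source := by
    have hc := continuousAt_extChartAt_symm (I := 𝓡 d) p
    rw [ContinuousAt, extChartAt_to_inv] at hc
    exact hc.eventually (e.open_source.mem_nhds hpe)
  have hsm : ∀ᶠ z in 𝓝 z₀, ContDiffAt ℝ ∞ (fun z => e ((extChartAt (𝓡 d) p).symm z)) z := by
    filter_upwards [hsymm, hsrc] with z h1 h2
    exact contMDiffAt_iff_contDiffAt.1
      ((contMDiffAt_of_mem_maximalAtlas (I := 𝓡 d) he h2).comp z h1)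
  have hsm0 := hsm.self_of_nhds
  have e0 : (extChartAt (𝓡 d) p).symm z₀ = p := extChartAt_to_inv p
  have hproj : ∀ (f : Euc d → Euc d) (z : Euc d), ContDiffAt ℝ ∞ f z →
      ContDiffAt ℝ ∞ (fun z => f z k) z := fun f z hf => by
    exact (EuclideanSpace.proj k : Euc d →L[ℝ] ℝ).contDiff.contDiffAt.comp z hf
  refine ⟨fun z => e ((extChartAt (𝓡 d) p).symm z) k, ?_, ?_, ?_, ?_⟩
  · filter_upwards [hsm] with z hz using hproj _ _ hz
  · filter_upwards [hsrc] with z hz using hk _ hz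
  · rw [e0]
    have hpD : p ∈ D := hD.1.frontier_subset hp
    refine le_antisymm (not_lt.1 fun hlt => hp.2 ?_) ((hk p hpe).1 hpD)
    rw [mem_interior_iff_mem_nhds]
    have hc : ContinuousAt (fun y => e y k) p :=
      (EuclideanSpace.proj k : Euc d →L[ℝ] ℝ).continuous.continuousAt.comp
        (e.continuousAt hpe)
    filter_upwards [e.open_source.mem_nhds hpe, hc.eventually (isOpen_Ioi.mem_nhds hlt)] with y h1 h2
    exact (hk y h1).2 (le_of_lt h2)
  · set f : Euc d → Euc d := fun z => e ((extChartAt (𝓡 d) p).symm z) with hf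
    have hfz : f z₀ = e p := by simp only [hf, e0]
    set g : Euc d → Euc d := fun z => extChartAt (𝓡 d) p (e.symm z) with hg
    have hgs : ContDiffAt ℝ ∞ g (e p) := by
      have h1 : ContMDiffAt 𝓘(ℝ, Euc d) (𝓡 d) ∞ e.symm (e p) :=
        contMDiffAt_symm_of_mem_maximalAtlas (I := 𝓡 d) he (e.map_source hpe)
      refine contMDiffAt_iff_contDiffAt.1 (ContMDiffAt.comp (e p) ?_ h1)
      rw [e.left_inv hpe]
      exact contMDiffAt_extChartAt
    have hgp : g (e p) = z₀ := by simp only [hg, e.left_inv hpe, hz₀]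
    have hfg : f ∘ g =ᶠ[𝓝 (e p)] id := by
      have hc : ContinuousAt e.symm (e p) := e.symm.continuousAt (e.map_source hpe)
      rw [ContinuousAt, e.left_inv hpe] at hc
      filter_upwards [e.open_target.mem_nhds (e.map_source hpe),
        hc.eventually (extChartAt_source_mem_nhds (I := 𝓡 d) p)] with z h1 h2
      simp only [hf, hg, Function.comp_apply, (extChartAt (𝓡 d) p).left_inv h2, e.right_inv h1, id]
    have hcomp := fderiv_comp (𝕜 := ℝ) (g := f) (f := g) (e p)
      (by rw [hgp]; exact hsm0.differentiableAt (by simp)) (hgs.differentiableAt (by simp))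
    rw [hfg.fderiv_eq, fderiv_id, hgp] at hcomp
    refine ⟨fderiv ℝ g (e p) (EuclideanSpace.single k 1), ?_⟩
    have h2 : fderiv ℝ (fun z => f z k) z₀ = (EuclideanSpace.proj k : Euc d →L[ℝ] ℝ).comp
        (fderiv ℝ f z₀) :=
      ((EuclideanSpace.proj k : Euc d →L[ℝ] ℝ).hasFDerivAt.comp z₀
        (hsm0.differentiableAt (by simp)).hasFDerivAt).fderiv
    rw [h2, ContinuousLinearMap.comp_apply]
    have h3 := congrArg (fun L : Euc d →L[ℝ] Euc d => L (EuclideanSpace.single k 1)) hcomp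
    simp only [ContinuousLinearMap.comp_apply, ContinuousLinearMap.id_apply] at h3
    rw [← h3]
    simp

/-- Straight rays in inward directions stay in the domain. -/
theorem IsDefining.eventually_ray {D : Set M} {p : M} {τ : Euc d → ℝ} (h : IsDefining d D p τ)
    {v : Euc d} (hv : 0 < fderiv ℝ τ (extChartAt (𝓡 d) p p) v) :
    ∀ᶠ s in 𝓝[≥] (0 : ℝ), (extChartAt (𝓡 d) p).symm (extChartAt (𝓡 d) p p + s • v) ∈ D := by
  obtain ⟨c, hc, r, hr, hg⟩ := exists_linear_growth h.contDiffAt.self_of_nhds hv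
  have hcont : Filter.Tendsto (fun s : ℝ => extChartAt (𝓡 d) p p + s • v) (𝓝[≥] 0)
      (𝓝 (extChartAt (𝓡 d) p p)) := by
    have : ContinuousAt (fun s : ℝ => extChartAt (𝓡 d) p p + s • v) 0 := by fun_prop
    have h2 := this.tendsto
    simp only [zero_smul, add_zero] at h2
    exact h2.mono_left nhdsWithin_le_nhds
  filter_upwards [hcont.eventually h.mem_iff, hcont.eventually (Metric.ball_mem_nhds _ hr),
    self_mem_nhdsWithin] with s h1 h2 h3
  refine h1.2 ?_
  have := hg _ (Metric.mem_ball_self hr) s h3 h2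
  rw [h.eq_zero] at this
  exact (mul_nonneg hc.le h3).trans (by linarith)

/-- Differentials of maps on a regular domain are determined by the values on the domain: by
`IsDefining.eventually_ray` the domain contains an open cone of rays at each boundary point. -/
theorem IsRegularDomain.uniqueMDiffWithinAt [IsManifold (𝓡 d) ∞ M] {D : Set M}
    (hD : IsRegularDomain d D) {p : M} (hp : p ∈ D) : UniqueMDiffWithinAt (𝓡 d) D p := by
  by_cases hi : p ∈ interior D
  · exact (isOpen_interior.uniqueMDiffWithinAt hi).mono interior_subset
  obtain ⟨τ, hτ⟩ := hD.exists_isDefining ⟨subset_closure hp, hi⟩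
  obtain ⟨v, hv⟩ := hτ.exists_pos
  obtain ⟨δ, hδ, hball⟩ := exists_ball_pos hv
  have hsub : Metric.ball v δ ⊆ Submodule.span ℝ (tangentConeAt ℝ
      ((extChartAt (𝓡 d) p).symm ⁻¹' D ∩ range (𝓡 d)) (extChartAt (𝓡 d) p p)) := by
    intro v' hv'
    refine Submodule.subset_span (mem_tangentConeAt_of_add_smul_mem (l := 𝓝[>] (0 : ℝ))
      (c := id) (Filter.tendsto_id'.2 (nhdsGT_le_nhdsNE 0)) ?_)
    filter_upwards [(hτ.eventually_ray (hball v' hv')).filter_mono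
      (nhdsWithin_mono _ Ioi_subset_Ici_self)] with s hs
    exact ⟨hs, by simp⟩
  have htop : Submodule.span ℝ (tangentConeAt ℝ
      ((extChartAt (𝓡 d) p).symm ⁻¹' D ∩ range (𝓡 d)) (extChartAt (𝓡 d) p p)) = ⊤ := by
    refine Submodule.eq_top_of_nonempty_interior' (R := ℝ) (M := Euc d) _ ⟨v, ?_⟩
    exact mem_interior.2 ⟨_, hsub, Metric.isOpen_ball, Metric.mem_ball_self hδ⟩
  refine ⟨by rw [htop]; simp, ?_⟩
  refine subset_closure ⟨?_, by simp⟩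
  rw [mem_preimage, extChartAt_to_inv]
  exact hp

/-! ### Differentials of maps defined on subsets, and the induced maps of forms -/

/-- The differential of a map defined on a subset, as an endomorphism of the model space. -/
noncomputable def don (d : ℕ) {M : Type u} [TopologicalSpace M]
    [ChartedSpace (EuclideanSpace ℝ (Fin d)) M] {N : Type v} [TopologicalSpace N]
    [ChartedSpace (EuclideanSpace ℝ (Fin d)) N] {S : Set M} (f : S → N) (x : S) :
    Euc d →L[ℝ] Euc d := derivOn d f x

theorem don_eq_mfd {S : Set M} (f : S → N) (x : S) (hS : UniqueMDiffWithinAt (𝓡 d) S x) {g : M → N}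
    (hg : MDifferentiableAt (𝓡 d) (𝓡 d) g x) (he : ∀ᶠ y in 𝓝 (x : M), ∀ h : y ∈ S, g y = f ⟨y, h⟩) :
    don d f x = mfd d g x := by
  have hx : g x = f x := he.self_of_nhds x.2
  have h1 : (fun y : M => open Classical in if h : y ∈ S then f ⟨y, h⟩ else f x) =ᶠ[𝓝[S] (x : M)] g := by
    filter_upwards [nhdsWithin_le_nhds he, self_mem_nhdsWithin] with y hy hyS
    rw [dif_pos hyS, hy hyS]
  have h2 := h1.mfderivWithin_eq (I := 𝓡 d) (I' := 𝓡 d) (by rw [dif_pos x.2, hx])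
  rw [mfderivWithin_eq_mfderiv hS hg] at h2
  exact h2

/-- The value of a form on a subset, with the tangent space identified with the model space. -/
def rev {S : Set M} (w : RawForm d S q) (x : S) : Euc d [⋀^Fin q]→L[ℝ] ℝ := w x

theorem pullback_rev {S : Set M} (f : S → N) {S' : Set M} {T : Set N} (hS : S' ⊆ S)
    (hT : ∀ x (hx : x ∈ S'), f ⟨x, hS hx⟩ ∈ T) (w : RawForm d T q) (x : S') (v : Fin q → Euc d) :
    rev (pullback d f hS hT q w) x v =
      rev w ⟨f ⟨x, hS x.2⟩, hT x x.2⟩ (fun i => don d f ⟨x, hS x.2⟩ (v i)) := rfl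

/-- The local smooth extensions of a map on `S` have the same differentials as the map. -/
theorem SmoothMapOn.exists_local {S : Set M} {f : S → N} (hf : SmoothMapOn d f)
    (hS : ∀ x ∈ S, UniqueMDiffWithinAt (𝓡 d) S x) (x : S) :
    ∃ U : Set M, IsOpen U ∧ (x : M) ∈ U ∧ ∃ g : M → N,
      (∀ y ∈ U, ContMDiffAt (𝓡 d) (𝓡 d) ∞ g y) ∧
        ∀ y : S, (y : M) ∈ U → g y = f y ∧ don d f y = mfd d g y := by
  obtain ⟨U, hU, hx, g, hg, he⟩ := hf x
  have hg' : ∀ y ∈ U, ContMDiffAt (𝓡 d) (𝓡 d) ∞ g y := fun y hy => hg.contMDiffAt (hU.mem_nhds hy)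
  refine ⟨U, hU, hx, g, hg', fun y hy => ⟨he y hy, ?_⟩⟩
  refine don_eq_mfd f y (hS y y.2) ((hg' y hy).mdifferentiableAt (by simp)) ?_
  filter_upwards [hU.mem_nhds hy] with z hz hzS using he ⟨z, hzS⟩ hz

theorem SmoothMapOn.pullback_eq_gpull {S : Set M} {f : S → N} {S' : Set M} {T : Set N}
    (hS : S' ⊆ S) (hT : ∀ x (hx : x ∈ S'), f ⟨x, hS hx⟩ ∈ T) (w : RawForm d T q) (x : S')
    {g : M → N} {η : GForm d N q} (hg : g x = f ⟨x, hS x.2⟩)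
    (hd : don d f ⟨x, hS x.2⟩ = mfd d g x) (hη : η (g x) = w ⟨g x, by rw [hg]; exact hT x x.2⟩) :
    gpull g η x = pullback d f hS hT q w x := by
  refine ContinuousAlternatingMap.ext fun (v : Fin q → Euc d) => ?_
  change (gpull g η).ev x v = rev (pullback d f hS hT q w) x v
  rw [gpull_ev, pullback_rev, hd]
  have h1 : η.ev (g x) = rev w ⟨g x, by rw [hg]; exact hT x x.2⟩ := hη
  have h2 : (⟨g x, by rw [hg]; exact hT x x.2⟩ : T) = ⟨f ⟨x, hS x.2⟩, hT x x.2⟩ := Subtype.ext hg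
  rw [h1, h2]

theorem SmoothMapOn.pullback_mem_Omega [IsManifold (𝓡 d) ∞ M] [IsManifold (𝓡 d) ∞ N]
    {S : Set M} {f : S → N} (hf : SmoothMapOn d f)
    (hu : ∀ x ∈ S, UniqueMDiffWithinAt (𝓡 d) S x) {S' : Set M} {T : Set N}
    (hS : S' ⊆ S) (hT : ∀ x (hx : x ∈ S'), f ⟨x, hS hx⟩ ∈ T) {w : RawForm d T q}
    (hw : w ∈ Omega d T q) : pullback d f hS hT q w ∈ Omega d S' q := by
  intro x
  obtain ⟨U, hU, hx, g, hg, he⟩ := hf.exists_local hu ⟨x, hS x.2⟩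
  obtain ⟨V, hV, hxV, η, hη, hηw⟩ := hw ⟨f ⟨x, hS x.2⟩, hT x x.2⟩
  have hgc : ContinuousOn g U := fun y hy => (hg y hy).continuousAt.continuousWithinAt
  have hgx : g x ∈ V := by rw [(he ⟨x, hS x.2⟩ hx).1]; exact hxV
  refine ⟨U ∩ g ⁻¹' V, hgc.isOpen_inter_preimage hU hV, ⟨hx, hgx⟩, gpull g η, fun y hy =>
    FormSmoothAt.gpull (hg y hy.1) (hη _ hy.2), fun y hy => ?_⟩
  have h1 := he ⟨y, hS y.2⟩ hy.1
  exact pullback_eq_gpull hS hT w y h1.1 h1.2 (hηw ⟨g y, by rw [h1.1]; exact hT y y.2⟩ hy.2)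

theorem HasExtDeriv.pullback [IsManifold (𝓡 d) ∞ M] [IsManifold (𝓡 d) ∞ N]
    {S : Set M} {f : S → N} (hf : SmoothMapOn d f)
    (hu : ∀ x ∈ S, UniqueMDiffWithinAt (𝓡 d) S x) {S' : Set M} {T : Set N}
    (hS : S' ⊆ S) (hT : ∀ x (hx : x ∈ S'), f ⟨x, hS hx⟩ ∈ T) {w : RawForm d T q}
    {θ : RawForm d T (q + 1)} (hw : HasExtDeriv d w θ) :
    HasExtDeriv d (NonHausdorff.pullback d f hS hT q w)
      (NonHausdorff.pullback d f hS hT (q + 1) θ) := by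
  intro x
  obtain ⟨U, hU, hx, g, hg, he⟩ := hf.exists_local hu ⟨x, hS x.2⟩
  obtain ⟨V, hV, hxV, η, hη, hηw⟩ := hw ⟨f ⟨x, hS x.2⟩, hT x x.2⟩
  have hgc : ContinuousOn g U := fun y hy => (hg y hy).continuousAt.continuousWithinAt
  have hgx : g x ∈ V := by rw [(he ⟨x, hS x.2⟩ hx).1]; exact hxV
  refine ⟨U ∩ g ⁻¹' V, hgc.isOpen_inter_preimage hU hV, ⟨hx, hgx⟩, gpull g η, fun y hy =>
    FormSmoothAt.gpull (hg y hy.1) (hη _ hy.2), fun y hy => ?_⟩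
  have h1 := he ⟨y, hS y.2⟩ hy.1
  have h2 := hηw ⟨g y, by rw [h1.1]; exact hT y y.2⟩ hy.2
  refine ⟨SmoothMapOn.pullback_eq_gpull hS hT w y h1.1 h1.2 h2.1, ?_⟩
  rw [dForm_gpull (hg y hy.1) (hη _ hy.2)]
  exact SmoothMapOn.pullback_eq_gpull hS hT θ y h1.1 h1.2 h2.2

theorem restrict_mem_Omega {S S' : Set M} (h : S' ⊆ S) {w : RawForm d S q} (hw : w ∈ Omega d S q) :
    restrict d h q w ∈ Omega d S' q := by
  intro x
  obtain ⟨U, hU, hx, η, hs, he⟩ := hw ⟨x, h x.2⟩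
  exact ⟨U, hU, hx, η, hs, fun y hy => he ⟨y, h y.2⟩ hy⟩

theorem HasExtDeriv.restrict {S S' : Set M} (h : S' ⊆ S) {w : RawForm d S q}
    {θ : RawForm d S (q + 1)} (hw : HasExtDeriv d w θ) :
    HasExtDeriv d (NonHausdorff.restrict d h q w) (NonHausdorff.restrict d h (q + 1) θ) := by
  intro x
  obtain ⟨U, hU, hx, η, hs, he⟩ := hw ⟨x, h x.2⟩
  exact ⟨U, hU, hx, η, hs, fun y hy => he ⟨y, h y.2⟩ hy⟩

/-! ### The exterior derivative on closed domains -/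

theorem HasExtDeriv.mem_Omega {S : Set M} {w : RawForm d S q} {θ : RawForm d S (q + 1)}
    (h : HasExtDeriv d w θ) : w ∈ Omega d S q := fun x => by
  obtain ⟨U, hU, hx, η, hs, he⟩ := h x
  exact ⟨U, hU, hx, η, hs, fun y hy => (he y hy).1⟩

theorem HasExtDeriv.dForm_mem_Omega [IsManifold (𝓡 d) ∞ M] {S : Set M} {w : RawForm d S q}
    {θ : RawForm d S (q + 1)} (h : HasExtDeriv d w θ) : θ ∈ Omega d S (q + 1) := fun x => by
  obtain ⟨U, hU, hx, η, hs, he⟩ := h x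
  refine ⟨U, hU, hx, dForm d η, fun y hy => FormSmoothAt.dForm ?_, fun y hy => (he y hy).2⟩
  filter_upwards [hU.mem_nhds hy] with z hz using hs z hz

theorem HasExtDeriv.hasExtDeriv_zero [IsManifold (𝓡 d) ∞ M] {S : Set M} {w : RawForm d S q}
    {θ : RawForm d S (q + 1)} (h : HasExtDeriv d w θ) : HasExtDeriv d θ 0 := fun x => by
  obtain ⟨U, hU, hx, η, hs, he⟩ := h x
  have hs' : ∀ y ∈ U, ∀ᶠ z in 𝓝 y, FormSmoothAt d η z := fun y hy => by
    filter_upwards [hU.mem_nhds hy] with z hz using hs z hz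
  exact ⟨U, hU, hx, dForm d η, fun y hy => FormSmoothAt.dForm (hs' y hy),
    fun y hy => ⟨(he y hy).2, dForm_dForm (hs' y hy)⟩⟩

theorem HasExtDeriv.mem_closedForms [IsManifold (𝓡 d) ∞ M] {S : Set M} {w : RawForm d S q}
    {θ : RawForm d S (q + 1)} (h : HasExtDeriv d w θ) : θ ∈ closedForms d S (q + 1) :=
  ⟨h.dForm_mem_Omega, h.hasExtDeriv_zero⟩

/-- On a set contained in the closure of its interior, the exterior derivative does not depend on the
local extensions. -/
theorem HasExtDeriv.unique [IsManifold (𝓡 d) ∞ M] {S : Set M} (hS : S ⊆ closure (interior S))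
    {w : RawForm d S q} {θ θ' : RawForm d S (q + 1)} (h : HasExtDeriv d w θ)
    (h' : HasExtDeriv d w θ') : θ = θ' := by
  funext x
  obtain ⟨U, hU, hx, η, hs, he⟩ := h x
  obtain ⟨U', hU', hx', η', hs', he'⟩ := h' x
  rw [← (he x hx).2, ← (he' x hx').2]
  refine dForm_eq_of_mem_closure isOpen_interior ?_ ?_ (hS x.2) ?_
  · filter_upwards [hU.mem_nhds hx] with z hz using hs z hz
  · filter_upwards [hU'.mem_nhds hx'] with z hz using hs' z hz
  · filter_upwards [hU.mem_nhds hx, hU'.mem_nhds hx'] with z hz hz' hzS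
    exact (he ⟨z, interior_subset hzS⟩ hz).1.trans (he' ⟨z, interior_subset hzS⟩ hz').1.symm

theorem exists_hasExtDeriv [IsManifold (𝓡 d) ∞ M] {S : Set M} (hS : S ⊆ closure (interior S))
    {w : RawForm d S q} (hw : w ∈ Omega d S q) : ∃ θ, HasExtDeriv d w θ := by
  choose U hU hx η hs he using hw
  refine ⟨fun x => dForm d (η x) x, fun x => ⟨U x, hU x, hx x, η x, hs x, fun y hy =>
    ⟨he x y hy, ?_⟩⟩⟩
  refine dForm_eq_of_mem_closure isOpen_interior ?_ ?_ (hS y.2) ?_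
  · filter_upwards [(hU x).mem_nhds hy] with z hz using hs x z hz
  · filter_upwards [(hU y).mem_nhds (hx y)] with z hz using hs y z hz
  · filter_upwards [(hU x).mem_nhds hy, (hU y).mem_nhds (hx y)] with z hz hz' hzS
    exact (he x ⟨z, interior_subset hzS⟩ hz).trans (he y ⟨z, interior_subset hzS⟩ hz').symm

/-- Smooth forms on `S` that agree on a subset whose closure contains `S` are equal. -/
theorem Omega.eq_of_dense [IsManifold (𝓡 d) ∞ M] {S : Set M} {O : Set M} (hO : O ⊆ S)
    (hS : S ⊆ closure O) {w w' : RawForm d S q} (hw : w ∈ Omega d S q) (hw' : w' ∈ Omega d S q)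
    (h : ∀ x (hx : x ∈ O), w ⟨x, hO hx⟩ = w' ⟨x, hO hx⟩) : w = w' := by
  funext x
  obtain ⟨U, hU, hx, η, hs, he⟩ := hw x
  obtain ⟨U', hU', hx', η', hs', he'⟩ := hw' x
  rw [← he x hx, ← he' x hx']
  refine (hs x hx).eq_of_mem_closure (hs' x hx') (hS x.2) ?_
  filter_upwards [hU.mem_nhds hx, hU'.mem_nhds hx'] with z hz hz' hzO
  rw [he ⟨z, hO hzO⟩ hz, he' ⟨z, hO hzO⟩ hz', h z hzO]

end Regular
namespace SmoothSystem

variable {d n q : ℕ} {M : Fin n → Type u} [∀ i, TopologicalSpace (M i)]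
  [∀ i, ChartedSpace (EuclideanSpace ℝ (Fin d)) (M i)] [∀ i, IsManifold (𝓡 d) ∞ (M i)]

/-! ### The extended gluing maps and their differentials -/

section Fbar

variable (F : SmoothSystem d M)

theorem fbar_mem (i j : Fin n) (x : closure (F.A i j)) : F.fbar i j x ∈ closure (F.A j i) := by
  have := F.closureSystem.f_mem i j ⟨x, by rw [F.closureSystem_A]; exact x.2⟩
  rwa [F.closureSystem_A] at this

theorem fbar_self (i : Fin n) (x : closure (F.A i i)) : F.fbar i i x = x :=
  F.closureSystem.f_self i _

theorem fbar_mem_of_mem {i j k : Fin n} {x : M i} (hj : x ∈ closure (F.A i j))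
    (hk : x ∈ closure (F.A i k)) : F.fbar i j ⟨x, hj⟩ ∈ closure (F.A j k) := by
  have := F.closureSystem.f_mem_of_mem i j k x (by rwa [F.closureSystem_A])
    (by rwa [F.closureSystem_A])
  rwa [F.closureSystem_A] at this

theorem fbar_cocycle {i j k : Fin n} {x : M i} (hj : x ∈ closure (F.A i j))
    (hk : x ∈ closure (F.A i k)) :
    F.fbar j k ⟨F.fbar i j ⟨x, hj⟩, F.fbar_mem_of_mem hj hk⟩ = F.fbar i k ⟨x, hk⟩ :=
  (F.closureSystem.cocycle i j k x (by rwa [F.closureSystem_A]) (by rwa [F.closureSystem_A])).symm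

theorem mem_closure_self (i : Fin n) (x : M i) : x ∈ closure (F.A i i) := by
  rw [F.A_self]; simp

theorem fbar_inv (i j : Fin n) (x : closure (F.A i j)) :
    F.fbar j i ⟨F.fbar i j x, F.fbar_mem i j x⟩ = x := by
  rw [← F.fbar_self i ⟨x, F.mem_closure_self i x⟩]
  exact F.fbar_cocycle x.2 (F.mem_closure_self i x)

theorem fbar_eq_f (i j : Fin n) (x : F.A i j) : F.fbar i j ⟨x, subset_closure x.2⟩ = F.f i j x :=
  F.closureSystem_f i j x x.2 _

theorem smooth_fbar (i j : Fin n) : SmoothMapOn d (F.fbar i j) := by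
  intro x
  obtain ⟨U, hU, hx, g, hg, he⟩ := F.smooth_closureSystem_f i j
    ⟨x, by rw [F.closureSystem_A]; exact x.2⟩
  exact ⟨U, hU, hx, g, hg, fun y hy => he ⟨y, by rw [F.closureSystem_A]; exact y.2⟩ hy⟩

theorem uniqueMDiff_closure (i j : Fin n) : ∀ x ∈ closure (F.A i j),
    UniqueMDiffWithinAt (𝓡 d) (closure (F.A i j)) x := fun _ hx =>
  (F.isRegularDomain_closure i j).uniqueMDiffWithinAt hx

/-- The differential of the extended gluing map. -/
noncomputable def Dbar (i j : Fin n) (x : closure (F.A i j)) : Euc d →L[ℝ] Euc d :=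
  don d (F.fbar i j) x

theorem fbar_local (i j : Fin n) (x : closure (F.A i j)) :
    ∃ U : Set (M i), IsOpen U ∧ (x : M i) ∈ U ∧ ∃ g : M i → M j,
      (∀ y ∈ U, ContMDiffAt (𝓡 d) (𝓡 d) ∞ g y) ∧
        ∀ y : closure (F.A i j), (y : M i) ∈ U → g y = F.fbar i j y ∧ F.Dbar i j y = mfd d g y :=
  (F.smooth_fbar i j).exists_local (F.uniqueMDiff_closure i j) x

theorem Dbar_self (i : Fin n) (x : closure (F.A i i)) : F.Dbar i i x = ContinuousLinearMap.id ℝ _ := by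
  rw [← mfd_id (d := d) (x : M i)]
  refine don_eq_mfd _ _ (F.uniqueMDiff_closure i i x x.2) mdifferentiableAt_id ?_
  filter_upwards with y hy
  exact (F.fbar_self i ⟨y, hy⟩).symm

/-- The differentials satisfy the cocycle condition at the points of the closure of the double
intersection, by density of the open intersection, where the condition holds for the maps. -/
theorem Dbar_cocycle {i j k : Fin n} {x : M i} (hx : x ∈ closure (F.A i j ∩ F.A i k))
    (hj : x ∈ closure (F.A i j)) (hk : x ∈ closure (F.A i k)) :
    F.Dbar i k ⟨x, hk⟩ = (F.Dbar j k ⟨F.fbar i j ⟨x, hj⟩, F.fbar_mem_of_mem hj hk⟩).comp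
      (F.Dbar i j ⟨x, hj⟩) := by
  obtain ⟨U, hU, hxU, g, hg, he⟩ := F.fbar_local i j ⟨x, hj⟩
  obtain ⟨V, hV, hxV, h, hh, hhe⟩ := F.fbar_local i k ⟨x, hk⟩
  obtain ⟨W, hW, hxW, l, hl, hle⟩ := F.fbar_local j k ⟨F.fbar i j ⟨x, hj⟩, F.fbar_mem_of_mem hj hk⟩
  have hgx : g x = F.fbar i j ⟨x, hj⟩ := (he ⟨x, hj⟩ hxU).1
  have hgW : g x ∈ W := by rw [hgx]; exact hxW
  have hlx : l (g x) = F.fbar i k ⟨x, hk⟩ := by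
    have := (hle _ hxW).1
    rw [hgx, this, F.fbar_cocycle hj hk]
  rw [(he ⟨x, hj⟩ hxU).2, (hhe ⟨x, hk⟩ hxV).2, (hle _ hxW).2]
  simp only
  rw [← hgx, ← mfd_comp ((hl _ hgW).mdifferentiableAt (by simp))
    ((hg _ hxU).mdifferentiableAt (by simp))]
  refine mfd_eq_of_mem_closure ((F.isOpen_A i j).inter (F.isOpen_A i k)) (hh _ hxV)
    ((hl _ hgW).comp x (hg _ hxU)) hx ?_ ?_
  · rw [(hhe ⟨x, hk⟩ hxV).1, Function.comp_apply, hlx]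
  · filter_upwards [hU.mem_nhds hxU, hV.mem_nhds hxV,
      (hg _ hxU).continuousAt.preimage_mem_nhds (hW.mem_nhds hgW)] with y h1 h2 h3 hy
    have hyj := subset_closure hy.1
    have hyk := subset_closure hy.2
    have e1 := (he ⟨y, hyj⟩ h1).1
    simp only at e1
    rw [mem_preimage, e1] at h3
    rw [(hhe ⟨y, hyk⟩ h2).1, Function.comp_apply, e1,
      (hle ⟨_, F.fbar_mem_of_mem hyj hyk⟩ h3).1, F.fbar_cocycle]

theorem Dbar_inv (i j : Fin n) (x : closure (F.A i j)) (v : Euc d) :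
    F.Dbar j i ⟨F.fbar i j x, F.fbar_mem i j x⟩ (F.Dbar i j x v) = v := by
  have h1 := F.Dbar_cocycle (i := i) (j := j) (k := i) (x := x)
    (by rw [F.A_self, inter_univ]; exact x.2) x.2 (F.mem_closure_self i x)
  rw [Dbar_self] at h1
  exact (congrArg (fun L : Euc d →L[ℝ] Euc d => L v) h1).symm

open Classical in
/-- The pullback of a form along the extended gluing map, extended by zero. -/
noncomputable def trans (i j : Fin n) (w : GForm d (M j) q) : GForm d (M i) q := fun x =>
  if h : x ∈ closure (F.A i j) then
    (w (F.fbar i j ⟨x, h⟩)).compContinuousLinearMap (derivOn d (F.fbar i j) ⟨x, h⟩) else 0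

theorem trans_ev {i j : Fin n} (w : GForm d (M j) q) {x : M i} (h : x ∈ closure (F.A i j))
    (v : Fin q → Euc d) : (F.trans i j w).ev x v =
      w.ev (F.fbar i j ⟨x, h⟩) (fun l => F.Dbar i j ⟨x, h⟩ (v l)) := by
  simp only [trans, GForm.ev, dif_pos h]
  rfl

theorem trans_self (i : Fin n) (w : GForm d (M i) q) : F.trans i i w = w := by
  funext x
  refine GForm.ext_ev x fun v => ?_
  rw [trans_ev F w (F.mem_closure_self i x), Dbar_self, fbar_self]
  rfl

theorem trans_trans {i j k : Fin n} (w : GForm d (M k) q) {x : M i}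
    (hx : x ∈ closure (F.A i j ∩ F.A i k)) : F.trans i j (F.trans j k w) x = F.trans i k w x := by
  have hj := closure_mono inter_subset_left hx
  have hk := closure_mono inter_subset_right hx
  refine GForm.ext_ev x fun v => ?_
  rw [trans_ev F _ hj, trans_ev F _ (F.fbar_mem_of_mem hj hk), trans_ev F _ hk,
    F.fbar_cocycle hj hk, F.Dbar_cocycle hx hj hk]
  rfl

theorem trans_congr {i j : Fin n} {w w' : GForm d (M j) q} {x : M i}
    (h : ∀ hx : x ∈ closure (F.A i j), w (F.fbar i j ⟨x, hx⟩) = w' (F.fbar i j ⟨x, hx⟩)) :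
    F.trans i j w x = F.trans i j w' x := by
  by_cases hx : x ∈ closure (F.A i j)
  · simp only [trans, dif_pos hx, h hx]
  · simp only [trans, dif_neg hx]

end Fbar

/-! ### The adjunction space is a smooth manifold -/

section Glued

variable (F : SmoothSystem d M)

theorem gluedChart_apply {i : Fin n} (x : M i)
    (c : OpenPartialHomeomorph (M i) (EuclideanSpace ℝ (Fin d))) (y : M i) :
    F.gluedChart i x c (F.φ i y) = c y := by
  have : Nonempty (M i) := ⟨x⟩
  have := (F.isOpenEmbedding_φ i).toOpenPartialHomeomorph_left_inv (F.φ i) (x := y)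
  exact congrArg c this

theorem gluedChart_symm_apply {i : Fin n} (x : M i)
    (c : OpenPartialHomeomorph (M i) (EuclideanSpace ℝ (Fin d))) (z : Euc d) :
    (F.gluedChart i x c).symm z = F.φ i (c.symm z) := rfl

theorem mem_gluedChart_source {i : Fin n} (x : M i)
    (c : OpenPartialHomeomorph (M i) (EuclideanSpace ℝ (Fin d))) {p : F.Glued} :
    p ∈ (F.gluedChart i x c).source ↔ ∃ y ∈ c.source, F.φ i y = p := by
  have : Nonempty (M i) := ⟨x⟩
  have key : p ∈ (F.gluedChart i x c).source ↔ p ∈ range (F.φ i) ∧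
      ((F.isOpenEmbedding_φ i).toOpenPartialHomeomorph (F.φ i)).symm p ∈ c.source := by
    simp only [gluedChart, OpenPartialHomeomorph.trans_source, OpenPartialHomeomorph.symm_source,
      mem_inter_iff, mem_preimage, IsOpenEmbedding.toOpenPartialHomeomorph_target]
  rw [key]
  have hinv := fun y => (F.isOpenEmbedding_φ i).toOpenPartialHomeomorph_left_inv (F.φ i) (x := y)
  constructor
  · rintro ⟨⟨y, rfl⟩, h⟩
    rw [hinv] at h
    exact ⟨y, h, rfl⟩
  · rintro ⟨y, h, rfl⟩
    exact ⟨⟨y, rfl⟩, by rwa [hinv]⟩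

theorem gluedChart_mem_target {i : Fin n} (x : M i)
    (c : OpenPartialHomeomorph (M i) (EuclideanSpace ℝ (Fin d))) {z : Euc d}
    (hz : z ∈ (F.gluedChart i x c).target) : z ∈ c.target := by
  simp only [gluedChart, OpenPartialHomeomorph.trans_target] at hz
  exact hz.1

instance isManifold_glued : IsManifold (𝓡 d) ∞ F.Glued := by
  refine isManifold_of_contDiffOn (𝓡 d) ∞ F.Glued ?_
  rintro _ _ ⟨i, x, c, hc, rfl⟩ ⟨j, x', c', hc', rfl⟩
  simp only [modelWithCornersSelf_coe, modelWithCornersSelf_coe_symm, Function.id_comp,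
    Function.comp_id, preimage_id, range_id, inter_univ]
  intro z hz
  rw [OpenPartialHomeomorph.trans_source] at hz
  have hz1 : z ∈ c.target := F.gluedChart_mem_target x c hz.1
  obtain ⟨y', hy's, hy'⟩ := (F.mem_gluedChart_source x' c').1 hz.2
  rw [F.gluedChart_symm_apply] at hy'
  obtain ⟨hA, hf⟩ := F.φ_eq_φ.1 hy'.symm
  obtain ⟨U, hU, hxU, g, hg, he⟩ := F.smooth_f i j ⟨c.symm z, hA⟩
  have hgz : g (c.symm z) = y' := (he ⟨_, hA⟩ hxU).trans hf
  have hsymm : ContMDiffAt 𝓘(ℝ, Euc d) (𝓡 d) ∞ c.symm z :=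
    contMDiffAt_symm_of_mem_maximalAtlas (I := 𝓡 d)
      (IsManifold.subset_maximalAtlas hc) hz1
  have h1 : ContDiffAt ℝ ∞ (fun z => c' (g (c.symm z))) z := by
    refine contMDiffAt_iff_contDiffAt.1 ?_
    have h2 : ContMDiffAt (𝓡 d) 𝓘(ℝ, Euc d) ∞ c' (g (c.symm z)) :=
      contMDiffAt_of_mem_maximalAtlas (I := 𝓡 d) (IsManifold.subset_maximalAtlas hc')
        (by rwa [hgz])
    exact h2.comp z ((hg.contMDiffAt (hU.mem_nhds hxU)).comp z hsymm)
  refine (h1.congr_of_eventuallyEq ?_).contDiffWithinAt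
  filter_upwards [hsymm.continuousAt.eventually ((hU.inter (F.isOpen_A i j)).mem_nhds ⟨hxU, hA⟩)]
    with t ht
  change F.gluedChart j x' c' (F.φ i (c.symm t)) = _
  rw [F.φ_eq_φ.2 ⟨ht.2, rfl⟩, F.gluedChart_apply, ← he ⟨_, ht.2⟩ ht.1]

theorem contMDiff_φ (i : Fin n) : ContMDiff (𝓡 d) (𝓡 d) ∞ (F.φ i) := by
  intro x
  set c := chartAt (Euc d) x with hcdef
  have hmem : F.gluedChart i x c ∈ IsManifold.maximalAtlas (𝓡 d) ∞ F.Glued :=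
    IsManifold.subset_maximalAtlas ⟨i, x, c, chart_mem_atlas _ _, rfl⟩
  have htgt : c x ∈ (F.gluedChart i x c).target := by
    have := (F.gluedChart i x c).map_source
      ((F.mem_gluedChart_source x c).2 ⟨x, mem_chart_source _ x, rfl⟩)
    rwa [F.gluedChart_apply] at this
  have h1 : ContMDiffAt 𝓘(ℝ, Euc d) (𝓡 d) ∞ (F.gluedChart i x c).symm (c x) :=
    contMDiffAt_symm_of_mem_maximalAtlas (I := 𝓡 d) hmem htgt
  have h2 : ContMDiffAt (𝓡 d) 𝓘(ℝ, Euc d) ∞ c x :=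
    contMDiffAt_of_mem_maximalAtlas (I := 𝓡 d) (IsManifold.chart_mem_maximalAtlas x)
      (mem_chart_source _ x)
  refine (h1.comp x h2).congr_of_eventuallyEq ?_
  filter_upwards [c.open_source.mem_nhds (mem_chart_source _ x)] with y hy
  rw [Function.comp_apply, F.gluedChart_symm_apply, c.left_inv hy]

/-- The canonical maps have smooth local inverses. -/
theorem exists_local_inverse (i : Fin n) (x : M i) : ∃ ψ : F.Glued → M i,
    ContMDiffAt (𝓡 d) (𝓡 d) ∞ ψ (F.φ i x) ∧ (∀ᶠ y in 𝓝 x, ContMDiffAt (𝓡 d) (𝓡 d) ∞ ψ (F.φ i y) ∧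
      ψ (F.φ i y) = y) ∧ ∀ᶠ p in 𝓝 (F.φ i x), F.φ i (ψ p) = p := by
  set c := chartAt (Euc d) x with hcdef
  have hmem : F.gluedChart i x c ∈ IsManifold.maximalAtlas (𝓡 d) ∞ F.Glued :=
    IsManifold.subset_maximalAtlas ⟨i, x, c, chart_mem_atlas _ _, rfl⟩
  have hs : ∀ y ∈ c.source, ContMDiffAt (𝓡 d) (𝓡 d) ∞
      (fun p => c.symm (F.gluedChart i x c p)) (F.φ i y) := by
    intro y hy
    have h1 : ContMDiffAt (𝓡 d) 𝓘(ℝ, Euc d) ∞ (F.gluedChart i x c) (F.φ i y) :=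
      contMDiffAt_of_mem_maximalAtlas (I := 𝓡 d) hmem
        ((F.mem_gluedChart_source x c).2 ⟨y, hy, rfl⟩)
    have h2 : ContMDiffAt 𝓘(ℝ, Euc d) (𝓡 d) ∞ c.symm (F.gluedChart i x c (F.φ i y)) :=
      contMDiffAt_symm_of_mem_maximalAtlas (I := 𝓡 d) (IsManifold.chart_mem_maximalAtlas x)
        (by rw [F.gluedChart_apply]; exact c.map_source hy)
    exact h2.comp _ h1
  refine ⟨fun p => c.symm (F.gluedChart i x c p), hs x (mem_chart_source _ x), ?_, ?_⟩
  · filter_upwards [c.open_source.mem_nhds (mem_chart_source _ x)] with y hy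
    exact ⟨hs y hy, by rw [F.gluedChart_apply, c.left_inv hy]⟩
  · filter_upwards [(F.gluedChart i x c).open_source.mem_nhds
      ((F.mem_gluedChart_source x c).2 ⟨x, mem_chart_source _ x, rfl⟩)] with p hp
    obtain ⟨y, hy, rfl⟩ := (F.mem_gluedChart_source x c).1 hp
    rw [F.gluedChart_apply, c.left_inv hy]

theorem mfd_φ_bijective (i : Fin n) (x : M i) : Function.Bijective (mfd d (F.φ i) x) := by
  obtain ⟨ψ, h1, h2, h3⟩ := F.exists_local_inverse i x
  have hφ : MDifferentiableAt (𝓡 d) (𝓡 d) (F.φ i) x := (F.contMDiff_φ i x).mdifferentiableAt (by simp)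
  have hψ : MDifferentiableAt (𝓡 d) (𝓡 d) ψ (F.φ i x) := h1.mdifferentiableAt (by simp)
  have e1 : mfd d (ψ ∘ F.φ i) x = ContinuousLinearMap.id ℝ _ := by
    rw [← mfd_id (d := d) x]
    refine mfd_congr ?_
    filter_upwards [h2] with y hy using hy.2
  have e2 : mfd d (F.φ i ∘ ψ) (F.φ i x) = ContinuousLinearMap.id ℝ _ := by
    rw [← mfd_id (d := d) (F.φ i x)]
    refine mfd_congr ?_
    filter_upwards [h3] with y hy using hy
  have hx := h2.self_of_nhds.2
  rw [mfd_comp hψ hφ] at e1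
  rw [mfd_comp (by rwa [hx]) hψ, hx] at e2
  refine ⟨fun a b hab => ?_, fun b => ⟨mfd d ψ (F.φ i x) b, ?_⟩⟩
  · have := fun v => congrArg (fun L : Euc d →L[ℝ] Euc d => L v) e1
    simp only [ContinuousLinearMap.comp_apply, ContinuousLinearMap.id_apply] at this
    rw [← this a, ← this b, hab]
  · exact congrArg (fun L : Euc d →L[ℝ] Euc d => L b) e2

theorem exists_φ_eq (p : F.Glued) : ∃ i x, F.φ i x = p := by
  obtain ⟨⟨i, x⟩, rfl⟩ := Quotient.exists_rep p
  exact ⟨i, x, rfl⟩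

/-- A form on the adjunction space is determined by its pullbacks. -/
theorem gform_ext {w w' : GForm d F.Glued q} (h : ∀ i, gpull (F.φ i) w = gpull (F.φ i) w') :
    w = w' := by
  funext p
  obtain ⟨i, x, rfl⟩ := F.exists_φ_eq p
  refine GForm.ext_ev _ fun v => ?_
  choose u hu using fun l => (F.mfd_φ_bijective i x).2 (v l)
  have h1 : (gpull (F.φ i) w).ev x u = (gpull (F.φ i) w').ev x u := by rw [h i]
  rw [gpull_ev, gpull_ev] at h1
  simpa only [hu] using h1

/-- Over the gluing region the differential of `φ_i` is that of `φ_j` composed with that of the gluing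
map. -/
theorem mfd_φ_comp {i j : Fin n} {x : M i} (hx : x ∈ F.A i j) :
    mfd d (F.φ i) x = (mfd d (F.φ j) (F.fbar i j ⟨x, subset_closure hx⟩)).comp
      (F.Dbar i j ⟨x, subset_closure hx⟩) := by
  obtain ⟨U, hU, hxU, g, hg, he⟩ := F.fbar_local i j ⟨x, subset_closure hx⟩
  have e1 := he ⟨x, subset_closure hx⟩ hxU
  rw [e1.2, ← e1.1, ← mfd_comp ((F.contMDiff_φ j _).mdifferentiableAt (by simp))
    ((hg _ hxU).mdifferentiableAt (by simp))]
  refine mfd_congr ?_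
  filter_upwards [hU.mem_nhds hxU, (F.isOpen_A i j).mem_nhds hx] with y hy hyA
  have e2 := (he ⟨y, subset_closure hyA⟩ hy).1
  simp only at e2
  rw [Function.comp_apply, e2, F.fbar_eq_f i j ⟨y, hyA⟩]
  exact F.φ_eq_φ.2 ⟨hyA, rfl⟩

theorem gpull_φ_eq_trans {i j : Fin n} (w : GForm d F.Glued q) {x : M i} (hx : x ∈ F.A i j) :
    F.trans i j (gpull (F.φ j) w) x = gpull (F.φ i) w x := by
  refine GForm.ext_ev x fun v => ?_
  have e : F.φ j (F.fbar i j ⟨x, subset_closure hx⟩) = F.φ i x := by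
    rw [F.fbar_eq_f i j ⟨x, hx⟩]
    exact (F.φ_eq_φ.2 ⟨hx, rfl⟩).symm
  rw [trans_ev F _ (subset_closure hx), gpull_ev, gpull_ev, F.mfd_φ_comp hx, e]
  rfl

/-- Compatible smooth forms on the `M i` glue to a smooth form on the adjunction space. -/
theorem exists_glue (w : ∀ i, GForm d (M i) q) (hw : ∀ i x, FormSmoothAt d (w i) x)
    (hc : ∀ i j, ∀ x ∈ F.A i j, F.trans i j (w j) x = w i x) :
    ∃ W : GForm d F.Glued q, (∀ p, FormSmoothAt d W p) ∧ ∀ i, gpull (F.φ i) W = w i := by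
  choose I X hX using fun p => F.exists_φ_eq p
  choose ψ hψ hψl hψr using fun p => F.exists_local_inverse (I p) (X p)
  have key : ∀ p, ∀ i x, F.φ i x = p → (gpull (F.φ i) fun p => gpull (ψ p) (w (I p)) p) x = w i x := by
    intro p i x hp
    refine GForm.ext_ev x fun v => ?_
    obtain ⟨hA, hf⟩ := F.φ_eq_φ.1 (hp.trans (hX p).symm)
    have e : (w i).ev x v = (F.trans i (I p) (w (I p))).ev x v := by
      unfold GForm.ev; rw [hc i (I p) x hA]
    rw [e, trans_ev F _ (subset_closure hA), gpull_ev, hp]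
    change (gpull (ψ p) (w (I p))).ev p _ = _
    rw [gpull_ev]
    have hXp := (hψl p).self_of_nhds.2
    rw [hX] at hXp
    rw [hXp, F.fbar_eq_f i (I p) ⟨x, hA⟩, hf]
    congr 1
    funext l
    rw [F.mfd_φ_comp hA, F.fbar_eq_f i (I p) ⟨x, hA⟩, hf]
    have e1 : mfd d (ψ p ∘ F.φ (I p)) (X p) = ContinuousLinearMap.id ℝ _ := by
      rw [← mfd_id (d := d) (X p)]
      refine mfd_congr ?_
      filter_upwards [hψl p] with y hy using hy.2
    rw [mfd_comp ((hψ p).mdifferentiableAt (by simp))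
      ((F.contMDiff_φ _ _).mdifferentiableAt (by simp)), hX] at e1
    exact congrArg (fun L : Euc d →L[ℝ] Euc d => L _) e1
  have key' : ∀ i, (gpull (F.φ i) fun p => gpull (ψ p) (w (I p)) p) = w i :=
    fun i => funext fun x => key _ i x rfl
  refine ⟨fun p => gpull (ψ p) (w (I p)) p, fun p => ?_, key'⟩
  have h0 : FormSmoothAt d (gpull (ψ p) (w (I p))) p := by
    refine FormSmoothAt.gpull ?_ (hw _ _)
    have := hψ p
    rwa [hX] at this
  generalize (fun p => gpull (ψ p) (w (I p)) p : GForm d F.Glued q) = W at key'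
  refine formSmoothAt_congr ?_ h0
  have h1 := hψr p
  have h2 := (contMDiffAt_iff_contMDiffAt_nhds (by simp)).1 ((hψ p).of_le (m := 1) (by simp))
  rw [hX] at h1 h2
  filter_upwards [h1.eventually_nhds, h2] with p' h1 h2
  refine GForm.ext_ev p' fun v => ?_
  have e2 : mfd d (F.φ (I p) ∘ ψ p) p' = ContinuousLinearMap.id ℝ _ := by
    rw [← mfd_id (d := d) p']
    refine mfd_congr ?_
    filter_upwards [h1] with y hy using hy
  rw [mfd_comp ((F.contMDiff_φ _ _).mdifferentiableAt (by simp))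
    (h2.mdifferentiableAt (by simp))] at e2
  rw [gpull_ev, ← key' (I p), gpull_ev, h1.self_of_nhds]
  congr 1
  funext l
  exact (congrArg (fun L : Euc d →L[ℝ] Euc d => L (v l)) e2).symm

end Glued

end SmoothSystem

/-! ### Extension by zero -/

section ZeroExtension

variable {d q : ℕ} {M : Type u} [TopologicalSpace M] [ChartedSpace (EuclideanSpace ℝ (Fin d)) M]

open Classical in
/-- The extension by zero of a form on a subset. -/
noncomputable def zeroExt {S : Set M} (w : RawForm d S q) : GForm d M q := fun x =>
  if h : x ∈ S then w ⟨x, h⟩ else 0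

theorem zeroExt_of_mem {S : Set M} (w : RawForm d S q) {x : M} (h : x ∈ S) :
    zeroExt w x = w ⟨x, h⟩ := dif_pos h

theorem formSmoothAt_zeroExt {S : Set M} {w : RawForm d S q} (hw : w ∈ Omega d S q) {x : M}
    (hx : S ∈ 𝓝 x) : FormSmoothAt d (zeroExt w) x := by
  obtain ⟨U, hU, hxU, η, hη, he⟩ := hw ⟨x, mem_of_mem_nhds hx⟩
  refine formSmoothAt_congr ?_ (hη x hxU)
  filter_upwards [hx, hU.mem_nhds hxU] with y hy hyU
  rw [zeroExt_of_mem w hy, he ⟨y, hy⟩ hyU]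

theorem mem_Omega_of_formSmoothAt {S : Set M} {w : RawForm d S q} {η : GForm d M q}
    (hη : ∀ x ∈ S, ∀ᶠ y in 𝓝 x, FormSmoothAt d η y) (h : ∀ x : S, w x = η x) : w ∈ Omega d S q := by
  intro x
  obtain ⟨U, hUs, hU, hxU⟩ := mem_nhds_iff.1 (hη x x.2)
  exact ⟨U, hU, hxU, η, fun y hy => hUs hy, fun y _ => (h y).symm⟩

theorem RawForm.ext_zeroExt {S : Set M} {w w' : RawForm d S q}
    (h : ∀ x ∈ S, zeroExt w x = zeroExt w' x) : w = w' := by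
  funext x
  have := h x x.2
  rwa [zeroExt_of_mem _ x.2, zeroExt_of_mem _ x.2] at this

theorem zeroExt_zero {S : Set M} : zeroExt (0 : RawForm d S q) = 0 := by
  funext x
  by_cases h : x ∈ S
  · exact zeroExt_of_mem _ h
  · exact dif_neg h

/-- The restriction of a form to a subset. -/
def GForm.on (w : GForm d M q) (S : Set M) : RawForm d S q := fun x => w x

theorem GForm.on_mem_Omega {w : GForm d M q} {S : Set M} (hw : ∀ x, FormSmoothAt d w x) :
    w.on S ∈ Omega d S q :=
  mem_Omega_of_formSmoothAt (fun _ _ => Filter.Eventually.of_forall hw) fun _ => rfl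

theorem zeroExt_on_univ (w : GForm d M q) : zeroExt (w.on univ) = w :=
  funext fun p => zeroExt_of_mem _ (mem_univ p)

end ZeroExtension

namespace SmoothSystem

variable {d n q : ℕ} {M : Fin n → Type u} [∀ i, TopologicalSpace (M i)]
  [∀ i, ChartedSpace (EuclideanSpace ℝ (Fin d)) (M i)] [∀ i, IsManifold (𝓡 d) ∞ (M i)]

/-! ### The beginning of the Čech complex -/

/-- The multi-index with a single entry. -/
def single (i : Fin n) : Fin 1 ↪o Fin n :=
  OrderEmbedding.ofStrictMono (fun _ => i) (Subsingleton.strictMono _)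

theorem eq_single (σ : Fin (0 + 1) ↪o Fin n) : ∃ i, σ = single i :=
  ⟨σ 0, by ext a; fin_cases a; rfl⟩

/-- The multi-index with two entries. -/
def pair {i j : Fin n} (h : i < j) : Fin 2 ↪o Fin n :=
  OrderEmbedding.ofStrictMono ![i, j] (by
    intro a b hab
    fin_cases a <;> fin_cases b <;> simp_all)

variable (F : SmoothSystem d M)

theorem inter_single (σ : Fin (0 + 1) ↪o Fin n) : F.inter σ = univ := by
  refine eq_univ_of_forall fun x => mem_iInter.2 fun a => ?_
  have e : a = 0 := by fin_cases a; rfl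
  rw [e, F.A_self]
  trivial

theorem inter_pair (σ : Fin 2 ↪o Fin n) : F.inter σ = F.A (σ 0) (σ 1) := by
  ext x
  refine mem_iInter.trans (Fin.forall_fin_two.trans ?_)
  simp only [F.A_self, mem_univ, true_and, Nat.reduceAdd]

theorem zeroExt_δ {p : ℕ} (β : F.RawCochain p q) (σ : Fin (p + 2) ↪o Fin n) {x : M (σ 0)}
    (hx : x ∈ closure (F.inter σ)) : zeroExt (F.δ p q β σ) x =
      ∑ α : Fin (p + 2), (-1 : ℝ) ^ ((α : ℕ) + 1) •
        F.trans (σ 0) (face σ α 0) (zeroExt (β (face σ α))) x := by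
  rw [zeroExt_of_mem _ hx]
  simp only [δ, LinearMap.pi_apply, LinearMap.sum_apply, LinearMap.smul_apply,
    LinearMap.comp_apply, LinearMap.proj_apply]
  have h1 : ∀ (s : Finset (Fin (p + 2))) (f : Fin (p + 2) → RawForm d (closure (F.inter σ)) q),
      (∑ α ∈ s, f α) ⟨x, hx⟩ = ∑ α ∈ s, f α ⟨x, hx⟩ := fun s f => Finset.sum_apply _ _ _
  refine (h1 _ _).trans (Finset.sum_congr rfl fun α _ => ?_)
  have h2 := F.closure_inter_subset σ α hx
  have h3 := F.fbar_mem_closure_inter σ α x hx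
  change (-1 : ℝ) ^ ((α : ℕ) + 1) • pullback d _ _ _ q (β (face σ α)) ⟨x, hx⟩ = _
  congr 1
  rw [trans, dif_pos h2, zeroExt_of_mem _ h3]
  rfl

theorem zeroExt_Φ (w : RawForm d (univ : Set F.Glued) q) (σ : Fin (0 + 1) ↪o Fin n) :
    zeroExt (F.Φ q w σ) = gpull (F.φ (σ 0)) (zeroExt w) := by
  funext x
  have hx : x ∈ closure (F.inter σ) := by rw [F.inter_single]; simp
  rw [zeroExt_of_mem _ hx]
  refine ContinuousAlternatingMap.ext fun (v : Fin q → Euc d) => ?_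
  change rev (F.Φ q w σ) ⟨x, hx⟩ v = (gpull (F.φ (σ 0)) (zeroExt w)).ev x v
  rw [gpull_ev]
  have h1 : don d (fun x : (univ : Set (M (σ 0))) => F.φ (σ 0) x) ⟨x, mem_univ x⟩ =
      mfd d (F.φ (σ 0)) x :=
    don_eq_mfd _ _ (uniqueMDiffWithinAt_univ _) ((F.contMDiff_φ _ x).mdifferentiableAt (by simp))
      (Filter.Eventually.of_forall fun _ _ => rfl)
  rw [← h1]
  have h2 : (zeroExt w).ev (F.φ (σ 0) x) = rev w ⟨F.φ (σ 0) x, mem_univ _⟩ :=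
    zeroExt_of_mem w (mem_univ _)
  rw [h2]
  rfl

theorem Φ_injective {w : RawForm d (univ : Set F.Glued) q} (h : F.Φ q w = 0) : w = 0 := by
  refine RawForm.ext_zeroExt fun p _ => congrFun (F.gform_ext fun i => ?_) p
  have h1 := F.zeroExt_Φ w (single i)
  have h2 := F.zeroExt_Φ (0 : RawForm d (univ : Set F.Glued) q) (single i)
  have h3 : F.Φ q w = F.Φ q 0 := by rw [h, map_zero]
  exact h1.symm.trans ((congrArg (fun β : F.RawCochain 0 q => zeroExt (β (single i))) h3).trans h2)

theorem face_pair_zero (σ : Fin 2 ↪o Fin n) : face σ 0 = single (σ 1) := by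
  ext a; fin_cases a; rfl

theorem face_pair_one (σ : Fin 2 ↪o Fin n) : face σ 1 = single (σ 0) := by
  ext a; fin_cases a; rfl

/-- The components of a cochain of degree zero, as forms on the manifolds. -/
noncomputable def component (β : F.RawCochain 0 q) (i : Fin n) : GForm d (M i) q :=
  zeroExt (β (single i))

theorem component_Φ (w : RawForm d (univ : Set F.Glued) q) (i : Fin n) :
    F.component (F.Φ q w) i = gpull (F.φ i) (zeroExt w) := F.zeroExt_Φ w (single i)

theorem zeroExt_δ_zero (β : F.RawCochain 0 q) (σ : Fin 2 ↪o Fin n) {x : M (σ 0)}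
    (hx : x ∈ closure (F.A (σ 0) (σ 1))) : (zeroExt (F.δ 0 q β σ)).ev x =
      (F.component β (σ 0)).ev x - (F.trans (σ 0) (σ 1) (F.component β (σ 1))).ev x := by
  have h1 := F.zeroExt_δ β σ (x := x) (by rwa [F.inter_pair])
  rw [Fin.sum_univ_two] at h1
  have h0 : ∀ τ : Fin 1 ↪o Fin n, ∀ i, τ = single i →
      F.trans (σ 0) (τ 0) (zeroExt (β τ)) x = F.trans (σ 0) i (F.component β i) x := by
    rintro _ i rfl
    rfl
  rw [h0 _ _ (face_pair_zero σ), h0 _ _ (face_pair_one σ), F.trans_self] at h1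
  refine Eq.trans h1 ?_
  have : ∀ (V : Type) [AddCommGroup V] [Module ℝ V] (a b : V),
      (-1 : ℝ) ^ (((0 : Fin 2) : ℕ) + 1) • a + (-1 : ℝ) ^ (((1 : Fin 2) : ℕ) + 1) • b = b - a := by
    intro V _ _ a b
    have e1 : (-1 : ℝ) ^ (((0 : Fin 2) : ℕ) + 1) = -1 := by norm_num
    have e2 : (-1 : ℝ) ^ (((1 : Fin 2) : ℕ) + 1) = 1 := by norm_num
    rw [e1, e2, neg_smul, one_smul, one_smul, neg_add_eq_sub]
  exact this (Euc d [⋀^Fin q]→L[ℝ] ℝ) _ _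

theorem formSmoothAt_component {β : F.RawCochain 0 q} (h : β ∈ F.Cochain 0 q) (i : Fin n)
    (x : M i) : FormSmoothAt d (F.component β i) x := by
  have h2 : closure (F.inter (single i)) ∈ 𝓝 x := by
    rw [F.inter_single, closure_univ]
    exact Filter.univ_mem
  exact formSmoothAt_zeroExt (h (single i) (mem_univ _)) h2

/-- Cocycles in degree zero are the families that agree under the extended gluing maps. -/
theorem mem_ker_δ_zero {β : F.RawCochain 0 q} : F.δ 0 q β = 0 ↔ ∀ i j, i < j → ∀ x ∈ closure (F.A i j),
    F.trans i j (F.component β j) x = F.component β i x := by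
  constructor
  · intro h i j hij x hx
    have h1 := F.zeroExt_δ_zero β (pair hij) (x := x) hx
    rw [h] at h1
    have h2 : zeroExt ((0 : F.RawCochain 1 q) (pair hij)) = 0 := zeroExt_zero
    rw [h2] at h1
    exact (sub_eq_zero.1 h1.symm).symm
  · intro h
    funext σ
    refine RawForm.ext_zeroExt fun x hx => ?_
    have hx' : x ∈ closure (F.A (σ 0) (σ 1)) := by rwa [F.inter_pair] at hx
    have h1 := F.zeroExt_δ_zero β σ hx'
    have h3 : (F.trans (σ 0) (σ 1) (F.component β (σ 1))).ev x = (F.component β (σ 0)).ev x :=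
      h _ _ (σ.strictMono Fin.zero_lt_one) x hx'
    rw [h3, sub_self] at h1
    have h2 : (zeroExt ((0 : F.RawCochain 1 q) σ)).ev x = 0 := congrFun zeroExt_zero x
    exact h1.trans h2.symm

theorem trans_on_mem_Omega {i j : Fin n} {w : GForm d (M j) q} (hw : ∀ y, FormSmoothAt d w y) :
    (F.trans i j w).on (closure (F.A i j)) ∈ Omega d (closure (F.A i j)) q := by
  have h2 := (F.smooth_fbar i j).pullback_mem_Omega (F.uniqueMDiff_closure i j) (Subset.refl _)
    (fun _ _ => mem_univ _) (GForm.on_mem_Omega (S := univ) hw)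
  have e : (F.trans i j w).on (closure (F.A i j)) =
      pullback d (F.fbar i j) (Subset.refl _) (fun _ _ => mem_univ _) q (w.on univ) :=
    funext fun x => dif_pos x.2
  rwa [e]

/-- Exactness at the cochains of degree zero: compatible families on the closures are in particular
compatible on the open gluing regions, and conversely by density. -/
theorem map_Φ : (Omega d (univ : Set F.Glued) q).map (F.Φ q) =
    F.Cochain 0 q ⊓ LinearMap.ker (F.δ 0 q) := by
  ext β
  constructor
  · rintro ⟨w, hw, rfl⟩
    have hws : ∀ p, FormSmoothAt d (zeroExt w) p := fun p => formSmoothAt_zeroExt hw Filter.univ_mem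
    have hg : ∀ i x, FormSmoothAt d (gpull (F.φ i) (zeroExt w)) x := fun i x =>
      FormSmoothAt.gpull (F.contMDiff_φ i x) (hws _)
    refine ⟨fun σ _ => mem_Omega_of_formSmoothAt (η := gpull (F.φ (σ 0)) (zeroExt w))
      (fun x _ => Filter.Eventually.of_forall (hg _)) fun x => ?_, F.mem_ker_δ_zero.2 ?_⟩
    · rw [← F.zeroExt_Φ, zeroExt_of_mem _ x.2]
    · intro i j hij x hx
      rw [F.component_Φ, F.component_Φ]
      have h2 := Omega.eq_of_dense subset_closure subset_rfl (F.trans_on_mem_Omega (hg j))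
        (GForm.on_mem_Omega (S := closure (F.A i j)) (hg i)) fun x hx => F.gpull_φ_eq_trans _ hx
      exact congrFun h2 ⟨x, hx⟩
  · rintro ⟨hβ, hδ⟩
    have hc := F.mem_ker_δ_zero.1 hδ
    obtain ⟨W, hW, hWφ⟩ := F.exists_glue (F.component β) (F.formSmoothAt_component hβ) (by
      intro i j x hx
      rcases lt_trichotomy i j with h | h | h
      · exact hc i j h x (subset_closure hx)
      · subst h
        rw [F.trans_self]
      · have hx' := subset_closure hx
        have e := F.trans_trans (k := i) (F.component β i) (x := x) (i := i) (j := j)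
          (by rw [F.A_self, inter_univ]; exact hx')
        rw [F.trans_self] at e
        rw [← e]
        refine F.trans_congr fun hy => ?_
        exact (hc j i h _ (F.fbar_mem i j ⟨x, hy⟩)).symm)
    refine ⟨W.on univ, GForm.on_mem_Omega hW, ?_⟩
    funext σ
    obtain ⟨i, rfl⟩ := eq_single σ
    refine RawForm.ext_zeroExt fun x _ => ?_
    have h1 := F.component_Φ (W.on univ) i
    rw [zeroExt_on_univ, hWφ i] at h1
    exact congrFun h1 x

end SmoothSystem

/-! ### De Rham cohomology classes and induced maps -/

section Cohomology

variable {d q : ℕ} {M : Type u} [TopologicalSpace M] [ChartedSpace (EuclideanSpace ℝ (Fin d)) M]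
  {N : Type v} [TopologicalSpace N] [ChartedSpace (EuclideanSpace ℝ (Fin d)) N]
  {S : Set M} {T : Set N}

theorem exists_cls (X : HdR d S q) : ∃ w hw, X = cls d w hw := by
  obtain ⟨⟨w, hw⟩, rfl⟩ := Submodule.Quotient.mk_surjective _ X
  exact ⟨w, hw, rfl⟩

theorem cls_eq_cls {w w' : RawForm d S q} {hw : w ∈ closedForms d S q} {hw' : w' ∈ closedForms d S q} :
    cls d w hw = cls d w' hw' ↔ w - w' ∈ exactForms d S q :=
  Submodule.Quotient.eq _

theorem cls_eq_zero {w : RawForm d S q} {hw : w ∈ closedForms d S q} :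
    cls d w hw = 0 ↔ w ∈ exactForms d S q :=
  Submodule.Quotient.mk_eq_zero _

theorem HasExtDeriv.neg {w : RawForm d S q} {θ : RawForm d S (q + 1)} (h : HasExtDeriv d w θ) :
    HasExtDeriv d (-w) (-θ) := by
  have := h.smul (-1)
  rwa [neg_one_smul, neg_one_smul] at this

theorem HasExtDeriv.sub {w₁ w₂ : RawForm d S q} {θ₁ θ₂ : RawForm d S (q + 1)}
    (h₁ : HasExtDeriv d w₁ θ₁) (h₂ : HasExtDeriv d w₂ θ₂) : HasExtDeriv d (w₁ - w₂) (θ₁ - θ₂) := by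
  rw [sub_eq_add_neg, sub_eq_add_neg]
  exact h₁.add h₂.neg

theorem exactForms_le_closedForms [IsManifold (𝓡 d) ∞ M] :
    exactForms d S q ≤ closedForms d S q := by
  cases q with
  | zero => exact bot_le
  | succ q =>
    rintro θ ⟨w, _, h⟩
    exact h.mem_closedForms

/-- A family of maps of forms that preserves smoothness and commutes with exterior derivatives. -/
structure IsFormMap (L : ∀ q, RawForm d S q →ₗ[ℝ] RawForm d T q) : Prop where
  mem_Omega : ∀ q, ∀ w ∈ Omega d S q, L q w ∈ Omega d T q
  hasExtDeriv : ∀ q (w : RawForm d S q) (θ : RawForm d S (q + 1)), HasExtDeriv d w θ →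
    HasExtDeriv d (L q w) (L (q + 1) θ)

namespace IsFormMap

variable {L : ∀ q, RawForm d S q →ₗ[ℝ] RawForm d T q} (hL : IsFormMap L)

include hL in
theorem mem_closedForms {w : RawForm d S q} (hw : w ∈ closedForms d S q) :
    L q w ∈ closedForms d T q := by
  refine ⟨hL.mem_Omega q w hw.1, ?_⟩
  have := hL.hasExtDeriv q w 0 hw.2
  rwa [map_zero] at this

include hL in
theorem mem_exactForms {w : RawForm d S q} (hw : w ∈ exactForms d S q) :
    L q w ∈ exactForms d T q := by
  cases q with
  | zero =>
    obtain rfl : w = 0 := hw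
    rw [map_zero]
    exact Submodule.zero_mem _
  | succ q =>
    obtain ⟨η, hη, h⟩ := hw
    exact ⟨L q η, hL.mem_Omega q η hη, hL.hasExtDeriv q η w h⟩

/-- The map induced in cohomology. -/
noncomputable def mapH (q : ℕ) : HdR d S q →ₗ[ℝ] HdR d T q :=
  Submodule.mapQ _ _ ((L q).restrict fun _ h => hL.mem_closedForms h) fun _ hw =>
    hL.mem_exactForms hw

end IsFormMap

theorem isFormMap_restrict {S' : Set M} (h : S' ⊆ S) : IsFormMap (restrict d h) :=
  ⟨fun _ _ hw => restrict_mem_Omega h hw, fun _ _ _ hw => hw.restrict h⟩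

theorem isFormMap_pullback [IsManifold (𝓡 d) ∞ M] [IsManifold (𝓡 d) ∞ N] {f : S → N}
    (hf : SmoothMapOn d f) (hu : ∀ x ∈ S, UniqueMDiffWithinAt (𝓡 d) S x) {S' : Set M} (hS : S' ⊆ S)
    (hT : ∀ x (hx : x ∈ S'), f ⟨x, hS hx⟩ ∈ T) : IsFormMap (pullback d f hS hT) :=
  ⟨fun _ _ hw => hf.pullback_mem_Omega hu hS hT hw, fun _ _ _ hw => hw.pullback hf hu hS hT⟩

end Cohomology

namespace SmoothSystem

variable {d q : ℕ} {M : Fin 2 → Type u} [∀ i, TopologicalSpace (M i)]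
  [∀ i, ChartedSpace (EuclideanSpace ℝ (Fin d)) (M i)] [∀ i, IsManifold (𝓡 d) ∞ (M i)]
  (F : SmoothSystem d M)

theorem isFormMap_φPull (i : Fin 2) : IsFormMap (F.φPull i) := by
  refine isFormMap_pullback (T := (univ : Set F.Glued)) (fun x => ⟨univ, isOpen_univ, mem_univ _, F.φ i,
    (F.contMDiff_φ i).contMDiffOn, fun _ _ => rfl⟩) (fun x _ => uniqueMDiffWithinAt_univ _)
    (subset_univ _) (fun _ _ => mem_univ _)

theorem isFormMap_pullback_univ {S : Set (M 0)} {g : S → M 1} (hg : SmoothMapOn d g)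
    (hu : ∀ x ∈ S, UniqueMDiffWithinAt (𝓡 d) S x) :
    IsFormMap (pullback d g (Subset.refl S) (fun _ _ => mem_univ _)) :=
  isFormMap_pullback hg hu _ _

section Diff

variable {S : Set (M 0)} {g : S → M 1}

theorem diff_sub {w₁ w₁' : RawForm d (univ : Set (M 0)) q} {w₂ w₂' : RawForm d (univ : Set (M 1)) q} :
    diff g q (w₁ - w₁') (w₂ - w₂') = diff g q w₁ w₂ - diff g q w₁' w₂' := by
  simp only [diff, map_sub]
  abel

theorem diff_add {w₁ w₁' : RawForm d (univ : Set (M 0)) q} {w₂ w₂' : RawForm d (univ : Set (M 1)) q} :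
    diff g q (w₁ + w₁') (w₂ + w₂') = diff g q w₁ w₂ + diff g q w₁' w₂' := by
  simp only [diff, map_add]
  abel

theorem diff_smul (c : ℝ) {w₁ : RawForm d (univ : Set (M 0)) q} {w₂ : RawForm d (univ : Set (M 1)) q} :
    diff g q (c • w₁) (c • w₂) = c • diff g q w₁ w₂ := by
  simp only [diff, map_smul, smul_sub]

theorem diff_zero : diff (d := d) g q 0 0 = 0 := by
  simp only [diff, map_zero, sub_zero]

variable (hg : SmoothMapOn d g) (hu : ∀ x ∈ S, UniqueMDiffWithinAt (𝓡 d) S x)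

include hg hu in
theorem diff_mem_Omega {w₁ : RawForm d (univ : Set (M 0)) q} {w₂ : RawForm d (univ : Set (M 1)) q}
    (h₁ : w₁ ∈ Omega d univ q) (h₂ : w₂ ∈ Omega d univ q) : diff g q w₁ w₂ ∈ Omega d S q :=
  Submodule.sub_mem _ ((isFormMap_restrict _).mem_Omega _ _ h₁)
    ((isFormMap_pullback_univ hg hu).mem_Omega _ _ h₂)

include hg hu in
theorem hasExtDeriv_diff {w₁ : RawForm d (univ : Set (M 0)) q} {w₂ : RawForm d (univ : Set (M 1)) q}
    {θ₁ : RawForm d (univ : Set (M 0)) (q + 1)} {θ₂ : RawForm d (univ : Set (M 1)) (q + 1)}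
    (h₁ : HasExtDeriv d w₁ θ₁) (h₂ : HasExtDeriv d w₂ θ₂) :
    HasExtDeriv d (diff g q w₁ w₂) (diff g (q + 1) θ₁ θ₂) :=
  ((isFormMap_restrict _).hasExtDeriv _ _ _ h₁).sub
    ((isFormMap_pullback_univ hg hu).hasExtDeriv _ _ _ h₂)

include hg hu in
theorem diff_mem_closedForms {w₁ : RawForm d (univ : Set (M 0)) q}
    {w₂ : RawForm d (univ : Set (M 1)) q} (h₁ : w₁ ∈ closedForms d univ q)
    (h₂ : w₂ ∈ closedForms d univ q) : diff g q w₁ w₂ ∈ closedForms d S q :=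
  Submodule.sub_mem _ ((isFormMap_restrict _).mem_closedForms h₁)
    ((isFormMap_pullback_univ hg hu).mem_closedForms h₂)

end Diff

/-! ### The short exact sequence for two manifolds -/

theorem φPull_eq_zero {w : RawForm d (univ : Set F.Glued) q} (h₀ : F.φPull 0 q w = 0)
    (h₁ : F.φPull 1 q w = 0) : w = 0 := by
  refine F.Φ_injective ?_
  have h : ∀ i, F.φPull i q w = 0 := by
    intro i
    fin_cases i
    · exact h₀
    · exact h₁
  funext σ x
  exact congrFun (h (σ 0)) ⟨x, mem_univ _⟩

theorem on_zeroExt_univ {X : Type u} [TopologicalSpace X] [ChartedSpace (EuclideanSpace ℝ (Fin d)) X]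
    (w : RawForm d (univ : Set X) q) : (zeroExt w).on univ = w :=
  funext fun x => zeroExt_of_mem w x.2

theorem diff_fbar_apply (w₁ : RawForm d (univ : Set (M 0)) q) (w₂ : RawForm d (univ : Set (M 1)) q)
    (x : closure (F.A 0 1)) : rev (diff (F.fbar 0 1) q w₁ w₂) x =
      (zeroExt w₁).ev x - (F.trans 0 1 (zeroExt w₂)).ev x := by
  have e1 : (zeroExt w₁).ev x = rev w₁ ⟨x, mem_univ _⟩ := zeroExt_of_mem w₁ _
  have e2 : (F.trans 0 1 (zeroExt w₂)).ev x =
      rev (pullback d (F.fbar 0 1) (Subset.refl _) (fun _ _ => mem_univ _) q w₂) x := by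
    refine (dif_pos x.2).trans ?_
    rw [zeroExt_of_mem w₂ (mem_univ _)]
    rfl
  rw [e1, e2]
  rfl

theorem zeroExt_φPull (i : Fin 2) (w : RawForm d (univ : Set F.Glued) q) :
    zeroExt (F.φPull i q w) = gpull (F.φ i) (zeroExt w) := by
  rw [← F.component_Φ]
  funext x
  have hx : x ∈ closure (F.inter (single i)) := by
    rw [F.inter_single, closure_univ]
    exact mem_univ (α := M i) x
  refine (zeroExt_of_mem _ (mem_univ x)).trans (Eq.trans ?_ (zeroExt_of_mem _ hx).symm)
  rfl

theorem diff_φPull {w : RawForm d (univ : Set F.Glued) q} (hw : w ∈ Omega d univ q) :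
    diff (F.fbar 0 1) q (F.φPull 0 q w) (F.φPull 1 q w) = 0 := by
  have h1 : F.Φ q w ∈ F.Cochain 0 q ⊓ LinearMap.ker (F.δ 0 q) := by
    rw [← F.map_Φ]
    exact ⟨w, hw, rfl⟩
  funext x
  have h2 := F.mem_ker_δ_zero.1 h1.2 0 1 Fin.zero_lt_one x x.2
  rw [F.component_Φ, F.component_Φ] at h2
  refine (F.diff_fbar_apply _ _ x).trans ?_
  rw [F.zeroExt_φPull, F.zeroExt_φPull]
  exact sub_eq_zero.2 (Eq.symm h2)

theorem exists_φPull_eq {w₁ : RawForm d (univ : Set (M 0)) q} {w₂ : RawForm d (univ : Set (M 1)) q}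
    (h₁ : w₁ ∈ Omega d univ q) (h₂ : w₂ ∈ Omega d univ q) (h : diff (F.fbar 0 1) q w₁ w₂ = 0) :
    ∃ w ∈ Omega d (univ : Set F.Glued) q, F.φPull 0 q w = w₁ ∧ F.φPull 1 q w = w₂ := by
  have h01 : ∀ x ∈ closure (F.A 0 1), F.trans 0 1 (zeroExt w₂) x = zeroExt w₁ x := by
    intro x hx
    have h3 := F.diff_fbar_apply w₁ w₂ ⟨x, hx⟩
    rw [h] at h3
    exact (sub_eq_zero.1 h3.symm).symm
  obtain ⟨W, hW, hWφ⟩ := F.exists_glue (Fin.cons (zeroExt w₁) (Fin.cons (zeroExt w₂) finZeroElim)) (by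
      intro i x
      fin_cases i
      · exact formSmoothAt_zeroExt h₁ Filter.univ_mem
      · exact formSmoothAt_zeroExt h₂ Filter.univ_mem) (by
      intro i j x hx
      fin_cases i <;> fin_cases j
      · exact congrFun (F.trans_self 0 (zeroExt w₁)) x
      · exact h01 x (subset_closure hx)
      · have hx' : x ∈ closure (F.A 1 0) := subset_closure hx
        have e := F.trans_trans (k := 1) (zeroExt w₂) (x := x) (i := 1) (j := 0)
          (by rw [F.A_self, inter_univ]; exact hx')
        rw [F.trans_self] at e
        refine Eq.trans ?_ e
        refine F.trans_congr fun hy => ?_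
        exact (h01 _ (F.fbar_mem 1 0 ⟨x, hy⟩)).symm
      · exact congrFun (F.trans_self 1 (zeroExt w₂)) x)
  refine ⟨W.on univ, GForm.on_mem_Omega hW, ?_, ?_⟩
  · rw [← on_zeroExt_univ (F.φPull 0 q _), F.zeroExt_φPull, zeroExt_on_univ, hWφ 0]
    exact on_zeroExt_univ w₁
  · rw [← on_zeroExt_univ (F.φPull 1 q _), F.zeroExt_φPull, zeroExt_on_univ, hWφ 1]
    exact on_zeroExt_univ w₂

theorem exists_diff_eq [∀ i, T2Space (M i)] [∀ i, SecondCountableTopology (M i)]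
    {θ : RawForm d (closure (F.A 0 1)) q} (hθ : θ ∈ Omega d (closure (F.A 0 1)) q) :
    ∃ w₁ ∈ Omega d (univ : Set (M 0)) q, ∃ w₂ ∈ Omega d (univ : Set (M 1)) q,
      diff (F.fbar 0 1) q w₁ w₂ = θ := by
  obtain ⟨V, hV, hVθ⟩ := exists_extension isClosed_closure hθ
  refine ⟨V.on univ, GForm.on_mem_Omega hV, 0, Submodule.zero_mem _, ?_⟩
  unfold diff
  rw [map_zero, sub_zero]
  exact funext fun x => hVθ x

end SmoothSystem

/-- A functional linear relation is the graph of a linear map. -/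
theorem exists_linearMap_of_relation {V W : Type*} [AddCommGroup V] [Module ℝ V] [AddCommGroup W]
    [Module ℝ W] (G : Submodule ℝ (V × W)) (h₁ : ∀ x, ∃ y, (x, y) ∈ G)
    (h₂ : ∀ y, ((0 : V), y) ∈ G → y = 0) : ∃ c : V →ₗ[ℝ] W, ∀ x y, (x, y) ∈ G → c x = y := by
  obtain ⟨f, hf⟩ := Submodule.exists_eq_graph (G := G) (by
    constructor
    · rintro ⟨⟨x, y⟩, hp⟩ ⟨⟨x', y'⟩, hp'⟩ h
      obtain rfl : x = x' := h
      have := h₂ (y - y') (by simpa using G.sub_mem hp hp')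
      obtain rfl := sub_eq_zero.1 this
      rfl
    · intro x
      obtain ⟨y, hy⟩ := h₁ x
      exact ⟨⟨(x, y), hy⟩, rfl⟩)
  refine ⟨f, fun x y h => ?_⟩
  rw [hf] at h
  exact ((LinearMap.mem_graph_iff f _).1 h).symm

namespace SmoothSystem

variable {d q : ℕ} {M : Fin 2 → Type u} [∀ i, TopologicalSpace (M i)]
  [∀ i, ChartedSpace (EuclideanSpace ℝ (Fin d)) (M i)] [∀ i, IsManifold (𝓡 d) ∞ (M i)]
  (F : SmoothSystem d M)

/-! ### The long exact sequence -/

theorem subset_closure_interior_univ {X : Type u} [TopologicalSpace X] :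
    (univ : Set X) ⊆ closure (interior univ) := by simp

theorem closure_A_subset (i j : Fin 2) : closure (F.A i j) ⊆ closure (interior (closure (F.A i j))) :=
  closure_mono ((F.isOpen_A i j).subset_interior_iff.2 subset_closure)

/-- A form on the adjunction space whose pullbacks are `dw₁, dw₂`, for `w₁, w₂` the pullbacks of `v`,
is `dv`. -/
theorem hasExtDeriv_of_φPull {v : RawForm d (univ : Set F.Glued) q}
    {w : RawForm d (univ : Set F.Glued) (q + 1)} (hv : v ∈ Omega d univ q)
    (h₀ : HasExtDeriv d (F.φPull 0 q v) (F.φPull 0 (q + 1) w))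
    (h₁ : HasExtDeriv d (F.φPull 1 q v) (F.φPull 1 (q + 1) w)) : HasExtDeriv d v w := by
  obtain ⟨w', hw'⟩ := exists_hasExtDeriv subset_closure_interior_univ hv
  have e0 := h₀.unique subset_closure_interior_univ ((F.isFormMap_φPull 0).hasExtDeriv _ _ _ hw')
  have e1 := h₁.unique subset_closure_interior_univ ((F.isFormMap_φPull 1).hasExtDeriv _ _ _ hw')
  have : w - w' = 0 := F.φPull_eq_zero (by rw [map_sub, e0, sub_self]) (by rw [map_sub, e1, sub_self])
  rwa [sub_eq_zero.1 this]

/-- The relation of the snake lemma: `θ = ι^* w₁ - g^* w₂` and `dw_i = φ_i^* w`. -/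
def snake (q : ℕ) : Submodule ℝ (HdR d (closure (F.A 0 1)) q × HdR d (univ : Set F.Glued) (q + 1)) where
  carrier := {p | ∃ w₁ ∈ Omega d (univ : Set (M 0)) q, ∃ w₂ ∈ Omega d (univ : Set (M 1)) q,
    ∃ (hθ : diff (F.fbar 0 1) q w₁ w₂ ∈ closedForms d (closure (F.A 0 1)) q)
      (w : RawForm d (univ : Set F.Glued) (q + 1)) (hw : w ∈ closedForms d univ (q + 1)),
      HasExtDeriv d w₁ (F.φPull 0 (q + 1) w) ∧ HasExtDeriv d w₂ (F.φPull 1 (q + 1) w) ∧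
        p = (cls d _ hθ, cls d w hw)}
  add_mem' := by
    rintro _ _ ⟨w₁, h₁, w₂, h₂, hθ, w, hw, e₁, e₂, rfl⟩ ⟨w₁', h₁', w₂', h₂', hθ', w', hw', e₁', e₂', rfl⟩
    refine ⟨w₁ + w₁', add_mem h₁ h₁', w₂ + w₂', add_mem h₂ h₂', ?_, w + w', add_mem hw hw', ?_, ?_, ?_⟩
    · rw [diff_add]
      exact add_mem hθ hθ'
    · rw [map_add]
      exact e₁.add e₁'
    · rw [map_add]
      exact e₂.add e₂'
    · simp only [diff_add]
      rfl
  zero_mem' := by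
    refine ⟨0, Submodule.zero_mem _, 0, Submodule.zero_mem _, ?_, 0, Submodule.zero_mem _, ?_, ?_, ?_⟩
    · rw [diff_zero]
      exact Submodule.zero_mem _
    · rw [map_zero]
      exact HasExtDeriv.zero _ _
    · rw [map_zero]
      exact HasExtDeriv.zero _ _
    · simp only [diff_zero]
      rfl
  smul_mem' := by
    rintro c _ ⟨w₁, h₁, w₂, h₂, hθ, w, hw, e₁, e₂, rfl⟩
    refine ⟨c • w₁, Submodule.smul_mem _ c h₁, c • w₂, Submodule.smul_mem _ c h₂, ?_, c • w,
      Submodule.smul_mem _ c hw, ?_, ?_, ?_⟩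
    · rw [diff_smul]
      exact Submodule.smul_mem _ c hθ
    · rw [map_smul]
      exact e₁.smul c
    · rw [map_smul]
      exact e₂.smul c
    · simp only [diff_smul]
      rfl

variable [∀ i, T2Space (M i)] [∀ i, SecondCountableTopology (M i)]

/-- Exact forms on the closure of the gluing region are differences of exact forms. -/
theorem exists_exact_diff {θ : RawForm d (closure (F.A 0 1)) q}
    (hθ : θ ∈ exactForms d (closure (F.A 0 1)) q) :
    ∃ w₁ ∈ exactForms d (univ : Set (M 0)) q, ∃ w₂ ∈ exactForms d (univ : Set (M 1)) q,
      diff (F.fbar 0 1) q w₁ w₂ = θ := by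
  cases q with
  | zero =>
    obtain rfl : θ = 0 := hθ
    exact ⟨0, Submodule.zero_mem _, 0, Submodule.zero_mem _, diff_zero⟩
  | succ q =>
    obtain ⟨η, hη, h⟩ := hθ
    obtain ⟨η₁, h₁, η₂, h₂, rfl⟩ := F.exists_diff_eq hη
    obtain ⟨w₁, e₁⟩ := exists_hasExtDeriv subset_closure_interior_univ h₁
    obtain ⟨w₂, e₂⟩ := exists_hasExtDeriv subset_closure_interior_univ h₂
    exact ⟨w₁, ⟨η₁, h₁, e₁⟩, w₂, ⟨η₂, h₂, e₂⟩,
      (hasExtDeriv_diff (F.smooth_fbar 0 1) (F.uniqueMDiff_closure 0 1) e₁ e₂).unique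
        (F.closure_A_subset 0 1) h⟩

/-- Every closed form on the closure of the gluing region is in the domain of the snake relation. -/
theorem exists_lift {θ : RawForm d (closure (F.A 0 1)) q} (hθ : θ ∈ closedForms d (closure (F.A 0 1)) q) :
    ∃ w₁ ∈ Omega d (univ : Set (M 0)) q, ∃ w₂ ∈ Omega d (univ : Set (M 1)) q,
      diff (F.fbar 0 1) q w₁ w₂ = θ ∧ ∃ w ∈ closedForms d (univ : Set F.Glued) (q + 1),
        HasExtDeriv d w₁ (F.φPull 0 (q + 1) w) ∧ HasExtDeriv d w₂ (F.φPull 1 (q + 1) w) := by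
  obtain ⟨w₁, h₁, w₂, h₂, rfl⟩ := F.exists_diff_eq hθ.1
  obtain ⟨u₁, e₁⟩ := exists_hasExtDeriv subset_closure_interior_univ h₁
  obtain ⟨u₂, e₂⟩ := exists_hasExtDeriv subset_closure_interior_univ h₂
  have h0 := (hasExtDeriv_diff (F.smooth_fbar 0 1) (F.uniqueMDiff_closure 0 1) e₁ e₂).unique
    (F.closure_A_subset 0 1) hθ.2
  obtain ⟨w, hw, rfl, rfl⟩ := F.exists_φPull_eq e₁.dForm_mem_Omega e₂.dForm_mem_Omega h0
  refine ⟨w₁, h₁, w₂, h₂, rfl, w, ⟨hw, ?_⟩, e₁, e₂⟩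
  refine F.hasExtDeriv_of_φPull hw ?_ ?_
  · rw [map_zero]
    exact e₁.hasExtDeriv_zero
  · rw [map_zero]
    exact e₂.hasExtDeriv_zero

/-- If `ι^* w₁ - g^* w₂` is exact and `dw_i = φ_i^* w`, then `w` is exact. -/
theorem mem_exactForms_of_diff {w₁ : RawForm d (univ : Set (M 0)) q}
    {w₂ : RawForm d (univ : Set (M 1)) q} (h₁ : w₁ ∈ Omega d univ q) (h₂ : w₂ ∈ Omega d univ q)
    (hθ : diff (F.fbar 0 1) q w₁ w₂ ∈ exactForms d (closure (F.A 0 1)) q)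
    {w : RawForm d (univ : Set F.Glued) (q + 1)}
    (e₁ : HasExtDeriv d w₁ (F.φPull 0 (q + 1) w)) (e₂ : HasExtDeriv d w₂ (F.φPull 1 (q + 1) w)) :
    w ∈ exactForms d univ (q + 1) := by
  obtain ⟨u₁, hu₁, u₂, hu₂, hu⟩ := F.exists_exact_diff hθ
  have c₁ := exactForms_le_closedForms hu₁
  have c₂ := exactForms_le_closedForms hu₂
  obtain ⟨v, hv, hv₁, hv₂⟩ := F.exists_φPull_eq (sub_mem h₁ c₁.1) (sub_mem h₂ c₂.1)
    (by rw [diff_sub, hu, sub_self])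
  refine ⟨v, hv, F.hasExtDeriv_of_φPull hv ?_ ?_⟩
  · rw [hv₁]
    simpa using e₁.sub c₁.2
  · rw [hv₂]
    simpa using e₂.sub c₂.2

/-- The connecting homomorphism; by `mem_exactForms_of_diff` the snake relation is functional. -/
theorem exists_connecting (q : ℕ) :
    ∃ c : HdR d (closure (F.A 0 1)) q →ₗ[ℝ] HdR d (univ : Set F.Glued) (q + 1),
      ∀ w₁ ∈ Omega d (univ : Set (M 0)) q, ∀ w₂ ∈ Omega d (univ : Set (M 1)) q,
        ∀ (hθ : diff (F.fbar 0 1) q w₁ w₂ ∈ closedForms d (closure (F.A 0 1)) q)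
          w (hw : w ∈ closedForms d (univ : Set F.Glued) (q + 1)),
          HasExtDeriv d w₁ (F.φPull 0 (q + 1) w) → HasExtDeriv d w₂ (F.φPull 1 (q + 1) w) →
            c (cls d _ hθ) = cls d w hw := by
  obtain ⟨c, hc⟩ := exists_linearMap_of_relation (F.snake q) (by
    intro X
    obtain ⟨θ, hθ, rfl⟩ := exists_cls X
    obtain ⟨w₁, h₁, w₂, h₂, rfl, w, hw, e₁, e₂⟩ := F.exists_lift hθ
    exact ⟨cls d w hw, w₁, h₁, w₂, h₂, hθ, w, hw, e₁, e₂, rfl⟩) (by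
    rintro Y ⟨w₁, h₁, w₂, h₂, hθ, w, hw, e₁, e₂, h⟩
    rw [Prod.mk.injEq] at h
    rw [h.2]
    exact cls_eq_zero.2 (F.mem_exactForms_of_diff h₁ h₂ (cls_eq_zero.1 h.1.symm) e₁ e₂))
  exact ⟨c, fun w₁ h₁ w₂ h₂ hθ w hw e₁ e₂ => hc _ _ ⟨w₁, h₁, w₂, h₂, hθ, w, hw, e₁, e₂, rfl⟩⟩

theorem mayerVietoris_fbar : F.MayerVietoris (F.fbar 0 1) := by
  have hg := F.smooth_fbar 0 1
  have hu := F.uniqueMDiff_closure 0 1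
  choose c hc using F.exists_connecting
  have ha := F.isFormMap_φPull
  refine ⟨fun q => ((ha 0).mapH q).prod ((ha 1).mapH q),
    fun q => ((isFormMap_restrict (subset_univ _)).mapH q).comp (LinearMap.fst ℝ _ _) -
      ((isFormMap_pullback_univ hg hu).mapH q).comp (LinearMap.snd ℝ _ _), c,
    fun q w hw => ⟨(ha 0).mem_closedForms hw, (ha 1).mem_closedForms hw, rfl⟩,
    fun q w₁ h₁ w₂ h₂ => ⟨diff_mem_closedForms hg hu h₁ h₂, rfl⟩,
    hc, ?_, fun q => ⟨?_, ?_, ?_⟩⟩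
  · rw [← LinearMap.ker_eq_bot, LinearMap.ker_eq_bot']
    intro X hX
    obtain ⟨w, hw, rfl⟩ := exists_cls X
    have h0 := cls_eq_zero.1 (congrArg Prod.fst hX)
    have h1 := cls_eq_zero.1 (congrArg Prod.snd hX)
    refine cls_eq_zero.2 ?_
    exact F.φPull_eq_zero h0 h1
  · rintro ⟨X, Y⟩
    obtain ⟨w₁, h₁, rfl⟩ := exists_cls X
    obtain ⟨w₂, h₂, rfl⟩ := exists_cls Y
    constructor
    · intro h
      have h0 : diff (F.fbar 0 1) q w₁ w₂ ∈ exactForms d (closure (F.A 0 1)) q :=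
        (cls_eq_zero (hw := diff_mem_closedForms hg hu h₁ h₂)).1 h
      obtain ⟨u₁, hu₁, u₂, hu₂, hdiff⟩ := F.exists_exact_diff h0
      have c₁ := exactForms_le_closedForms hu₁
      have c₂ := exactForms_le_closedForms hu₂
      obtain ⟨v, hv, hv₁, hv₂⟩ := F.exists_φPull_eq (sub_mem h₁.1 c₁.1) (sub_mem h₂.1 c₂.1)
        (by rw [diff_sub, hdiff, sub_self])
      have hvc : v ∈ closedForms d univ q := by
        refine ⟨hv, F.hasExtDeriv_of_φPull hv ?_ ?_⟩
        · rw [hv₁, map_zero]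
          exact (sub_mem h₁ c₁).2
        · rw [hv₂, map_zero]
          exact (sub_mem h₂ c₂).2
      refine ⟨cls d v hvc, Prod.ext ?_ ?_⟩
      · exact (cls_eq_cls (hw := (ha 0).mem_closedForms hvc) (hw' := h₁)).2
          (by rw [hv₁, sub_sub_cancel_left]; exact neg_mem hu₁)
      · exact (cls_eq_cls (hw := (ha 1).mem_closedForms hvc) (hw' := h₂)).2
          (by rw [hv₂, sub_sub_cancel_left]; exact neg_mem hu₂)
    · rintro ⟨Z, hZ⟩
      obtain ⟨w, hw, rfl⟩ := exists_cls Z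
      rw [← hZ]
      refine (cls_eq_zero (hw := diff_mem_closedForms hg hu ((ha 0).mem_closedForms hw)
        ((ha 1).mem_closedForms hw))).2 ?_
      rw [F.diff_φPull hw.1]
      exact Submodule.zero_mem _
  · intro X
    obtain ⟨θ, hθ, rfl⟩ := exists_cls X
    constructor
    · intro h
      obtain ⟨w₁, h₁, w₂, h₂, rfl, w, hw, e₁, e₂⟩ := F.exists_lift hθ
      rw [hc q w₁ h₁ w₂ h₂ hθ w hw e₁ e₂] at h
      obtain ⟨v, hv, hvw⟩ := cls_eq_zero.1 h
      have c₁ : w₁ - F.φPull 0 q v ∈ closedForms d univ q :=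
        ⟨sub_mem h₁ ((ha 0).mem_Omega _ _ hv), by
          simpa using e₁.sub ((ha 0).hasExtDeriv _ _ _ hvw)⟩
      have c₂ : w₂ - F.φPull 1 q v ∈ closedForms d univ q :=
        ⟨sub_mem h₂ ((ha 1).mem_Omega _ _ hv), by
          simpa using e₂.sub ((ha 1).hasExtDeriv _ _ _ hvw)⟩
      refine ⟨(cls d _ c₁, cls d _ c₂), ?_⟩
      refine (cls_eq_cls (hw := diff_mem_closedForms hg hu c₁ c₂) (hw' := hθ)).2 ?_
      rw [diff_sub, F.diff_φPull hv, sub_zero, sub_self]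
      exact Submodule.zero_mem _
    · rintro ⟨⟨Y, Z⟩, hYZ⟩
      obtain ⟨w₁, h₁, rfl⟩ := exists_cls Y
      obtain ⟨w₂, h₂, rfl⟩ := exists_cls Z
      rw [← hYZ]
      have := hc q w₁ h₁.1 w₂ h₂.1 (diff_mem_closedForms hg hu h₁ h₂) 0 (Submodule.zero_mem _)
        (by rw [map_zero]; exact h₁.2) (by rw [map_zero]; exact h₂.2)
      exact this
  · intro X
    obtain ⟨w, hw, rfl⟩ := exists_cls X
    constructor
    · intro h
      obtain ⟨w₁, h₁, e₁⟩ := cls_eq_zero.1 (congrArg Prod.fst h)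
      obtain ⟨w₂, h₂, e₂⟩ := cls_eq_zero.1 (congrArg Prod.snd h)
      change HasExtDeriv d w₁ (F.φPull 0 (q + 1) w) at e₁
      change HasExtDeriv d w₂ (F.φPull 1 (q + 1) w) at e₂
      have hθ : diff (F.fbar 0 1) q w₁ w₂ ∈ closedForms d (closure (F.A 0 1)) q := by
        refine ⟨diff_mem_Omega hg hu h₁ h₂, ?_⟩
        have := hasExtDeriv_diff hg hu e₁ e₂
        rwa [F.diff_φPull hw.1] at this
      exact ⟨cls d _ hθ, hc q w₁ h₁ w₂ h₂ hθ w hw e₁ e₂⟩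
    · rintro ⟨Y, hY⟩
      obtain ⟨θ, hθ, rfl⟩ := exists_cls Y
      obtain ⟨w₁, h₁, w₂, h₂, rfl, w', hw', e₁, e₂⟩ := F.exists_lift hθ
      rw [hc q w₁ h₁ w₂ h₂ hθ w' hw' e₁ e₂] at hY
      rw [← hY]
      refine Prod.ext ?_ ?_
      · exact (cls_eq_zero (hw := (ha 0).mem_closedForms hw')).2 ⟨w₁, h₁, e₁⟩
      · exact (cls_eq_zero (hw := (ha 1).mem_closedForms hw')).2 ⟨w₂, h₂, e₂⟩

end SmoothSystem
namespace SmoothSystem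

/-! ### The Čech complex of two manifolds -/

section General

variable {d n q : ℕ} {M : Fin n → Type u} [∀ i, TopologicalSpace (M i)]
  [∀ i, ChartedSpace (EuclideanSpace ℝ (Fin d)) (M i)] [∀ i, IsManifold (𝓡 d) ∞ (M i)]
  (F : SmoothSystem d M)

theorem δ_mem_Cochain {p : ℕ} {β : F.RawCochain p q} (hβ : β ∈ F.Cochain p q) :
    F.δ p q β ∈ F.Cochain (p + 1) q := by
  intro σ _
  have h : F.δ p q β σ = ∑ α : Fin (p + 2), (-1 : ℝ) ^ ((α : ℕ) + 1) •
      pullback d (F.fbar (σ 0) (face σ α 0)) (F.closure_inter_subset σ α)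
      (F.fbar_mem_closure_inter σ α) q (β (face σ α)) := by
    simp only [δ, LinearMap.pi_apply, LinearMap.sum_apply, LinearMap.smul_apply,
      LinearMap.comp_apply, LinearMap.proj_apply]
  rw [h]
  exact Submodule.sum_mem _ fun α _ => Submodule.smul_mem _ _
    ((F.smooth_fbar _ _).pullback_mem_Omega (F.uniqueMDiff_closure _ _) _ _ (hβ _ (mem_univ _)))

theorem trans_zero (i j : Fin n) : F.trans i j (0 : GForm d (M j) q) = 0 := by
  funext x
  by_cases hx : x ∈ closure (F.A i j)
  · exact dif_pos hx
  · exact dif_neg hx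

/-- The cochain of degree zero with given components. -/
def ofComponents (W : ∀ i, GForm d (M i) q) : F.RawCochain 0 q := fun σ => (W (σ 0)).on _

theorem component_ofComponents (W : ∀ i, GForm d (M i) q) (i : Fin n) :
    F.component (F.ofComponents W) i = W i := by
  funext x
  have hx : x ∈ closure (F.inter (single i)) := by
    rw [F.inter_single, closure_univ]
    exact mem_univ (α := M i) x
  exact zeroExt_of_mem _ hx

theorem ofComponents_mem_Cochain {W : ∀ i, GForm d (M i) q} (hW : ∀ i x, FormSmoothAt d (W i) x) :
    F.ofComponents W ∈ F.Cochain 0 q := fun σ _ => GForm.on_mem_Omega (hW (σ 0))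

end General

section Two

variable {d q : ℕ} {M : Fin 2 → Type u} [∀ i, TopologicalSpace (M i)]
  [∀ i, ChartedSpace (EuclideanSpace ℝ (Fin d)) (M i)] [∀ i, IsManifold (𝓡 d) ∞ (M i)]
  [∀ i, T2Space (M i)] [∀ i, SecondCountableTopology (M i)] (F : SmoothSystem d M)

theorem isEmpty_multiindex (p : ℕ) : IsEmpty (Fin (p + 3) ↪o Fin 2) :=
  ⟨fun σ => by
    have := Fintype.card_le_of_injective σ σ.injective
    simp at this⟩

theorem eq_pair (σ : Fin 2 ↪o Fin 2) : σ = pair Fin.zero_lt_one := by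
  have h := σ.strictMono Fin.zero_lt_one
  have h0 : σ 0 = 0 := by omega
  have h1 : σ 1 = 1 := by omega
  ext a
  fin_cases a
  · exact congrArg Fin.val h0
  · exact congrArg Fin.val h1

/-- For two manifolds the only cochains of positive degree are forms on the closed set
`cl M_{12} ⊆ M_1`; they extend to `M_1`, so no hypothesis on the gluing regions is needed. -/
theorem cechExact_two (q : ℕ) : F.CechExact q := by
  refine ⟨fun w _ h => F.Φ_injective h, F.map_Φ, fun p => ?_⟩
  have hsub : ∀ p, Subsingleton (F.RawCochain (p + 2) q) := fun p =>
    have := isEmpty_multiindex p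
    inferInstanceAs (Subsingleton (∀ σ : Fin (p + 3) ↪o Fin 2, _))
  cases p with
  | succ p =>
    have := hsub p
    exact Subsingleton.elim _ _
  | zero =>
    have := hsub 0
    ext β
    constructor
    · rintro ⟨γ, hγ, rfl⟩
      exact ⟨F.δ_mem_Cochain hγ, Subsingleton.elim _ _⟩
    · rintro ⟨hβ, -⟩
      obtain ⟨V, hV, hVβ⟩ := exists_extension isClosed_closure
        (hβ (pair Fin.zero_lt_one) (mem_univ _))
      change GForm d (M 0) q at V
      refine ⟨F.ofComponents (Fin.cons V (Fin.cons 0 finZeroElim)), F.ofComponents_mem_Cochain ?_, ?_⟩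
      · intro i x
        fin_cases i
        · exact hV x
        · exact FormSmoothAt.zero (M := M 1) x
      · funext σ
        obtain rfl := eq_pair σ
        refine RawForm.ext_zeroExt fun x hx => ?_
        have hx' : x ∈ closure (F.A ((pair Fin.zero_lt_one : Fin 2 ↪o Fin 2) 0)
          ((pair Fin.zero_lt_one : Fin 2 ↪o Fin 2) 1)) := by rwa [F.inter_pair] at hx
        have h1 := F.zeroExt_δ_zero (F.ofComponents (Fin.cons V (Fin.cons 0 finZeroElim)))
          (pair Fin.zero_lt_one) hx'
        rw [F.component_ofComponents, F.component_ofComponents] at h1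
        have h2 : (F.trans 0 1 (0 : GForm d (M 1) q)).ev x = 0 := congrFun (F.trans_zero 0 1) x
        refine Eq.trans h1 (Eq.trans (sub_eq_self.2 h2) ?_)
        rw [zeroExt_of_mem _ hx]
        exact hVβ ⟨x, hx⟩

end Two

end SmoothSystem

/-! ### Integration along line segments -/

section Integration

open MeasureTheory intervalIntegral

variable {E F : Type} [NormedAddCommGroup E] [NormedSpace ℝ E] [FiniteDimensional ℝ E]
  [NormedAddCommGroup F] [NormedSpace ℝ F] [CompleteSpace F]

/-- The integral of a function over the segment from `y` to `y + ε v`. -/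
noncomputable def segInt (v : E) (ε : ℝ) (g : E → F) (y : E) : F := ∫ s in (0 : ℝ)..ε, g (y + s • v)

theorem continuousOn_segment {v : E} {ε : ℝ} {W : Set E} {G : Type} [TopologicalSpace G] {g : E → G}
    (hg : ∀ z ∈ W, ContinuousAt g z) {y : E} (hy : ∀ s ∈ Icc 0 ε, y + s • v ∈ W) :
    ContinuousOn (fun s : ℝ => g (y + s • v)) (Icc 0 ε) := fun s hs => by
  have h1 : ContinuousAt (fun s : ℝ => y + s • v) s := by fun_prop
  exact (ContinuousAt.comp (g := g) (f := fun s : ℝ => y + s • v) (hg _ (hy s hs)) h1).continuousWithinAt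

theorem eventually_segment_subset {v : E} {ε : ℝ} {W : Set E} (hW : IsOpen W) {y₀ : E}
    (hy : ∀ s ∈ Icc 0 ε, y₀ + s • v ∈ W) : ∀ᶠ y in 𝓝 y₀, ∀ s ∈ Icc 0 ε, y + s • v ∈ W := by
  have := isCompact_Icc (a := (0 : ℝ)) (b := ε)
  refine this.eventually_forall_of_forall_eventually fun s hs => ?_
  have hc : ContinuousAt (fun p : E × ℝ => p.1 + p.2 • v) (y₀, s) := by fun_prop
  exact hc.eventually (hW.mem_nhds (hy s hs))

/-- Differentiation under the integral sign. -/
theorem hasFDerivAt_segInt {v : E} {ε : ℝ} (hε : 0 ≤ ε) {g : E → F} {W : Set E} (hW : IsOpen W)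
    (hg : ∀ z ∈ W, ContDiffAt ℝ 1 g z) {y₀ : E} (hy : ∀ s ∈ Icc 0 ε, y₀ + s • v ∈ W) :
    HasFDerivAt (segInt v ε g) (segInt v ε (fderiv ℝ g) y₀) y₀ := by
  have hgc : ∀ z ∈ W, ContinuousAt g z := fun z hz => (hg z hz).continuousAt
  have hgd : ∀ z ∈ W, ContinuousAt (fderiv ℝ g) z := fun z hz =>
    ((hg z hz).fderiv_right (m := 0) (by simp)).continuousAt
  have hI : uIoc (0 : ℝ) ε ⊆ Icc 0 ε := by
    rw [uIoc_of_le hε]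
    exact Ioc_subset_Icc_self
  have hK : IsCompact ((fun s : ℝ => y₀ + s • v) '' Icc 0 ε) :=
    isCompact_Icc.image (by fun_prop)
  obtain ⟨δ, hδ, hsub⟩ := hK.exists_cthickening_subset_open hW (by
    rintro _ ⟨s, hs, rfl⟩
    exact hy s hs)
  have hmem : ∀ y ∈ Metric.ball y₀ δ, ∀ s ∈ Icc 0 ε,
      y + s • v ∈ Metric.cthickening δ ((fun s : ℝ => y₀ + s • v) '' Icc 0 ε) := by
    intro y hy s hs
    refine Metric.mem_cthickening_of_dist_le _ (y₀ + s • v) δ _ ⟨s, hs, rfl⟩ ?_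
    rw [dist_add_right]
    exact (Metric.mem_ball.1 hy).le
  have hcomp := hK.cthickening (r := δ)
  obtain ⟨C, hC⟩ := hcomp.exists_bound_of_continuousOn (f := fderiv ℝ g) fun z hz =>
    (hgd z (hsub hz)).continuousWithinAt
  have hint : ∀ {G : Type} [NormedAddCommGroup G] (h : E → G), (∀ z ∈ W, ContinuousAt h z) →
      ∀ y, (∀ s ∈ Icc 0 ε, y + s • v ∈ W) →
      IntervalIntegrable (fun s : ℝ => h (y + s • v)) volume 0 ε := fun h hh y hy => by
    refine ContinuousOn.intervalIntegrable ?_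
    rw [uIcc_of_le hε]
    exact continuousOn_segment hh hy
  refine hasFDerivAt_integral_of_dominated_of_fderiv_le (s := Metric.ball y₀ δ)
    (F := fun y (s : ℝ) => g (y + s • v)) (F' := fun y (s : ℝ) => fderiv ℝ g (y + s • v))
    (bound := fun _ => C) (Metric.ball_mem_nhds _ hδ) ?_ (hint g hgc y₀ hy) ?_ ?_ (by simp) ?_
  · filter_upwards [eventually_segment_subset hW hy] with y hy
    exact (hint g hgc y hy).def'.aestronglyMeasurable
  · exact (hint _ hgd y₀ hy).def'.aestronglyMeasurable
  · exact Filter.Eventually.of_forall fun s hs y hy => hC _ (hmem y hy s (hI hs))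
  · refine Filter.Eventually.of_forall fun s hs y hy => ?_
    have h1 := ((hg _ (hsub (hmem y hy s (hI hs)))).differentiableAt (by simp)).hasFDerivAt
    exact h1.comp y ((hasFDerivAt_id y).add_const (s • v))

theorem contDiffAt_segInt {v : E} {ε : ℝ} (hε : 0 ≤ ε) {g : E → F} {W : Set E} (hW : IsOpen W)
    (hg : ∀ z ∈ W, ContDiffAt ℝ ∞ g z) {y₀ : E} (hy : ∀ s ∈ Icc 0 ε, y₀ + s • v ∈ W) :
    ContDiffAt ℝ ∞ (segInt v ε g) y₀ := by
  refine contDiffAt_infty.2 fun n => ?_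
  have hd : ∀ {F : Type} [NormedAddCommGroup F] [NormedSpace ℝ F] [CompleteSpace F] (g : E → F),
      (∀ z ∈ W, ContDiffAt ℝ ∞ g z) → ∀ y₀ : E, (∀ s ∈ Icc 0 ε, y₀ + s • v ∈ W) →
      HasFDerivAt (segInt v ε g) (segInt v ε (fderiv ℝ g) y₀) y₀ := fun g hg y₀ hy =>
    hasFDerivAt_segInt hε hW (fun z hz => (hg z hz).of_le (by simp)) hy
  induction n generalizing F y₀ with
  | zero =>
    refine contDiffAt_zero.2 ⟨_, eventually_segment_subset hW hy, fun y hy => ?_⟩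
    exact (hd g hg y hy).continuousAt.continuousWithinAt
  | succ n ih =>
    refine contDiffAt_succ_iff_hasFDerivAt.2 ⟨segInt v ε (fderiv ℝ g),
      ⟨_, eventually_segment_subset hW hy, fun y hy => hd g hg y hy⟩,
      ih (fun z hz => (hg z hz).fderiv_right (by simp)) hy⟩

theorem ContinuousLinearMap.comp_segInt {G : Type} [NormedAddCommGroup G] [NormedSpace ℝ G]
    [CompleteSpace G] (L : F →L[ℝ] G) {v : E} {ε : ℝ} (hε : 0 ≤ ε) {g : E → F} {W : Set E}
    (hg : ∀ z ∈ W, ContinuousAt g z) {y : E} (hy : ∀ s ∈ Icc 0 ε, y + s • v ∈ W) :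
    L (segInt v ε g y) = segInt v ε (fun z => L (g z)) y := by
  refine (L.intervalIntegral_comp_comm ?_).symm
  refine ContinuousOn.intervalIntegrable ?_
  rw [uIcc_of_le hε]
  exact continuousOn_segment hg hy

/-- The fundamental theorem of calculus along a segment. -/
theorem segInt_fderiv {v : E} {ε : ℝ} (hε : 0 ≤ ε) {g : E → F} {W : Set E}
    (hg : ∀ z ∈ W, ContDiffAt ℝ 1 g z) {y : E} (hy : ∀ s ∈ Icc 0 ε, y + s • v ∈ W) :
    segInt v ε (fun z => fderiv ℝ g z v) y = g (y + ε • v) - g y := by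
  have hgd : ∀ z ∈ W, ContinuousAt (fun z => fderiv ℝ g z v) z := fun z hz =>
    (((hg z hz).fderiv_right (m := 0) (by simp)).clm_apply contDiffAt_const).continuousAt
  have h := integral_eq_sub_of_hasDerivAt (f := fun s : ℝ => g (y + s • v))
    (f' := fun s : ℝ => fderiv ℝ g (y + s • v) v) (a := 0) (b := ε) (fun s hs => ?_) ?_
  · simpa [segInt] using h
  · rw [uIcc_of_le hε] at hs
    have h1 := ((hg _ (hy s hs)).differentiableAt (by simp)).hasFDerivAt
    have h2 : HasDerivAt (fun s : ℝ => y + s • v) v s := by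
      simpa using ((hasDerivAt_id s).smul_const v).const_add y
    exact h1.comp_hasDerivAt s h2
  · refine ContinuousOn.intervalIntegrable ?_
    rw [uIcc_of_le hε]
    exact continuousOn_segment hgd hy

end Integration

/-! ### Contraction with a constant vector field -/

section Contraction

variable {E : Type} [NormedAddCommGroup E] [NormedSpace ℝ E] {q : ℕ}

/-- Contraction of alternating forms with a vector, in the first argument. -/
noncomputable def contr (v : E) : E [⋀^Fin (q + 1)]→L[ℝ] ℝ →L[ℝ] E [⋀^Fin q]→L[ℝ] ℝ :=
  alternatize.comp ((ContinuousLinearMap.apply ℝ _ v).comp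
    ((continuousMultilinearCurryLeftEquiv ℝ (fun _ : Fin (q + 1) => E) ℝ
      ).toContinuousLinearEquiv.toContinuousLinearMap.comp
        (ContinuousAlternatingMap.toContinuousMultilinearMapCLM ℝ)))

theorem contr_apply (v : E) (f : E [⋀^Fin (q + 1)]→L[ℝ] ℝ) (w : Fin q → E) :
    contr v f w = f (Fin.cons v w) := by
  let g : E [⋀^Fin q]→L[ℝ] ℝ :=
    { f.toContinuousMultilinearMap.curryLeft v with
      map_eq_zero_of_eq' := fun w i j hw hij => f.map_eq_zero_of_eq (i := i.succ) (j := j.succ)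
        (Fin.cons v w) (by simpa using hw) (by simpa using hij) }
  have h : contr v f = alternatize g.toContinuousMultilinearMap := rfl
  rw [h, alternatize_toContinuousMultilinearMap]
  rfl

/-- Cartan's formula for a constant vector field. -/
theorem extDeriv_contr {b : E → E [⋀^Fin (q + 1)]→L[ℝ] ℝ} {y : E} (hb : DifferentiableAt ℝ b y)
    (v : E) : extDeriv (fun z => contr v (b z)) y = fderiv ℝ b y v - contr v (extDeriv b y) := by
  have hc : DifferentiableAt ℝ (fun z => contr v (b z)) y :=
    (contr (q := q) v).differentiableAt.comp y hb
  rw [eq_sub_iff_add_eq]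
  ext w
  have h1 := extDeriv_apply hb (Fin.cons v w)
  rw [Fin.sum_univ_succ] at h1
  rw [ContinuousAlternatingMap.add_apply, contr_apply, h1, extDeriv_apply hc]
  have h2 : ∀ i : Fin (q + 1), Fin.removeNth i.succ (Fin.cons v w : Fin (q + 2) → E) =
      Fin.cons v (Fin.removeNth i w) := by
    intro i
    funext j
    refine Fin.cases ?_ (fun j => ?_) j
    · simp [Fin.removeNth]
    · simp [Fin.removeNth]
  have h3 : Fin.removeNth 0 (Fin.cons v w : Fin (q + 2) → E) = w := by
    funext j
    simp [Fin.removeNth]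
  simp only [h2, h3, contr_apply, Fin.cons_zero, Fin.cons_succ, Fin.val_zero, pow_zero, one_smul,
    Fin.val_succ, pow_succ, mul_neg, mul_one, neg_smul, Finset.sum_neg_distrib]
  rw [add_comm, add_assoc, neg_add_cancel, add_zero,
    fderiv_continuousAlternatingMap_apply_const_apply hb]

theorem fderiv_zero_form {b : E → E [⋀^Fin 0]→L[ℝ] ℝ} {y : E} (hb : DifferentiableAt ℝ b y)
    (v : E) : fderiv ℝ b y v = contr v (extDeriv b y) := by
  ext w
  rw [contr_apply, extDeriv_apply hb]
  rw [Fin.sum_univ_succ]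
  simp only [Finset.univ_eq_empty, Finset.sum_empty, add_zero, Fin.val_zero, pow_zero, one_smul,
    Fin.cons_zero]
  rw [fderiv_continuousAlternatingMap_apply_const_apply hb]
  congr 1

end Contraction


/-! ### Forms on an open set modulo forms that extend over the boundary: local acyclicity -/

section Model

variable {E : Type} [NormedAddCommGroup E] [NormedSpace ℝ E] [FiniteDimensional ℝ E] {q : ℕ}
  {v : E} {ε : ℝ} {T W : Set E} {z₀ : E}

theorem contDiffAt_translate_sub {b : E → E [⋀^Fin q]→L[ℝ] ℝ}
    {θ : E → E [⋀^Fin (q + 1)]→L[ℝ] ℝ} (hε : 0 ≤ ε) (hT : IsOpen T) (hW : IsOpen W)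
    (hb : ∀ z ∈ T, ContDiffAt ℝ ∞ b z) (hθ : ∀ z ∈ W, ContDiffAt ℝ ∞ θ z)
    (h₁ : ∀ s ∈ Icc 0 ε, z₀ + s • v ∈ W) (h₂ : z₀ + ε • v ∈ T) :
    ∀ᶠ y in 𝓝 z₀, ContDiffAt ℝ ∞
      (fun y => b (y + ε • v) - segInt v ε (fun z => contr v (θ z)) y) y := by
  have hc : ContinuousAt (fun y : E => y + ε • v) z₀ := by fun_prop
  filter_upwards [eventually_segment_subset hW h₁, hc.eventually (hT.mem_nhds h₂)] with y hy hyT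
  refine ContDiffAt.sub ?_ (contDiffAt_segInt hε hW (fun z hz => ?_) hy)
  · exact ContDiffAt.comp (g := b) y (hb _ hyT) (by fun_prop)
  · exact (contr v).contDiff.contDiffAt.comp z (hθ z hz)

/-- Near a boundary point, a function whose differential extends over the boundary extends too. -/
theorem eq_translate_sub_zero {b : E → E [⋀^Fin 0]→L[ℝ] ℝ} {θ : E → E [⋀^Fin 1]→L[ℝ] ℝ}
    (hε : 0 ≤ ε) (hb : ∀ z ∈ T, ContDiffAt ℝ ∞ b z) (hd : ∀ z ∈ T, extDeriv b z = θ z) {y : E}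
    (hy : ∀ s ∈ Icc 0 ε, y + s • v ∈ T) :
    b y = b (y + ε • v) - segInt v ε (fun z => contr v (θ z)) y := by
  rw [← sub_sub_cancel (b (y + ε • v)) (b y),
    ← segInt_fderiv hε (fun z hz => (hb z hz).of_le (by simp)) hy]
  congr 1
  refine intervalIntegral.integral_congr fun s hs => ?_
  rw [uIcc_of_le hε] at hs
  change fderiv ℝ b (y + s • v) v = contr v (θ (y + s • v))
  rw [fderiv_zero_form ((hb _ (hy s hs)).differentiableAt (by simp)), hd _ (hy s hs)]

/-- Near a boundary point, a form whose exterior derivative extends over the boundary is the sum of a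
form that extends over the boundary and an exact form: integrate Cartan's formula along an inward
direction. -/
theorem eq_translate_sub_succ {b : E → E [⋀^Fin (q + 1)]→L[ℝ] ℝ}
    {θ : E → E [⋀^Fin (q + 2)]→L[ℝ] ℝ} (hε : 0 ≤ ε) (hT : IsOpen T)
    (hb : ∀ z ∈ T, ContDiffAt ℝ ∞ b z) (hd : ∀ z ∈ T, extDeriv b z = θ z)
    (hθ : ∀ z ∈ T, ContinuousAt θ z) {y : E} (hy : ∀ s ∈ Icc 0 ε, y + s • v ∈ T) :
    b y = extDeriv ((-1 : ℝ) • segInt v ε (fun z => contr v (b z))) y +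
      (b (y + ε • v) - segInt v ε (fun z => contr v (θ z)) y) := by
  have hg : ∀ z ∈ T, ContDiffAt ℝ ∞ (fun z => contr v (b z)) z := fun z hz =>
    (contr v).contDiff.contDiffAt.comp z (hb z hz)
  have hgd : ∀ z ∈ T, ContinuousAt (fderiv ℝ (fun z => contr v (b z))) z := fun z hz =>
    ((hg z hz).fderiv_right (m := ∞) (by simp)).continuousAt
  have hbd : ∀ z ∈ T, ContinuousAt (fun z => fderiv ℝ b z v) z := fun z hz =>
    (((hb z hz).fderiv_right (m := ∞) (by simp)).clm_apply contDiffAt_const).continuousAt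
  have h1 : extDeriv (segInt v ε (fun z => contr v (b z))) y =
      segInt v ε (fun z => fderiv ℝ b z v - contr v (θ z)) y := by
    have e1 : extDeriv (segInt v ε (fun z => contr v (b z))) y =
        ContinuousAlternatingMap.alternatizeUncurryFinCLM ℝ E ℝ
          (fderiv ℝ (segInt v ε (fun z => contr v (b z))) y) := rfl
    rw [e1, (hasFDerivAt_segInt hε hT (fun z hz => (hg z hz).of_le (by simp)) hy).fderiv,
      ContinuousLinearMap.comp_segInt (F := E →L[ℝ] E [⋀^Fin q]→L[ℝ] ℝ) _ hε hgd hy]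
    refine intervalIntegral.integral_congr fun s hs => ?_
    rw [uIcc_of_le hε] at hs
    have hz := hy s hs
    change extDeriv (fun z => contr v (b z)) (y + s • v) = _
    rw [extDeriv_contr ((hb _ hz).differentiableAt (by simp)), hd _ hz]
  have h2 : segInt v ε (fun z => fderiv ℝ b z v - contr v (θ z)) y =
      b (y + ε • v) - b y - segInt v ε (fun z => contr v (θ z)) y := by
    rw [← segInt_fderiv hε (fun z hz => (hb z hz).of_le (by simp)) hy]
    refine intervalIntegral.integral_sub ?_ ?_
    · refine ContinuousOn.intervalIntegrable ?_
      rw [uIcc_of_le hε]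
      exact continuousOn_segment hbd hy
    · refine ContinuousOn.intervalIntegrable ?_
      rw [uIcc_of_le hε]
      exact continuousOn_segment (g := fun z => contr v (θ z))
        (fun z hz => (contr v).continuous.continuousAt.comp (hθ z hz)) hy
  rw [extDeriv_smul, h1, h2, neg_one_smul]
  abel

end Model

section Local

variable {d q : ℕ} {M : Type u} [TopologicalSpace M] [ChartedSpace (EuclideanSpace ℝ (Fin d)) M]

theorem extChartAt_euc (z : Euc d) : extChartAt (𝓡 d) z = PartialEquiv.refl (Euc d) :=
  extChartAt_model_space_eq_id _ z

theorem coordRep_euc (z₀ : Euc d) (a : GForm d (Euc d) q) :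
    coordRep d z₀ a = fun z => GForm.ev a z := by
  funext z
  ext v
  rw [coordRep_apply]
  have h1 : chs d z₀ z = ContinuousLinearMap.id ℝ _ := by
    unfold chs chartSymmDeriv
    rw [extChartAt_euc]
    exact mfderiv_id
  rw [h1, extChartAt_euc]
  rfl

theorem formSmoothAt_euc {a : GForm d (Euc d) q} {z : Euc d}
    (h : ContDiffAt ℝ ∞ (fun z => GForm.ev a z) z) : FormSmoothAt d a z := by
  unfold FormSmoothAt
  rw [coordRep_euc, extChartAt_euc]
  exact h

theorem dForm_euc (a : GForm d (Euc d) q) (z : Euc d) :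
    GForm.ev (dForm d a) z = extDeriv (fun z => GForm.ev a z) z := by
  ext v
  rw [dForm_ev, coordRep_euc]
  have h1 : chd d z z = ContinuousLinearMap.id ℝ _ := by
    unfold chd
    rw [extChartAt_euc]
    exact mfderiv_id
  rw [h1, extChartAt_euc]
  rfl

/-- `w` is the sum of `β` and of a form that extends smoothly from `A` to a neighbourhood of `x`. -/
def ExtDiffAt (A : Set M) (β w : GForm d M q) (x : M) : Prop :=
  ∃ η : GForm d M q, (∀ᶠ y in 𝓝 x, FormSmoothAt d η y) ∧ ∀ᶠ y in 𝓝 x, y ∈ A → β y = w y + η y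

/-- The forms `dγ` for `γ` smooth on `A ∩ U`; in degree zero, only the zero form. -/
def IsCob (A U : Set M) : ∀ {q : ℕ}, GForm d M q → Prop
  | 0, w => w = 0
  | q + 1, w => ∃ γ : GForm d M q, (∀ x ∈ A ∩ U, FormSmoothAt d γ x) ∧ w = dForm d γ

/-- On `U`, the form `β` on `A` is a coboundary up to forms that extend smoothly from `A`. -/
def Solvable (A : Set M) (β : GForm d M q) (U : Set M) : Prop :=
  ∃ w : GForm d M q, IsCob A U w ∧ ∀ x ∈ U, ExtDiffAt A β w x

theorem IsCob.mono {A U V : Set M} (h : V ⊆ U) {w : GForm d M q} (hw : IsCob A U w) : IsCob A V w := by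
  cases q with
  | zero => exact hw
  | succ q =>
    obtain ⟨γ, hγ, e⟩ := hw
    exact ⟨γ, fun x hx => hγ x ⟨hx.1, h hx.2⟩, e⟩

theorem Solvable.mono {A U V : Set M} (h : V ⊆ U) {β : GForm d M q} (hβ : Solvable A β U) :
    Solvable A β V := by
  obtain ⟨w, hw, h'⟩ := hβ
  exact ⟨w, hw.mono h, fun x hx => h' x (h hx)⟩

theorem isCob_zero (A U : Set M) : IsCob A U (0 : GForm d M q) := by
  cases q with
  | zero => rfl
  | succ q => exact ⟨0, fun x _ => FormSmoothAt.zero x, funext fun x => (dForm_zero x).symm⟩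

theorem contMDiffAt_extChartAt_of_mem [IsManifold (𝓡 d) ∞ M] {x y : M}
    (hy : y ∈ (chartAt (Euc d) x).source) :
    ContMDiffAt (𝓡 d) 𝓘(ℝ, Euc d) ∞ (extChartAt (𝓡 d) x) y :=
  (contMDiffOn_extChartAt (I := 𝓡 d) (n := ∞) (x := x)).contMDiffAt
    ((chartAt (Euc d) x).open_source.mem_nhds hy)

/-- Local solvability at a boundary point: in a chart, `eq_translate_sub_zero` and
`eq_translate_sub_succ` apply to an inward direction `v`. -/
theorem exists_solvable_boundary [IsManifold (𝓡 d) ∞ M] {A U : Set M} (hA : IsOpen A)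
    (hU : IsOpen U) (hreg : interior (closure A) = A) (hD : IsRegularDomain d (closure A))
    {β : GForm d M q} (hβ : ∀ x ∈ A ∩ U, FormSmoothAt d β x)
    (hdβ : ∀ x ∈ U, ExtDiffAt A (dForm d β) 0 x) {x : M} (hxU : x ∈ U) (hx : x ∈ frontier (closure A)) :
    ∃ V, IsOpen V ∧ x ∈ V ∧ V ⊆ U ∧ Solvable A β V := by
  obtain ⟨τ, hτ⟩ := hD.exists_isDefining hx
  obtain ⟨v, hv⟩ := hτ.exists_pos
  set z₀ := extChartAt (𝓡 d) x x with hz₀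
  obtain ⟨c, hc, r₁, hr₁, hgrow⟩ := exists_linear_growth hτ.contDiffAt.self_of_nhds hv
  obtain ⟨η, hη, hηβ⟩ := hdβ x hxU
  have hsymm : ∀ {P : M → Prop}, (∀ᶠ y in 𝓝 x, P y) →
      ∀ᶠ z in 𝓝 z₀, P ((extChartAt (𝓡 d) x).symm z) := fun {P} hP => by
    have := continuousAt_extChartAt_symm (I := 𝓡 d) x
    rw [ContinuousAt, extChartAt_to_inv] at this
    exact this.eventually hP
  obtain ⟨r, hr, hball⟩ := Metric.eventually_nhds_iff_ball.1
    ((show ∀ᶠ z in 𝓝 z₀, z ∈ (extChartAt (𝓡 d) x).target from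
      extChartAt_target_mem_nhds x).and ((hsymm (hU.mem_nhds hxU)).and
      ((hsymm hη).and ((hsymm hηβ).and (hτ.contDiffAt.and (hτ.mem_iff.and
        (show ∀ᶠ z in 𝓝 z₀, z ∈ Metric.ball z₀ r₁ from Metric.ball_mem_nhds z₀ hr₁)))))))
  choose htgt hsU hsη hsβ hsτ hmem hr₁' using hball
  set W := Metric.ball z₀ r with hWdef
  have hτc : ContinuousOn τ W := fun z hz => (hsτ z hz).continuousAt.continuousWithinAt
  -- `T` is the part of `A` in the ball `W`; it is here that `A` has to be regular open
  set T := W ∩ τ ⁻¹' Ioi 0 with hTdef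
  have hT : IsOpen T := hτc.isOpen_inter_preimage Metric.isOpen_ball isOpen_Ioi
  have hTA : ∀ z ∈ W, (extChartAt (𝓡 d) x).symm z ∈ A ↔ z ∈ T := by
    intro z hz
    have hcs := continuousAt_extChartAt_symm'' (htgt z hz)
    constructor
    · intro hzA
      refine ⟨hz, lt_of_le_of_ne ((hmem z hz).1 (subset_closure hzA)) fun h0 => ?_⟩
      -- otherwise points slightly behind `z` would be in `A` and have `τ < 0`
      have hc1 : ContinuousAt (fun s : ℝ => z + (-s) • v) 0 := by fun_prop
      have hc2 : Filter.Tendsto (fun s : ℝ => z + (-s) • v) (𝓝[>] 0) (𝓝 z) := by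
        have := hc1.tendsto
        simp only [neg_zero, zero_smul, add_zero] at this
        exact this.mono_left nhdsWithin_le_nhds
      have h3 := hc2.eventually ((show ∀ᶠ z' in 𝓝 z, z' ∈ W from
        Metric.isOpen_ball.mem_nhds hz).and (hcs.eventually (hA.mem_nhds hzA)))
      obtain ⟨s, ⟨hs1, hs2⟩, hs3⟩ := (h3.and self_mem_nhdsWithin).exists
      have h4 := (hmem _ hs1).1 (subset_closure hs2)
      have h5 := hgrow (z + (-s) • v) (hr₁' _ hs1) s (le_of_lt hs3) (by
        rw [add_assoc, ← add_smul, neg_add_cancel, zero_smul, add_zero]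
        exact hr₁' z hz)
      rw [add_assoc, ← add_smul, neg_add_cancel, zero_smul, add_zero, ← h0] at h5
      have h6 : 0 < c * s := mul_pos hc hs3
      linarith
    · intro hzT
      rw [← hreg]
      have hnhds : (extChartAt (𝓡 d) x).symm ⁻¹' closure A ∈ 𝓝 z := by
        filter_upwards [hT.mem_nhds hzT] with z' hz' using (hmem z' hz'.1).2 (le_of_lt hz'.2)
      rw [mem_interior_iff_mem_nhds]
      have hzs := (extChartAt (𝓡 d) x).map_target (htgt z hz)
      have hcx : ContinuousAt (extChartAt (𝓡 d) x) ((extChartAt (𝓡 d) x).symm z) :=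
        continuousAt_extChartAt' hzs
      rw [ContinuousAt, (extChartAt (𝓡 d) x).right_inv (htgt z hz)] at hcx
      filter_upwards [hcx hnhds, (isOpen_extChartAt_source x).mem_nhds hzs] with y hy hys
      rwa [mem_preimage, mem_preimage, (extChartAt (𝓡 d) x).left_inv hys] at hy
  have hsrc : ∀ z ∈ W, (extChartAt (𝓡 d) x).symm z ∈ (chartAt (Euc d) x).source := fun z hz => by
    have := (extChartAt (𝓡 d) x).map_target (htgt z hz)
    rwa [extChartAt_source] at this
  have hb : ∀ z ∈ T, ContDiffAt ℝ ∞ (coordRep d x β) z := by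
    intro z hz
    have := (formSmoothAt_iff (hsrc z hz.1)).1 (hβ _ ⟨(hTA z hz.1).2 hz, hsU z hz.1⟩)
    rwa [(extChartAt (𝓡 d) x).right_inv (htgt z hz.1)] at this
  have hθ : ∀ z ∈ W, ContDiffAt ℝ ∞ (coordRep d x η) z := by
    intro z hz
    have := (formSmoothAt_iff (hsrc z hz)).1 (hsη z hz)
    rwa [(extChartAt (𝓡 d) x).right_inv (htgt z hz)] at this
  have hd : ∀ z ∈ T, extDeriv (coordRep d x β) z = coordRep d x η z := by
    intro z hz
    rw [← coordRep_dForm (htgt z hz.1) (hβ _ ⟨(hTA z hz.1).2 hz, hsU z hz.1⟩)]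
    have h1 := hsβ z hz.1 ((hTA z hz.1).2 hz)
    simp only [coordRep, h1]
    congr 1
    exact zero_add _
  -- the segment of length `ε` in the direction `v` stays in the ball
  set ε := r / (2 * (‖v‖ + 1)) with hεdef
  have hvpos : 0 < ‖v‖ + 1 := by positivity
  have hε : 0 < ε := by positivity
  have hεW : ∀ s ∈ Icc 0 ε, z₀ + s • v ∈ W := by
    intro s hs
    rw [hWdef, Metric.mem_ball, dist_self_add_left, norm_smul, Real.norm_of_nonneg hs.1]
    calc s * ‖v‖ ≤ ε * (‖v‖ + 1) := by
          have := norm_nonneg v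
          exact mul_le_mul hs.2 (by linarith) this hε.le
      _ = r / 2 := by rw [hεdef]; field_simp
      _ < r := by linarith
  have hz₀W : z₀ ∈ W := Metric.mem_ball_self hr
  have hεT : z₀ + ε • v ∈ T := by
    refine ⟨hεW ε ⟨hε.le, le_rfl⟩, ?_⟩
    have h1 := hgrow z₀ (hr₁' _ hz₀W) ε hε.le (hr₁' _ (hεW ε ⟨hε.le, le_rfl⟩))
    rw [hτ.eq_zero] at h1
    have := mul_pos hc hε
    exact lt_of_lt_of_le this (by linarith)
  have hray : ∀ᶠ y in 𝓝 z₀, y ∈ T → ∀ s ∈ Icc 0 ε, y + s • v ∈ T := by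
    filter_upwards [eventually_segment_subset Metric.isOpen_ball hεW] with y hy hyT s hs
    refine ⟨hy s hs, ?_⟩
    have h1 := hgrow y (hr₁' _ hyT.1) s hs.1 (hr₁' _ (hy s hs))
    have h2 : 0 < τ y := hyT.2
    have := mul_nonneg hc.le hs.1
    exact lt_of_lt_of_le h2 (by linarith)
  -- the extension over the boundary: it only involves `β` at the interior points `y + ε v`
  set e : Euc d → Euc d [⋀^Fin q]→L[ℝ] ℝ := fun y => coordRep d x β (y + ε • v) -
    segInt v ε (fun z => contr v (coordRep d x η z)) y with hedef
  have hesm := contDiffAt_translate_sub hε.le hT Metric.isOpen_ball hb hθ hεW hεT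
  obtain ⟨N, hN, hNo, hzN⟩ := eventually_nhds_iff.1
    (hesm.and (hray.and (Metric.isOpen_ball.mem_nhds hz₀W)))
  choose hN1 hN2 hN3 using hN
  set V := (chartAt (Euc d) x).source ∩ extChartAt (𝓡 d) x ⁻¹' N with hVdef
  have hVo : IsOpen V := by
    have := (continuousOn_extChartAt (I := 𝓡 d) x).isOpen_inter_preimage (isOpen_extChartAt_source x) hNo
    rwa [extChartAt_source] at this
  have hlinv : ∀ y ∈ V, (extChartAt (𝓡 d) x).symm (extChartAt (𝓡 d) x y) = y := fun y hy =>
    (extChartAt (𝓡 d) x).left_inv (by rw [extChartAt_source]; exact hy.1)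
  have hVT : ∀ y ∈ V, y ∈ A → extChartAt (𝓡 d) x y ∈ T := fun y hy hyA =>
    (hTA _ (hN3 _ hy.2)).1 (by rwa [hlinv y hy])
  have hesmooth : ∀ y ∈ V, FormSmoothAt d (gpull (extChartAt (𝓡 d) x) e) y := fun y hy =>
    FormSmoothAt.gpull (N := Euc d) (contMDiffAt_extChartAt_of_mem hy.1)
      (formSmoothAt_euc (hN1 _ hy.2))
  refine ⟨V ∩ U, hVo.inter hU, ⟨⟨mem_chart_source _ x, hzN⟩, hxU⟩, inter_subset_right, ?_⟩
  have key : ∃ w : GForm d M q, IsCob A (V ∩ U) w ∧ ∀ y ∈ V, y ∈ A →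
      β y = w y + gpull (extChartAt (𝓡 d) x) e y := by
    cases q with
    | zero =>
      refine ⟨0, rfl, fun y hy hyA => ?_⟩
      have h1 := eq_translate_sub_zero hε.le hb hd (hN2 _ hy.2 (hVT y hy hyA))
      refine Eq.trans ?_ (zero_add _).symm
      refine GForm.ext_ev y fun u => ?_
      rw [ev_eq_coordRep β hy.1, h1]
      rfl
    | succ q =>
      set a : Euc d → Euc d [⋀^Fin q]→L[ℝ] ℝ :=
        (-1 : ℝ) • segInt v ε (fun z => contr v (coordRep d x β z)) with hadef
      have ha : ∀ y ∈ V, y ∈ A → FormSmoothAt (M := Euc d) d a (extChartAt (𝓡 d) x y) := by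
        intro y hy hyA
        refine formSmoothAt_euc ?_
        refine ContDiffAt.const_smul (-1 : ℝ) (contDiffAt_segInt hε.le hT (fun z hz => ?_)
          (hN2 _ hy.2 (hVT y hy hyA)))
        exact (contr v).contDiff.contDiffAt.comp z (hb z hz)
      refine ⟨dForm d (gpull (extChartAt (𝓡 d) x) a), ⟨_, fun y hy =>
        FormSmoothAt.gpull (N := Euc d) (contMDiffAt_extChartAt_of_mem hy.2.1.1)
          (ha y hy.2.1 hy.1), rfl⟩, fun y hy hyA => ?_⟩
      have h1 := eq_translate_sub_succ hε.le hT hb hd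
        (fun z hz => (hθ z hz.1).continuousAt) (hN2 _ hy.2 (hVT y hy hyA))
      rw [dForm_gpull (N := Euc d) (contMDiffAt_extChartAt_of_mem hy.1) (ha y hy hyA)]
      refine ContinuousAlternatingMap.ext fun (u : Fin (q + 1) → Euc d) => ?_
      have h2 : GForm.ev (M := Euc d) (dForm d (a : GForm d (Euc d) q)) (extChartAt (𝓡 d) x y) =
        extDeriv a (extChartAt (𝓡 d) x y) := dForm_euc _ _
      change β.ev y u = GForm.ev (M := Euc d) (dForm d (a : GForm d (Euc d) q))
        (extChartAt (𝓡 d) x y) (fun i => chd d x y (u i)) +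
          e (extChartAt (𝓡 d) x y) (fun i => chd d x y (u i))
      rw [ev_eq_coordRep β hy.1, h1, h2]
      rfl
  obtain ⟨w, hw, hwβ⟩ := key
  refine ⟨w, hw, fun y hy => ⟨gpull (extChartAt (𝓡 d) x) e, ?_, ?_⟩⟩
  · filter_upwards [hVo.mem_nhds hy.1] with y' hy' using hesmooth y' hy'
  · filter_upwards [hVo.mem_nhds hy.1] with y' hy' using hwβ y' hy'

end Local


/-! ### Forms on an open set modulo forms that extend over the boundary: global acyclicity -/

/-- An open cover of an open set by sets with a hereditary property has a locally finite refinement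
that is a sequence. -/
theorem exists_seq_cover {X : Type u} [TopologicalSpace X] [T2Space X] [SecondCountableTopology X]
    [LocallyCompactSpace X] {U : Set X} (hU : IsOpen U) {P : Set X → Prop} (hP₀ : P ∅)
    (hP : ∀ V W : Set X, V ⊆ W → P W → P V) (h : ∀ x ∈ U, ∃ V, IsOpen V ∧ x ∈ V ∧ V ⊆ U ∧ P V) :
    ∃ V : ℕ → Set X, (∀ k, IsOpen (V k)) ∧ (∀ k, V k ⊆ U) ∧ (∀ k, P (V k)) ∧
      (∀ x ∈ U, ∃ k, x ∈ V k) ∧ ∀ x ∈ U, ∃ K, ∀ᶠ y in 𝓝 x, ∀ k, K ≤ k → y ∉ V k := by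
  rcases U.eq_empty_or_nonempty with rfl | ⟨x₀, hx₀⟩
  · exact ⟨fun _ => ∅, fun _ => isOpen_empty, fun _ => subset_rfl, fun _ => hP₀, by simp, by simp⟩
  have : LocallyCompactSpace U := hU.locallyCompactSpace
  choose V hVo hxV hVU hPV using fun x : U => h x x.2
  obtain ⟨s, hs, hsu⟩ := TopologicalSpace.countable_cover_nhds
    (f := fun x : U => (Subtype.val ⁻¹' V x : Set U))
    (fun x => ((hVo x).preimage continuous_subtype_val).mem_nhds (hxV x))
  have hne : s.Nonempty := by
    have : (⟨x₀, hx₀⟩ : U) ∈ ⋃ x ∈ s, (Subtype.val ⁻¹' V x : Set U) := by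
      rw [hsu]
      trivial
    obtain ⟨x, hx, -⟩ := mem_iUnion₂.1 this
    exact ⟨x, hx⟩
  obtain ⟨g, rfl⟩ := hs.exists_eq_range hne
  obtain ⟨v, hv, hvu, hvl, hvs⟩ := precise_refinement (fun k => (Subtype.val ⁻¹' V (g k) : Set U))
    (fun k => (hVo _).preimage continuous_subtype_val) (by rwa [biUnion_range] at hsu)
  refine ⟨fun k => Subtype.val '' v k, fun k => hU.isOpenMap_subtype_val _ (hv k), fun k => ?_,
    fun k => ?_, fun x hx => ?_, fun x hx => ?_⟩
  · rintro _ ⟨y, _, rfl⟩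
    exact y.2
  · refine hP _ (V (g k)) ?_ (hPV _)
    rintro _ ⟨y, hy, rfl⟩
    exact hvs k hy
  · have : (⟨x, hx⟩ : U) ∈ ⋃ k, v k := by
      rw [hvu]
      trivial
    obtain ⟨k, hk⟩ := mem_iUnion.1 this
    exact ⟨k, _, hk, rfl⟩
  · obtain ⟨t, ht, hfin⟩ := hvl ⟨x, hx⟩
    obtain ⟨K, hK⟩ := hfin.bddAbove
    refine ⟨K + 1, ?_⟩
    have h1 := hU.isOpenEmbedding_subtypeVal.image_mem_nhds.2 ht
    filter_upwards [h1]
    rintro _ ⟨y, hy, rfl⟩ k hk ⟨y', hy', e⟩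
    obtain rfl := Subtype.ext e
    have := hK (show k ∈ {i | (v i ∩ t).Nonempty} from ⟨y', hy', hy⟩)
    omega

section Global

variable {d q : ℕ} {M : Type u} [TopologicalSpace M] [ChartedSpace (EuclideanSpace ℝ (Fin d)) M]
  [IsManifold (𝓡 d) ∞ M]

theorem eventually_formSmoothAt {w : GForm d M q} {O : Set M} (hO : IsOpen O)
    (h : ∀ x ∈ O, FormSmoothAt d w x) {x : M} (hx : x ∈ O) : ∀ᶠ y in 𝓝 x, FormSmoothAt d w y := by
  filter_upwards [hO.mem_nhds hx] with y hy using h y hy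

theorem IsCob.formSmoothAt {A U : Set M} (hA : IsOpen A) (hU : IsOpen U) {w : GForm d M q}
    (hw : IsCob A U w) {x : M} (hx : x ∈ A ∩ U) : FormSmoothAt d w x := by
  cases q with
  | zero =>
    obtain rfl : w = 0 := hw
    exact FormSmoothAt.zero x
  | succ q =>
    obtain ⟨γ, hγ, rfl⟩ := hw
    exact FormSmoothAt.dForm (eventually_formSmoothAt (hA.inter hU) hγ hx)

theorem IsCob.dForm_eq_zero {A U : Set M} (hA : IsOpen A) (hU : IsOpen U) {w : GForm d M q}
    (hw : IsCob A U w) {x : M} (hx : x ∈ A ∩ U) : dForm d w x = 0 := by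
  cases q with
  | zero =>
    obtain rfl : w = 0 := hw
    exact dForm_zero x
  | succ q =>
    obtain ⟨γ, hγ, rfl⟩ := hw
    exact dForm_dForm (eventually_formSmoothAt (hA.inter hU) hγ hx)

theorem exists_solvable_local {A U : Set M} (hA : IsOpen A) (hU : IsOpen U)
    (hreg : interior (closure A) = A) (hD : IsRegularDomain d (closure A)) {β : GForm d M q}
    (hβ : ∀ x ∈ A ∩ U, FormSmoothAt d β x) (hdβ : ∀ x ∈ U, ExtDiffAt A (dForm d β) 0 x) {x : M}
    (hx : x ∈ U) : ∃ V, IsOpen V ∧ x ∈ V ∧ V ⊆ U ∧ Solvable A β V := by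
  by_cases hxA : x ∈ A
  · refine ⟨A ∩ U, hA.inter hU, ⟨hxA, hx⟩, inter_subset_right, 0, isCob_zero A _, fun y hy =>
      ⟨β, eventually_formSmoothAt (hA.inter hU) hβ hy,
        Filter.Eventually.of_forall fun z _ => (zero_add (β z)).symm⟩⟩
  by_cases hxC : x ∈ closure A
  · refine exists_solvable_boundary hA hU hreg hD hβ hdβ hx ⟨by rwa [closure_closure], ?_⟩
    rwa [hreg]
  · refine ⟨(closure A)ᶜ ∩ U, isClosed_closure.isOpen_compl.inter hU, ⟨hxC, hx⟩,
      inter_subset_right, 0, isCob_zero A _, fun y hy =>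
      ⟨0, Filter.Eventually.of_forall fun z => FormSmoothAt.zero z, ?_⟩⟩
    filter_upwards [isClosed_closure.isOpen_compl.mem_nhds hy.1] with z hz hzA
    exact (hz (subset_closure hzA)).elim

/-- The acyclicity statement in degree `q`, for all open subsets `U`: a form on `A ∩ U` whose exterior
derivative extends smoothly over the points of `U` is itself, up to a coboundary, such a form. -/
def Acyclic (d : ℕ) {M : Type u} [TopologicalSpace M] [ChartedSpace (EuclideanSpace ℝ (Fin d)) M]
    (A : Set M) (q : ℕ) : Prop :=
  ∀ (U : Set M) (β : GForm d M q), IsOpen U → (∀ x ∈ A ∩ U, FormSmoothAt d β x) →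
    (∀ x ∈ U, ExtDiffAt A (dForm d β) 0 x) → Solvable A β U

theorem ExtDiffAt.congr {A : Set M} {β w w' : GForm d M q} {x : M} (h : ExtDiffAt A β w x)
    (hw : ∀ᶠ y in 𝓝 x, y ∈ A → w y = w' y) : ExtDiffAt A β w' x := by
  obtain ⟨η, hη, he⟩ := h
  refine ⟨η, hη, ?_⟩
  filter_upwards [he, hw] with y h1 h2 hy
  rw [h1 hy, h2 hy]

theorem ExtDiffAt.congr_dForm {A : Set M} (hA : IsOpen A) {β : GForm d M (q + 1)}
    {γ γ' : GForm d M q} {x : M} (h : ExtDiffAt A β (dForm d γ) x)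
    (hw : ∀ᶠ y in 𝓝 x, y ∈ A → γ y = γ' y) : ExtDiffAt A β (dForm d γ') x := by
  refine h.congr ?_
  filter_upwards [hw.eventually_nhds] with y hy hyA
  refine dForm_congr ?_
  filter_upwards [hy, hA.mem_nhds hyA] with z h1 h2 using h1 h2

variable [T2Space M] [SecondCountableTopology M]

/-- A coboundary on an intersection can be cut off, remaining a coboundary. -/
theorem IsCob.exists_cutoff {A U V : Set M}
    {f : M → ℝ} (hf : ∀ x ∈ U ∪ V, ContMDiffAt (𝓡 d) 𝓘(ℝ, ℝ) ∞ f x)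
    (hf₀ : ∀ x ∈ V, x ∉ U → ∀ᶠ y in 𝓝 x, f y = 0) (hf₁ : ∀ x ∈ U, x ∉ V → ∀ᶠ y in 𝓝 x, f y = 1)
    {w : GForm d M q} (hw : IsCob A (U ∩ V) w) : ∃ w₁ : GForm d M q, IsCob A (U ∩ V) w₁ ∧
      (∀ x ∈ U, x ∉ V → ∀ᶠ y in 𝓝 x, w₁ y = 0) ∧
      ∀ x ∈ V, x ∉ U → ∀ᶠ y in 𝓝 x, w₁ y = w y := by
  cases q with
  | zero =>
    obtain rfl : w = 0 := hw
    exact ⟨0, rfl, fun _ _ _ => Filter.Eventually.of_forall fun _ => rfl,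
      fun _ _ _ => Filter.Eventually.of_forall fun _ => rfl⟩
  | succ q =>
    obtain ⟨γ, hγ, rfl⟩ := hw
    refine ⟨dForm d (fun y => (1 - f y) • γ y), ⟨_, fun x hx => FormSmoothAt.fsmul
      (contMDiffAt_const.sub (hf x (Or.inl hx.2.1))) (hγ x hx), rfl⟩, fun x hx hxV => ?_,
      fun x hx hxU => ?_⟩
    · filter_upwards [(hf₁ x hx hxV).eventually_nhds] with y hy
      rw [← dForm_zero (d := d) (q := q) y]
      refine dForm_congr ?_
      filter_upwards [hy] with z hz
      rw [hz, sub_self, zero_smul]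
      rfl
    · filter_upwards [(hf₀ x hx hxU).eventually_nhds] with y hy
      refine dForm_congr ?_
      filter_upwards [hy] with z hz
      rw [hz, sub_zero, one_smul]

/-- Solutions on two open sets can be merged; the solution on `U` only changes inside `V`.  On the
intersection `γ₁ - γ₂` has an exterior derivative that extends over the boundary, so by acyclicity in
lower degree it is the sum of a coboundary `w` and a form that extends; both are cut off. -/
theorem exists_merge {A U V : Set M} (hA : IsOpen A) (hU : IsOpen U) (hV : IsOpen V)
    (hac : Acyclic d A q) {β : GForm d M (q + 1)} {γ₁ γ₂ : GForm d M q}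
    (h₁ : ∀ x ∈ A ∩ U, FormSmoothAt d γ₁ x) (e₁ : ∀ x ∈ U, ExtDiffAt A β (dForm d γ₁) x)
    (h₂ : ∀ x ∈ A ∩ V, FormSmoothAt d γ₂ x) (e₂ : ∀ x ∈ V, ExtDiffAt A β (dForm d γ₂) x) :
    ∃ γ : GForm d M q, (∀ x ∈ A ∩ (U ∪ V), FormSmoothAt d γ x) ∧
      (∀ x ∈ U ∪ V, ExtDiffAt A β (dForm d γ) x) ∧ ∀ x ∈ U, x ∉ V → γ x = γ₁ x := by
  classical
  obtain ⟨f, hf, hf₀, hf₁⟩ := NonHausdorff.exists_cutoff (d := d) hU hV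
  set D : GForm d M q := γ₁ + (-1 : ℝ) • γ₂ with hD
  have hDs : ∀ x ∈ A ∩ (U ∩ V), FormSmoothAt d D x := fun x hx =>
    (h₁ x ⟨hx.1, hx.2.1⟩).add ((h₂ x ⟨hx.1, hx.2.2⟩).smul _)
  obtain ⟨w, hw, hwD⟩ := hac (U ∩ V) D (hU.inter hV) hDs (by
    intro x hx
    obtain ⟨η₁, hη₁, k₁⟩ := e₁ x hx.1
    obtain ⟨η₂, hη₂, k₂⟩ := e₂ x hx.2
    refine ⟨η₂ + (-1 : ℝ) • η₁, ?_, ?_⟩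
    · filter_upwards [hη₁, hη₂] with y hy₁ hy₂ using hy₂.add (hy₁.smul _)
    · filter_upwards [k₁, k₂, (hU.inter hV).mem_nhds hx] with y hy₁ hy₂ hy hyA
      have h3 := (hy₁ hyA).symm.trans (hy₂ hyA)
      rw [hD, dForm_add (h₁ y ⟨hyA, hy.1⟩) ((h₂ y ⟨hyA, hy.2⟩).smul _), dForm_smul]
      have gen : ∀ (V : Type) [AddCommGroup V] [Module ℝ V] (a b c e : V), a + b = c + e →
          a + (-1 : ℝ) • c = 0 + (e + (-1 : ℝ) • b) := by
        intro V _ _ a b c e h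
        rw [neg_one_smul, neg_one_smul, zero_add, ← sub_eq_add_neg, ← sub_eq_add_neg,
          sub_eq_sub_iff_add_eq_add, h, add_comm]
      exact gen (Euc d [⋀^Fin (q + 1)]→L[ℝ] ℝ) _ _ _ _ h3)
  obtain ⟨w₁, hw₁, hw₁0, hw₁w⟩ := hw.exists_cutoff hf hf₀ hf₁
  -- on the intersection the new form is `γ₁ - w₁ - (1 - f) (γ₁ - γ₂ - w)`
  set G : GForm d M q := (γ₁ + (-1 : ℝ) • w₁) + fun y => (f y - 1) • (D + (-1 : ℝ) • w) y with hG
  set γ : GForm d M q := fun x => if x ∈ U ∩ V then G x else if x ∈ U then γ₁ x else γ₂ x with hγ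
  have hγUV : ∀ x ∈ U ∩ V, ∀ᶠ y in 𝓝 x, γ y = G y := fun x hx => by
    filter_upwards [(hU.inter hV).mem_nhds hx] with y hy
    simp only [hγ, if_pos hy]
  have hγU : ∀ x ∈ U, x ∉ V → ∀ᶠ y in 𝓝 x, γ y = γ₁ y := fun x hx hxV => by
    filter_upwards [hU.mem_nhds hx, hf₁ x hx hxV, hw₁0 x hx hxV] with y hy hfy hwy
    by_cases hyV : y ∈ V
    · simp only [hγ, if_pos (mem_inter hy hyV)]
      change γ₁ y + (-1 : ℝ) • w₁ y + (f y - 1) • (D + (-1 : ℝ) • w) y = γ₁ y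
      rw [hfy, hwy, sub_self, zero_smul, smul_zero, add_zero, add_zero]
    · simp only [hγ, if_neg (fun h : y ∈ U ∩ V => hyV h.2), if_pos hy]
  have hγV : ∀ x ∈ V, x ∉ U → ∀ᶠ y in 𝓝 x, γ y = γ₂ y := fun x hx hxU => by
    filter_upwards [hV.mem_nhds hx, hf₀ x hx hxU, hw₁w x hx hxU] with y hy hfy hwy
    by_cases hyU : y ∈ U
    · simp only [hγ, if_pos (mem_inter hyU hy)]
      change γ₁ y + (-1 : ℝ) • w₁ y + (f y - 1) • (γ₁ y + (-1 : ℝ) • γ₂ y + (-1 : ℝ) • w y) = γ₂ y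
      rw [hfy, hwy]
      have gen : ∀ (V : Type) [AddCommGroup V] [Module ℝ V] (a b c : V),
          a + (-1 : ℝ) • b + ((0 : ℝ) - 1) • (a + (-1 : ℝ) • c + (-1 : ℝ) • b) = c := by
        intro V _ _ a b c
        module
      exact gen (Euc d [⋀^Fin q]→L[ℝ] ℝ) _ _ _
    · simp only [hγ, if_neg (fun h : y ∈ U ∩ V => hyU h.1), if_neg hyU]
  have hcases : ∀ x ∈ U ∪ V, x ∈ U ∩ V ∨ (x ∈ U ∧ x ∉ V) ∨ (x ∈ V ∧ x ∉ U) := by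
    rintro x (h | h)
    · by_cases h' : x ∈ V
      · exact Or.inl ⟨h, h'⟩
      · exact Or.inr (Or.inl ⟨h, h'⟩)
    · by_cases h' : x ∈ U
      · exact Or.inl ⟨h', h⟩
      · exact Or.inr (Or.inr ⟨h, h'⟩)
  refine ⟨γ, ?_, ?_, fun x hx hxV => (hγU x hx hxV).self_of_nhds⟩
  · rintro x ⟨hxA, hx⟩
    rcases hcases x hx with h | ⟨h, h'⟩ | ⟨h, h'⟩
    · refine formSmoothAt_congr (hγUV x h) ?_
      have hwx := hw.formSmoothAt hA (hU.inter hV) ⟨hxA, h⟩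
      have hwx₁ := hw₁.formSmoothAt hA (hU.inter hV) ⟨hxA, h⟩
      exact ((h₁ x ⟨hxA, h.1⟩).add (hwx₁.smul _)).add (FormSmoothAt.fsmul
        ((hf x hx).sub contMDiffAt_const) ((hDs x ⟨hxA, h⟩).add (hwx.smul _)))
    · exact formSmoothAt_congr (hγU x h h') (h₁ x ⟨hxA, h⟩)
    · exact formSmoothAt_congr (hγV x h h') (h₂ x ⟨hxA, h⟩)
  · intro x hx
    rcases hcases x hx with h | ⟨h, h'⟩ | ⟨h, h'⟩
    · obtain ⟨e, he, hwe⟩ := hwD x h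
      obtain ⟨η, hη, k⟩ := e₁ x h.1
      have hes : ∀ᶠ y in 𝓝 x, FormSmoothAt d (fun y => (f y - 1) • e y) y := by
        filter_upwards [he, (hU.inter hV).mem_nhds h] with y hy hyUV
        exact FormSmoothAt.fsmul ((hf y (Or.inl hyUV.1)).sub contMDiffAt_const) hy
      refine ⟨η + (-1 : ℝ) • dForm d (fun y => (f y - 1) • e y), ?_, ?_⟩
      · filter_upwards [hη, hes.eventually_nhds] with y h3 h4
        exact h3.add ((FormSmoothAt.dForm h4).smul _)
      · filter_upwards [k, hwe.eventually_nhds, hes, (hγUV x h).eventually_nhds,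
          (hU.inter hV).mem_nhds h] with y hk hwe hes hγy hyUV hyA
        have hγe : dForm d γ y = dForm d ((γ₁ + (-1 : ℝ) • w₁) + fun y => (f y - 1) • e y) y := by
          refine dForm_congr ?_
          filter_upwards [hγy, hwe, hA.mem_nhds hyA] with z h5 h6 h7
          rw [h5]
          have h8 : (D + (-1 : ℝ) • w) z = e z := by
            change D z + (-1 : ℝ) • w z = e z
            rw [h6 h7]
            have gen : ∀ (V : Type) [AddCommGroup V] [Module ℝ V] (a b : V),
                a + b + (-1 : ℝ) • a = b := by
              intro V _ _ a b
              module
            exact gen (Euc d [⋀^Fin q]→L[ℝ] ℝ) _ _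
          change γ₁ z + (-1 : ℝ) • w₁ z + (f z - 1) • (D + (-1 : ℝ) • w) z = _
          rw [h8]
          rfl
        have hw₁y := hw₁.formSmoothAt hA (hU.inter hV) ⟨hyA, hyUV⟩
        rw [hk hyA, hγe, dForm_add ((h₁ y ⟨hyA, hyUV.1⟩).add (hw₁y.smul _)) hes,
          dForm_add (h₁ y ⟨hyA, hyUV.1⟩) (hw₁y.smul _), dForm_smul,
          hw₁.dForm_eq_zero hA (hU.inter hV) ⟨hyA, hyUV⟩]
        have gen : ∀ (V : Type) [AddCommGroup V] [Module ℝ V] (a b c : V),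
            a + b = a + (-1 : ℝ) • (0 : V) + c + (b + (-1 : ℝ) • c) := by
          intro V _ _ a b c
          module
        exact gen (Euc d [⋀^Fin (q + 1)]→L[ℝ] ℝ) _ _ _
    · refine (e₁ x h).congr_dForm hA ?_
      filter_upwards [hγU x h h'] with y hy _ using hy.symm
    · refine (e₂ x h).congr_dForm hA ?_
      filter_upwards [hγV x h h'] with y hy _ using hy.symm

/-- Forms on `A` modulo forms on the closure of `A` are an acyclic complex.  Local solutions on a
locally finite sequence of open sets are merged one after the other; the result stabilizes near every
point. -/
theorem acyclic {A : Set M} (hA : IsOpen A) (hreg : interior (closure A) = A)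
    (hD : IsRegularDomain d (closure A)) (q : ℕ) : Acyclic d A q := by
  have : LocallyCompactSpace M := Manifold.locallyCompact_of_finiteDimensional (𝓡 d)
  induction q with
  | zero =>
    intro U β hU hβ hdβ
    refine ⟨0, rfl, fun x hx => ?_⟩
    obtain ⟨V, hV, hxV, -, w, hw, hwβ⟩ := exists_solvable_local hA hU hreg hD hβ hdβ hx
    obtain rfl : w = 0 := hw
    exact hwβ x hxV
  | succ q ih =>
    intro U β hU hβ hdβ
    obtain ⟨V, hV, hVU, hVs, hcov, hlf⟩ := exists_seq_cover hU (P := Solvable A β)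
      ⟨0, isCob_zero A _, fun x hx => hx.elim⟩ (fun _ _ h h' => h'.mono h)
      (fun x hx => exists_solvable_local hA hU hreg hD hβ hdβ hx)
    set O : ℕ → Set M := fun k => ⋃ i ∈ Finset.range k, V i with hO
    have hOo : ∀ k, IsOpen (O k) := fun k => isOpen_biUnion fun i _ => hV i
    have hOs : ∀ k, O (k + 1) = O k ∪ V k := by
      intro k
      simp only [hO, Finset.range_add_one, Finset.set_biUnion_insert]
      exact union_comm _ _
    have hOm : Monotone O := monotone_nat_of_le_succ fun k => by
      rw [hOs]
      exact subset_union_left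
    have hstep : ∀ k (γ : GForm d M q), ((∀ x ∈ A ∩ O k, FormSmoothAt d γ x) ∧
        ∀ x ∈ O k, ExtDiffAt A β (dForm d γ) x) → ∃ γ' : GForm d M q,
        ((∀ x ∈ A ∩ O (k + 1), FormSmoothAt d γ' x) ∧
          ∀ x ∈ O (k + 1), ExtDiffAt A β (dForm d γ') x) ∧ ∀ x ∈ O k, x ∉ V k → γ' x = γ x := by
      rintro k γ ⟨h1, h2⟩
      obtain ⟨w, ⟨γ₂, h3, rfl⟩, h4⟩ := hVs k
      obtain ⟨γ', h5, h6, h7⟩ := exists_merge hA (hOo k) (hV k) ih h1 h2 h3 h4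
      rw [hOs]
      exact ⟨γ', ⟨h5, h6⟩, h7⟩
    choose! step hstep1 hstep2 using hstep
    let s : ℕ → GForm d M q := fun k => Nat.rec 0 (fun k γ => step k γ) k
    have hs : ∀ k, (∀ x ∈ A ∩ O k, FormSmoothAt d (s k) x) ∧
        ∀ x ∈ O k, ExtDiffAt A β (dForm d (s k)) x := by
      intro k
      induction k with
      | zero => exact ⟨fun x hx => by simp [hO] at hx, fun x hx => by simp [hO] at hx⟩
      | succ k ihk => exact hstep1 k (s k) ihk
    have hss : ∀ k, ∀ x ∈ O k, x ∉ V k → s (k + 1) x = s k x := fun k => hstep2 k (s k) (hs k)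
    -- near every point of `U` the sequence is eventually constant
    have hstab : ∀ x ∈ U, ∃ K, x ∈ O K ∧ ∀ᶠ y in 𝓝 x, ∀ k, K ≤ k → s k y = s K y := by
      intro x hx
      obtain ⟨k₀, hk₀⟩ := hcov x hx
      obtain ⟨K, hK⟩ := hlf x hx
      have hxO : x ∈ O (max K (k₀ + 1)) := hOm (le_max_right _ _) (by
        rw [hOs]
        exact Or.inr hk₀)
      refine ⟨max K (k₀ + 1), hxO, ?_⟩
      filter_upwards [hK, (hOo _).mem_nhds hxO] with y hy hyO k hk
      induction k, hk using Nat.le_induction with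
      | base => rfl
      | succ k hk ihk =>
        rw [hss k y (hOm hk hyO) (hy k ((le_max_left _ _).trans hk)), ihk]
    choose! K hKO hK using hstab
    have hlim : ∀ x ∈ U, ∀ᶠ y in 𝓝 x, s (K y) y = s (K x) y := by
      intro x hx
      filter_upwards [hK x hx, hU.mem_nhds hx] with y hy hyU
      rw [← hy (max (K x) (K y)) (le_max_left _ _),
        (hK y hyU).self_of_nhds (max (K x) (K y)) (le_max_right _ _)]
    refine ⟨dForm d fun x => s (K x) x, ⟨_, fun x hx => ?_, rfl⟩, fun x hx => ?_⟩
    · exact formSmoothAt_congr (hlim x hx.2) ((hs (K x)).1 x ⟨hx.1, hKO x hx.2⟩)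
    · refine ((hs (K x)).2 x (hKO x hx)).congr_dForm hA ?_
      filter_upwards [hlim x hx] with y hy _ using hy.symm

end Global

/-! ### Restriction to the interior is an isomorphism in cohomology -/

section Decomposition

variable {d q : ℕ} {M : Type u} [TopologicalSpace M] [ChartedSpace (EuclideanSpace ℝ (Fin d)) M]
  [IsManifold (𝓡 d) ∞ M] {A : Set M}

theorem IsCob.on_mem_exactForms (hA : IsOpen A) {w : GForm d M q} (hw : IsCob A univ w) :
    w.on A ∈ exactForms d A q := by
  cases q with
  | zero =>
    obtain rfl : w = 0 := hw
    exact Submodule.zero_mem _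
  | succ q =>
    obtain ⟨γ, hγ, rfl⟩ := hw
    have hs : ∀ x ∈ A, FormSmoothAt d γ x := fun x hx => hγ x ⟨hx, mem_univ x⟩
    exact ⟨γ.on A, mem_Omega_of_formSmoothAt (η := γ) (fun x hx => eventually_formSmoothAt hA hs hx)
      (fun _ => rfl), fun x => ⟨A, hA, x.2, γ, hs, fun y _ => ⟨rfl, rfl⟩⟩⟩

/-- The local smooth extensions fit together to a form `u` on the closure of `A`, and `du` is
determined by density. -/
theorem Solvable.exists_decomposition (hA : IsOpen A) {β : GForm d M q}
    (h : Solvable A β univ) {ζ : RawForm d (closure A) (q + 1)}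
    (hζ : ζ ∈ Omega d (closure A) (q + 1))
    (hdβ : ∀ (x : M) (hx : x ∈ A), dForm d β x = ζ ⟨x, subset_closure hx⟩) :
    ∃ (w : GForm d M q) (u : RawForm d (closure A) q), w.on A ∈ exactForms d A q ∧
      HasExtDeriv d u ζ ∧ β.on A = w.on A + restrict d subset_closure q u := by
  obtain ⟨w, hw, he⟩ := h
  choose η hη hβη using fun x => he x (mem_univ x)
  have key : ∀ x y, y ∈ closure A → FormSmoothAt d (η x) y →
      (∀ᶠ z in 𝓝 y, z ∈ A → β z = w z + η x z) → η x y = η y y := by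
    intro x y hy h1 h2
    refine h1.eq_of_mem_closure (hη y).self_of_nhds hy ?_
    filter_upwards [h2, hβη y] with z h3 h4 hz
    exact add_left_cancel ((h3 hz).symm.trans (h4 hz))
  refine ⟨w, fun x => η x x, hw.on_mem_exactForms hA, fun x => ?_, ?_⟩
  · obtain ⟨U, hU, hUo, hxU⟩ := mem_nhds_iff.1 ((hη x).and (hβη x).eventually_nhds)
    refine ⟨U, hUo, hxU, η x, fun y hy => (hU hy).1, fun y hy => ⟨?_, ?_⟩⟩
    · exact key x y y.2 (hU hy).1 (hU hy).2
    · obtain ⟨V, hV, hyV, ζ', hζ', hζe⟩ := hζ y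
      have h1 : ∀ᶠ z in 𝓝 (y : M), FormSmoothAt d (η x) z :=
        eventually_formSmoothAt hUo (fun z hz => (hU hz).1) hy
      refine (FormSmoothAt.eq_of_mem_closure (FormSmoothAt.dForm h1) (hζ' y hyV) y.2 ?_).trans
        (hζe y hyV)
      filter_upwards [(hU hy).2.eventually_nhds, h1, hV.mem_nhds hyV] with z h2 h3 hzV hzA
      have h4 : dForm d β z = dForm d (w + η x) z := dForm_congr (by
        filter_upwards [h2, hA.mem_nhds hzA] with t h5 h6 using h5 h6)
      rw [dForm_add (hw.formSmoothAt hA isOpen_univ ⟨hzA, mem_univ z⟩) h3,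
        hw.dForm_eq_zero hA isOpen_univ ⟨hzA, mem_univ z⟩, hdβ z hzA] at h4
      rw [hζe ⟨z, subset_closure hzA⟩ hzV]
      exact (h4.trans (zero_add (dForm d (η x) z))).symm
  · exact funext fun x => (hβη x).self_of_nhds x.2

theorem dForm_zeroExt (hA : IsOpen A) {w : RawForm d A q} {θ : RawForm d A (q + 1)}
    (h : HasExtDeriv d w θ) {x : M} (hx : x ∈ A) : dForm d (zeroExt w) x = θ ⟨x, hx⟩ := by
  obtain ⟨U, hU, hxU, η, -, he⟩ := h ⟨x, hx⟩
  rw [← (he ⟨x, hx⟩ hxU).2]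
  refine dForm_congr ?_
  filter_upwards [hA.mem_nhds hx, hU.mem_nhds hxU] with y hy hyU
  rw [zeroExt_of_mem w hy]
  exact ((he ⟨y, hy⟩ hyU).1).symm

end Decomposition

namespace SmoothSystem

variable {d q : ℕ} {M : Fin 2 → Type u} [∀ i, TopologicalSpace (M i)]
  [∀ i, ChartedSpace (EuclideanSpace ℝ (Fin d)) (M i)] [∀ i, IsManifold (𝓡 d) ∞ (M i)]
  [∀ i, T2Space (M i)] [∀ i, SecondCountableTopology (M i)] (F : SmoothSystem d M)

/-- A form on the gluing region whose exterior derivative extends to the closure is, up to an exact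
form, itself the restriction of a form on the closure. -/
theorem exists_decomposition (hF : F.RegularOpen) {w : RawForm d (F.A 0 1) q}
    {ζ : RawForm d (closure (F.A 0 1)) (q + 1)} (hw : w ∈ Omega d (F.A 0 1) q)
    (hζ : ζ ∈ Omega d (closure (F.A 0 1)) (q + 1))
    (h : HasExtDeriv d w (restrict d subset_closure (q + 1) ζ)) :
    ∃ u : RawForm d (closure (F.A 0 1)) q, HasExtDeriv d u ζ ∧
      restrict d subset_closure q u - w ∈ exactForms d (F.A 0 1) q := by
  have hA := F.isOpen_A 0 1
  have hβ : ∀ x ∈ F.A 0 1, FormSmoothAt d (zeroExt w) x := fun x hx =>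
    formSmoothAt_zeroExt hw (hA.mem_nhds hx)
  have hdβ : ∀ (x : M 0) (hx : x ∈ F.A 0 1), dForm d (zeroExt w) x = ζ ⟨x, subset_closure hx⟩ :=
    fun x hx => dForm_zeroExt hA h hx
  obtain ⟨w', u, h1, h2, h3⟩ := (acyclic hA (hF 0 1) (F.isRegularDomain_closure 0 1) q univ
    (zeroExt w) isOpen_univ (fun x hx => hβ x hx.1) (by
      intro x _
      by_cases hx : x ∈ closure (F.A 0 1)
      · obtain ⟨U, hU, hxU, η, hη, he⟩ := hζ ⟨x, hx⟩
        refine ⟨η, eventually_formSmoothAt hU hη hxU, ?_⟩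
        filter_upwards [hU.mem_nhds hxU] with y hyU hy
        rw [hdβ y hy, ← he ⟨y, subset_closure hy⟩ hyU]
        exact (zero_add (η y)).symm
      · refine ⟨0, Filter.Eventually.of_forall fun z => FormSmoothAt.zero z, ?_⟩
        filter_upwards [isClosed_closure.isOpen_compl.mem_nhds hx] with y hy hyA
        exact (hy (subset_closure hyA)).elim)).exists_decomposition hA hζ hdβ
  refine ⟨u, h2, ?_⟩
  have e : (zeroExt w).on (F.A 0 1) = w := funext fun x => zeroExt_of_mem w x.2
  rw [e] at h3
  rw [h3, add_comm, sub_add_cancel_left]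
  exact neg_mem h1

/-- The restriction map in cohomology. -/
noncomputable def resH (q : ℕ) : HdR d (closure (F.A 0 1)) q →ₗ[ℝ] HdR d (F.A 0 1) q :=
  (isFormMap_restrict subset_closure).mapH q

theorem resH_bijective (hF : F.RegularOpen) (q : ℕ) : Function.Bijective (F.resH q) := by
  constructor
  · rw [← LinearMap.ker_eq_bot, LinearMap.ker_eq_bot']
    intro X hX
    obtain ⟨θ, hθ, rfl⟩ := exists_cls X
    have h := (cls_eq_zero (hw := (isFormMap_restrict subset_closure).mem_closedForms hθ)).1 hX
    refine cls_eq_zero.2 ?_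
    cases q with
    | zero =>
      have h0 : restrict d subset_closure 0 θ = 0 := h
      exact Omega.eq_of_dense subset_closure Subset.rfl hθ.1 (Submodule.zero_mem _)
        fun x hx => congrFun h0 ⟨x, hx⟩
    | succ q =>
      obtain ⟨w, hw, e⟩ := h
      obtain ⟨u, hu, -⟩ := F.exists_decomposition hF hw hθ.1 e
      exact ⟨u, hu.mem_Omega, hu⟩
  · intro X
    obtain ⟨w, hw, rfl⟩ := exists_cls X
    obtain ⟨u, hu, h⟩ := F.exists_decomposition (ζ := 0) hF hw.1 (Submodule.zero_mem _)
      (by rw [map_zero]; exact hw.2)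
    have hc : u ∈ closedForms d (closure (F.A 0 1)) q := ⟨hu.mem_Omega, hu⟩
    exact ⟨cls d u hc,
      (cls_eq_cls (hw := (isFormMap_restrict subset_closure).mem_closedForms hc)).2 h⟩

theorem restrictionIso (hF : F.RegularOpen) : F.RestrictionIso := fun q =>
  ⟨LinearEquiv.ofBijective (F.resH q) (F.resH_bijective hF q), fun _ hθ =>
    ⟨(isFormMap_restrict subset_closure).mem_closedForms hθ, rfl⟩⟩

/-- The difference map for the gluing map is the restriction of the difference map for its
extension. -/
theorem diff_f (w₁ : RawForm d (univ : Set (M 0)) q) (w₂ : RawForm d (univ : Set (M 1)) q) :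
    diff (F.f 0 1) q w₁ w₂ = restrict d subset_closure q (diff (F.fbar 0 1) q w₁ w₂) := by
  have h : pullback d (F.f 0 1) (Subset.refl _) (fun _ _ => mem_univ _) q w₂ =
      restrict d subset_closure q (pullback d (F.fbar 0 1) (Subset.refl _)
        (fun _ _ => mem_univ _) q w₂) := by
    funext x
    obtain ⟨U, hU, hxU, g, hg, he⟩ := F.fbar_local 0 1 ⟨x, subset_closure x.2⟩
    have hd : don d (F.f 0 1) x = don d (F.fbar 0 1) ⟨x, subset_closure x.2⟩ := by
      refine Eq.trans ?_ (he ⟨x, subset_closure x.2⟩ hxU).2.symm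
      refine don_eq_mfd _ _ ((F.isOpen_A 0 1).uniqueMDiffWithinAt x.2)
        ((hg x hxU).mdifferentiableAt (by simp)) ?_
      filter_upwards [hU.mem_nhds hxU] with y hyU hy
      rw [(he ⟨y, subset_closure hy⟩ hyU).1]
      exact F.fbar_eq_f 0 1 ⟨y, hy⟩
    refine ContinuousAlternatingMap.ext fun (v : Fin q → Euc d) => ?_
    change rev w₂ ⟨F.f 0 1 x, mem_univ _⟩ (fun i => don d (F.f 0 1) x (v i)) =
      rev w₂ ⟨F.fbar 0 1 ⟨x, subset_closure x.2⟩, mem_univ _⟩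
        (fun i => don d (F.fbar 0 1) ⟨x, subset_closure x.2⟩ (v i))
    rw [hd]
    congr 3
    exact (F.fbar_eq_f 0 1 x).symm
  unfold diff
  rw [map_sub, h]
  rfl

theorem mayerVietoris_f (hF : F.RegularOpen) : F.MayerVietoris (F.f 0 1) := by
  obtain ⟨a, b, c, ha, hb, hc, hinj, hex⟩ := F.mayerVietoris_fbar
  let ρ := fun q => LinearEquiv.ofBijective (F.resH q) (F.resH_bijective hF q)
  refine ⟨a, fun q => (ρ q).toLinearMap.comp (b q), fun q => (c q).comp (ρ q).symm.toLinearMap,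
    ha, ?_, ?_, hinj, fun q => ⟨?_, ?_, ?_⟩⟩
  · intro q w₁ h₁ w₂ h₂
    obtain ⟨h, e⟩ := hb q w₁ h₁ w₂ h₂
    have h' := (isFormMap_restrict (subset_closure (s := F.A 0 1))).mem_closedForms h
    rw [← F.diff_f] at h'
    refine ⟨h', ?_⟩
    change F.resH q (b q _) = _
    rw [e]
    refine cls_eq_cls.2 ?_
    rw [F.diff_f]
    change restrict d subset_closure q (diff (F.fbar 0 1) q w₁ w₂) - _ ∈ _
    rw [sub_self]
    exact Submodule.zero_mem _
  · intro q w₁ h₁ w₂ h₂ hθ w hw e₁ e₂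
    have hθ' : diff (F.fbar 0 1) q w₁ w₂ ∈ closedForms d (closure (F.A 0 1)) q := by
      have h3 := hasExtDeriv_diff (F.smooth_fbar 0 1) (F.uniqueMDiff_closure 0 1) e₁ e₂
      rw [F.diff_φPull hw.1] at h3
      exact ⟨h3.mem_Omega, h3⟩
    rw [← hc q w₁ h₁ w₂ h₂ hθ' w hw e₁ e₂]
    change c q ((ρ q).symm _) = _
    congr 1
    rw [LinearEquiv.symm_apply_eq]
    refine cls_eq_cls.2 ?_
    rw [F.diff_f]
    change _ - restrict d subset_closure q (diff (F.fbar 0 1) q w₁ w₂) ∈ _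
    rw [sub_self]
    exact Submodule.zero_mem _
  · intro X
    rw [← (hex q).1 X]
    exact (ρ q).map_eq_zero_iff
  · intro X
    refine ((hex q).2.1 ((ρ q).symm X)).trans ?_
    constructor
    · rintro ⟨Y, hY⟩
      exact ⟨Y, (LinearEquiv.eq_symm_apply _).1 hY⟩
    · rintro ⟨Y, hY⟩
      exact ⟨Y, (LinearEquiv.eq_symm_apply _).2 hY⟩
  · intro X
    rw [(hex q).2.2 X]
    constructor
    · rintro ⟨Y, rfl⟩
      exact ⟨ρ q Y, congrArg (c q) ((ρ q).symm_apply_apply Y)⟩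
    · rintro ⟨Y, rfl⟩
      exact ⟨(ρ q).symm Y, rfl⟩

end SmoothSystem

/-! ### Moderate and flat functions -/

section Moderate

variable {E G : Type*} [NormedAddCommGroup E] [NormedSpace ℝ E] [NormedAddCommGroup G]
  [NormedSpace ℝ G] {u : E → ℝ} {O : Set E} {m : ℕ}

/-- A smooth function on `O` whose derivatives up to order `m` are bounded by powers of the weight
`u`. -/
def ModerateUpTo (u : E → ℝ) (O : Set E) (m : ℕ) (g : E → G) : Prop :=
  ContDiffOn ℝ ∞ g O ∧ ∀ k ≤ m, ∃ (N : ℕ) (C : ℝ), ∀ z ∈ O, ‖iteratedFDeriv ℝ k g z‖ ≤ C * u z ^ N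

/-- A smooth function on `O` each of whose derivatives decays faster than every negative power of the
weight `u`. -/
def FlatOn (u : E → ℝ) (O : Set E) (g : E → G) : Prop :=
  ContDiffOn ℝ ∞ g O ∧ ∀ m N : ℕ, ∃ C : ℝ, ∀ z ∈ O, ‖iteratedFDeriv ℝ m g z‖ * u z ^ N ≤ C

theorem contDiffOn_fderiv (hO : IsOpen O) {g : E → G} (hg : ContDiffOn ℝ ∞ g O) :
    ContDiffOn ℝ ∞ (fderiv ℝ g) O := hg.fderiv_of_isOpen hO (by simp)

theorem moderateUpTo_zero_iff {g : E → G} : ModerateUpTo u O 0 g ↔ ContDiffOn ℝ ∞ g O ∧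
    ∃ (N : ℕ) (C : ℝ), ∀ z ∈ O, ‖g z‖ ≤ C * u z ^ N := by
  constructor
  · rintro ⟨h, h'⟩
    simpa only [norm_iteratedFDeriv_zero] using And.intro h (h' 0 le_rfl)
  · rintro ⟨h, h'⟩
    refine ⟨h, fun k hk => ?_⟩
    obtain rfl := Nat.le_zero.1 hk
    simpa only [norm_iteratedFDeriv_zero] using h'

theorem moderateUpTo_succ_iff (hO : IsOpen O) {g : E → G} : ModerateUpTo u O (m + 1) g ↔
    ModerateUpTo u O 0 g ∧ ModerateUpTo u O m (fderiv ℝ g) := by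
  constructor
  · rintro ⟨h, h'⟩
    refine ⟨⟨h, fun k hk => h' k (hk.trans (Nat.zero_le _))⟩, contDiffOn_fderiv hO h, fun k hk => ?_⟩
    simpa only [norm_iteratedFDeriv_fderiv] using h' (k + 1) (Nat.succ_le_succ hk)
  · rintro ⟨⟨h, h0⟩, -, h'⟩
    refine ⟨h, fun k hk => ?_⟩
    cases k with
    | zero => exact h0 0 le_rfl
    | succ k => simpa only [norm_iteratedFDeriv_fderiv] using h' k (Nat.le_of_succ_le_succ hk)

theorem iteratedFDeriv_congr_on (hO : IsOpen O) {f g : E → G} (h : ∀ z ∈ O, f z = g z) {k : ℕ} {z : E}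
    (hz : z ∈ O) : iteratedFDeriv ℝ k f z = iteratedFDeriv ℝ k g z := by
  have h1 : f =ᶠ[𝓝 z] g := Filter.eventuallyEq_of_mem (hO.mem_nhds hz) h
  exact (h1.iteratedFDeriv ℝ k).eq_of_nhds

theorem ModerateUpTo.congr (hO : IsOpen O) {f g : E → G} (hg : ModerateUpTo u O m g)
    (h : ∀ z ∈ O, f z = g z) : ModerateUpTo u O m f := by
  refine ⟨hg.1.congr h, fun k hk => ?_⟩
  obtain ⟨N, C, hC⟩ := hg.2 k hk
  refine ⟨N, C, fun z hz => ?_⟩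
  rw [iteratedFDeriv_congr_on hO h hz]
  exact hC z hz

theorem norm_iteratedFDeriv_smul_le_on (hO : IsOpen O) {f : E → ℝ} {g : E → G}
    (hf : ContDiffOn ℝ ∞ f O) (hg : ContDiffOn ℝ ∞ g O) (k : ℕ) {z : E} (hz : z ∈ O) :
    ‖iteratedFDeriv ℝ k (fun y => f y • g y) z‖ ≤ ∑ i ∈ Finset.range (k + 1),
      (k.choose i : ℝ) * ‖iteratedFDeriv ℝ i f z‖ * ‖iteratedFDeriv ℝ (k - i) g z‖ := by
  have h := norm_iteratedFDerivWithin_smul_le hf hg hO.uniqueDiffOn hz (n := k)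
    (by exact_mod_cast le_top)
  simpa only [iteratedFDerivWithin_of_isOpen _ hO hz] using h

theorem ModerateUpTo.smul (hO : IsOpen O) (hu : ∀ z ∈ O, 1 ≤ u z) {f : E → ℝ} {g : E → G}
    (hf : ModerateUpTo u O m f) (hg : ModerateUpTo u O m g) :
    ModerateUpTo u O m fun z => f z • g z := by
  refine ⟨hf.1.smul hg.1, fun k hk => ?_⟩
  choose! N C hC using hf.2
  choose! N' C' hC' using hg.2
  refine ⟨∑ i ∈ Finset.range (k + 1), (N i + N' (k - i)),
    ∑ i ∈ Finset.range (k + 1), (k.choose i : ℝ) * |C i| * |C' (k - i)|, fun z hz => ?_⟩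
  refine (norm_iteratedFDeriv_smul_le_on hO hf.1 hg.1 k hz).trans ?_
  rw [Finset.sum_mul]
  refine Finset.sum_le_sum fun i hi => ?_
  have hi' : i ≤ k := Nat.lt_succ_iff.1 (Finset.mem_range.1 hi)
  have hu0 : 0 ≤ u z := zero_le_one.trans (hu z hz)
  have h1 : ‖iteratedFDeriv ℝ i f z‖ ≤ |C i| * u z ^ N i := (hC i (hi'.trans hk) z hz).trans
    (mul_le_mul_of_nonneg_right (le_abs_self _) (pow_nonneg hu0 _))
  have h2 : ‖iteratedFDeriv ℝ (k - i) g z‖ ≤ |C' (k - i)| * u z ^ N' (k - i) :=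
    (hC' (k - i) ((Nat.sub_le _ _).trans hk) z hz).trans
    (mul_le_mul_of_nonneg_right (le_abs_self _) (pow_nonneg hu0 _))
  have h3 : N i + N' (k - i) ≤ ∑ i ∈ Finset.range (k + 1), (N i + N' (k - i)) :=
    Finset.single_le_sum (f := fun i => N i + N' (k - i)) (fun _ _ => Nat.zero_le _) hi
  calc (k.choose i : ℝ) * ‖iteratedFDeriv ℝ i f z‖ * ‖iteratedFDeriv ℝ (k - i) g z‖
      ≤ (k.choose i : ℝ) * (|C i| * u z ^ N i) * (|C' (k - i)| * u z ^ N' (k - i)) := by gcongr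
    _ = (k.choose i : ℝ) * |C i| * |C' (k - i)| * u z ^ (N i + N' (k - i)) := by ring
    _ ≤ _ := by
      gcongr
      exact hu z hz

theorem ModerateUpTo.add (hO : IsOpen O) (hu : ∀ z ∈ O, 1 ≤ u z) {f g : E → G}
    (hf : ModerateUpTo u O m f) (hg : ModerateUpTo u O m g) :
    ModerateUpTo u O m fun z => f z + g z := by
  refine ⟨hf.1.add hg.1, fun k hk => ?_⟩
  obtain ⟨N, C, hC⟩ := hf.2 k hk
  obtain ⟨N', C', hC'⟩ := hg.2 k hk
  refine ⟨N + N', |C| + |C'|, fun z hz => ?_⟩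
  have hu0 : 0 ≤ u z := zero_le_one.trans (hu z hz)
  have h0 : iteratedFDeriv ℝ k (fun z => f z + g z) z =
      iteratedFDeriv ℝ k f z + iteratedFDeriv ℝ k g z :=
    iteratedFDeriv_add_apply ((hf.1.contDiffAt (hO.mem_nhds hz)).of_le (by exact_mod_cast le_top))
      ((hg.1.contDiffAt (hO.mem_nhds hz)).of_le (by exact_mod_cast le_top))
  rw [h0, add_mul]
  refine (norm_add_le _ _).trans (add_le_add ?_ ?_)
  · refine (hC z hz).trans (mul_le_mul (le_abs_self _) (pow_le_pow_right₀ (hu z hz) ?_)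
      (pow_nonneg hu0 _) (abs_nonneg _))
    exact Nat.le_add_right _ _
  · refine (hC' z hz).trans (mul_le_mul (le_abs_self _) (pow_le_pow_right₀ (hu z hz) ?_)
      (pow_nonneg hu0 _) (abs_nonneg _))
    exact Nat.le_add_left _ _

theorem moderateUpTo_const (c : G) : ModerateUpTo u O m fun _ : E => c := by
  refine ⟨contDiffOn_const, fun k _ => ⟨0, ‖c‖, fun z _ => ?_⟩⟩
  cases k with
  | zero => simp
  | succ k =>
    rw [iteratedFDeriv_const_of_ne (Nat.succ_ne_zero k)]
    simp

/-- The weight itself is moderate: `D(1/q) = -(1/q)² Dq`. -/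
theorem moderateUpTo_inv (hO : IsOpen O) {q : E → ℝ} (hq : ∀ z ∈ O, 0 < q z)
    (hq1 : ∀ z ∈ O, 1 ≤ (q z)⁻¹) (h : ∀ m, ModerateUpTo (fun z => (q z)⁻¹) O m q) :
    ModerateUpTo (fun z => (q z)⁻¹) O m fun z => (q z)⁻¹ := by
  have hs : ContDiffOn ℝ ∞ (fun z => (q z)⁻¹) O := (h 0).1.inv fun z hz => (hq z hz).ne'
  have h0 : ModerateUpTo (fun z => (q z)⁻¹) O 0 fun z => (q z)⁻¹ := by
    refine moderateUpTo_zero_iff.2 ⟨hs, 1, 1, fun z hz => ?_⟩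
    rw [Real.norm_of_nonneg (inv_nonneg.2 (hq z hz).le), one_mul, pow_one]
  induction m with
  | zero => exact h0
  | succ m ih =>
    refine (moderateUpTo_succ_iff hO).2 ⟨h0, ?_⟩
    refine ((ih.smul hO hq1 (ih.smul hO hq1 ((moderateUpTo_const (-1 : ℝ)).smul hO hq1
      ((moderateUpTo_succ_iff hO).1 (h (m + 1))).2)))).congr hO fun z hz => ?_
    have hd : DifferentiableAt ℝ q z :=
      ((h 0).1.contDiffAt (hO.mem_nhds hz)).differentiableAt (by simp)
    have h1 := ((hasDerivAt_inv (hq z hz).ne').comp_hasFDerivAt z hd.hasFDerivAt).fderiv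
    refine h1.trans ?_
    ext v
    simp only [smul_apply, smul_eq_mul, neg_smul, neg_apply]
    ring

/-- A smooth function on the line that is constant on `(-∞, 0]` and on `[1, ∞)`. -/
def IsStep (h : ℝ → ℝ) : Prop :=
  ContDiff ℝ ∞ h ∧ (∀ x ≤ 0, h x = h 0) ∧ ∀ x, 1 ≤ x → h x = h 1

theorem isStep_smoothTransition : IsStep Real.smoothTransition :=
  ⟨Real.smoothTransition.contDiff, fun x hx => by
    rw [Real.smoothTransition.zero_of_nonpos hx, Real.smoothTransition.zero_of_nonpos le_rfl],
    fun x hx => by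
      rw [Real.smoothTransition.one_of_one_le hx, Real.smoothTransition.one_of_one_le le_rfl]⟩

theorem IsStep.exists_bound {h : ℝ → ℝ} (hh : IsStep h) : ∃ C, ∀ x, ‖h x‖ ≤ C := by
  obtain ⟨C, hC⟩ := (isCompact_Icc (a := (0 : ℝ)) (b := 1)).exists_bound_of_continuousOn
    hh.1.continuous.continuousOn
  refine ⟨C, fun x => ?_⟩
  rcases le_total x 0 with h0 | h0
  · rw [hh.2.1 x h0]
    exact hC 0 (by simp)
  rcases le_total 1 x with h1 | h1
  · rw [hh.2.2 x h1]
    exact hC 1 (by simp)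
  · exact hC x ⟨h0, h1⟩

theorem IsStep.deriv {h : ℝ → ℝ} (hh : IsStep h) : IsStep (deriv h) := by
  have hd : ContDiff ℝ ∞ (_root_.deriv h) := ((contDiff_infty_iff_deriv).1 hh.1).2
  have h0 : ∀ x ≤ 0, _root_.deriv h x = 0 := by
    intro x hx
    have hD : HasDerivWithinAt h (_root_.deriv h x) (Iic x) x :=
      ((hh.1.differentiable (by simp)) x).hasDerivAt.hasDerivWithinAt
    refine (uniqueDiffWithinAt_Iic x).eq_deriv _ hD ?_
    exact (hasDerivWithinAt_const x (Iic x) (h 0)).congr (fun y hy => hh.2.1 y (le_trans hy hx))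
      (hh.2.1 x hx)
  have h1 : ∀ x, 1 ≤ x → _root_.deriv h x = 0 := by
    intro x hx
    have hD : HasDerivWithinAt h (_root_.deriv h x) (Ici x) x :=
      ((hh.1.differentiable (by simp)) x).hasDerivAt.hasDerivWithinAt
    refine (uniqueDiffWithinAt_Ici x).eq_deriv _ hD ?_
    exact (hasDerivWithinAt_const x (Ici x) (h 1)).congr (fun y hy => hh.2.2 y (le_trans hx hy))
      (hh.2.2 x hx)
  exact ⟨hd, fun x hx => by rw [h0 x hx, h0 0 le_rfl], fun x hx => by rw [h1 x hx, h1 1 le_rfl]⟩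

theorem ModerateUpTo.step_comp (hO : IsOpen O) (hu : ∀ z ∈ O, 1 ≤ u z) {g : E → ℝ}
    (hg : ∀ m, ModerateUpTo u O m g) {h : ℝ → ℝ} (hh : IsStep h) :
    ModerateUpTo u O m fun z => h (g z) := by
  have h0 : ∀ {h : ℝ → ℝ}, IsStep h → ModerateUpTo u O 0 fun z => h (g z) := by
    intro h hh
    obtain ⟨C, hC⟩ := hh.exists_bound
    refine moderateUpTo_zero_iff.2 ⟨hh.1.comp_contDiffOn (hg 0).1, 0, C, fun z _ => ?_⟩
    rw [pow_zero, mul_one]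
    exact hC _
  induction m generalizing h with
  | zero => exact h0 hh
  | succ m ih =>
    refine (moderateUpTo_succ_iff hO).2 ⟨h0 hh, ?_⟩
    refine ((ih hh.deriv).smul hO hu ((moderateUpTo_succ_iff hO).1 (hg (m + 1))).2).congr hO
      fun z hz => ?_
    have hd : DifferentiableAt ℝ g z :=
      ((hg 0).1.contDiffAt (hO.mem_nhds hz)).differentiableAt (by simp)
    exact (((hh.1.differentiable (by simp)) (g z)).hasDerivAt.comp_hasFDerivAt z
      hd.hasFDerivAt).fderiv

/-- A function that is flat on the part of `O` where the moderate function `χ` may be nonzero becomes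
flat on `O` when multiplied by `χ`. -/
theorem FlatOn.of_moderate (hO : IsOpen O) (hu : ∀ z ∈ O, 1 ≤ u z) {χ : E → ℝ} {f : E → G} {R : Set E}
    (hχ : ∀ m, ModerateUpTo u O m χ) (hχR : ∀ z ∈ O, z ∉ R → ∀ᶠ y in 𝓝 z, χ y = 0)
    (hf : ContDiffOn ℝ ∞ f O)
    (hfR : ∀ m N : ℕ, ∃ C : ℝ, ∀ z ∈ O ∩ R, ‖iteratedFDeriv ℝ m f z‖ * u z ^ N ≤ C) :
    FlatOn u O fun z => χ z • f z := by
  refine ⟨(hχ 0).1.smul hf, fun m N => ?_⟩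
  choose! K C hC using (hχ m).2
  choose C' hC' using hfR
  refine ⟨∑ i ∈ Finset.range (m + 1), (m.choose i : ℝ) * |C i| * |C' (m - i) (K i + N)|,
    fun z hz => ?_⟩
  by_cases hzR : z ∈ R
  · have hu0 : 0 ≤ u z := zero_le_one.trans (hu z hz)
    refine (mul_le_mul_of_nonneg_right (norm_iteratedFDeriv_smul_le_on hO (hχ 0).1 hf m hz)
      (pow_nonneg hu0 N)).trans ?_
    rw [Finset.sum_mul]
    refine Finset.sum_le_sum fun i hi => ?_
    have h1 : ‖iteratedFDeriv ℝ i χ z‖ ≤ |C i| * u z ^ K i :=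
      (hC i (Nat.lt_succ_iff.1 (Finset.mem_range.1 hi)) z hz).trans
      (mul_le_mul_of_nonneg_right (le_abs_self _) (pow_nonneg hu0 _))
    have h2 := (hC' (m - i) (K i + N) z ⟨hz, hzR⟩).trans (le_abs_self _)
    calc (m.choose i : ℝ) * ‖iteratedFDeriv ℝ i χ z‖ * ‖iteratedFDeriv ℝ (m - i) f z‖ * u z ^ N
        ≤ (m.choose i : ℝ) * (|C i| * u z ^ K i) * ‖iteratedFDeriv ℝ (m - i) f z‖ * u z ^ N := by
          gcongr
      _ = (m.choose i : ℝ) * |C i| * (‖iteratedFDeriv ℝ (m - i) f z‖ * u z ^ (K i + N)) := by ring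
      _ ≤ _ := by gcongr
  · have h1 : (fun y => χ y • f y) =ᶠ[𝓝 z] fun _ => 0 := by
      filter_upwards [hχR z hz hzR] with y hy
      rw [hy, zero_smul]
    rw [(h1.iteratedFDeriv ℝ m).eq_of_nhds]
    have h2 : iteratedFDeriv ℝ m (fun _ : E => (0 : G)) z = 0 := by
      have := iteratedFDeriv_fun_zero (𝕜 := ℝ) (E := E) (F := G) (n := m)
      exact congrFun this z
    rw [h2, norm_zero, zero_mul]
    exact Finset.sum_nonneg fun i _ => by positivity

end Moderate

/-- A flat function on `O` extends by zero to a smooth function, provided that the weight is at least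
proportional to the inverse of the distance to the complement of `O`.  The derivatives of the function
are flat too, so it suffices to see that the extension has derivative zero outside `O`. -/
theorem FlatOn.contDiffOn {E G : Type u} [NormedAddCommGroup E] [NormedSpace ℝ E]
    [NormedAddCommGroup G] [NormedSpace ℝ G] {u : E → ℝ} {B O : Set E} (hB : IsOpen B)
    (hO : IsOpen O) {L : ℝ}
    (hL : ∀ z ∈ O, ∀ w ∈ B, w ∉ O → 1 ≤ L * ‖z - w‖ * u z) {F : E → G} (hF : FlatOn u O F)
    (hF0 : ∀ z ∈ B, z ∉ O → F z = 0) : ContDiffOn ℝ ∞ F B := by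
  have key : ∀ {G : Type u} [NormedAddCommGroup G] [NormedSpace ℝ G] {F : E → G}, FlatOn u O F →
      (∀ z ∈ B, z ∉ O → F z = 0) → ∀ w ∈ B, w ∉ O → HasFDerivAt F (0 : E →L[ℝ] G) w := by
    intro G _ _ F hF hF0 w hw hwO
    obtain ⟨C, hC⟩ := hF.2 0 2
    have hbd : ∀ z ∈ B, ‖F z‖ ≤ |C| * L ^ 2 * ‖z - w‖ ^ 2 := by
      intro z hz
      by_cases hzO : z ∈ O
      · have h1 := hC z hzO
        rw [norm_iteratedFDeriv_zero] at h1
        have h2 := hL z hzO w hw hwO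
        have h3 : 1 ≤ (L * ‖z - w‖ * u z) ^ 2 := one_le_pow₀ h2
        calc ‖F z‖ ≤ ‖F z‖ * (L * ‖z - w‖ * u z) ^ 2 := le_mul_of_one_le_right (norm_nonneg _) h3
          _ = (‖F z‖ * u z ^ 2) * (L ^ 2 * ‖z - w‖ ^ 2) := by ring
          _ ≤ |C| * (L ^ 2 * ‖z - w‖ ^ 2) := by
            gcongr
            exact h1.trans (le_abs_self _)
          _ = _ := by ring
      · rw [hF0 z hz hzO, norm_zero]
        positivity
    rw [hasFDerivAt_iff_isLittleO_nhds_zero]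
    simp only [hF0 w hw hwO, sub_zero, zero_apply]
    have hB' : ∀ᶠ h in 𝓝 (0 : E), w + h ∈ B :=
      (continuousAt_const.add continuousAt_id).eventually_mem
        (by simpa using hB.mem_nhds hw)
    have h4 : (fun h : E => F (w + h)) =O[𝓝 0] fun h : E => ‖h‖ ^ 2 := by
      refine Asymptotics.IsBigO.of_bound (|C| * L ^ 2) ?_
      filter_upwards [hB'] with h hh
      have := hbd _ hh
      rw [add_sub_cancel_left] at this
      simpa using this
    refine h4.trans_isLittleO ?_
    have := Asymptotics.isLittleO_pow_id (𝕜 := ℝ) (n := 2) one_lt_two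
    have h5 := this.comp_tendsto (k := fun h : E => ‖h‖) (l' := 𝓝 (0 : E)) (by
      have := (continuous_norm (E := E)).tendsto 0
      rwa [norm_zero] at this)
    exact h5.norm_right.congr_right (fun h => by simp) |>.of_norm_right
  have main : ∀ n : ℕ, ∀ {G : Type u} [NormedAddCommGroup G] [NormedSpace ℝ G] {F : E → G},
      FlatOn u O F → (∀ z ∈ B, z ∉ O → F z = 0) → ContDiffOn ℝ n F B := by
    intro n
    induction n with
    | zero =>
      intro G _ _ F hF hF0
      refine contDiffOn_zero.2 fun z hz => ContinuousAt.continuousWithinAt ?_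
      by_cases hzO : z ∈ O
      · exact (hF.1.contDiffAt (hO.mem_nhds hzO)).continuousAt
      · exact (key hF hF0 z hz hzO).continuousAt
    | succ n ih =>
      intro G _ _ F hF hF0
      push_cast
      refine (contDiffOn_succ_iff_fderiv_of_isOpen hB).2 ⟨fun z hz => ?_, by simp, ?_⟩
      · by_cases hzO : z ∈ O
        · exact ((hF.1.contDiffAt (hO.mem_nhds hzO)).differentiableAt
            (by simp)).differentiableWithinAt
        · exact (key hF hF0 z hz hzO).differentiableAt.differentiableWithinAt
      · refine ih ⟨contDiffOn_fderiv hO hF.1, fun m N => ?_⟩ fun z hz hzO =>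
          (key hF hF0 z hz hzO).fderiv
        obtain ⟨C, hC⟩ := hF.2 (m + 1) N
        exact ⟨C, fun z hz => by simpa only [norm_iteratedFDeriv_fderiv] using hC z hz⟩
  exact contDiffOn_infty.2 fun n => main n hF hF0

section Flatness

variable {E G : Type*} [NormedAddCommGroup E] [NormedSpace ℝ E] [NormedAddCommGroup G]
  [NormedSpace ℝ G] {f : E → G} {W T : Set E} {v : E}

theorem contDiffAt_iteratedFDeriv {z : E} (h : ContDiffAt ℝ ∞ f z) (m : ℕ) :
    ContDiffAt ℝ ∞ (iteratedFDeriv ℝ m f) z :=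
  h.iteratedFDeriv_right (by exact_mod_cast le_top)

theorem exists_bound_iteratedFDeriv {K : Set E} (hK : IsCompact K)
    (hf : ∀ z ∈ K, ContDiffAt ℝ ∞ f z) (m : ℕ) : ∃ C, ∀ z ∈ K, ‖iteratedFDeriv ℝ m f z‖ ≤ C :=
  hK.exists_bound_of_continuousOn fun z hz =>
    (contDiffAt_iteratedFDeriv (hf z hz) m).continuousAt.continuousWithinAt

/-- All derivatives of a function vanishing on `T` vanish on `T`, if every point of `T` is a limit of
interior points. -/
theorem iteratedFDeriv_eq_zero_of_mem (hW : IsOpen W) (hf : ∀ z ∈ W, ContDiffAt ℝ ∞ f z)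
    (hT : T ⊆ W) (hfT : ∀ z ∈ T, f z = 0)
    (hv : ∀ z ∈ T, ∀ s : ℝ, 0 < s → z + s • v ∈ W → z + s • v ∈ interior T) (m : ℕ) {z : E}
    (hz : z ∈ T) : iteratedFDeriv ℝ m f z = 0 := by
  have h1 : ∀ y ∈ interior T, iteratedFDeriv ℝ m f y = 0 := by
    intro y hy
    have h2 : f =ᶠ[𝓝 y] fun _ => 0 := by
      filter_upwards [isOpen_interior.mem_nhds hy] with x hx using hfT x (interior_subset hx)
    rw [(h2.iteratedFDeriv ℝ m).eq_of_nhds]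
    exact congrFun (iteratedFDeriv_fun_zero (𝕜 := ℝ) (E := E) (F := G) (n := m)) y
  have hc : Filter.Tendsto (fun s : ℝ => z + s • v) (𝓝[>] 0) (𝓝 z) := by
    have : Continuous fun s : ℝ => z + s • v := by fun_prop
    have := this.tendsto 0
    rw [zero_smul, add_zero] at this
    exact this.mono_left nhdsWithin_le_nhds
  have h3 : Filter.Tendsto (fun s : ℝ => iteratedFDeriv ℝ m f (z + s • v)) (𝓝[>] 0)
      (𝓝 (iteratedFDeriv ℝ m f z)) :=
    (contDiffAt_iteratedFDeriv (hf z (hT hz)) m).continuousAt.tendsto.comp hc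
  refine tendsto_nhds_unique h3 (tendsto_const_nhds.congr' ?_)
  filter_upwards [hc.eventually (hW.mem_nhds (hT hz)), self_mem_nhdsWithin] with s hs hs0
  exact (h1 _ (hv z hz s hs0 hs)).symm

/-- A smooth function vanishing on `T` decays faster than every power of the distance to `T` in the
direction `v`, by repeated use of the mean value inequality along segments in the direction `v`. -/
theorem exists_flat_bound (hW : IsOpen W) (hf : ∀ z ∈ W, ContDiffAt ℝ ∞ f z)
    (hT : T ⊆ W) (hfT : ∀ z ∈ T, f z = 0)
    (hv : ∀ z ∈ T, ∀ s : ℝ, 0 < s → z + s • v ∈ W → z + s • v ∈ interior T) {K : Set E}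
    (hK : IsCompact K) (hKc : Convex ℝ K) (hKW : K ⊆ W) (N : ℕ) : ∀ m : ℕ, ∃ C, ∀ z ∈ K, ∀ s : ℝ,
      0 ≤ s → z + s • v ∈ T ∩ K → ‖iteratedFDeriv ℝ m f z‖ ≤ C * s ^ N := by
  induction N with
  | zero =>
    intro m
    obtain ⟨C, hC⟩ := exists_bound_iteratedFDeriv hK (fun z hz => hf z (hKW hz)) m
    exact ⟨C, fun z hz s _ _ => by simpa using hC z hz⟩
  | succ N ih =>
    intro m
    obtain ⟨C, hC⟩ := ih (m + 1)
    refine ⟨|C| * ‖v‖, fun z hz s hs hzs => ?_⟩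
    have h1 : ∀ x ∈ segment ℝ z (z + s • v), ‖fderiv ℝ (iteratedFDeriv ℝ m f) x‖ ≤ |C| * s ^ N := by
      intro x hx
      rw [segment_eq_image'] at hx
      obtain ⟨θ, hθ, rfl⟩ := hx
      simp only [add_sub_cancel_left]
      change ‖fderiv ℝ (iteratedFDeriv ℝ m f) (z + θ • s • v)‖ ≤ _
      rw [smul_smul, norm_fderiv_iteratedFDeriv]
      have h2 : θ * s ≤ s := mul_le_of_le_one_left hs hθ.2
      have h3 : z + (θ * s) • v + (s - θ * s) • v = z + s • v := by
        rw [add_assoc, ← add_smul, add_sub_cancel]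
      refine (hC _ ?_ (s - θ * s) (sub_nonneg.2 h2) (by rwa [h3])).trans ?_
      · have := hKc.segment_subset hz hzs.2
        refine this ?_
        rw [segment_eq_image']
        exact ⟨θ, hθ, by simp only [add_sub_cancel_left, smul_smul]⟩
      · refine mul_le_mul (le_abs_self _) (pow_le_pow_left₀ (sub_nonneg.2 h2) ?_ _)
          (pow_nonneg (sub_nonneg.2 h2) _) (abs_nonneg _)
        exact sub_le_self _ (mul_nonneg hθ.1 hs)
    have h4 := (convex_segment z (z + s • v)).norm_image_sub_le_of_norm_fderiv_le (𝕜 := ℝ)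
      (fun x hx => (contDiffAt_iteratedFDeriv (hf x (hKW (hKc.segment_subset hz hzs.2 hx)))
        m).differentiableAt (by simp)) h1 (right_mem_segment ℝ z (z + s • v))
      (left_mem_segment ℝ z (z + s • v))
    rw [iteratedFDeriv_eq_zero_of_mem hW hf hT hfT hv m hzs.1, sub_zero, sub_add_cancel_left,
      norm_neg, norm_smul, Real.norm_of_nonneg hs] at h4
    exact h4.trans (le_of_eq (by ring))

theorem moderateUpTo_of_compact {u : E → ℝ} {O K : Set E} (hK : IsCompact K) (hOK : O ⊆ K)
    (hf : ∀ z ∈ K, ContDiffAt ℝ ∞ f z) (m : ℕ) : ModerateUpTo u O m f := by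
  refine ⟨fun z hz => (hf z (hOK hz)).contDiffWithinAt, fun k _ => ?_⟩
  obtain ⟨C, hC⟩ := exists_bound_iteratedFDeriv hK hf k
  exact ⟨0, C, fun z hz => by simpa using hC z (hOK hz)⟩

theorem ModerateUpTo.prod {ι : Type*} {u : E → ℝ} {O : Set E} {m : ℕ} (hO : IsOpen O)
    (hu : ∀ z ∈ O, 1 ≤ u z) (J : Finset ι) {g : ι → E → ℝ} (hg : ∀ a ∈ J, ModerateUpTo u O m (g a)) :
    ModerateUpTo u O m fun z => ∏ a ∈ J, g a z := by
  classical
  induction J using Finset.induction_on with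
  | empty => simpa using moderateUpTo_const (1 : ℝ)
  | insert a J ha ih =>
    simp only [Finset.prod_insert ha]
    exact (hg a (Finset.mem_insert_self a J)).smul hO hu
      (ih fun b hb => hg b (Finset.mem_insert_of_mem hb))

end Flatness


/-! ### Cutting off a function on the intersection of two domains -/

section Cut

/-- Let `f` be smooth near `z₀` and vanish on the intersection of the domains `τ a ≥ 0`, all of which
share an inward direction `v` at `z₀`.  Within the intersection of the domains with `a ≠ l, t`, the
function equal to `f` on `τ l ≥ 0` and to zero on `τ t ≥ 0` extends smoothly: it is `χ f`, where the cutoff `χ`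
is singular only where `τ l = τ t = 0`, and there `f` is flat on the support of `χ`. -/
theorem exists_extension_of_cutoff {E G : Type u} [NormedAddCommGroup E] [NormedSpace ℝ E]
    [ProperSpace E] [NormedAddCommGroup G] [NormedSpace ℝ G] {ι : Type*} (K : Finset ι) {l t : ι}
    (hl : l ∈ K) (ht : t ∈ K) {τ : ι → E → ℝ} {z₀ v : E}
    (hτ : ∀ a ∈ K, ∀ᶠ z in 𝓝 z₀, ContDiffAt ℝ ∞ (τ a) z) (hτ0 : ∀ a ∈ K, τ a z₀ = 0)
    (hτv : ∀ a ∈ K, 0 < fderiv ℝ (τ a) z₀ v) {f : E → G} (hf : ∀ᶠ z in 𝓝 z₀, ContDiffAt ℝ ∞ f z)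
    (hf0 : ∀ᶠ z in 𝓝 z₀, (∀ a ∈ K, 0 ≤ τ a z) → f z = 0) :
    ∃ F : E → G, (∀ᶠ z in 𝓝 z₀, ContDiffAt ℝ ∞ F z) ∧ (∀ z, f z = 0 → F z = 0) ∧
      ∀ᶠ z in 𝓝 z₀, (∀ a ∈ K, a ≠ l → a ≠ t → 0 ≤ τ a z) →
        (0 ≤ τ l z → F z = f z) ∧ (0 ≤ τ t z → F z = 0) := by
  classical
  -- a ball `W` of radius `r` on which everything is smooth and all `τ a` grow at rate `c` along `v`
  have hgrow : ∃ c > 0, ∃ r > 0, ∀ a ∈ K, ∀ z ∈ Metric.ball z₀ r, ∀ s : ℝ, 0 ≤ s →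
      z + s • v ∈ Metric.ball z₀ r → τ a z + c * s ≤ τ a (z + s • v) := by
    have h1 : ∀ a ∈ K, ∃ c > 0, ∃ r > 0, ∀ z ∈ Metric.ball z₀ r, ∀ s : ℝ, 0 ≤ s →
      z + s • v ∈ Metric.ball z₀ r → τ a z + c * s ≤ τ a (z + s • v) :=
      fun a ha => exists_linear_growth (hτ a ha).self_of_nhds (hτv a ha)
    choose! c hc r hr h using h1
    have hK : K.Nonempty := ⟨l, hl⟩
    refine ⟨K.inf' hK c, (Finset.lt_inf'_iff hK).2 hc, K.inf' hK r, (Finset.lt_inf'_iff hK).2 hr,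
      fun a ha z hz s hs hzs => ?_⟩
    have hr' := Metric.ball_subset_ball (x := z₀) (Finset.inf'_le r ha)
    refine le_trans ?_ (h a ha z (hr' hz) s hs (hr' hzs))
    gcongr
    exact Finset.inf'_le c ha
  obtain ⟨c, hc, r₁, hr₁, hgrow⟩ := hgrow
  obtain ⟨r₂, hr₂, hball⟩ := Metric.eventually_nhds_iff_ball.1
    (((Filter.eventually_all_finset K).2 hτ).and (hf.and hf0))
  set r := min r₁ r₂ with hrdef
  have hr : 0 < r := lt_min hr₁ hr₂
  set W := Metric.ball z₀ r with hWdef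
  have hW₁ : W ⊆ Metric.ball z₀ r₁ := Metric.ball_subset_ball (min_le_left _ _)
  have hW₂ : W ⊆ Metric.ball z₀ r₂ := Metric.ball_subset_ball (min_le_right _ _)
  set T : Set E := {z | z ∈ W ∧ ∀ a ∈ K, 0 ≤ τ a z} with hTdef
  set C : Set E := Metric.closedBall z₀ (3 * r / 4) with hCdef
  have hCW : C ⊆ W := Metric.closedBall_subset_ball (by linarith)
  have hCc : IsCompact C := isCompact_closedBall _ _
  have hflat := fun N => exists_flat_bound (f := f) (W := W) (T := T) (v := v) Metric.isOpen_ball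
    (fun z hz => (hball z (hW₂ hz)).2.1) (fun z hz => hz.1)
    (fun z hz => (hball z (hW₂ hz.1)).2.2 hz.2) (by
      intro z hz s hs hzs
      have hopen : ∀ᶠ y in 𝓝 (z + s • v), y ∈ W ∧ ∀ a ∈ K, 0 < τ a y := by
        refine (Metric.isOpen_ball.eventually_mem hzs).and
          ((Filter.eventually_all_finset K).2 fun a ha => ?_)
        have h1 : 0 < τ a (z + s • v) := lt_of_lt_of_le (by
          have := hz.2 a ha
          have := mul_pos hc hs
          linarith) (hgrow a ha z (hW₁ hz.1) s hs.le (hW₁ hzs))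
        exact ((hball _ (hW₂ hzs)).1 a ha).continuousAt.eventually (isOpen_Ioi.mem_nhds h1)
      rw [mem_interior_iff_mem_nhds]
      filter_upwards [hopen] with y hy using ⟨hy.1, fun a ha => (hy.2 a ha).le⟩)
    hCc (convex_closedBall _ _) hCW N
  -- the gauge `q` and the ball `B`, chosen so that `B` is moved into `T ∩ C` by the flow along `v`
  set q : E → ℝ := fun z => τ l z ^ 2 + τ t z ^ 2 with hqdef
  have hqsm : ∀ z ∈ W, ContDiffAt ℝ ∞ q z := fun z hz =>
    (((hball z (hW₂ hz)).1 l hl).pow 2).add (((hball z (hW₂ hz)).1 t ht).pow 2)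
  have hq0 : q z₀ = 0 := by simp [hqdef, hτ0 l hl, hτ0 t ht]
  have hz₀W : z₀ ∈ W := Metric.mem_ball_self hr
  have hqc : ∀ᶠ z in 𝓝 z₀, q z < 1 ∧ 2 * √(q z) / c * ‖v‖ < r / 4 := by
    have h1 : ContinuousAt q z₀ := (hqsm z₀ hz₀W).continuousAt
    have h2 : ContinuousAt (fun z => 2 * √(q z) / c * ‖v‖) z₀ :=
      ((continuousAt_const.mul (Real.continuous_sqrt.continuousAt.comp h1)).div_const _).mul
        continuousAt_const
    refine (h1.eventually_lt continuousAt_const (by rw [hq0]; exact one_pos)).and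
      (h2.eventually_lt continuousAt_const ?_)
    rw [hq0]
    simp [hr]
  obtain ⟨r₃, hr₃, hballq⟩ := Metric.eventually_nhds_iff_ball.1 hqc
  set ρ := min r₃ (r / 2) with hρdef
  have hρ : 0 < ρ := lt_min hr₃ (half_pos hr)
  set B := Metric.ball z₀ ρ with hBdef
  have hBr₃ : B ⊆ Metric.ball z₀ r₃ := Metric.ball_subset_ball (min_le_left _ _)
  have hBr : B ⊆ Metric.ball z₀ (r / 2) := Metric.ball_subset_ball (min_le_right _ _)
  have hBC : B ⊆ C := (hBr.trans Metric.ball_subset_closedBall).trans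
    (Metric.closedBall_subset_closedBall (by linarith))
  have hBW : B ⊆ W := hBC.trans hCW
  have hqnn : ∀ z, 0 ≤ q z := fun z => by positivity
  set O : Set E := {z | z ∈ B ∧ 0 < q z} with hOdef
  have hOB : O ⊆ B := fun z hz => hz.1
  have hqcB : ∀ z ∈ B, ContinuousAt q z := fun z hz => (hqsm z (hBW hz)).continuousAt
  have hO : IsOpen O := by
    rw [isOpen_iff_mem_nhds]
    intro z hz
    filter_upwards [Metric.isOpen_ball.mem_nhds hz.1,
      (hqcB z hz.1).eventually (isOpen_Ioi.mem_nhds hz.2)] with y h1 h2 using ⟨h1, h2⟩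
  set u : E → ℝ := fun z => (q z)⁻¹ with hudef
  have hu : ∀ z ∈ O, 1 ≤ u z := fun z hz =>
    (one_le_inv₀ hz.2).2 (hballq z (hBr₃ hz.1)).1.le
  have hmod : ∀ {g : E → ℝ}, (∀ z ∈ W, ContDiffAt ℝ ∞ g z) → ∀ m, ModerateUpTo u O m g :=
    fun hg m => moderateUpTo_of_compact hCc (hOB.trans hBC) (fun z hz => hg z (hCW hz)) m
  have humod : ∀ m, ModerateUpTo u O m u := fun m =>
    moderateUpTo_inv hO (fun z hz => hz.2) hu (hmod hqsm)
  have hτW : ∀ a ∈ K, ∀ z ∈ W, ContDiffAt ℝ ∞ (τ a) z := fun a ha z hz => (hball z (hW₂ hz)).1 a ha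
  -- The first factor is one for `τ l - τ t ≥ q` and zero for `τ l - τ t ≤ -q`; the others are one for
  -- `τ a ≥ -q` and zero for `τ a ≤ -2q`, so that `χ` is supported in the region `R` below.
  set J := (K.erase l).erase t with hJdef
  have hJK : ∀ a ∈ J, a ∈ K := fun a ha => Finset.mem_of_mem_erase (Finset.mem_of_mem_erase ha)
  set H := Real.smoothTransition with hHdef
  set χ : E → ℝ := fun z => H ((1 + u z • (τ l z + (-1 : ℝ) • τ t z)) * 2⁻¹) •
    ∏ a ∈ J, H (2 + u z • τ a z) with hχdef
  have hχmod : ∀ m, ModerateUpTo u O m χ := by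
    intro m
    refine ModerateUpTo.smul hO hu ?_ (ModerateUpTo.prod hO hu J fun a ha => ?_)
    · refine ModerateUpTo.step_comp hO hu (fun m => ?_) isStep_smoothTransition
      refine ((moderateUpTo_const (1 : ℝ)).add hO hu ((humod m).smul hO hu ((hmod (hτW l hl) m).add hO
        hu ((moderateUpTo_const (-1 : ℝ)).smul hO hu (hmod (hτW t ht) m))))).smul hO hu
        (moderateUpTo_const (2⁻¹ : ℝ))
    · refine ModerateUpTo.step_comp hO hu (fun m => ?_) isStep_smoothTransition
      exact (moderateUpTo_const (2 : ℝ)).add hO hu ((humod m).smul hO hu (hmod (hτW a (hJK a ha)) m))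
  set R : Set E := {z | ∀ a ∈ J, -(2 * q z) ≤ τ a z} with hRdef
  have hχR : ∀ z ∈ O, z ∉ R → ∀ᶠ y in 𝓝 z, χ y = 0 := by
    intro z hz hzR
    simp only [hRdef, mem_ofPred_eq, not_forall, not_le] at hzR
    obtain ⟨a, ha, haz⟩ := hzR
    have h1 : ContinuousAt (fun y => τ a y + 2 * q y) z :=
      (hτW a (hJK a ha) z (hBW hz.1)).continuousAt.add (continuousAt_const.mul (hqcB z hz.1))
    filter_upwards [h1.eventually_lt continuousAt_const
      (show τ a z + 2 * q z < 0 by linarith), hO.mem_nhds hz] with y hy hyO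
    have h2 : H (2 + u y • τ a y) = 0 := by
      refine Real.smoothTransition.zero_of_nonpos ?_
      have h3 : 2 + u y • τ a y = (τ a y + 2 * q y) * (q y)⁻¹ := by
        have := hyO.2.ne'
        simp only [hudef, smul_eq_mul]
        field_simp
        ring
      rw [h3]
      exact mul_nonpos_of_nonpos_of_nonneg hy.le (inv_nonneg.2 hyO.2.le)
    simp only [hχdef]
    rw [Finset.prod_eq_zero ha h2, smul_zero]
  have hfR : ∀ m N : ℕ, ∃ D : ℝ, ∀ z ∈ O ∩ R, ‖iteratedFDeriv ℝ m f z‖ * u z ^ N ≤ D := by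
    intro m N
    obtain ⟨D, hD⟩ := hflat (2 * N) m
    refine ⟨D * (4 / c ^ 2) ^ N, fun z hz => ?_⟩
    have hqz : 0 < q z := hz.1.2
    have hq1 : q z < 1 := (hballq z (hBr₃ hz.1.1)).1
    have hsq : √(q z) ^ 2 = q z := Real.sq_sqrt hqz.le
    have hs0 : 0 ≤ √(q z) := Real.sqrt_nonneg _
    have hs1 : √(q z) ≤ 1 := Real.sqrt_le_one.2 hq1.le
    -- moving by `s v` increases every `τ a` by `2 √q`, while `|τ l|, |τ t| ≤ √q` and `τ a ≥ -2q` else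
    set s := 2 * √(q z) / c with hsdef
    have hs : 0 ≤ s := by positivity
    have hcs : c * s = 2 * √(q z) := by
      rw [hsdef]
      field_simp
    have hzs : z + s • v ∈ C := by
      rw [hCdef, Metric.mem_closedBall]
      have h1 := hBr hz.1.1
      rw [Metric.mem_ball] at h1
      have h2 : dist (z + s • v) z ≤ r / 4 := by
        rw [dist_self_add_left, norm_smul, Real.norm_of_nonneg hs]
        exact (hballq z (hBr₃ hz.1.1)).2.le
      linarith [dist_triangle (z + s • v) z z₀]
    have hmemT : z + s • v ∈ T := by
      refine ⟨hCW hzs, fun a ha => ?_⟩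
      have h1 := hgrow a ha z (hW₁ (hBW hz.1.1)) s hs (hW₁ (hCW hzs))
      rw [hcs] at h1
      refine le_trans ?_ h1
      have habs : ∀ x : ℝ, x ^ 2 ≤ q z → -√(q z) ≤ x := fun x hx => by
        have := Real.abs_le_sqrt hx
        exact neg_le_of_abs_le this
      by_cases hal : a = l
      · have := habs (τ a z) (by rw [hal]; exact le_add_of_nonneg_right (sq_nonneg _))
        linarith
      by_cases hat : a = t
      · have := habs (τ a z) (by rw [hat]; exact le_add_of_nonneg_left (sq_nonneg _))
        linarith
      · have h2 := hz.2 a (Finset.mem_erase.2 ⟨hat, Finset.mem_erase.2 ⟨hal, ha⟩⟩)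
        nlinarith
    have h1 := hD z (hBC hz.1.1) s hs ⟨hmemT, hzs⟩
    have h2 : s ^ (2 * N) = (4 / c ^ 2) ^ N * q z ^ N := by
      rw [pow_mul, ← mul_pow]
      congr 1
      rw [hsdef, div_pow, mul_pow, hsq]
      ring
    calc ‖iteratedFDeriv ℝ m f z‖ * u z ^ N ≤ D * s ^ (2 * N) * u z ^ N := by
          gcongr
      _ = D * (4 / c ^ 2) ^ N * (q z * (q z)⁻¹) ^ N := by
          rw [h2, mul_pow]
          ring
      _ = D * (4 / c ^ 2) ^ N := by rw [mul_inv_cancel₀ hqz.ne', one_pow, mul_one]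
  have hfO : ContDiffOn ℝ ∞ f O := fun z hz =>
    (hball z (hW₂ (hBW hz.1))).2.1.contDiffWithinAt
  have hFlat := FlatOn.of_moderate hO hu hχmod hχR hfO hfR
  set F : E → G := fun z => if z ∈ O then χ z • f z else 0 with hFdef
  have hFO : ∀ z ∈ O, F z = χ z • f z := fun z hz => if_pos hz
  have hFflat : FlatOn u O F := by
    refine ⟨hFlat.1.congr hFO, fun m N => ?_⟩
    obtain ⟨D, hD⟩ := hFlat.2 m N
    refine ⟨D, fun z hz => ?_⟩
    rw [iteratedFDeriv_congr_on hO hFO hz]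
    exact hD z hz
  -- the gauge is Lipschitz, so that it controls the distance to its zero set
  obtain ⟨L, hL⟩ := exists_bound_iteratedFDeriv hCc (fun z hz => hqsm z (hCW hz)) 1
  have hLip : ∀ z ∈ O, ∀ w ∈ B, w ∉ O → 1 ≤ L * ‖z - w‖ * u z := by
    intro z hz w hw hwO
    have hqw : q w = 0 := le_antisymm (not_lt.1 fun h => hwO ⟨hw, h⟩) (hqnn w)
    have h1 := (convex_ball z₀ ρ).norm_image_sub_le_of_norm_fderiv_le (𝕜 := ℝ) (f := q) (C := L)
      (fun x hx => (hqsm x (hBW hx)).differentiableAt (by simp))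
      (fun x hx => by rw [← norm_iteratedFDeriv_one]; exact hL x (hBC hx)) hw hz.1
    rw [hqw, sub_zero, Real.norm_of_nonneg (hqnn z)] at h1
    calc 1 = q z * u z := (mul_inv_cancel₀ hz.2.ne').symm
      _ ≤ L * ‖z - w‖ * u z := mul_le_mul_of_nonneg_right h1 (zero_le_one.trans (hu z hz))
  have hFsm := hFflat.contDiffOn Metric.isOpen_ball hO hLip fun z _ hz => if_neg hz
  have hzero : ∀ z, f z = 0 → F z = 0 := fun z h => by
    simp only [hFdef, h, smul_zero, ite_self]
  refine ⟨F, ?_, hzero, ?_⟩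
  · filter_upwards [Metric.ball_mem_nhds z₀ hρ] with z hz
    exact hFsm.contDiffAt (Metric.isOpen_ball.mem_nhds hz)
  filter_upwards [Metric.ball_mem_nhds z₀ hρ] with z hz hzJ
  have hfz : 0 ≤ τ l z → 0 ≤ τ t z → f z = 0 := by
    intro h1 h2
    refine (hball z (hW₂ (hBW hz))).2.2 fun a ha => ?_
    by_cases hal : a = l
    · rwa [hal]
    by_cases hat : a = t
    · rwa [hat]
    exact hzJ a ha hal hat
  constructor
  · intro hlz
    by_cases htz : 0 ≤ τ t z
    · rw [hfz hlz htz]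
      exact hzero z (hfz hlz htz)
    push Not at htz
    have hqz : 0 < q z := by
      have := sq_pos_of_neg htz
      positivity
    have hzO : z ∈ O := ⟨hz, hqz⟩
    have hq1 : q z < 1 := (hballq z (hBr₃ hz)).1
    have h1 : H ((1 + u z • (τ l z + (-1 : ℝ) • τ t z)) * 2⁻¹) = 1 := by
      refine Real.smoothTransition.one_of_one_le ?_
      have h2 : 1 ≤ u z • (τ l z + (-1 : ℝ) • τ t z) := by
        simp only [hudef, smul_eq_mul]
        rw [← div_eq_inv_mul, one_le_div hqz]
        -- `q ≤ (τ l - τ t)²` as the two terms have opposite signs, and `q ≤ 1`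
        have h3 : q z ≤ (τ l z + -1 * τ t z) ^ 2 := by
          simp only [hqdef]
          nlinarith [mul_nonneg hlz (neg_nonneg.2 htz.le)]
        have h4 : 0 ≤ τ l z + -1 * τ t z := by linarith
        by_contra! h5
        nlinarith
      linarith
    have h2 : ∏ a ∈ J, H (2 + u z • τ a z) = 1 := by
      refine Finset.prod_eq_one fun a ha => Real.smoothTransition.one_of_one_le ?_
      have h3 := hzJ a (hJK a ha) (Finset.ne_of_mem_erase (Finset.mem_of_mem_erase ha))
        (Finset.ne_of_mem_erase ha)
      have h4 : 0 ≤ u z • τ a z := mul_nonneg (zero_le_one.trans (hu z hzO)) h3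
      linarith
    rw [hFO z hzO]
    simp only [hχdef]
    rw [h1, h2, smul_eq_mul, mul_one, one_smul]
  · intro htz
    by_cases hlz : 0 ≤ τ l z
    · exact hzero z (hfz hlz htz)
    push Not at hlz
    have hqz : 0 < q z := by
      have := sq_pos_of_neg hlz
      positivity
    have hzO : z ∈ O := ⟨hz, hqz⟩
    have hq1 : q z < 1 := (hballq z (hBr₃ hz)).1
    have h1 : H ((1 + u z • (τ l z + (-1 : ℝ) • τ t z)) * 2⁻¹) = 0 := by
      refine Real.smoothTransition.zero_of_nonpos ?_
      have h2 : 1 ≤ u z • (τ t z + (-1 : ℝ) • τ l z) := by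
        simp only [hudef, smul_eq_mul]
        rw [← div_eq_inv_mul, one_le_div hqz]
        have h3 : q z ≤ (τ t z + -1 * τ l z) ^ 2 := by
          simp only [hqdef]
          nlinarith [mul_nonneg htz (neg_nonneg.2 hlz.le)]
        have h4 : 0 ≤ τ t z + -1 * τ l z := by linarith
        by_contra! h5
        nlinarith
      have h3 : u z • (τ l z + (-1 : ℝ) • τ t z) = -(u z • (τ t z + (-1 : ℝ) • τ l z)) := by
        simp only [smul_eq_mul]
        ring
      rw [h3]
      linarith
    rw [hFO z hzO]
    simp only [hχdef]
    rw [h1, zero_smul, zero_smul]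

end Cut

/-! ### Conormals of regular domains -/

section Conormal

theorem nonneg_of_frequently_nonneg {φ : ℝ → ℝ} {a : ℝ} (h : HasDerivAt φ a 0) (h0 : φ 0 = 0)
    (hφ : ∃ᶠ s in 𝓝[>] 0, 0 ≤ φ s) : 0 ≤ a := by
  by_contra! ha
  have h1 := (hasDerivAt_iff_tendsto_slope.1 h).mono_left (nhdsGT_le_nhdsNE (0 : ℝ))
  refine hφ ?_
  filter_upwards [h1.eventually (isOpen_Iio.mem_nhds ha), self_mem_nhdsWithin] with s hs hs0
  have hs0' : (0 : ℝ) < s := hs0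
  change slope φ 0 s < 0 at hs
  rw [slope_def_field, h0, sub_zero, sub_zero, div_lt_iff₀ hs0', zero_mul] at hs
  exact not_le.2 hs

/-- A linear functional vanishing on a nonempty open set is zero. -/
theorem eq_zero_of_eventually_eq_zero {E : Type*} [NormedAddCommGroup E] [NormedSpace ℝ E]
    {L : E →L[ℝ] ℝ} {u : E} (h : ∀ᶠ w in 𝓝 u, L w = 0) (w : E) : L w = 0 := by
  have hc : Filter.Tendsto (fun s : ℝ => u + s • w) (𝓝[>] 0) (𝓝 u) := by
    have : Continuous fun s : ℝ => u + s • w := by fun_prop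
    have := this.tendsto 0
    rw [zero_smul, add_zero] at this
    exact this.mono_left nhdsWithin_le_nhds
  obtain ⟨s, hs, hs0⟩ := ((hc.eventually h).and self_mem_nhdsWithin).exists
  rw [map_add, h.self_of_nhds, zero_add, map_smul, smul_eq_mul] at hs
  exact (mul_eq_zero.1 hs).resolve_left (ne_of_gt hs0)

/-- If no vector is mapped to a positive number by `α` and to a negative one by the nonzero functional
`β`, then `β` is positive where `α` is. -/
theorem pos_of_pos {E : Type*} [NormedAddCommGroup E] [NormedSpace ℝ E] {α β : E →L[ℝ] ℝ}
    (hβ : ∃ w, 0 < β w) (h : ∀ v, 0 < α v → ¬ β v < 0) {v : E} (hv : 0 < α v) : 0 < β v := by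
  refine lt_of_le_of_ne (not_lt.1 (h v hv)) fun h0 => ?_
  obtain ⟨w, hw⟩ := hβ
  have hc : Filter.Tendsto (fun s : ℝ => v + (-s) • w) (𝓝[>] 0) (𝓝 v) := by
    have : Continuous fun s : ℝ => v + (-s) • w := by fun_prop
    have := this.tendsto 0
    rw [neg_zero, zero_smul, add_zero] at this
    exact this.mono_left nhdsWithin_le_nhds
  obtain ⟨s, hs, hs0⟩ := ((hc.eventually (α.continuous.continuousAt.eventually
    (isOpen_Ioi.mem_nhds hv))).and self_mem_nhdsWithin).exists
  refine h _ hs ?_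
  rw [map_add, ← h0, zero_add, map_smul, smul_eq_mul]
  exact mul_neg_of_neg_of_pos (neg_neg_of_pos hs0) hw

variable {d : ℕ} {M : Type u} [TopologicalSpace M] [ChartedSpace (EuclideanSpace ℝ (Fin d)) M]
  {N : Type v} [TopologicalSpace N] [ChartedSpace (EuclideanSpace ℝ (Fin d)) N]

/-- The differential at `p`, as a functional on the tangent space, of the function given by `τ` in the
preferred chart at `p`. -/
noncomputable def conormal (d : ℕ) {M : Type u} [TopologicalSpace M]
    [ChartedSpace (EuclideanSpace ℝ (Fin d)) M] (p : M) (τ : Euc d → ℝ) : Euc d →L[ℝ] ℝ :=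
  (fderiv ℝ τ (extChartAt (𝓡 d) p p)).comp (chd d p p)

/-- The curve through `p` with velocity `v` that is straight in the preferred chart at `p`. -/
noncomputable def ray (d : ℕ) {M : Type u} [TopologicalSpace M]
    [ChartedSpace (EuclideanSpace ℝ (Fin d)) M] (p : M) (v : Euc d) (s : ℝ) : M :=
  (extChartAt (𝓡 d) p).symm (extChartAt (𝓡 d) p p + s • chd d p p v)

theorem tendsto_line (d : ℕ) {M : Type u} [TopologicalSpace M]
    [ChartedSpace (EuclideanSpace ℝ (Fin d)) M] (p : M) (v : Euc d) :
    Filter.Tendsto (fun s : ℝ => extChartAt (𝓡 d) p p + s • chd d p p v) (𝓝 0)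
      (𝓝 (extChartAt (𝓡 d) p p)) := by
  have : Continuous fun s : ℝ => extChartAt (𝓡 d) p p + s • chd d p p v := by fun_prop
  have := this.tendsto 0
  rwa [zero_smul, add_zero] at this

theorem tendsto_ray (p : M) (v : Euc d) : Filter.Tendsto (ray d p v) (𝓝 0) (𝓝 p) := by
  have hc := continuousAt_extChartAt_symm (I := 𝓡 d) p
  rw [ContinuousAt, extChartAt_to_inv] at hc
  exact hc.comp (tendsto_line d p v)

variable [IsManifold (𝓡 d) ∞ M] [IsManifold (𝓡 d) ∞ N]

theorem IsDefining.exists_conormal_pos {D : Set M} {p : M} {τ : Euc d → ℝ} (h : IsDefining d D p τ) :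
    ∃ v, 0 < conormal d p τ v := by
  obtain ⟨v, hv⟩ := h.exists_pos
  refine ⟨chs d p (extChartAt (𝓡 d) p p) v, ?_⟩
  have h1 := chd_chs (d := d) (mem_extChartAt_target (I := 𝓡 d) p) v
  rw [extChartAt_to_inv] at h1
  change 0 < fderiv ℝ τ (extChartAt (𝓡 d) p p) (chd d p p (chs d p (extChartAt (𝓡 d) p p) v))
  rwa [h1]

theorem IsDefining.hasDerivAt_comp_ray {g : M → N} {D : Set N} {p : M} {τ : Euc d → ℝ}
    (h : IsDefining d D (g p) τ) (hg : ContMDiffAt (𝓡 d) (𝓡 d) ∞ g p) (v : Euc d) :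
    HasDerivAt (fun s => τ (extChartAt (𝓡 d) (g p) (g (ray d p v s))))
      (conormal d (g p) τ (mfd d g p v)) 0 := by
  have hz := mem_extChartAt_target (I := 𝓡 d) p
  have e0 : (extChartAt (𝓡 d) p).symm (extChartAt (𝓡 d) p p) = p := extChartAt_to_inv p
  have hsrc : g ((extChartAt (𝓡 d) p).symm (extChartAt (𝓡 d) p p)) ∈
      (chartAt (Euc d) (g p)).source := by
    rw [e0]
    exact mem_chart_source _ _
  have h1 : ContDiffAt ℝ ∞ (coordMap d p (g p) g) (extChartAt (𝓡 d) p p) :=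
    contDiffAt_coordMap hz (by rwa [e0]) hsrc
  have h2 := fderiv_coordMap hz (by rw [e0]; exact hg.mdifferentiableAt (by simp)) hsrc (chd d p p v)
  rw [chs_chd (mem_chart_source _ p), e0] at h2
  have h3 : HasDerivAt (fun s : ℝ => extChartAt (𝓡 d) p p + s • chd d p p v) (chd d p p v) 0 := by
    simpa using ((hasDerivAt_id (0 : ℝ)).smul_const (chd d p p v)).const_add (extChartAt (𝓡 d) p p)
  have h4 : HasFDerivAt (coordMap d p (g p) g) (fderiv ℝ (coordMap d p (g p) g)
      (extChartAt (𝓡 d) p p)) (extChartAt (𝓡 d) p p + (0 : ℝ) • chd d p p v) := by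
    rw [zero_smul, add_zero]
    exact (h1.differentiableAt (by simp)).hasFDerivAt
  have h5 := h4.comp_hasDerivAt (0 : ℝ) h3
  have e1 : coordMap d p (g p) g (extChartAt (𝓡 d) p p + (0 : ℝ) • chd d p p v) =
      extChartAt (𝓡 d) (g p) (g p) := by
    rw [zero_smul, add_zero]
    change extChartAt (𝓡 d) (g p) (g ((extChartAt (𝓡 d) p).symm (extChartAt (𝓡 d) p p))) = _
    rw [e0]
  have h6 : HasFDerivAt τ (fderiv ℝ τ (extChartAt (𝓡 d) (g p) (g p)))
      (coordMap d p (g p) g (extChartAt (𝓡 d) p p + (0 : ℝ) • chd d p p v)) := by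
    rw [e1]
    exact (h.contDiffAt.self_of_nhds.differentiableAt (by simp)).hasFDerivAt
  have h7 := h6.comp_hasDerivAt (0 : ℝ) h5
  rw [h2] at h7
  exact h7

theorem IsDefining.eventually_mem_iff_ray {g : M → N} {D : Set N} {p : M} {τ : Euc d → ℝ}
    (h : IsDefining d D (g p) τ) (hg : ContMDiffAt (𝓡 d) (𝓡 d) ∞ g p) (v : Euc d) :
    ∀ᶠ s in 𝓝 0, g (ray d p v s) ∈ D ↔ 0 ≤ τ (extChartAt (𝓡 d) (g p) (g (ray d p v s))) := by
  have h1 : Filter.Tendsto (fun s => g (ray d p v s)) (𝓝 0) (𝓝 (g p)) :=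
    hg.continuousAt.tendsto.comp (tendsto_ray p v)
  have h2 := ((continuousAt_extChartAt (I := 𝓡 d) (g p)).tendsto.comp h1).eventually h.mem_iff
  filter_upwards [h2, h1.eventually (extChartAt_source_mem_nhds (I := 𝓡 d) (g p))] with s h3 h4
  rwa [Function.comp_apply, (extChartAt (𝓡 d) (g p)).left_inv h4] at h3

theorem IsDefining.comp_ray_zero {g : M → N} {D : Set N} {p : M} {τ : Euc d → ℝ}
    (h : IsDefining d D (g p) τ) (v : Euc d) :
    τ (extChartAt (𝓡 d) (g p) (g (ray d p v 0))) = 0 := by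
  unfold ray
  rw [zero_smul, add_zero, extChartAt_to_inv, h.eq_zero]

theorem IsDefining.conormal_nonneg {g : M → N} {D : Set N} {p : M} {τ : Euc d → ℝ}
    (h : IsDefining d D (g p) τ) (hg : ContMDiffAt (𝓡 d) (𝓡 d) ∞ g p) {v : Euc d}
    (hv : ∃ᶠ s in 𝓝[>] 0, g (ray d p v s) ∈ D) : 0 ≤ conormal d (g p) τ (mfd d g p v) :=
  nonneg_of_frequently_nonneg (h.hasDerivAt_comp_ray hg v) (h.comp_ray_zero v)
    ((hv.and_eventually ((h.eventually_mem_iff_ray hg v).filter_mono nhdsWithin_le_nhds)).mono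
      fun _ hs => hs.2.1 hs.1)

theorem IsDefining.conormal_nonpos {g : M → N} {D : Set N} {p : M} {τ : Euc d → ℝ}
    (h : IsDefining d D (g p) τ) (hg : ContMDiffAt (𝓡 d) (𝓡 d) ∞ g p) {v : Euc d}
    (hv : ∃ᶠ s in 𝓝[>] 0, g (ray d p v s) ∉ D) : conormal d (g p) τ (mfd d g p v) ≤ 0 := by
  have h1 := (h.hasDerivAt_comp_ray hg v).neg
  refine neg_nonneg.1 (nonneg_of_frequently_nonneg h1 ?_ ?_)
  · simpa using h.comp_ray_zero v
  · refine (hv.and_eventually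
      ((h.eventually_mem_iff_ray hg v).filter_mono nhdsWithin_le_nhds)).mono fun s hs => ?_
    exact neg_nonneg.2 (not_le.1 fun h' => hs.1 (hs.2.2 h')).le

theorem IsDefining.eventually_ray_mem {D : Set M} {p : M} {τ : Euc d → ℝ} (h : IsDefining d D p τ)
    {v : Euc d} (hv : 0 < conormal d p τ v) : ∀ᶠ s in 𝓝[>] 0, ray d p v s ∈ D := by
  by_contra h'
  have h1 := IsDefining.conormal_nonpos (g := id) (p := p) h contMDiffAt_id (v := v)
    (Filter.not_eventually.1 h')
  rw [mfd_id] at h1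
  exact absurd hv (not_lt.2 h1)

theorem IsDefining.eventually_ray_notMem {D : Set M} {p : M} {τ : Euc d → ℝ} (h : IsDefining d D p τ)
    {v : Euc d} (hv : conormal d p τ v < 0) : ∀ᶠ s in 𝓝[>] 0, ray d p v s ∉ D := by
  by_contra h'
  have h1 := IsDefining.conormal_nonneg (g := id) (p := p) h contMDiffAt_id (v := v)
    h'
  rw [mfd_id] at h1
  exact absurd hv (not_lt.2 h1)

end Conormal

namespace SmoothSystem

variable {d n q : ℕ} {M : Fin n → Type u} [∀ i, TopologicalSpace (M i)]
  [∀ i, ChartedSpace (EuclideanSpace ℝ (Fin d)) (M i)] [∀ i, IsManifold (𝓡 d) ∞ (M i)]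
  (F : SmoothSystem d M)

theorem mem_closure_inter_of_mem (hF : F.ClosureIntersection) {i j k : Fin n} {x : M i}
    (hj : x ∈ closure (F.A i j)) (hk : x ∈ closure (F.A i k)) :
    x ∈ closure (F.A i j ∩ F.A i k) := by
  have h := hF i {j, k}
  simp only [Finset.mem_insert, Finset.mem_singleton, iInter_iInter_eq_or_left,
    iInter_iInter_eq_left] at h
  rw [h]
  exact ⟨hj, hk⟩

theorem Dbar_injective (i j : Fin n) (x : closure (F.A i j)) : Function.Injective (F.Dbar i j x) :=
  fun v w h => by rw [← F.Dbar_inv i j x v, h, F.Dbar_inv]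

theorem Dbar_surjective (i j : Fin n) (x : closure (F.A i j)) : Function.Surjective (F.Dbar i j x) :=
  (LinearMap.injective_iff_surjective (f := (F.Dbar i j x).toLinearMap)).1 (F.Dbar_injective i j x)

/-- The conormal of a domain, transported by a gluing map, is not zero. -/
theorem not_eventually_conormal_Dbar_eq_zero {i j : Fin n} (x : closure (F.A i j)) {D : Set (M j)} {y : M j}
    {τ : Euc d → ℝ} (h : IsDefining d D y τ) {u : Euc d} :
    ¬ ∀ᶠ w in 𝓝 u, conormal d y τ (F.Dbar i j x w) = 0 := by
  intro h0
  obtain ⟨v, hv⟩ := h.exists_conormal_pos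
  obtain ⟨w, rfl⟩ := F.Dbar_surjective i j x v
  have := eq_zero_of_eventually_eq_zero (L := (conormal d y τ).comp (F.Dbar i j x)) h0 w
  exact hv.ne' this

section Tangent

variable {F} {i j k : Fin n} {p : M i} {τj τk : Euc d → ℝ}

/-- In a direction that points into `cl M_{ij}` and out of `cl M_{ik}`, the image under the gluing map
points out of `cl M_{jk}`. -/
theorem eventually_notMem_of_conormal
    (hj : IsDefining d (closure (F.A i j)) p τj) (hk : IsDefining d (closure (F.A i k)) p τk)
    {g : M i → M j} {U : Set (M i)} (hU : U ∈ 𝓝 p)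
    (hg : ∀ y : closure (F.A i j), (y : M i) ∈ U → g y = F.fbar i j y) {u : Euc d}
    (hju : 0 < conormal d p τj u) (hku : conormal d p τk u < 0) :
    ∀ᶠ s in 𝓝[>] 0, g (ray d p u s) ∉ closure (F.A j k) := by
  filter_upwards [hj.eventually_ray_mem hju, hk.eventually_ray_notMem hku,
    ((tendsto_ray p u).mono_left nhdsWithin_le_nhds).eventually hU] with s h1 h2 h3 h4
  rw [hg ⟨_, h1⟩ h3] at h4
  have h5 := F.fbar_mem_of_mem (F.fbar_mem i j ⟨_, h1⟩) h4
  rw [F.fbar_inv i j ⟨_, h1⟩] at h5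
  exact h2 h5

/-- If some direction at `p` points into `cl M_{ij}` and out of `cl M_{ik}`, then the image of `p` is a
boundary point of `cl M_{jk}`. -/
theorem fbar_mem_frontier (hpj : p ∈ closure (F.A i j)) (hpk : p ∈ closure (F.A i k))
    (hj : IsDefining d (closure (F.A i j)) p τj) (hk : IsDefining d (closure (F.A i k)) p τk)
    {u : Euc d} (hju : 0 < conormal d p τj u) (hku : conormal d p τk u < 0) :
    F.fbar i j ⟨p, hpj⟩ ∈ frontier (closure (F.A j k)) := by
  obtain ⟨U, hU, hpU, g, hg, he⟩ := F.fbar_local i j ⟨p, hpj⟩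
  have h1 := eventually_notMem_of_conormal hj hk (hU.mem_nhds hpU) (fun y hy => (he y hy).1)
    hju hku
  refine ⟨subset_closure (F.fbar_mem_of_mem hpj hpk), fun hint => ?_⟩
  have h2 : Filter.Tendsto (fun s => g (ray d p u s)) (𝓝[>] 0) (𝓝 (g p)) :=
    (hg p hpU).continuousAt.tendsto.comp ((tendsto_ray p u).mono_left nhdsWithin_le_nhds)
  rw [(he ⟨p, hpj⟩ hpU).1] at h2
  obtain ⟨s, hs1, hs2⟩ := ((h2.eventually (mem_interior_iff_mem_nhds.1 hint)).and h1).exists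
  exact hs2 hs1

theorem conormal_Dbar_nonpos (hpj : p ∈ closure (F.A i j))
    (hj : IsDefining d (closure (F.A i j)) p τj) (hk : IsDefining d (closure (F.A i k)) p τk)
    {τ : Euc d → ℝ} (hτ : IsDefining d (closure (F.A j k)) (F.fbar i j ⟨p, hpj⟩) τ)
    {u : Euc d} (hju : 0 < conormal d p τj u) (hku : conormal d p τk u < 0) :
    conormal d (F.fbar i j ⟨p, hpj⟩) τ (F.Dbar i j ⟨p, hpj⟩ u) ≤ 0 := by
  obtain ⟨U, hU, hpU, g, hg, he⟩ := F.fbar_local i j ⟨p, hpj⟩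
  have h1 := eventually_notMem_of_conormal hj hk (hU.mem_nhds hpU) (fun y hy => (he y hy).1)
    hju hku
  have e := he ⟨p, hpj⟩ hpU
  rw [e.2]
  rw [← e.1] at hτ ⊢
  exact hτ.conormal_nonpos (hg p hpU) h1.frequently

/-- The gluing map `cl M_{ij} → cl M_{ji}` does not map inward directions to outward ones. -/
theorem conormal_Dbar_nonneg (hpj : p ∈ closure (F.A i j))
    (hj : IsDefining d (closure (F.A i j)) p τj) {y : M j} (hy : F.fbar i j ⟨p, hpj⟩ = y)
    {τ : Euc d → ℝ} (hτ : IsDefining d (closure (F.A j i)) y τ) {u : Euc d}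
    (hu : 0 < conormal d p τj u) : 0 ≤ conormal d y τ (F.Dbar i j ⟨p, hpj⟩ u) := by
  obtain ⟨U, hU, hpU, g, hg, he⟩ := F.fbar_local i j ⟨p, hpj⟩
  have e := he ⟨p, hpj⟩ hpU
  subst hy
  rw [e.2]
  rw [← e.1] at hτ ⊢
  refine hτ.conormal_nonneg (hg p hpU) (Filter.Eventually.frequently ?_)
  filter_upwards [hj.eventually_ray_mem hu,
    ((tendsto_ray p u).mono_left nhdsWithin_le_nhds).eventually (hU.mem_nhds hpU)] with s h1 h2
  rw [(he ⟨_, h1⟩ h2).1]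
  exact F.fbar_mem i j _

/-- At a common boundary point, the domains `cl M_{ij}` and `cl M_{ik}` have the same inward
directions: otherwise the conormal `λ` of `cl M_{jk}`, seen in `M_i`, would be nonpositive on the two
opposite open cones of directions pointing into one of the domains and out of the other. -/
theorem not_conormal_neg (hF : F.ClosureIntersection) (hpj : p ∈ frontier (closure (F.A i j)))
    (hpk : p ∈ frontier (closure (F.A i k))) (hj : IsDefining d (closure (F.A i j)) p τj)
    (hk : IsDefining d (closure (F.A i k)) p τk) {u : Euc d} (hju : 0 < conormal d p τj u) :
    ¬ conormal d p τk u < 0 := by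
  intro hku
  have hpj' : p ∈ closure (F.A i j) := isClosed_closure.frontier_subset hpj
  have hpk' : p ∈ closure (F.A i k) := isClosed_closure.frontier_subset hpk
  have hneg : ∀ {τ : Euc d → ℝ} {v : Euc d}, conormal d p τ (-v) = -conormal d p τ v :=
    fun {τ v} => map_neg _ _
  obtain ⟨τ', hτ'⟩ := (F.isRegularDomain_closure j k).exists_isDefining
    (fbar_mem_frontier hpj' hpk' hj hk hju hku)
  obtain ⟨τ'', hτ''⟩ := (F.isRegularDomain_closure k j).exists_isDefining
    (fbar_mem_frontier (u := -u) hpk' hpj' hk hj (by rw [hneg]; exact neg_pos.2 hku)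
      (by rw [hneg]; exact neg_neg_of_pos hju))
  have h1 : ∀ v, 0 < conormal d p τj v → conormal d p τk v < 0 →
      conormal d (F.fbar i j ⟨p, hpj'⟩) τ' (F.Dbar i j ⟨p, hpj'⟩ v) ≤ 0 := fun v h h' =>
    conormal_Dbar_nonpos hpj' hj hk hτ' h h'
  have hopen : ∀ v, 0 < conormal d p τj v → conormal d p τk v < 0 →
      ∀ᶠ w in 𝓝 v, 0 < conormal d p τj w ∧ conormal d p τk w < 0 := fun v h h' =>
    ((conormal d p τj).continuous.continuousAt.eventually (isOpen_Ioi.mem_nhds h)).and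
      ((conormal d p τk).continuous.continuousAt.eventually (isOpen_Iio.mem_nhds h'))
  have hcoc : F.Dbar i k ⟨p, hpk'⟩ = (F.Dbar j k ⟨F.fbar i j ⟨p, hpj'⟩,
      F.fbar_mem_of_mem hpj' hpk'⟩).comp (F.Dbar i j ⟨p, hpj'⟩) := by
    exact F.Dbar_cocycle (F.mem_closure_inter_of_mem hF hpj' hpk') hpj' hpk'
  -- on the opposite cone, where `j` and `k` are exchanged: if `λ` were positive somewhere on it, the
  -- conormal of `cl M_{kj}` would vanish on an open set
  have h2 : ∀ v, 0 < conormal d p τj v → conormal d p τk v < 0 →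
      conormal d (F.fbar i j ⟨p, hpj'⟩) τ' (F.Dbar i j ⟨p, hpj'⟩ (-v)) ≤ 0 := by
    intro v h h'
    by_contra! hpos
    refine F.not_eventually_conormal_Dbar_eq_zero (u := -v) ⟨p, hpk'⟩ hτ'' ?_
    have hc : ContinuousAt (fun w => -w) (-v) := continuous_neg.continuousAt
    rw [ContinuousAt, neg_neg] at hc
    have hc2 : ∀ᶠ w in 𝓝 (-v), 0 < conormal d (F.fbar i j ⟨p, hpj'⟩) τ' (F.Dbar i j ⟨p, hpj'⟩ w) :=
      ((conormal d (F.fbar i j ⟨p, hpj'⟩) τ').comp (F.Dbar i j ⟨p, hpj'⟩)).continuous.continuousAt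
        |>.eventually (isOpen_Ioi.mem_nhds hpos)
    filter_upwards [hc.eventually (hopen v h h'), hc2] with w hw hw2
    rw [hneg, hneg] at hw
    refine le_antisymm ?_ ?_
    · exact conormal_Dbar_nonpos hpk' hk hj hτ'' (neg_neg_iff_pos.1 hw.2) (neg_pos.1 hw.1)
    · rw [hcoc]
      exact conormal_Dbar_nonneg (F.fbar_mem_of_mem hpj' hpk') hτ' (F.fbar_cocycle hpj' hpk') hτ'' hw2
  refine F.not_eventually_conormal_Dbar_eq_zero (u := u) ⟨p, hpj'⟩ hτ' ?_
  filter_upwards [hopen u hju hku] with w hw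
  have h3 := h2 w hw.1 hw.2
  rw [map_neg, map_neg] at h3
  exact le_antisymm (h1 w hw.1 hw.2) (neg_nonpos.1 h3)

end Tangent

end SmoothSystem

namespace SmoothSystem

variable {d n q : ℕ} {M : Fin n → Type u} [∀ i, TopologicalSpace (M i)]
  [∀ i, ChartedSpace (EuclideanSpace ℝ (Fin d)) (M i)] [∀ i, IsManifold (𝓡 d) ∞ (M i)]
  (F : SmoothSystem d M)

/-! ### Extension of forms from unions of intersections of closures -/

/-- The local form of `exists_form_extension`, at a common boundary point of `cl M_{il}` and `cl M_{it}`.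
By `not_conormal_neg` all the domains having the point on their boundary share an inward direction. -/
theorem exists_local_extension (hF : F.ClosureIntersection) {i : Fin n} (s : Finset (Fin n))
    {l t : Fin n} {V : GForm d (M i) q} (hV : ∀ x, FormSmoothAt d V x)
    (h0 : ∀ x, (∀ j ∈ s, x ∈ closure (F.A i j)) → x ∈ closure (F.A i l) → x ∈ closure (F.A i t) →
      V x = 0) {p : M i} (hps : ∀ j ∈ s, p ∈ closure (F.A i j))
    (hl : p ∈ frontier (closure (F.A i l))) (ht : p ∈ frontier (closure (F.A i t))) :
    ∃ η : GForm d (M i) q, (∀ᶠ y in 𝓝 p, FormSmoothAt d η y) ∧ (∀ᶠ y in 𝓝 p, V y = 0 → η y = 0) ∧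
      ∀ᶠ y in 𝓝 p, (∀ j ∈ s, y ∈ closure (F.A i j)) →
        (y ∈ closure (F.A i l) → η y = V y) ∧ (y ∈ closure (F.A i t) → η y = 0) := by
  classical
  -- only the domains with `p` on their boundary matter
  set S := insert l (insert t s) with hSdef
  set K := S.filter fun a => p ∈ frontier (closure (F.A i a)) with hKdef
  have hKf : ∀ a ∈ K, p ∈ frontier (closure (F.A i a)) := fun a ha => (Finset.mem_filter.1 ha).2
  choose! τ hτ using fun a (ha : a ∈ K) =>
    (F.isRegularDomain_closure i a).exists_isDefining (hKf a ha)
  have hlS : l ∈ S := Finset.mem_insert_self _ _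
  have htS : t ∈ S := Finset.mem_insert_of_mem (Finset.mem_insert_self _ _)
  have hsS : ∀ j ∈ s, j ∈ S := fun j hj => Finset.mem_insert_of_mem (Finset.mem_insert_of_mem hj)
  have hlK : l ∈ K := Finset.mem_filter.2 ⟨hlS, hl⟩
  have htK : t ∈ K := Finset.mem_filter.2 ⟨htS, ht⟩
  have hint : ∀ a ∈ S, a ∉ K → ∀ᶠ y in 𝓝 p, y ∈ closure (F.A i a) := by
    intro a ha haK
    have hpa : p ∈ closure (F.A i a) := by
      rcases Finset.mem_insert.1 ha with rfl | ha
      · exact isClosed_closure.frontier_subset hl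
      rcases Finset.mem_insert.1 ha with rfl | ha
      · exact isClosed_closure.frontier_subset ht
      · exact hps a ha
    have h1 : p ∈ interior (closure (F.A i a)) := by
      by_contra h
      exact haK (Finset.mem_filter.2 ⟨ha, subset_closure hpa, h⟩)
    exact mem_interior_iff_mem_nhds.1 h1
  obtain ⟨v, hv⟩ := (hτ l hlK).exists_conormal_pos
  set z₀ := extChartAt (𝓡 d) p p with hz₀
  have hsymm : Filter.Tendsto (extChartAt (𝓡 d) p).symm (𝓝 z₀) (𝓝 p) := by
    have hc := continuousAt_extChartAt_symm (I := 𝓡 d) p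
    rwa [ContinuousAt, extChartAt_to_inv] at hc
  have htgt : ∀ᶠ z in 𝓝 z₀, z ∈ (extChartAt (𝓡 d) p).target :=
    (isOpen_extChartAt_target p).mem_nhds (mem_extChartAt_target p)
  obtain ⟨f, hf, hf0, hfe⟩ := exists_extension_of_cutoff K hlK htK (τ := τ) (z₀ := z₀) (v := chd d p p v)
    (fun a ha => (hτ a ha).contDiffAt) (fun a ha => (hτ a ha).eq_zero)
    (fun a ha => pos_of_pos (hτ a ha).exists_conormal_pos
      (fun w hw => not_conormal_neg hF hl (hKf a ha) (hτ l hlK) (hτ a ha) hw) hv)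
    (f := coordRep d p V) (by
      filter_upwards [htgt] with z hz
      have h1 := (extChartAt (𝓡 d) p).map_target hz
      rw [extChartAt_source] at h1
      have h2 := (formSmoothAt_iff h1).1 (hV _)
      rwa [(extChartAt (𝓡 d) p).right_inv hz] at h2) (by
      filter_upwards [(Filter.eventually_all_finset K).2 fun a ha => (hτ a ha).mem_iff,
        (Filter.eventually_all_finset S).2 fun a ha =>
          (Filter.eventually_imp_distrib_left (p := a ∉ K)).2 fun h => hsymm.eventually (hint a ha h)]
        with z h1 h2 h3
      have h4 : ∀ a ∈ S, (extChartAt (𝓡 d) p).symm z ∈ closure (F.A i a) := fun a ha => by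
        by_cases haK : a ∈ K
        · exact (h1 a haK).2 (h3 a haK)
        · exact h2 a ha haK
      have h5 := h0 _ (fun j hj => h4 j (hsS j hj)) (h4 l hlS) (h4 t htS)
      simp only [coordRep, h5]
      rfl)
  have hc : Filter.Tendsto (extChartAt (𝓡 d) p) (𝓝 p) (𝓝 z₀) := continuousAt_extChartAt p
  have hsrc : ∀ᶠ y in 𝓝 p, y ∈ (chartAt (Euc d) p).source :=
    (chartAt (Euc d) p).open_source.mem_nhds (mem_chart_source _ p)
  refine ⟨gpull (extChartAt (𝓡 d) p) f, ?_, ?_, ?_⟩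
  · filter_upwards [hc.eventually hf, hsrc] with y h1 h2
    exact FormSmoothAt.gpull (N := Euc d) (contMDiffAt_extChartAt_of_mem h2) (formSmoothAt_euc h1)
  · filter_upwards [hsrc] with y h1 h2
    have hinv : (extChartAt (𝓡 d) p).symm (extChartAt (𝓡 d) p y) = y :=
      (extChartAt (𝓡 d) p).left_inv (by rwa [extChartAt_source])
    have h3 : coordRep d p V (extChartAt (𝓡 d) p y) = 0 := by
      have h4 : V ((extChartAt (𝓡 d) p).symm (extChartAt (𝓡 d) p y)) = 0 := by
        rw [hinv]
        exact h2
      simp only [coordRep, h4]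
      rfl
    refine GForm.ext_ev (η := (0 : GForm d (M i) q)) y fun u => ?_
    change f (extChartAt (𝓡 d) p y) (fun i => chd d p y (u i)) = 0
    rw [hf0 _ h3]
    rfl
  · filter_upwards [hsrc, hc.eventually hfe, hc.eventually ((Filter.eventually_all_finset K).2
      fun a ha => (hτ a ha).mem_iff)] with y h1 h2 h3 hys
    have hinv : (extChartAt (𝓡 d) p).symm (extChartAt (𝓡 d) p y) = y :=
      (extChartAt (𝓡 d) p).left_inv (by rwa [extChartAt_source])
    rw [hinv] at h3
    have h4 := h2 fun a ha hal hat => (h3 a ha).1 (hys a (by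
      rcases Finset.mem_insert.1 (Finset.mem_filter.1 ha).1 with h | h
      · exact (hal h).elim
      rcases Finset.mem_insert.1 h with h | h
      · exact (hat h).elim
      · exact h))
    constructor
    · intro hyl
      refine GForm.ext_ev y fun u => ?_
      rw [ev_eq_coordRep V h1, ← h4.1 ((h3 l hlK).1 hyl)]
      rfl
    · intro hyt
      refine GForm.ext_ev (η := (0 : GForm d (M i) q)) y fun u => ?_
      change f (extChartAt (𝓡 d) p y) (fun i => chd d p y (u i)) = 0
      rw [h4.2 ((h3 t htK).1 hyt)]
      rfl

variable [∀ i, T2Space (M i)] [∀ i, SecondCountableTopology (M i)]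

/-- A form vanishing on `C ∩ cl M_{il} ∩ cl M_{it}`, where `C` is an intersection of closures, can be
changed outside `C ∩ cl M_{il}` so as to vanish on `C ∩ cl M_{it}`.  It can be kept zero on any closed
set `Z`. -/
theorem exists_form_extension (hF : F.ClosureIntersection) {i : Fin n} (s : Finset (Fin n))
    {l t : Fin n} {V : GForm d (M i) q} (hV : ∀ x, FormSmoothAt d V x)
    (h0 : ∀ x, (∀ j ∈ s, x ∈ closure (F.A i j)) → x ∈ closure (F.A i l) → x ∈ closure (F.A i t) →
      V x = 0) {Z : Set (M i)} (hZ : IsClosed Z) (hVZ : ∀ x ∈ Z, V x = 0) :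
    ∃ V' : GForm d (M i) q, (∀ x, FormSmoothAt d V' x) ∧ (∀ x ∈ Z, V' x = 0) ∧
      ∀ x, (∀ j ∈ s, x ∈ closure (F.A i j)) →
        (x ∈ closure (F.A i l) → V' x = V x) ∧ (x ∈ closure (F.A i t) → V' x = 0) := by
  classical
  set C : Set (M i) := ⋂ j ∈ s, closure (F.A i j) with hCdef
  have hC : IsClosed C := isClosed_biInter fun _ _ => isClosed_closure
  have hCs : ∀ x ∈ C, ∀ j ∈ s, x ∈ closure (F.A i j) := fun x hx => mem_iInter₂.1 hx
  set D : Set (M i) := C ∩ (closure (F.A i l) ∪ closure (F.A i t)) ∪ Z with hDdef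
  have hD : IsClosed D := (hC.inter (isClosed_closure.union isClosed_closure)).union hZ
  let w : RawForm d D q := fun x =>
    if (x : M i) ∈ C ∧ (x : M i) ∉ closure (F.A i t) then V x else 0
  have hwZ : ∀ x : D, (x : M i) ∈ Z → w x = 0 := fun x hx => by
    by_cases h : (x : M i) ∈ C ∧ (x : M i) ∉ closure (F.A i t)
    · exact (if_pos h).trans (hVZ x hx)
    · exact if_neg h
  have hw2 : ∀ x : D, (x : M i) ∈ closure (F.A i t) → w x = 0 := fun x hx => if_neg fun h => h.2 hx
  have hw1 : ∀ x : D, (x : M i) ∈ closure (F.A i l) → w x = V x := by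
    intro x hx
    rcases x.2 with h | h
    · by_cases ht : (x : M i) ∈ closure (F.A i t)
      · exact (hw2 x ht).trans (h0 x (hCs x h.1) hx ht).symm
      · exact if_pos ⟨h.1, ht⟩
    · exact (hwZ x h).trans (hVZ x h).symm
  have hw3 : ∀ x : D, (x : M i) ∉ closure (F.A i l) → w x = 0 := fun x hx => by
    rcases x.2 with h | h
    · exact hw2 x (h.2.resolve_left hx)
    · exact hwZ x h
  have hw4 : ∀ x : D, (x : M i) ∉ closure (F.A i t) → w x = V x := fun x hx => by
    rcases x.2 with h | h
    · exact hw1 x (h.2.resolve_right hx)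
    · exact (hwZ x h).trans (hVZ x h).symm
  have hw5 : ∀ x : D, (x : M i) ∉ C → w x = 0 := fun x hx => if_neg fun h => hx h.1
  have hw : w ∈ Omega d D q := by
    intro x
    by_cases hxC : (x : M i) ∈ C
    swap
    · exact ⟨Cᶜ, hC.isOpen_compl, hxC, 0, fun y _ => FormSmoothAt.zero y,
        fun y hy => (hw5 y hy).symm⟩
    by_cases hxt : (x : M i) ∈ closure (F.A i t)
    swap
    · exact ⟨(closure (F.A i t))ᶜ, isClosed_closure.isOpen_compl, hxt, V, fun y _ => hV y,
        fun y hy => (hw4 y hy).symm⟩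
    by_cases hxl : (x : M i) ∈ closure (F.A i l)
    swap
    · exact ⟨(closure (F.A i l))ᶜ, isClosed_closure.isOpen_compl, hxl, 0,
        fun y _ => FormSmoothAt.zero y, fun y hy => (hw3 y hy).symm⟩
    by_cases hxt' : (x : M i) ∈ interior (closure (F.A i t))
    · exact ⟨_, isOpen_interior, hxt', 0, fun y _ => FormSmoothAt.zero y,
        fun y hy => (hw2 y (interior_subset hy)).symm⟩
    by_cases hxl' : (x : M i) ∈ interior (closure (F.A i l))
    · exact ⟨_, isOpen_interior, hxl', V, fun y _ => hV y,
        fun y hy => (hw1 y (interior_subset hy)).symm⟩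
    obtain ⟨η, hη, hη0, he⟩ := F.exists_local_extension hF s hV h0 (hCs x hxC)
      ⟨subset_closure hxl, hxl'⟩ ⟨subset_closure hxt, hxt'⟩
    obtain ⟨U, hU, hUo, hxU⟩ := mem_nhds_iff.1 (hη.and (hη0.and he))
    refine ⟨U, hUo, hxU, η, fun y hy => (hU hy).1, fun y hy => ?_⟩
    rcases y.2 with h | h
    · have h1 := (hU hy).2.2 (hCs y h.1)
      rcases h.2 with h2 | h2
      · rw [hw1 y h2, h1.1 h2]
      · rw [hw2 y h2, h1.2 h2]
    · rw [hwZ y h, (hU hy).2.1 (hVZ y h)]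
  obtain ⟨V', hV', he⟩ := exists_extension hD hw
  refine ⟨V', hV', fun x hx => (he ⟨x, Or.inr hx⟩).trans (hwZ _ hx), fun x hx => ⟨fun h => ?_,
    fun h => ?_⟩⟩
  · exact (he ⟨x, Or.inl ⟨mem_iInter₂.2 hx, Or.inl h⟩⟩).trans (hw1 _ h)
  · exact (he ⟨x, Or.inl ⟨mem_iInter₂.2 hx, Or.inr h⟩⟩).trans (hw2 _ h)

/-- The version of `exists_form_extension` for several closures `cl M_{it}`, which are treated one after
the other. -/
theorem exists_form_extension_finset (hF : F.ClosureIntersection) {i : Fin n} (s : Finset (Fin n))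
    {l : Fin n} (T : Finset (Fin n)) {V : GForm d (M i) q} (hV : ∀ x, FormSmoothAt d V x)
    (h0 : ∀ t ∈ T, ∀ x, (∀ j ∈ s, x ∈ closure (F.A i j)) → x ∈ closure (F.A i l) →
      x ∈ closure (F.A i t) → V x = 0) :
    ∃ V' : GForm d (M i) q, (∀ x, FormSmoothAt d V' x) ∧ ∀ x, (∀ j ∈ s, x ∈ closure (F.A i j)) →
      (x ∈ closure (F.A i l) → V' x = V x) ∧ ∀ t ∈ T, x ∈ closure (F.A i t) → V' x = 0 := by
  classical
  induction T using Finset.induction_on with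
  | empty => exact ⟨V, hV, fun x _ => ⟨fun _ => rfl, fun t ht => by simp at ht⟩⟩
  | insert t T _ ih =>
    obtain ⟨V₁, hV₁, h₁⟩ := ih fun t' ht' => h0 t' (Finset.mem_insert_of_mem ht')
    obtain ⟨V₂, hV₂, hZ, h₂⟩ := F.exists_form_extension hF s (l := l) (t := t) hV₁
      (fun x hx hl ht => ((h₁ x hx).1 hl).trans (h0 t (Finset.mem_insert_self _ _) x hx hl ht))
      (Z := ⋃ t' ∈ T, ((⋂ j ∈ s, closure (F.A i j)) ∩ closure (F.A i t')))
      (T.finite_toSet.isClosed_biUnion fun t' _ =>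
        (isClosed_biInter fun _ _ => isClosed_closure).inter isClosed_closure) (by
      intro x hx
      obtain ⟨t', ht', hx, hxt⟩ := mem_iUnion₂.1 hx
      exact (h₁ x (mem_iInter₂.1 hx)).2 t' ht' hxt)
    refine ⟨V₂, hV₂, fun x hx => ⟨fun hl => ((h₂ x hx).1 hl).trans ((h₁ x hx).1 hl),
      fun t' ht' hxt => ?_⟩⟩
    rcases Finset.mem_insert.1 ht' with rfl | ht'
    · exact (h₂ x hx).2 hxt
    · exact hZ x (mem_iUnion₂.2 ⟨t', ht', mem_iInter₂.2 hx, hxt⟩)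

end SmoothSystem

/-! ### Alternating sums over finite sets -/

section Combinatorics

variable {ι Γ : Type*} [LinearOrder ι] [AddCommGroup Γ] [Module ℝ Γ]

/-- The simplicial coboundary of a function on finite sets: the alternating sum of the values at the
sets obtained by removing one element. -/
noncomputable def coboundary (c : Finset ι → Γ) (s : Finset ι) : Γ :=
  ∑ a ∈ s, (-1 : ℝ) ^ (s.filter (· < a)).card • c (s.erase a)

theorem coboundary_congr {c c' : Finset ι → Γ} {s : Finset ι}
    (h : ∀ a ∈ s, c (s.erase a) = c' (s.erase a)) : coboundary c s = coboundary c' s :=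
  Finset.sum_congr rfl fun a ha => by rw [h a ha]

theorem coboundary_add (c c' : Finset ι → Γ) (s : Finset ι) :
    coboundary (fun s => c s + c' s) s = coboundary c s + coboundary c' s := by
  simp only [coboundary, smul_add, Finset.sum_add_distrib]

theorem coboundary_sub_smul (c c' : Finset ι → Γ) (r : ℝ) (s : Finset ι) :
    coboundary (fun s => c s - r • c' s) s = coboundary c s - r • coboundary c' s := by
  simp only [coboundary, smul_sub, Finset.sum_sub_distrib, Finset.smul_sum, smul_comm r]

theorem coboundary_mem {Z : Finset ι → Submodule ℝ Γ} (hZ : Monotone Z) {c : Finset ι → Γ}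
    {s : Finset ι} (h : ∀ a ∈ s, c (s.erase a) ∈ Z (s.erase a)) : coboundary c s ∈ Z s :=
  Submodule.sum_mem _ fun a ha => Submodule.smul_mem _ _ (hZ (Finset.erase_subset a s) (h a ha))

theorem coboundary_singleton (c : Finset ι → Γ) (a : ι) : coboundary c {a} = c ∅ := by
  simp [coboundary, Finset.filter_singleton]

theorem coboundary_insert_max (c : Finset ι → Γ) {l : ι} {s : Finset ι} (hl : ∀ x ∈ s, x < l) :
    coboundary c (insert l s) =
      coboundary (fun s => c (insert l s)) s + (-1 : ℝ) ^ s.card • c s := by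
  have hls : l ∉ s := fun h => lt_irrefl l (hl l h)
  unfold coboundary
  rw [Finset.sum_insert hls, add_comm, Finset.erase_insert hls]
  congr 1
  · refine Finset.sum_congr rfl fun a ha => ?_
    rw [Finset.filter_insert, if_neg (not_lt.2 (hl a ha).le),
      Finset.erase_insert_of_ne (hl a ha).ne']
  · rw [Finset.filter_insert, if_neg (lt_irrefl l), Finset.filter_true_of_mem hl]

theorem coboundary_coboundary (c : Finset ι → Γ) (s : Finset ι) : coboundary (coboundary c) s = 0 := by
  induction s using Finset.induction_on_max generalizing c with
  | empty => simp [coboundary]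
  | insert l s hl ih =>
    rw [coboundary_insert_max _ hl]
    have h1 : coboundary (fun s => coboundary c (insert l s)) s =
        coboundary (fun t => coboundary (fun s => c (insert l s)) t -
          (-1 : ℝ) ^ s.card • c t) s := by
      refine coboundary_congr fun a ha => ?_
      rw [coboundary_insert_max _ fun x hx => hl x (Finset.mem_of_mem_erase hx), sub_eq_add_neg,
        ← neg_smul, ← Finset.card_erase_add_one ha, pow_succ, mul_neg_one, neg_neg]
    rw [h1, coboundary_sub_smul, ih, zero_sub, neg_add_cancel]

/-- Abstract acyclicity.  The quotients `S s / Z s` stand for forms on the intersection of the closed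
sets with indices in `s`.  If such a form, when it vanishes on further intersections, can be extended to
a form on a larger intersection with the corresponding vanishing property, then cocycles are
coboundaries; this is seen by splitting off the largest index. -/
theorem exists_coboundary_eq (S Z : Finset ι → Submodule ℝ Γ) (hS : Monotone S) (hZ : Monotone Z)
    (hext : ∀ (s : Finset ι) (l : ι) (T : Finset ι) (x : Γ), s.Nonempty → x ∈ S (insert l s) →
      (∀ t ∈ T, x ∈ Z (insert t (insert l s))) →
        ∃ y ∈ S s, y - x ∈ Z (insert l s) ∧ ∀ t ∈ T, y ∈ Z (insert t s)) (T : Finset ι) :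
    ∀ (s₀ : Finset ι) (p : ℕ) (c : Finset ι → Γ), s₀.Nonempty ∨ 1 ≤ p →
      (∀ s ⊆ T, s.card = p + 1 → c s ∈ S (s ∪ s₀)) →
      (∀ s ⊆ T, s.card = p + 2 → coboundary c s ∈ Z (s ∪ s₀)) →
      ∃ b : Finset ι → Γ, (∀ s ⊆ T, s.card = p → b s ∈ S (s ∪ s₀)) ∧
        ∀ s ⊆ T, s.card = p + 1 → coboundary b s - c s ∈ Z (s ∪ s₀) := by
  induction T using Finset.induction_on_max with
  | empty =>
    intro s₀ p c _ _ _
    refine ⟨0, fun s _ _ => Submodule.zero_mem _, fun s hs hp => ?_⟩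
    rw [Finset.subset_empty.1 hs] at hp
    simp at hp
  | insert l T hl ih =>
    intro s₀ p c hp hcS hcZ
    have hT : T ⊆ insert l T := Finset.subset_insert l T
    have hins : ∀ {s}, s ⊆ T → insert l s ⊆ insert l T := fun h => Finset.insert_subset_insert l h
    have hnot : ∀ {s}, s ⊆ T → l ∉ s := fun h hls => lt_irrefl l (hl l (h hls))
    have hmax : ∀ {s}, s ⊆ T → ∀ x ∈ s, x < l := fun h x hx => hl x (h hx)
    have hun : ∀ s : Finset ι, s ∪ insert l s₀ = insert l s ∪ s₀ := fun s => by
      rw [Finset.union_insert, Finset.insert_union]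
    have hle : ∀ s : Finset ι, s ∪ s₀ ⊆ insert l s ∪ s₀ := fun s =>
      Finset.union_subset_union_left (Finset.subset_insert l s)
    have hsplit : ∀ s ⊆ insert l T, s ⊆ T ∨ ∃ s₁ ⊆ T, s = insert l s₁ := by
      intro s hs
      by_cases h : l ∈ s
      · exact Or.inr ⟨s.erase l, Finset.subset_insert_iff.1 hs, (Finset.insert_erase h).symm⟩
      · exact Or.inl ((Finset.subset_insert_iff_of_notMem h).1 hs)
    obtain ⟨b, hbS, hbZ⟩ := ih s₀ p c hp (fun s hs => hcS s (hs.trans hT))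
      (fun s hs => hcZ s (hs.trans hT))
    -- the part of `c` involving `l`, after subtraction of the coboundary of `b`
    set e : Finset ι → Γ := fun s => c (insert l s) - (-1 : ℝ) ^ p • b s with hedef
    have heS : ∀ s ⊆ T, s.card = p → e s ∈ S (s ∪ insert l s₀) := by
      intro s hs hsp
      rw [hun]
      exact Submodule.sub_mem _
        (hcS _ (hins hs) (by rw [Finset.card_insert_of_notMem (hnot hs), hsp]))
        (Submodule.smul_mem _ _ (hS (hle s) (hbS s hs hsp)))
    have heZ : ∀ s ⊆ T, s.card = p + 1 → coboundary e s ∈ Z (s ∪ insert l s₀) := by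
      intro s hs hsp
      rw [hun]
      have h1 := hcZ _ (hins hs) (by rw [Finset.card_insert_of_notMem (hnot hs), hsp])
      have h2 := Submodule.smul_mem _ ((-1 : ℝ) ^ p) (hZ (hle s) (hbZ s hs hsp))
      rw [coboundary_insert_max c (hmax hs), hsp] at h1
      have h3 := Submodule.sub_mem _ h1 h2
      rw [hedef, coboundary_sub_smul]
      convert h3 using 1
      rw [pow_succ]
      module
    rcases Nat.eq_zero_or_pos p with rfl | hp0
    · obtain ⟨y, hyS, hyl, hyT⟩ := hext s₀ l T (e ∅) (hp.resolve_right (by norm_num))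
        (by simpa using heS ∅ (Finset.empty_subset T) rfl) (fun t ht => by
          have := heZ {t} (Finset.singleton_subset_iff.2 ht) rfl
          rwa [coboundary_singleton, Finset.singleton_union] at this)
      refine ⟨fun s => b s + y, fun s hs hs0 => ?_, fun s hs hs1 => ?_⟩
      · obtain rfl := Finset.card_eq_zero.1 hs0
        have h1 := hbS ∅ (Finset.empty_subset T) rfl
        rw [Finset.empty_union] at h1 ⊢
        exact Submodule.add_mem _ h1 hyS
      · obtain ⟨a, rfl⟩ := Finset.card_eq_one.1 hs1
        rw [coboundary_singleton, Finset.singleton_union]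
        rcases Finset.mem_insert.1 (Finset.singleton_subset_iff.1 hs) with rfl | ha
        · convert hyl using 1
          simp only [hedef, pow_zero, one_smul, insert_empty_eq]
          abel
        · have h1 := hbZ {a} (Finset.singleton_subset_iff.2 ha) rfl
          rw [coboundary_singleton, Finset.singleton_union] at h1
          convert Submodule.add_mem _ h1 (hyT a ha) using 1
          abel
    · obtain ⟨p, rfl⟩ := Nat.exists_eq_succ_of_ne_zero hp0.ne'
      obtain ⟨b', hbS', hbZ'⟩ := ih (insert l s₀) p e (Or.inl (Finset.insert_nonempty l s₀)) heS heZ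
      refine ⟨fun s => if l ∈ s then b' (s.erase l) else b s, fun s hs hsp => ?_, fun s hs hsp => ?_⟩
      · rcases hsplit s hs with h | ⟨s₁, h, rfl⟩
        · beta_reduce
          rw [if_neg (hnot h)]
          exact hbS s h hsp
        · beta_reduce
          rw [if_pos (Finset.mem_insert_self l s₁), Finset.erase_insert (hnot h), ← hun]
          refine hbS' s₁ h ?_
          rw [Finset.card_insert_of_notMem (hnot h)] at hsp
          exact Nat.succ.inj hsp
      · rcases hsplit s hs with h | ⟨s₁, h, rfl⟩
        · have h1 := hbZ s h hsp
          rw [coboundary_congr (c' := b)]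
          · exact h1
          · intro a _
            exact if_neg fun h' => hnot h (Finset.mem_of_mem_erase h')
        · rw [Finset.card_insert_of_notMem (hnot h)] at hsp
          have hsp' : s₁.card = p + 1 := Nat.succ.inj hsp
          have h1 := hbZ' s₁ h hsp'
          rw [hun] at h1
          rw [coboundary_insert_max _ (hmax h), coboundary_congr (c' := b'), if_neg (hnot h), hsp']
          · convert h1 using 1
            simp only [hedef, Nat.succ_eq_add_one]
            abel
          · intro a _
            rw [if_pos (Finset.mem_insert_self l _), Finset.erase_insert
              fun h' => hnot h (Finset.mem_of_mem_erase h')]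

end Combinatorics

/-! ### Multi-indices as finite sets -/

section Multiindices

variable {n p : ℕ} {Γ : Type*} [AddCommGroup Γ] [Module ℝ Γ]

/-- The set of entries of a multi-index. -/
def entries (σ : Fin p ↪o Fin n) : Finset (Fin n) := Finset.univ.map σ.toEmbedding

theorem mem_entries {σ : Fin p ↪o Fin n} (a : Fin p) : σ a ∈ entries σ :=
  Finset.mem_map_of_mem _ (Finset.mem_univ a)

theorem card_entries (σ : Fin p ↪o Fin n) : (entries σ).card = p := by
  rw [entries, Finset.card_map, Finset.card_univ, Fintype.card_fin]

theorem exists_entries_eq {s : Finset (Fin n)} (hs : s.card = p) :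
    ∃ σ : Fin p ↪o Fin n, entries σ = s := by
  refine ⟨s.orderEmbOfFin hs, ?_⟩
  ext x
  simp [entries]

theorem entries_injective : Function.Injective (entries : (Fin p ↪o Fin n) → Finset (Fin n)) := by
  intro σ τ h
  have h1 := Finset.orderEmbOfFin_unique' (card_entries σ) (f := σ) fun a => mem_entries a
  have h2 := Finset.orderEmbOfFin_unique' (card_entries σ) (f := τ) fun a => h ▸ mem_entries a
  rw [h1, h2]

theorem entries_face (σ : Fin (p + 2) ↪o Fin n) (α : Fin (p + 2)) :
    entries (SmoothSystem.face σ α) = (entries σ).erase (σ α) := by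
  ext x
  simp only [entries, Finset.mem_map, Finset.mem_univ, true_and, Finset.mem_erase]
  constructor
  · rintro ⟨b, rfl⟩
    exact ⟨fun h => Fin.succAbove_ne α b (σ.injective h), _, rfl⟩
  · rintro ⟨hx, b, rfl⟩
    obtain ⟨c, rfl⟩ := Fin.exists_succAbove_eq (x := b) (y := α) fun h => hx (by rw [h]; rfl)
    exact ⟨c, rfl⟩

/-- The coboundary is indexed by the positions of the omitted entries. -/
theorem coboundary_entries (c : Finset (Fin n) → Γ) (σ : Fin (p + 2) ↪o Fin n) :
    coboundary c (entries σ) =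
      ∑ α : Fin (p + 2), (-1 : ℝ) ^ (α : ℕ) • c (entries (SmoothSystem.face σ α)) := by
  rw [coboundary, entries, Finset.sum_map]
  refine Finset.sum_congr rfl fun α _ => ?_
  have h1 : (Finset.univ.map σ.toEmbedding).filter (· < σ.toEmbedding α) =
      (Finset.univ.filter (· < α)).map σ.toEmbedding := by
    rw [Finset.filter_map]
    congr 1
    ext b
    simp
  rw [h1, Finset.card_map, entries_face]
  have h2 : (Finset.univ.filter (· < α)) = Finset.Iio α := by ext; simp
  rw [h2, Fin.card_Iio]
  rfl

end Multiindices

namespace SmoothSystem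

variable {d n q : ℕ} {M : Fin n → Type u} [∀ i, TopologicalSpace (M i)]
  [∀ i, ChartedSpace (EuclideanSpace ℝ (Fin d)) (M i)] [∀ i, IsManifold (𝓡 d) ∞ (M i)]
  (F : SmoothSystem d M)

/-! ### Compatible families of forms on intersections of closures -/

theorem trans_add (i j : Fin n) (w w' : GForm d (M j) q) :
    F.trans i j (w + w') = F.trans i j w + F.trans i j w' := by
  funext x
  by_cases hx : x ∈ closure (F.A i j)
  · refine GForm.ext_ev x fun v => ?_
    rw [F.trans_ev _ hx]
    change _ = (F.trans i j w).ev x v + (F.trans i j w').ev x v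
    rw [F.trans_ev _ hx, F.trans_ev _ hx]
    rfl
  · refine (dif_neg hx).trans ?_
    change _ = F.trans i j w x + F.trans i j w' x
    rw [show F.trans i j w x = 0 from dif_neg hx, show F.trans i j w' x = 0 from dif_neg hx, add_zero]

theorem trans_smul (i j : Fin n) (c : ℝ) (w : GForm d (M j) q) :
    F.trans i j (c • w) = c • F.trans i j w := by
  funext x
  by_cases hx : x ∈ closure (F.A i j)
  · refine GForm.ext_ev x fun v => ?_
    rw [F.trans_ev _ hx]
    change _ = c • (F.trans i j w).ev x v
    rw [F.trans_ev _ hx]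
    rfl
  · refine (dif_neg hx).trans ?_
    change _ = c • F.trans i j w x
    rw [show F.trans i j w x = 0 from dif_neg hx, smul_zero]

/-- The pullback along the extended gluing map as a linear map. -/
noncomputable def transL (i j : Fin n) : GForm d (M j) q →ₗ[ℝ] GForm d (M i) q where
  toFun := F.trans i j
  map_add' := F.trans_add i j
  map_smul' := F.trans_smul i j

/-- The set of the points of `M i` in the closures of all gluing regions with indices in `s`. -/
def meet (s : Finset (Fin n)) (i : Fin n) : Set (M i) := ⋂ j ∈ s, closure (F.A i j)

theorem mem_meet {s : Finset (Fin n)} {i : Fin n} {x : M i} :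
    x ∈ F.meet s i ↔ ∀ j ∈ s, x ∈ closure (F.A i j) := mem_iInter₂

theorem meet_anti {s t : Finset (Fin n)} (h : s ⊆ t) (i : Fin n) : F.meet t i ⊆ F.meet s i :=
  fun _ hx => F.mem_meet.2 fun j hj => F.mem_meet.1 hx j (h hj)

theorem fbar_mem_meet {s : Finset (Fin n)} {i j : Fin n} {x : M i} (hx : x ∈ F.meet s i)
    (hj : x ∈ closure (F.A i j)) : F.fbar i j ⟨x, hj⟩ ∈ F.meet s j :=
  F.mem_meet.2 fun k hk => F.fbar_mem_of_mem hj (F.mem_meet.1 hx k hk)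

theorem closure_inter_eq_meet (hF : F.ClosureIntersection) {p : ℕ} (σ : Fin (p + 1) ↪o Fin n) :
    closure (F.inter σ) = F.meet (entries σ) (σ 0) := by
  rw [meet, ← hF]
  congr 1
  ext x
  simp [inter, entries]

/-- Families of forms which on the intersections of the closures with indices in `s` are smooth and
correspond to each other under the extended gluing maps.  For nonempty `s`, and
under `F.ClosureIntersection`, such a family modulo `vanishing q s` is the same as a smooth form on
`F.meet s i`, for any one index `i ∈ s`. -/
def compatible (q : ℕ) (s : Finset (Fin n)) : Submodule ℝ (∀ i, GForm d (M i) q) where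
  carrier := {w | (∀ i, ∃ V : GForm d (M i) q, (∀ x, FormSmoothAt d V x) ∧
      ∀ x ∈ F.meet s i, w i x = V x) ∧
    ∀ i j, ∀ x ∈ F.meet s i, x ∈ closure (F.A i j) → F.transL i j (w j) x = w i x}
  add_mem' := by
    rintro w w' ⟨h₁, h₂⟩ ⟨h₁', h₂'⟩
    refine ⟨fun i => ?_, fun i j x hx hxj => ?_⟩
    · obtain ⟨V, hV, e⟩ := h₁ i
      obtain ⟨V', hV', e'⟩ := h₁' i
      exact ⟨V + V', fun x => (hV x).add (hV' x), fun x hx => congrArg₂ (· + ·) (e x hx) (e' x hx)⟩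
    · rw [Pi.add_apply, map_add]
      exact congrArg₂ (· + ·) (h₂ i j x hx hxj) (h₂' i j x hx hxj)
  zero_mem' := by
    refine ⟨fun i => ⟨0, fun x => FormSmoothAt.zero x, fun _ _ => rfl⟩, fun i j x _ _ => ?_⟩
    rw [Pi.zero_apply, map_zero]
    rfl
  smul_mem' := by
    rintro c w ⟨h₁, h₂⟩
    refine ⟨fun i => ?_, fun i j x hx hxj => ?_⟩
    · obtain ⟨V, hV, e⟩ := h₁ i
      exact ⟨c • V, fun x => (hV x).smul c, fun x hx => congrArg (c • ·) (e x hx)⟩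
    · rw [Pi.smul_apply, map_smul]
      exact congrArg (c • ·) (h₂ i j x hx hxj)

/-- Families of forms that vanish on the intersections of the closures with indices in `s`. -/
def vanishing (q : ℕ) (s : Finset (Fin n)) : Submodule ℝ (∀ i, GForm d (M i) q) where
  carrier := {w | ∀ i, ∀ x ∈ F.meet s i, w i x = 0}
  add_mem' := fun h h' i x hx => (congrArg₂ (· + ·) (h i x hx) (h' i x hx)).trans (add_zero _)
  zero_mem' := fun _ _ _ => rfl
  smul_mem' := fun c _ h i x hx => (congrArg (c • ·) (h i x hx)).trans (smul_zero c)

theorem compatible_mono : Monotone (F.compatible q) := by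
  rintro s t hst w ⟨h₁, h₂⟩
  refine ⟨fun i => ?_, fun i j x hx => h₂ i j x (F.meet_anti hst i hx)⟩
  obtain ⟨V, hV, e⟩ := h₁ i
  exact ⟨V, hV, fun x hx => e x (F.meet_anti hst i hx)⟩

theorem vanishing_mono : Monotone (F.vanishing q) :=
  fun _ _ hst _ h i x hx => h i x (F.meet_anti hst i hx)

/-- The family of the pullbacks of a form on one of the manifolds to all of them. -/
noncomputable def spread (i : Fin n) : GForm d (M i) q →ₗ[ℝ] ∀ k, GForm d (M k) q :=
  LinearMap.pi fun k => F.transL k i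

theorem spread_self (i : Fin n) (w : GForm d (M i) q) : F.spread i w i = w := F.trans_self i w

theorem spread_congr {s : Finset (Fin n)} {i : Fin n} {w w' : GForm d (M i) q}
    (h : ∀ x ∈ F.meet s i, w x = w' x) {k : Fin n} {x : M k} (hx : x ∈ F.meet s k) :
    F.spread i w k x = F.spread i w' k x :=
  F.trans_congr fun hxi => h _ (F.fbar_mem_meet hx hxi)

theorem spread_mem_vanishing {s : Finset (Fin n)} {i : Fin n} {w : GForm d (M i) q}
    (h : ∀ x ∈ F.meet s i, w x = 0) : F.spread i w ∈ F.vanishing q s := fun k x hx =>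
  (F.spread_congr (w' := 0) h hx).trans (congrFun (congrFun (map_zero (F.spread (q := q) i)) k) x)

variable [∀ i, T2Space (M i)] [∀ i, SecondCountableTopology (M i)]

theorem spread_mem_compatible (hF : F.ClosureIntersection) {s : Finset (Fin n)} {i : Fin n}
    (hi : i ∈ s) {w V : GForm d (M i) q} (hV : ∀ x, FormSmoothAt d V x)
    (h : ∀ x ∈ F.meet s i, w x = V x) : F.spread i w ∈ F.compatible q s := by
  refine ⟨fun k => ?_, fun k j x hx hxj => ?_⟩
  · obtain ⟨V', hV', e⟩ := exists_extension isClosed_closure (F.trans_on_mem_Omega (i := k) hV)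
    exact ⟨V', hV', fun x hx =>
      (F.spread_congr h hx).trans (e ⟨x, F.mem_meet.1 hx i hi⟩).symm⟩
  · exact F.trans_trans w (F.mem_closure_inter_of_mem hF hxj (F.mem_meet.1 hx i hi))

/-- The extension property required by `exists_coboundary_eq`: it is applied on one manifold `M i`,
`i ∈ s`, and the result is transported to the others. -/
theorem exists_compatible_extension (hF : F.ClosureIntersection) (s : Finset (Fin n)) (l : Fin n)
    (T : Finset (Fin n)) (w : ∀ i, GForm d (M i) q) (hs : s.Nonempty)
    (hw : w ∈ F.compatible q (insert l s))
    (hT : ∀ t ∈ T, w ∈ F.vanishing q (insert t (insert l s))) :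
    ∃ y ∈ F.compatible q s, y - w ∈ F.vanishing q (insert l s) ∧
      ∀ t ∈ T, y ∈ F.vanishing q (insert t s) := by
  obtain ⟨i, hi⟩ := hs
  obtain ⟨V, hV, e⟩ := hw.1 i
  have hins : ∀ {s : Finset (Fin n)} {a k} {x : M k},
      x ∈ F.meet (insert a s) k ↔ x ∈ closure (F.A k a) ∧ x ∈ F.meet s k := by
    intro s a k x
    simp only [mem_meet, Finset.forall_mem_insert]
  obtain ⟨V', hV', h⟩ := F.exists_form_extension_finset hF s (l := l) T hV (by
    intro t ht x hx hl htx
    have hx' : x ∈ F.meet (insert l s) i := hins.2 ⟨hl, F.mem_meet.2 hx⟩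
    rw [← e x hx']
    exact hT t ht i x (hins.2 ⟨htx, hx'⟩))
  refine ⟨F.spread i V', F.spread_mem_compatible hF hi hV' fun _ _ => rfl, fun k x hx => ?_,
    fun t ht => F.spread_mem_vanishing fun x hx => ?_⟩
  · have hxi := F.mem_meet.1 hx i (Finset.mem_insert_of_mem hi)
    refine sub_eq_zero.2 ((F.spread_congr (s := insert l s) (w' := w i) (fun y hy => ?_) hx).trans
      (hw.2 k i x hx hxi))
    have hy' := hins.1 hy
    rw [e y hy]
    exact (h y (F.mem_meet.1 hy'.2)).1 hy'.1
  · have hx' := hins.1 hx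
    exact (h x (F.mem_meet.1 hx'.2)).2 t ht hx'.1

end SmoothSystem

theorem zeroExt_add {d q : ℕ} {M : Type u} [TopologicalSpace M]
    [ChartedSpace (EuclideanSpace ℝ (Fin d)) M] {S : Set M} (w w' : RawForm d S q) :
    zeroExt (w + w') = zeroExt w + zeroExt w' := by
  funext x
  by_cases hx : x ∈ S
  · exact (zeroExt_of_mem _ hx).trans
      (congrArg₂ (· + ·) (zeroExt_of_mem w hx) (zeroExt_of_mem w' hx)).symm
  · exact (dif_neg hx).trans ((congrArg₂ (· + ·) (show zeroExt w x = 0 from dif_neg hx)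
      (show zeroExt w' x = 0 from dif_neg hx)).trans (add_zero _)).symm

namespace SmoothSystem

/-! ### Exactness of the Čech complex in positive degrees -/

variable {d n q : ℕ} {M : Fin n → Type u} [∀ i, TopologicalSpace (M i)]
  [∀ i, ChartedSpace (EuclideanSpace ℝ (Fin d)) (M i)] [∀ i, IsManifold (𝓡 d) ∞ (M i)]
  (F : SmoothSystem d M)

open Classical in
/-- A cochain as a function on finite sets of indices: its value at the set of entries of `σ` is the
family of the pullbacks of the component at `σ`. -/
noncomputable def familyOf {p : ℕ} (β : F.RawCochain p q) (s : Finset (Fin n)) :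
    ∀ k, GForm d (M k) q :=
  if h : ∃ σ : Fin (p + 1) ↪o Fin n, entries σ = s then
    F.spread (h.choose 0) (zeroExt (β h.choose)) else 0

theorem familyOf_entries {p : ℕ} (β : F.RawCochain p q) (σ : Fin (p + 1) ↪o Fin n) :
    F.familyOf β (entries σ) = F.spread (σ 0) (zeroExt (β σ)) := by
  have h : ∃ τ : Fin (p + 1) ↪o Fin n, entries τ = entries σ := ⟨σ, rfl⟩
  have e := entries_injective h.choose_spec
  rw [familyOf, dif_pos h, e]

theorem familyOf_add {p : ℕ} (β γ : F.RawCochain p q) {s : Finset (Fin n)} (hs : s.card = p + 1) :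
    F.familyOf (β + γ) s = F.familyOf β s + F.familyOf γ s := by
  obtain ⟨σ, rfl⟩ := exists_entries_eq hs
  rw [familyOf_entries, familyOf_entries, familyOf_entries, ← map_add, ← zeroExt_add]
  rfl

theorem eq_zero_of_familyOf (hF : F.ClosureIntersection) {p : ℕ} {β : F.RawCochain p q}
    (h : ∀ s, s.card = p + 1 → F.familyOf β s ∈ F.vanishing q s) : β = 0 := by
  funext σ
  refine RawForm.ext_zeroExt fun x hx => ?_
  have h1 := h _ (card_entries σ) (σ 0) x (by rwa [← F.closure_inter_eq_meet hF])
  rw [familyOf_entries, spread_self] at h1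
  exact h1.trans (congrFun zeroExt_zero x).symm

/-- The Čech differential corresponds to the negative of the coboundary. -/
theorem coboundary_familyOf (hF : F.ClosureIntersection) {p : ℕ} (β : F.RawCochain p q)
    {s : Finset (Fin n)} (hs : s.card = p + 2) :
    F.familyOf (F.δ p q β) s + coboundary (F.familyOf β) s ∈ F.vanishing q s := by
  obtain ⟨σ, rfl⟩ := exists_entries_eq hs
  have h1 : F.familyOf (F.δ p q β) (entries σ) + coboundary (F.familyOf β) (entries σ) =
      F.spread (σ 0) (zeroExt (F.δ p q β σ)) + ∑ α : Fin (p + 2),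
        (-1 : ℝ) ^ (α : ℕ) • F.spread (face σ α 0) (zeroExt (β (face σ α))) := by
    rw [familyOf_entries, coboundary_entries]
    simp only [familyOf_entries]
  rw [h1]
  have h2 : ∀ x ∈ F.meet (entries σ) (σ 0), zeroExt (F.δ p q β σ) x =
      (∑ α : Fin (p + 2), (-1 : ℝ) ^ ((α : ℕ) + 1) •
        F.transL (σ 0) (face σ α 0) (zeroExt (β (face σ α)))) x := by
    intro x hx
    rw [F.zeroExt_δ β σ (by rwa [F.closure_inter_eq_meet hF])]
    have hsum : ∀ f : Fin (p + 2) → GForm d (M (σ 0)) q, (∑ α, f α) x = ∑ α, f α x :=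
      fun f => Finset.sum_apply _ _ _
    exact (hsum fun α => (-1 : ℝ) ^ ((α : ℕ) + 1) •
      F.transL (σ 0) (face σ α 0) (zeroExt (β (face σ α)))).symm
  intro k x hx
  have h3 := F.spread_congr h2 hx
  rw [map_sum, Finset.sum_apply, Finset.sum_apply] at h3
  have h4 : ∀ α : Fin (p + 2), F.spread (σ 0) ((-1 : ℝ) ^ ((α : ℕ) + 1) •
      F.transL (σ 0) (face σ α 0) (zeroExt (β (face σ α)))) k x =
      (-1 : ℝ) ^ ((α : ℕ) + 1) • F.spread (face σ α 0) (zeroExt (β (face σ α))) k x := by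
    intro α
    rw [map_smul]
    have h5 : face σ α 0 ∈ entries σ := mem_entries _
    exact congrArg ((-1 : ℝ) ^ ((α : ℕ) + 1) • ·) (F.trans_trans _
      (F.mem_closure_inter_of_mem hF (F.mem_meet.1 hx _ (mem_entries 0)) (F.mem_meet.1 hx _ h5)))
  change F.spread (σ 0) (zeroExt (F.δ p q β σ)) k x + (∑ α : Fin (p + 2),
        (-1 : ℝ) ^ (α : ℕ) • F.spread (face σ α 0) (zeroExt (β (face σ α)))) k x = 0
  rw [h3, Finset.sum_apply, Finset.sum_apply, ← Finset.sum_add_distrib]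
  refine Finset.sum_eq_zero fun α _ => ?_
  rw [h4]
  have gen : ∀ (V : Type) [AddCommGroup V] [Module ℝ V] (a : V) (m : ℕ),
      (-1 : ℝ) ^ (m + 1) • a + (-1 : ℝ) ^ m • a = 0 := by
    intro V _ _ a m
    rw [pow_succ]
    module
  exact gen (Euc d [⋀^Fin q]→L[ℝ] ℝ) _ _

theorem coboundary_familyOf_of_δ_eq_zero (hF : F.ClosureIntersection) {p : ℕ} {β : F.RawCochain p q}
    (hβ : F.δ p q β = 0) {s : Finset (Fin n)} (hs : s.card = p + 2) :
    coboundary (F.familyOf β) s ∈ F.vanishing q s := by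
  have h := F.coboundary_familyOf hF β hs
  obtain ⟨σ, rfl⟩ := exists_entries_eq hs
  have h0 : F.familyOf (F.δ p q β) (entries σ) = 0 := by
    rw [hβ, familyOf_entries]
    exact (congrArg (F.spread (σ 0)) zeroExt_zero).trans (map_zero _)
  rwa [h0, zero_add] at h

theorem δ_δ (hF : F.ClosureIntersection) {p : ℕ} (β : F.RawCochain p q) :
    F.δ (p + 1) q (F.δ p q β) = 0 := by
  refine F.eq_zero_of_familyOf hF fun s hs => ?_
  have h1 := F.coboundary_familyOf hF (F.δ p q β) hs
  have h2 : coboundary (fun t => F.familyOf (F.δ p q β) t + coboundary (F.familyOf β) t) s ∈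
      F.vanishing q s := by
    refine coboundary_mem F.vanishing_mono fun a ha => ?_
    refine F.coboundary_familyOf hF β ?_
    rw [Finset.card_erase_of_mem ha, hs]
    rfl
  rw [coboundary_add, coboundary_coboundary, add_zero] at h2
  simpa using Submodule.sub_mem _ h1 h2

variable [∀ i, T2Space (M i)] [∀ i, SecondCountableTopology (M i)]

theorem familyOf_mem_compatible (hF : F.ClosureIntersection) {p : ℕ} {β : F.RawCochain p q}
    (hβ : β ∈ F.Cochain p q) {s : Finset (Fin n)} (hs : s.card = p + 1) :
    F.familyOf β s ∈ F.compatible q s := by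
  obtain ⟨σ, rfl⟩ := exists_entries_eq hs
  obtain ⟨V, hV, e⟩ := exists_extension isClosed_closure (hβ σ (mem_univ _))
  rw [familyOf_entries]
  refine F.spread_mem_compatible hF (mem_entries 0) hV fun x hx => ?_
  rw [← F.closure_inter_eq_meet hF] at hx
  rw [zeroExt_of_mem _ hx]
  exact (e ⟨x, hx⟩).symm

/-- Čech cocycles of positive degree are coboundaries: translate `exists_coboundary_eq`, with the
opposite sign, back to cochains. -/
theorem exists_δ_eq (hF : F.ClosureIntersection) {p : ℕ} {β : F.RawCochain (p + 1) q}
    (hβ : β ∈ F.Cochain (p + 1) q) (hδ : F.δ (p + 1) q β = 0) :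
    ∃ γ ∈ F.Cochain p q, F.δ p q γ = β := by
  obtain ⟨b, hbS, hbZ⟩ := exists_coboundary_eq (F.compatible q) (F.vanishing q) F.compatible_mono
    F.vanishing_mono (F.exists_compatible_extension hF) Finset.univ ∅ (p + 1) (F.familyOf β)
    (Or.inr (Nat.le_add_left 1 p))
    (fun s _ hs => by
      rw [Finset.union_empty]
      exact F.familyOf_mem_compatible hF hβ hs)
    (fun s _ hs => by
      rw [Finset.union_empty]
      exact F.coboundary_familyOf_of_δ_eq_zero hF hδ hs)
  simp only [Finset.union_empty, Finset.subset_univ, forall_true_left] at hbS hbZ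
  set γ : F.RawCochain p q := fun σ => (b (entries σ) (σ 0)).on _ with hγdef
  have hγ : γ ∈ F.Cochain p q := by
    intro σ _
    obtain ⟨V, hV, e⟩ := (hbS _ (card_entries σ)).1 (σ 0)
    refine mem_Omega_of_formSmoothAt (η := V) (fun x _ => Filter.Eventually.of_forall hV) fun x => ?_
    exact e x (by rw [← F.closure_inter_eq_meet hF]; exact x.2)
  have hγb : ∀ s, s.card = p + 1 → F.familyOf γ s - b s ∈ F.vanishing q s := by
    intro s hs
    obtain ⟨σ, rfl⟩ := exists_entries_eq hs
    intro k x hx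
    rw [familyOf_entries]
    refine sub_eq_zero.2 ((F.spread_congr (w' := b (entries σ) (σ 0)) (fun y hy => ?_) hx).trans
      ((hbS _ hs).2 k (σ 0) x hx (F.mem_meet.1 hx _ (mem_entries 0))))
    exact zeroExt_of_mem _ (by rwa [F.closure_inter_eq_meet hF])
  refine ⟨-γ, Submodule.neg_mem _ hγ, ?_⟩
  rw [map_neg, ← sub_eq_zero, ← neg_eq_zero, neg_sub, sub_neg_eq_add]
  refine F.eq_zero_of_familyOf hF fun s hs => ?_
  have h1 := F.coboundary_familyOf hF γ hs
  have h2 : coboundary (fun t => F.familyOf γ t - (1 : ℝ) • b t) s ∈ F.vanishing q s := by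
    refine coboundary_mem F.vanishing_mono fun a ha => ?_
    rw [one_smul]
    refine hγb _ ?_
    rw [Finset.card_erase_of_mem ha, hs]
    rfl
  rw [coboundary_sub_smul, one_smul] at h2
  have h3 := Submodule.sub_mem _ (Submodule.sub_mem _ h1 h2) (hbZ s hs)
  rw [familyOf_add F _ _ hs]
  convert h3 using 1
  abel

theorem cechExact (hF : F.ClosureIntersection) (q : ℕ) : F.CechExact q := by
  refine ⟨fun w _ h => F.Φ_injective h, F.map_Φ, fun p => ?_⟩
  ext β
  constructor
  · rintro ⟨γ, hγ, rfl⟩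
    exact ⟨F.δ_mem_Cochain hγ, F.δ_δ hF γ⟩
  · rintro ⟨hβ, hδ⟩
    exact F.exists_δ_eq hF hβ hδ

end SmoothSystem
end NonHausdorff

theorem mainTheorem3 (d : ℕ) :
    (∀ (n : ℕ) (M : Fin n → Type u) [∀ i, TopologicalSpace (M i)]
        [∀ i, ChartedSpace (EuclideanSpace ℝ (Fin d)) (M i)] [∀ i, IsManifold (𝓡 d) ∞ (M i)]
        [∀ i, T2Space (M i)] [∀ i, SecondCountableTopology (M i)]
        (F : NonHausdorff.SmoothSystem d M),
        F.RegularOpen → F.ClosureIntersection → ∀ q : ℕ, F.CechExact q) ∧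
    (∀ (M : Fin 2 → Type u) [∀ i, TopologicalSpace (M i)]
        [∀ i, ChartedSpace (EuclideanSpace ℝ (Fin d)) (M i)] [∀ i, IsManifold (𝓡 d) ∞ (M i)]
        [∀ i, T2Space (M i)] [∀ i, SecondCountableTopology (M i)]
        (F : NonHausdorff.SmoothSystem d M),
        (∀ q : ℕ, F.CechExact q) ∧ F.MayerVietoris (F.fbar 0 1) ∧
          (F.RegularOpen → F.RestrictionIso ∧ F.MayerVietoris (F.f 0 1))) := by
  exact ⟨fun n M _ _ _ _ _ F _ hC q => F.cechExact hC q, fun M _ _ _ _ _ F => ⟨F.cechExact_two, F.mayerVietoris_fbar, fun h =>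
    ⟨F.restrictionIso h, F.mayerVietoris_f h⟩⟩⟩
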